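/- **Setting.** Fix $F>0$, $F\neq 1$, viscosities $\nu,\nu'>0$ with $\nu\neq\nu'$, and put $\nu_0=\min(\nu,\nu')$, $\omega=\max(\nu,\nu')/\nu_0$. For $\varepsilon>0$ consider on $\mathbb{R}^3$, for $f=(v,\theta)$ with four components, the system $$\partial_t f-\Big(L-\frac1\varepsilon\mathbb{P}\mathcal{A}\Big)f=F^b+F^l,\qquad f_{|t=0}=f_0,$$ where $L(v,\theta)=(\nu\Delta v,\nu'\Delta\theta)$, $\mathbb{P}$ is the Leray projector (acting on $v$) and $\mathcal{A}(v,\theta)=(-v^2,v^1,F^{-1}\theta,-F^{-1}v^3)$. Let $\mathbb{B}(\xi,\varepsilon)$ be the symbol of $L-\frac1\varepsilon\mathbb{P}\mathcal{A}$. Let $\lambda(\xi,\varepsilon)$ be its eigenvalue with positive imaginary part, and let $\mathbb{P}_3,\mathbb{P}_4$ be the Fourier multipliers whose symbols are the spectral projectors of $\mathbb{B}(\xi,\varepsilon)$ onto the eigenspaces of $\lambda$ and $\overline\lambda$. The potential vorticity is $\Omega(v,\theta)=\partial_1v^2-\partial_2v^1-F\partial_3\theta$. Let $\chi$ be a smooth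 function on $[0,\infty)$, nonincreasing, equal to $1$ on $[0,\frac34]$ and to $0$ on $[\frac43,\infty)$; put $\varphi(\xi)=\chi(|\xi|/2)-\chi(|\xi|)$, $\dot\Delta_j=\varphi(2^{-j}D)$, $\mathcal{P}_{r,R}=\chi(|D|/R)(1-\chi(|D_3|/r))$. The Besov norms are $$\|u\|_{\dot B^s_{a,q}}=\big\|2^{js}\|\dot\Delta_ju\|_{L^a}\big\|_{\ell^q(\mathbb{Z})},\qquad \|u\|_{\widetilde L^\rho_T\dot B^s_{a,q}}=\big\|2^{js}\|\dot\Delta_ju\|_{L^\rho(0,T;L^a)}\big\|_{\ell^q(\mathbb{Z})}.$$ Fields are tempered distributions whose Fourier transform is a locally integrable function. **Statement.** There is a constant $C_{F,\omega}>0$, depending only on $F$, $\omega$ (and on the fixed function $\chi$), with the following property. Let $m,M>0$ with $M<\frac14$ and $3M+m<1$, and put $r_\varepsilon=\varepsilon^m$, $R_\varepsilon=\varepsilon^{-M}$. There is $\varepsilon_0>0$, depending only on $\chi,F,\nu,\nu',m,M$, such that for all $0<\varepsilon<\varepsilon_0$, $d\in\mathbb{R}$, $r\in(4,\infty]$, $q\in[1,\infty]$,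 $1\le p<\frac{4}{1-4/r}$ and $T\in[0,\infty]$: if $f$ solves the system on $[0,T)$ with $f_0,F^b,F^l$ all of zero divergence and zero potential vorticity, and if moreover $p\geq2$ or $F^l=0$, then for $i=3,4$ $$\big\||D|^d\,\mathbb{P}_i\mathcal{P}_{r_\varepsilon,R_\varepsilon}f\big\|_{\widetilde L^p_T\dot B^0_{r,q}}\le C_{F,\omega}\Big(\frac83\Big)^{|d|}\frac{D_{p,r}}{\nu_0^{\frac1p-\frac14(1-\frac4r)}}\;\varepsilon^{\frac14(1-\frac4r)}\;\frac{R_\varepsilon^{4-\frac9r}}{r_\varepsilon^{\frac52+\frac2p-\frac6r}}$$ $$\times\Big(\|\mathcal{P}_{r_\varepsilon,R_\varepsilon}f_0\|_{\dot B^d_{2,q}}+\|\mathcal{P}_{r_\varepsilon,R_\varepsilon}F^b\|_{L^1(0,T;\dot B^d_{2,q})}+\frac{1}{\nu_0^{1/2}r_\varepsilon}\|\mathcal{P}_{r_\varepsilon,R_\varepsilon}F^l\|_{L^2(0,T;\dot B^d_{2,q})}\Big),$$ where $D_{p,r}=\max(b_{p,r},d_{p,r})$ and, with $c=\frac34$ and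 $a=\frac1p-\frac14(1-\frac4r)$, $$b_{p,r}=\Big(\frac{2}{c^2}\Big)^{a}a^{a},\qquad d_{p,r}=2^{\frac1p}\Big(\frac{8}{c^2p}\Big)^{a}\Big(\int_0^\infty\frac{e^{-x}}{x^{\frac p4(1-\frac4r)}}\,dx\Big)^{\frac1p}.$$ -/

import Mathlib

open MeasureTheory
open scoped ENNReal SchwartzMap

noncomputable section

namespace PrimitiveSystem

/-- The physical (and frequency) space `ℝ³`. -/
abbrev Space := EuclideanSpace ℝ (Fin 3)

/-- The space of values of the fields `U = (v, θ)`; complex values are allowed. -/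
abbrev Vec := EuclideanSpace ℂ (Fin 4)

/-! ### Fields and their Fourier transforms -/

/-- The inverse Fourier transform in the convention `û(ξ) = ∫ e^{-i x·ξ} u(x) dx`, for which
`∂ⱼ` has the symbol `i ξⱼ`: `(𝓕⁻¹ g)(x) = (2π)⁻³ ∫ e^{i x·ξ} g(ξ) dξ`. -/
def invFourier {V : Type*} [NormedAddCommGroup V] [NormedSpace ℂ V] (g : Space → V)
    (x : Space) : V :=
  ((2 * Real.pi : ℂ) ^ 3)⁻¹ • ∫ ξ : Space, Complex.exp (Complex.I * (inner ℝ x ξ : ℝ)) • g ξ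

/-- A field on `ℝ³`: a tempered distribution whose Fourier transform is a locally integrable
function `hat`. The last field says that `hat` is that Fourier transform:
`⟨u, φ⟩ = ⟨û, 𝓕⁻¹ φ⟩` for all Schwartz functions `φ`. -/
structure Field where
  toDist : 𝓢'(Space, Vec)
  hat : Space → Vec
  locallyIntegrable_hat : LocallyIntegrable hat volume
  integrable_test : ∀ φ : 𝓢(Space, ℂ),
    Integrable (fun ξ => invFourier (fun x => φ x) ξ • hat ξ) volume
  toDist_apply : ∀ φ : 𝓢(Space, ℂ),
    toDist φ = ∫ ξ : Space, invFourier (fun x => φ x) ξ • hat ξ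

/-- The time interval `(0, T)`, where `0 ≤ T ≤ ∞`. -/
def timeInterval (T : ℝ≥0∞) : Set ℝ := {t | 0 < t ∧ ENNReal.ofReal t < T}

/-- `û ∈ L¹((0, t) × K)` for every `t < T` and every compact set `K` of frequencies. -/
def LocIntegrableInTime (T : ℝ≥0∞) (u : ℝ → Field) : Prop :=
  ∀ t ∈ timeInterval T, ∀ K : Set Space, IsCompact K →
    IntegrableOn (fun z : ℝ × Space => (u z.1).hat z.2) (Set.Ioc 0 t ×ˢ K) volume

/-- `div v = ∂₁v¹ + ∂₂v² + ∂₃v³ = 0` for `u = (v, θ)`. -/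
def DivFree (u : Field) : Prop :=
  ∀ᵐ ξ : Space, Complex.I * ξ 0 * u.hat ξ 0 + Complex.I * ξ 1 * u.hat ξ 1
    + Complex.I * ξ 2 * u.hat ξ 2 = 0

/-- The potential vorticity `Ω(u) = ∂₁v² - ∂₂v¹ - F ∂₃θ` of `u = (v, θ)` vanishes. -/
def ZeroPotentialVorticity (F : ℝ) (u : Field) : Prop :=
  ∀ᵐ ξ : Space, Complex.I * ξ 0 * u.hat ξ 1 - Complex.I * ξ 1 * u.hat ξ 0
    - F * (Complex.I * ξ 2 * u.hat ξ 3) = 0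

/-! ### The linear system `∂ₜ f - (L - ε⁻¹ ℙ 𝒜) f = F_ext` -/

/-- Symbol of the Leray projector, acting on the first three components. -/
def leraySymbol (ξ : Space) : Matrix (Fin 4) (Fin 4) ℝ :=
  1 - (‖ξ‖ ^ 2)⁻¹ • Matrix.vecMulVec ![ξ 0, ξ 1, ξ 2, 0] ![ξ 0, ξ 1, ξ 2, 0]

/-- The matrix `𝒜` of the rotation and stratification terms. -/
def rotStratMatrix (F : ℝ) : Matrix (Fin 4) (Fin 4) ℝ :=
  !![0, -1, 0, 0;
     1, 0, 0, 0;
     0, 0, 0, F⁻¹;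
     0, 0, -F⁻¹, 0]

/-- Symbol `𝔹(ξ, ε)` of `L - ε⁻¹ ℙ 𝒜`, where `L (v, θ) = (ν Δ v, ν' Δ θ)`. -/
def symbolB (F ν ν' ε : ℝ) (ξ : Space) : Matrix (Fin 4) (Fin 4) ℂ :=
  ((-‖ξ‖ ^ 2) • Matrix.diagonal ![ν, ν, ν, ν']
    - ε⁻¹ • (leraySymbol ξ * rotStratMatrix F)).map Complex.ofReal

/-- `f` solves `∂ₜ f - (L - ε⁻¹ ℙ 𝒜) f = Fb + Fl` on `(0, T)` with `f(0) = f₀`. The equation is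
read on the Fourier side, `∂ₜ f̂ - 𝔹 f̂ = F̂b + F̂l`, and integrated in time from `0`, which also
encodes the initial condition. -/
structure IsSolution (F ν ν' ε : ℝ) (T : ℝ≥0∞) (f₀ : Field) (Fb Fl f : ℝ → Field) : Prop where
  locIntegrable : LocIntegrableInTime T f
  eqn : ∀ᵐ t ∂(volume.restrict (timeInterval T)), ∀ᵐ ξ : Space,
    (f t).hat ξ = f₀.hat ξ + ∫ s in (0 : ℝ)..t,
      (Matrix.toEuclideanLin (symbolB F ν ν' ε ξ) ((f s).hat ξ)
        + ((Fb s).hat ξ + (Fl s).hat ξ))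

/-! ### The spectral projectors `ℙ₃` and `ℙ₄` -/

/-- `P` is the projector onto the eigenspace `ker (B - z)` along the range of `B - z` (which is the
sum of the other eigenspaces when `B` is diagonalizable). -/
def IsEigenprojection (B : Matrix (Fin 4) (Fin 4) ℂ) (z : ℂ) (P : Matrix (Fin 4) (Fin 4) ℂ) :
    Prop :=
  P * P = P ∧ (∀ v, P.mulVec v = v ↔ B.mulVec v = z • v) ∧
    ∀ v, P.mulVec v = 0 ↔ ∃ w, v = B.mulVec w - z • w

open Classical in
/-- The (unique) projector of `IsEigenprojection`. -/
def eigenprojection (B : Matrix (Fin 4) (Fin 4) ℂ) (z : ℂ) : Matrix (Fin 4) (Fin 4) ℂ :=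
  if h : ∃ P, IsEigenprojection B z P then h.choose else 0

open Classical in
/-- The eigenvalue with positive imaginary part. For the matrices `𝔹(ξ, ε)`, which are real and
have the real eigenvalue `-ν|ξ|²`, there is at most one. -/
def upperEigenvalue (B : Matrix (Fin 4) (Fin 4) ℂ) : ℂ :=
  if h : ∃ z : ℂ, 0 < z.im ∧ Module.End.HasEigenvalue (Matrix.toLin' B) z then h.choose else 0

/-- The eigenvalue `λ(ξ, ε) = -τ(ξ)|ξ|² + i |ξ|_F / (ε F |ξ|) + …` of `𝔹(ξ, ε)`. -/
def lam (F ν ν' ε : ℝ) (ξ : Space) : ℂ := upperEigenvalue (symbolB F ν ν' ε ξ)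

/-- Symbol of `ℙ₃`: the projector onto the eigenspace of `λ`. -/
def proj₃ (F ν ν' ε : ℝ) (ξ : Space) : Matrix (Fin 4) (Fin 4) ℂ :=
  eigenprojection (symbolB F ν ν' ε ξ) (lam F ν ν' ε ξ)

/-- Symbol of `ℙ₄`: the projector onto the eigenspace of the conjugate of `λ`. -/
def proj₄ (F ν ν' ε : ℝ) (ξ : Space) : Matrix (Fin 4) (Fin 4) ℂ :=
  eigenprojection (symbolB F ν ν' ε ξ) (starRingEnd ℂ (lam F ν ν' ε ξ))

/-! ### Littlewood–Paley theory -/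

/-- Radial profile of the cut-off function of the Littlewood–Paley decomposition: smooth,
nonincreasing on `[0, ∞)`, equal to `1` on `[0, 3/4]` and to `0` beyond `4/3`. -/
structure IsCutoff (χ : ℝ → ℝ) : Prop where
  smooth : ContDiff ℝ (⊤ : ℕ∞) χ
  antitone : AntitoneOn χ (Set.Ici 0)
  eq_one : ∀ x ∈ Set.Icc (0 : ℝ) (3 / 4), χ x = 1
  eq_zero : ∀ x, 4 / 3 ≤ x → χ x = 0

/-- Symbol of the dyadic block `Δ̇ⱼ`: `φ(2⁻ʲ ξ)` with `φ(ξ) = χ(|ξ|/2) - χ(|ξ|)`. -/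
def dyadicSymbol (χ : ℝ → ℝ) (j : ℤ) (ξ : Space) : ℝ :=
  χ ((2 : ℝ) ^ (-j) * ‖ξ‖ / 2) - χ ((2 : ℝ) ^ (-j) * ‖ξ‖)

/-- `Δ̇ⱼ u`, as a function on `ℝ³`, for the field `u` with Fourier transform `g`. -/
def dyadicBlock (χ : ℝ → ℝ) (j : ℤ) (g : Space → Vec) : Space → Vec :=
  invFourier fun ξ => (dyadicSymbol χ j ξ : ℂ) • g ξ

/-- The norm `‖u‖` in `Ḃ^s_{p,q}`, where `g` is the Fourier transform of `u`. -/
def besovNorm (χ : ℝ → ℝ) (s : ℝ) (p q : ℝ≥0∞) (g : Space → Vec) : ℝ≥0∞ :=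
  eLpNorm (fun j : ℤ => ENNReal.ofReal ((2 : ℝ) ^ ((j : ℝ) * s)) *
    eLpNorm (dyadicBlock χ j g) p volume) q Measure.count

/-- The norm `‖u‖` in `L^ρ(0, T; Ḃ^s_{p,q})`, where `g t` is the Fourier transform of `u(t)`. -/
def timeBesovNorm (χ : ℝ → ℝ) (T ρ : ℝ≥0∞) (s : ℝ) (p q : ℝ≥0∞) (g : ℝ → Space → Vec) :
    ℝ≥0∞ :=
  eLpNorm (fun t => besovNorm χ s p q (g t)) ρ (volume.restrict (timeInterval T))

/-- The norm `‖u‖` in `L̃^ρ(0, T; Ḃ^s_{p,q})`, where `g t` is the Fourier transform of `u(t)`. -/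
def tildeBesovNorm (χ : ℝ → ℝ) (T ρ : ℝ≥0∞) (s : ℝ) (p q : ℝ≥0∞) (g : ℝ → Space → Vec) :
    ℝ≥0∞ :=
  eLpNorm (fun j : ℤ => ENNReal.ofReal ((2 : ℝ) ^ ((j : ℝ) * s)) *
    eLpNorm (fun t => eLpNorm (dyadicBlock χ j (g t)) p volume) ρ
      (volume.restrict (timeInterval T))) q Measure.count

/-- Fourier transform of `𝒫_{r,R} u = χ(|D|/R) (1 - χ(|D₃|/r)) u`, for `g` that of `u`. -/
def truncate (χ : ℝ → ℝ) (r R : ℝ) (g : Space → Vec) (ξ : Space) : Vec :=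
  ((χ (‖ξ‖ / R) * (1 - χ (|ξ 2| / r)) : ℝ) : ℂ) • g ξ

/-- Fourier transform of `|D|^d P(D) u`, for a matrix symbol `P` and `g` that of `u`. -/
def derivProj (d : ℝ) (P : Space → Matrix (Fin 4) (Fin 4) ℂ) (g : Space → Vec) (ξ : Space) :
    Vec :=
  ((‖ξ‖ ^ d : ℝ) : ℂ) • Matrix.toEuclideanLin (P ξ) (g ξ)

/-! ### The constants; `ρ` stands for `1/r`, so that `r = ∞` is allowed -/

/-- The exponent `1/p - (1 - 4/r)/4`. -/
def expo (p ρ : ℝ) : ℝ := 1 / p - (1 - 4 * ρ) / 4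

/-- `b_{p,r}`, with `c = 3/4`. -/
def bConst (p ρ : ℝ) : ℝ := (2 / (3 / 4) ^ 2 : ℝ) ^ expo p ρ * expo p ρ ^ expo p ρ

/-- `d_{p,r}`, with `c = 3/4`. -/
def dConst (p ρ : ℝ) : ℝ :=
  (2 : ℝ) ^ (1 / p) * (8 / ((3 / 4) ^ 2 * p)) ^ expo p ρ *
    (∫ x in Set.Ioi (0 : ℝ), Real.exp (-x) / x ^ (p / 4 * (1 - 4 * ρ))) ^ (1 / p)

/-- `D_{p,r} = max (b_{p,r}, d_{p,r})`. -/
def DConst (p ρ : ℝ) : ℝ := max (bConst p ρ) (dConst p ρ)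

end PrimitiveSystem

end

noncomputable section

namespace PrimitiveSystem

open scoped FourierTransform

/-! ### Plancherel's theorem for integrable functions -/

section Plancherel

variable {E V : Type*} [NormedAddCommGroup E] [InnerProductSpace ℝ E] [FiniteDimensional ℝ E]
  [MeasurableSpace E] [BorelSpace E] [NormedAddCommGroup V] [InnerProductSpace ℂ V]

theorem continuous_fourier_of_integrable {g : E → V} (hg : Integrable g) : Continuous (𝓕 g) :=
  VectorFourier.fourierIntegral_continuous Real.continuous_fourierChar
    (by simpa using continuous_inner) hg

variable [CompleteSpace V]

theorem integral_fourier_schwartz_smul (φ : 𝓢(E, ℂ)) {g : E → V} (hg : Integrable g) :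
    ∫ ξ, (𝓕 φ) ξ • g ξ = ∫ x, φ x • (𝓕 g) x := by
  have h := VectorFourier.integral_fourierIntegral_smul_eq_flip (μ := (volume : Measure E))
    (ν := (volume : Measure E)) (L := innerₗ E) (e := Real.fourierChar) (f := fun x => φ x)
    (g := g) Real.continuous_fourierChar
    (by simpa using continuous_inner) φ.integrable hg
  rw [flip_innerₗ] at h
  exact h

theorem ae_eq_of_schwartz_pairing {f g : E → V} (hf : LocallyIntegrable f)
    (hg : LocallyIntegrable g) (h : ∀ φ : 𝓢(E, ℂ), ∫ x, φ x • f x = ∫ x, φ x • g x) :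
    f =ᵐ[volume] g := by
  refine ae_eq_of_integral_contDiff_smul_eq hf hg fun φ hφ hφc => ?_
  have h₁ : HasCompactSupport (Complex.ofRealCLM ∘ φ) := hφc.comp_left rfl
  have h₂ : ContDiff ℝ (⊤ : ℕ∞) (Complex.ofRealCLM ∘ φ) := by fun_prop
  have := h (h₁.toSchwartzMap h₂)
  simpa using this

theorem fourier_ae_eq_of_memLp {g : E → V} (hg : Integrable g) (h2 : MemLp g 2) :
    𝓕 g =ᵐ[volume] (𝓕 (h2.toLp g) : Lp (α := E) V 2) := by
  refine ae_eq_of_schwartz_pairing (continuous_fourier_of_integrable hg).locallyIntegrable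
    ((Lp.memLp _).locallyIntegrable (by norm_num)) fun φ => ?_
  rw [← integral_fourier_schwartz_smul φ hg]
  have h := DFunLike.congr_fun (Lp.fourier_toTemperedDistribution_eq (h2.toLp g)) φ
  rw [TemperedDistribution.fourier_apply, Lp.toTemperedDistribution_apply,
    Lp.toTemperedDistribution_apply] at h
  rw [← h]
  refine integral_congr_ae ?_
  filter_upwards [h2.coeFn_toLp] with x hx
  rw [hx]

theorem ae_eq_fourierInv_of_memLp_fourier {g : E → V} (hg : Integrable g)
    (h2 : MemLp (𝓕 g) 2) : g =ᵐ[volume] (𝓕⁻ (h2.toLp (𝓕 g)) : Lp (α := E) V 2) := by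
  refine ae_eq_of_schwartz_pairing hg.locallyIntegrable
    ((Lp.memLp _).locallyIntegrable (by norm_num)) fun φ => ?_
  have h := DFunLike.congr_fun (Lp.fourierInv_toTemperedDistribution_eq (h2.toLp (𝓕 g))) φ
  rw [TemperedDistribution.fourierInv_apply, Lp.toTemperedDistribution_apply,
    Lp.toTemperedDistribution_apply] at h
  rw [← h]
  have h3 : ∫ x, (𝓕⁻ φ) x • (h2.toLp (𝓕 g)) x = ∫ x, (𝓕⁻ φ) x • (𝓕 g) x := by
    refine integral_congr_ae ?_
    filter_upwards [h2.coeFn_toLp] with x hx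
    rw [hx]
  rw [h3, ← integral_fourier_schwartz_smul _ hg, FourierTransform.fourier_fourierInv_eq]

/-- Plancherel's theorem for integrable functions, with both sides possibly infinite. -/
theorem eLpNorm_fourier_eq {g : E → V} (hg : Integrable g) :
    eLpNorm (𝓕 g) 2 volume = eLpNorm g 2 volume := by
  by_cases h2 : MemLp g 2
  · rw [eLpNorm_congr_ae (fourier_ae_eq_of_memLp hg h2), ← eLpNorm_congr_ae h2.coeFn_toLp,
      ← Lp.enorm_def, ← Lp.enorm_def, enorm_eq_nnnorm, enorm_eq_nnnorm]
    congr 1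
    exact NNReal.eq (Lp.norm_fourier_eq _)
  · have h1 : eLpNorm g 2 volume = ∞ := by
      by_contra h
      exact h2 ⟨hg.aestronglyMeasurable, lt_top_iff_ne_top.2 h⟩
    rw [h1]
    by_contra h
    have h3 : MemLp (𝓕 g) 2 volume :=
      ⟨(continuous_fourier_of_integrable hg).aestronglyMeasurable, lt_top_iff_ne_top.2 h⟩
    exact h2 ((Lp.memLp _).ae_eq (ae_eq_fourierInv_of_memLp_fourier hg h3).symm)

end Plancherel

theorem invFourier_eq_fourier {V : Type*} [NormedAddCommGroup V] [NormedSpace ℂ V]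
    (g : Space → V) (x : Space) :
    invFourier g x = ((2 * Real.pi : ℂ) ^ 3)⁻¹ • (𝓕 g) ((-(2 * Real.pi)⁻¹ : ℝ) • x) := by
  rw [invFourier, Real.fourier_eq']
  congr 1
  refine integral_congr_ae (Filter.Eventually.of_forall fun ξ => ?_)
  simp only [inner_smul_right, real_inner_comm]
  congr 2
  have : (Real.pi : ℂ) ≠ 0 := by exact_mod_cast Real.pi_ne_zero
  push_cast
  rw [real_inner_comm]
  field_simp

/-- The constant of Plancherel's theorem for `invFourier`. -/
def plancherelConst : ℝ≥0∞ :=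
  ENNReal.ofReal ((2 * Real.pi) ^ 3)⁻¹ * ENNReal.ofReal ((2 * Real.pi) ^ 3) ^ (1 / 2 : ℝ)

theorem plancherelConst_ne_zero : plancherelConst ≠ 0 := by
  have := Real.pi_pos
  rw [plancherelConst, mul_ne_zero_iff]
  refine ⟨by simp; positivity, ?_⟩
  rw [Ne, ENNReal.rpow_eq_zero_iff]
  simp
  positivity

theorem plancherelConst_ne_top : plancherelConst ≠ ⊤ :=
  ENNReal.mul_ne_top ENNReal.ofReal_ne_top
    (ENNReal.rpow_ne_top_of_nonneg (by norm_num) ENNReal.ofReal_ne_top)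

theorem enorm_two_pi_pow_inv :
    ‖((2 * Real.pi : ℂ) ^ 3)⁻¹‖ₑ = ENNReal.ofReal ((2 * Real.pi) ^ 3)⁻¹ := by
  rw [← ofReal_norm]
  congr 1
  simp [abs_of_pos Real.pi_pos]

theorem eLpNorm_invFourier_two {g : Space → Vec} (hg : Integrable g) :
    eLpNorm (invFourier g) 2 volume = plancherelConst * eLpNorm g 2 volume := by
  have h1 : invFourier g = ((2 * Real.pi : ℂ) ^ 3)⁻¹ •
      fun x => (𝓕 g) ((-(2 * Real.pi)⁻¹ : ℝ) • x) := funext (invFourier_eq_fourier g)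
  have h0 : (-(2 * Real.pi)⁻¹ : ℝ) ≠ 0 := by simp [Real.pi_ne_zero]
  rw [h1, eLpNorm_const_smul, enorm_two_pi_pow_inv, plancherelConst, mul_assoc]
  congr 1
  rw [← eLpNorm_fourier_eq hg, eLpNorm_eq_lintegral_rpow_enorm_toReal (by simp) (by simp),
    eLpNorm_eq_lintegral_rpow_enorm_toReal (by simp) (by simp)]
  simp only [ENNReal.toReal_ofNat]
  rw [← ENNReal.mul_rpow_of_nonneg _ _ (by norm_num)]
  congr 1
  have hm : Measurable fun y : Space => ‖(𝓕 g) y‖ₑ ^ (2 : ℝ) :=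
    ((continuous_fourier_of_integrable hg).enorm.measurable).pow_const _
  have h3 : ∫⁻ x : Space, ‖(𝓕 g) ((-(2 * Real.pi)⁻¹ : ℝ) • x)‖ₑ ^ (2 : ℝ) =
      ∫⁻ y, ‖(𝓕 g) y‖ₑ ^ (2 : ℝ)
        ∂(Measure.map ((-(2 * Real.pi)⁻¹ : ℝ) • ·) (volume : Measure Space)) :=
    (lintegral_map hm (measurable_const_smul _)).symm
  rw [h3, Measure.map_addHaar_smul _ h0, lintegral_smul_measure, smul_eq_mul]
  congr 2
  rw [finrank_euclideanSpace_fin, neg_pow, abs_inv, abs_mul, inv_pow, abs_inv,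
    abs_of_pos (by positivity : (0 : ℝ) < (2 * Real.pi) ^ 3)]
  simp

theorem continuous_invFourier {g : Space → Vec} (hg : Integrable g) : Continuous (invFourier g) := by
  rw [funext (invFourier_eq_fourier g)]
  exact ((continuous_fourier_of_integrable hg).comp
    (continuous_id.const_smul (-(2 * Real.pi)⁻¹ : ℝ))).const_smul ((2 * Real.pi : ℂ) ^ 3)⁻¹

/-! ### Minkowski's integral inequality -/

section Minkowski

variable {α β : Type*} [MeasurableSpace α] [MeasurableSpace β] {μ : Measure α} {ν : Measure β}

theorem rpow_le_of_le_mul_rpow {I J : ℝ≥0∞} {p : ℝ} (hp : 1 ≤ p) (hI : I ≠ ⊤)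
    (h : I ≤ J * I ^ (1 - 1 / p)) : I ^ (1 / p) ≤ J := by
  rcases eq_or_ne I 0 with rfl | h0
  · rw [ENNReal.zero_rpow_of_pos (by positivity)]
    exact zero_le
  have h1 : I ^ (1 - 1 / p) ≠ 0 := by
    simp [ENNReal.rpow_eq_zero_iff, h0, hI]
  have h2 : I ^ (1 - 1 / p) ≠ ⊤ := by
    simp [ENNReal.rpow_eq_top_iff, h0, hI]
  have h3 : I ^ (1 / p) * I ^ (1 - 1 / p) ≤ J * I ^ (1 - 1 / p) := by
    rw [← ENNReal.rpow_add _ _ h0 hI]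
    simpa using h
  exact (ENNReal.mul_le_mul_iff_left h1 h2).1 h3

/-- **Minkowski's integral inequality.** -/
theorem lintegral_lintegral_rpow_le [SigmaFinite μ] [SFinite ν] {f : α → β → ℝ≥0∞}
    (hf : Measurable (Function.uncurry f)) {p : ℝ} (hp : 1 ≤ p) :
    (∫⁻ a, (∫⁻ b, f a b ∂ν) ^ p ∂μ) ^ (1 / p) ≤
      ∫⁻ b, (∫⁻ a, f a b ^ p ∂μ) ^ (1 / p) ∂ν := by
  have hp0 : 0 < p := by linarith
  set J := ∫⁻ b, (∫⁻ a, f a b ^ p ∂μ) ^ (1 / p) ∂ν with hJ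
  set h : α → ℝ≥0∞ := fun a => ∫⁻ b, f a b ∂ν with hh
  have hhm : Measurable h := hf.lintegral_prod_right'
  set g : ℕ → α → ℝ≥0∞ := fun n => (spanningSets μ n).indicator fun a => min (h a) n with hg
  have hgm : ∀ n, Measurable (g n) := fun n =>
    (hhm.min measurable_const).indicator (measurableSet_spanningSets μ n)
  have hgmono : Monotone g := by
    intro m n hmn a
    simp only [hg]
    by_cases ha : a ∈ spanningSets μ m
    · rw [Set.indicator_of_mem ha, Set.indicator_of_mem (monotone_spanningSets μ hmn ha)]
      exact min_le_min_left _ (by exact_mod_cast hmn)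
    · rw [Set.indicator_of_notMem ha]
      exact zero_le
  have hgle : ∀ n a, g n a ≤ h a := by
    intro n a
    simp only [hg]
    by_cases ha : a ∈ spanningSets μ n
    · rw [Set.indicator_of_mem ha]
      exact min_le_left _ _
    · rw [Set.indicator_of_notMem ha]
      exact zero_le
  have hgsup : ∀ a, ⨆ n, g n a ^ p = h a ^ p := by
    intro a
    have : ⨆ n, g n a = h a := by
      apply le_antisymm (iSup_le fun n => hgle n a)
      refine le_of_forall_lt fun c hc => ?_
      obtain ⟨n, hn⟩ := ENNReal.exists_nat_gt (ne_top_of_lt hc)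
      obtain ⟨m, hm⟩ := Set.mem_iUnion.1 (by rw [iUnion_spanningSets]; trivial :
        a ∈ ⋃ i, spanningSets μ i)
      refine lt_of_lt_of_le ?_ (le_iSup (fun n => g n a) (max n m))
      simp only [hg]
      rw [Set.indicator_of_mem (monotone_spanningSets μ (le_max_right n m) hm)]
      exact lt_min hc (hn.trans_le (by exact_mod_cast le_max_left n m))
    rw [← this]
    exact ((ENNReal.orderIsoRpow p hp0).map_iSup _).symm
  have key : ∀ n, (∫⁻ a, g n a ^ p ∂μ) ^ (1 / p) ≤ J := by
    intro n
    have hfin : ∫⁻ a, g n a ^ p ∂μ ≠ ⊤ := by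
      have h1 : ∫⁻ a, g n a ^ p ∂μ ≤ ∫⁻ a, (spanningSets μ n).indicator (fun _ => (n : ℝ≥0∞) ^ p) a ∂μ := by
        refine lintegral_mono fun a => ?_
        simp only [hg]
        by_cases ha : a ∈ spanningSets μ n
        · rw [Set.indicator_of_mem ha, Set.indicator_of_mem ha]
          exact ENNReal.rpow_le_rpow (min_le_right _ _) hp0.le
        · rw [Set.indicator_of_notMem ha, Set.indicator_of_notMem ha, ENNReal.zero_rpow_of_pos hp0]
      refine ne_top_of_le_ne_top ?_ h1
      rw [lintegral_indicator_const (measurableSet_spanningSets μ n)]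
      exact ENNReal.mul_ne_top (ENNReal.rpow_ne_top_of_nonneg hp0.le (by simp))
        (measure_spanningSets_lt_top μ n).ne
    refine rpow_le_of_le_mul_rpow hp hfin ?_
    calc ∫⁻ a, g n a ^ p ∂μ ≤ ∫⁻ a, h a * g n a ^ (p - 1) ∂μ := by
          refine lintegral_mono fun a => ?_
          calc g n a ^ p = g n a * g n a ^ (p - 1) := by
                rcases eq_or_ne (g n a) 0 with h0 | h0
                · simp [h0, hp0]
                · have ht : g n a ≠ ⊤ := by
                    simp only [hg]
                    by_cases ha : a ∈ spanningSets μ n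
                    · rw [Set.indicator_of_mem ha]
                      exact ne_top_of_le_ne_top (by simp) (min_le_right _ _)
                    · rw [Set.indicator_of_notMem ha]; simp
                  conv_rhs => rw [← ENNReal.rpow_one (g n a), ← ENNReal.rpow_mul,
                    ← ENNReal.rpow_add _ _ h0 ht]
                  congr 1; ring
            _ ≤ _ := mul_le_mul_left (hgle n a) _
      _ = ∫⁻ a, ∫⁻ b, f a b * g n a ^ (p - 1) ∂ν ∂μ := by
          refine lintegral_congr fun a => ?_
          exact (lintegral_mul_const _ (hf.comp measurable_prodMk_left)).symm
      _ = ∫⁻ b, ∫⁻ a, f a b * g n a ^ (p - 1) ∂μ ∂ν := by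
          refine lintegral_lintegral_swap ?_
          exact (hf.mul (((hgm n).comp measurable_fst).pow_const _)).aemeasurable
      _ ≤ ∫⁻ b, (∫⁻ a, f a b ^ p ∂μ) ^ (1 / p) * (∫⁻ a, g n a ^ p ∂μ) ^ (1 - 1 / p) ∂ν := by
          refine lintegral_mono fun b => ?_
          rcases hp.eq_or_lt with rfl | hp1
          · simp
          have hpq : p.HolderConjugate (p / (p - 1)) := Real.HolderConjugate.conjExponent hp1
          have := ENNReal.lintegral_mul_le_Lp_mul_Lq μ hpq
            (f := fun a => f a b) (g := fun a => g n a ^ (p - 1))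
            (hf.comp measurable_prodMk_right).aemeasurable ((hgm n).pow_const _).aemeasurable
          refine this.trans (le_of_eq ?_)
          congr 2
          · refine lintegral_congr fun a => ?_
            rw [← ENNReal.rpow_mul]
            congr 1
            have : p - 1 ≠ 0 := by linarith
            field_simp
          · field_simp
      _ = J * (∫⁻ a, g n a ^ p ∂μ) ^ (1 - 1 / p) := by
          rw [lintegral_mul_const _ ?_]
          exact ((hf.comp measurable_swap).pow_const p).lintegral_prod_right'.pow_const _
  have hlim : ∫⁻ a, h a ^ p ∂μ = ⨆ n, ∫⁻ a, g n a ^ p ∂μ := by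
    rw [← lintegral_iSup (fun n => (hgm n).pow_const p)
      (fun m n hmn a => ENNReal.rpow_le_rpow (hgmono hmn a) hp0.le)]
    exact lintegral_congr fun a => (hgsup a).symm
  rw [one_div, ENNReal.rpow_inv_le_iff hp0]
  refine hlim.le.trans (iSup_le fun n => ?_)
  rw [← ENNReal.rpow_inv_le_iff hp0, ← one_div]
  exact key n

end Minkowski

section Duhamel

theorem lintegral_Ioi_duhamel_section (N : ℝ → ℝ≥0∞) {s : ℝ} (hs : 0 < s) :
    ∫⁻ t in Set.Ioi (0 : ℝ), (Set.Ioi s).indicator (fun t => N (t - s)) t =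
      ∫⁻ τ in Set.Ioi (0 : ℝ), N τ := by
  rw [setLIntegral_indicator measurableSet_Ioi, Set.inter_eq_left.2 (Set.Ioi_subset_Ioi hs.le),
    ← lintegral_indicator measurableSet_Ioi, ← lintegral_indicator measurableSet_Ioi,
    ← lintegral_sub_right_eq_self ((Set.Ioi 0).indicator fun τ => N τ) s]
  refine lintegral_congr fun t => ?_
  simp [Set.indicator_apply]

/-- Minkowski's inequality for a Duhamel integral. -/
theorem duhamel_minkowski {N : ℝ → ℝ → ℝ≥0∞} (hN : Measurable (Function.uncurry N)) {q : ℝ}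
    (hq : 1 ≤ q) :
    (∫⁻ t in Set.Ioi (0 : ℝ), (∫⁻ s in Set.Ioo 0 t, N (t - s) s) ^ q) ^ (1 / q) ≤
      ∫⁻ s in Set.Ioi (0 : ℝ), (∫⁻ τ in Set.Ioi (0 : ℝ), N τ s ^ q) ^ (1 / q) := by
  have hq0 : 0 < q := by linarith
  set f : ℝ → ℝ → ℝ≥0∞ := fun t s => (Set.Ioi s).indicator (fun t => N (t - s) s) t with hf
  have hfm : Measurable (Function.uncurry f) := by
    have h1 : Function.uncurry f = {z : ℝ × ℝ | z.2 < z.1}.indicator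
        (fun z => N (z.1 - z.2) z.2) := by
      ext z
      simp [hf, Function.uncurry, Set.indicator_apply]
    rw [h1]
    refine Measurable.indicator ?_ (measurableSet_lt measurable_snd measurable_fst)
    exact hN.comp ((measurable_fst.sub measurable_snd).prodMk measurable_snd)
  have h := lintegral_lintegral_rpow_le (μ := volume.restrict (Set.Ioi (0 : ℝ)))
    (ν := volume.restrict (Set.Ioi (0 : ℝ))) hfm hq
  refine le_trans (le_of_eq ?_) (h.trans (le_of_eq ?_))
  · congr 1
    refine lintegral_congr fun t => ?_
    congr 1
    rw [← lintegral_indicator measurableSet_Ioo, ← lintegral_indicator measurableSet_Ioi]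
    refine lintegral_congr fun s => ?_
    by_cases h1 : 0 < s <;> by_cases h2 : s < t <;> simp [hf, Set.indicator_apply, h1, h2]
  · refine setLIntegral_congr_fun measurableSet_Ioi fun s hs => ?_
    congr 1
    rw [← lintegral_Ioi_duhamel_section (fun τ => N τ s ^ q) hs]
    refine lintegral_congr fun t => ?_
    by_cases h2 : s < t <;> simp [hf, Set.indicator_apply, h2, hq0]

theorem lintegral_exp_neg_Ioi {κ : ℝ} (hκ : 0 < κ) :
    ∫⁻ t in Set.Ioi (0 : ℝ), ENNReal.ofReal (Real.exp (-κ * t)) = ENNReal.ofReal (1 / κ) := by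
  rw [← ofReal_integral_eq_lintegral_ofReal (integrableOn_exp_mul_Ioi (by linarith) 0)
    (Filter.Eventually.of_forall fun t => (Real.exp_pos _).le),
    integral_exp_mul_Ioi (by linarith) 0]
  simp

/-- A damped Duhamel integral of a source which is square integrable in time. -/
theorem duhamel_minkowski_two {N : ℝ → ℝ → ℝ≥0∞} (hN : Measurable (Function.uncurry N)) {p κ : ℝ}
    (hp : 2 ≤ p) (hκ : 0 < κ) :
    (∫⁻ t in Set.Ioi (0 : ℝ), (∫⁻ s in Set.Ioo 0 t,
      ENNReal.ofReal (Real.exp (-κ * (t - s))) * N (t - s) s) ^ p) ^ (1 / p) ≤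
      ENNReal.ofReal (1 / (2 * κ)) ^ (1 / 2 : ℝ) *
      (∫⁻ s in Set.Ioi (0 : ℝ),
        ((∫⁻ τ in Set.Ioi (0 : ℝ), N τ s ^ p) ^ (1 / p)) ^ (2 : ℝ)) ^ (1 / 2 : ℝ) := by
  have hp0 : 0 < p := by linarith
  set c := ENNReal.ofReal (1 / (2 * κ)) with hc
  have hexp : ∀ t : ℝ, ∫⁻ s in Set.Ioo 0 t,
      ENNReal.ofReal (Real.exp (-κ * (t - s))) ^ (2 : ℝ) ≤ c := by
    intro t
    rw [hc, ← lintegral_exp_neg_Ioi (by positivity : 0 < 2 * κ)]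
    calc ∫⁻ s in Set.Ioo 0 t, ENNReal.ofReal (Real.exp (-κ * (t - s))) ^ (2 : ℝ)
        = ∫⁻ s, (Set.Ioo 0 t).indicator
            (fun s => ENNReal.ofReal (Real.exp (-(2 * κ) * (t - s)))) s := by
          rw [← lintegral_indicator measurableSet_Ioo]
          refine lintegral_congr fun s => ?_
          congr 1
          ext s
          rw [ENNReal.ofReal_rpow_of_pos (Real.exp_pos _), ← Real.exp_mul]
          ring_nf
      _ ≤ ∫⁻ s, (Set.Ioi (0 : ℝ)).indicator
            (fun s => ENNReal.ofReal (Real.exp (-(2 * κ) * s))) (t - s) := by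
          refine lintegral_mono fun s => ?_
          by_cases h : s ∈ Set.Ioo 0 t
          · have h2 : t - s ∈ Set.Ioi (0 : ℝ) := by simpa using h.2
            rw [Set.indicator_of_mem h, Set.indicator_of_mem h2]
          · rw [Set.indicator_of_notMem h]; exact zero_le
      _ = _ := by
          rw [lintegral_sub_left_eq_self
            (fun s => (Set.Ioi (0 : ℝ)).indicator
              (fun s => ENNReal.ofReal (Real.exp (-(2 * κ) * s))) s) t,
            lintegral_indicator measurableSet_Ioi]
  have hstep : ∀ t : ℝ, (∫⁻ s in Set.Ioo 0 t,
      ENNReal.ofReal (Real.exp (-κ * (t - s))) * N (t - s) s) ^ p ≤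
      c ^ (p / 2) * (∫⁻ s in Set.Ioo 0 t, N (t - s) s ^ (2 : ℝ)) ^ (p / 2) := by
    intro t
    have h1 := ENNReal.lintegral_mul_le_Lp_mul_Lq (volume.restrict (Set.Ioo 0 t))
      Real.HolderConjugate.two_two
      (f := fun s => ENNReal.ofReal (Real.exp (-κ * (t - s)))) (g := fun s => N (t - s) s)
      (by fun_prop)
      (hN.comp ((measurable_const.sub measurable_id).prodMk measurable_id)).aemeasurable
    have h2 := ENNReal.rpow_le_rpow h1 hp0.le
    refine h2.trans ?_
    rw [ENNReal.mul_rpow_of_nonneg _ _ hp0.le, ← ENNReal.rpow_mul, ← ENNReal.rpow_mul,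
      show 1 / 2 * p = p / 2 by ring]
    gcongr
    exact hexp t
  have hM := duhamel_minkowski (N := fun τ s => N τ s ^ (2 : ℝ)) (hN.pow_const _)
    (q := p / 2) (by linarith)
  calc _ ≤ (∫⁻ t in Set.Ioi (0 : ℝ), c ^ (p / 2) *
        (∫⁻ s in Set.Ioo 0 t, N (t - s) s ^ (2 : ℝ)) ^ (p / 2)) ^ (1 / p) :=
        ENNReal.rpow_le_rpow (lintegral_mono hstep) (by positivity)
    _ = c ^ (1 / 2 : ℝ) * ((∫⁻ t in Set.Ioi (0 : ℝ),
        (∫⁻ s in Set.Ioo 0 t, N (t - s) s ^ (2 : ℝ)) ^ (p / 2)) ^ (1 / (p / 2))) ^ (1 / 2 : ℝ) := by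
        rw [lintegral_const_mul' _ _ (ENNReal.rpow_ne_top_of_nonneg (by positivity)
          ENNReal.ofReal_ne_top), ENNReal.mul_rpow_of_nonneg _ _ (by positivity),
          ← ENNReal.rpow_mul, ← ENNReal.rpow_mul]
        congr 2 <;> field_simp
    _ ≤ _ := by
        gcongr
        refine hM.trans (le_of_eq ?_)
        refine lintegral_congr fun s => ?_
        rw [← ENNReal.rpow_mul]
        congr 1
        · refine lintegral_congr fun τ => ?_
          rw [← ENNReal.rpow_mul]
          congr 1; ring
        · field_simp

end Duhamel

/-! ### An oscillatory integral in one variable -/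

/-- First derivative test: a phase `θ` with `θ' = 1 / g`. -/
theorem norm_integral_exp_phase_le {θ g dg : ℝ → ℝ} {α β : ℝ} (hαβ : α ≤ β)
    (hg0 : ∀ y ∈ Set.Icc α β, g y ≠ 0)
    (hθ : ∀ y ∈ Set.Icc α β, HasDerivAt θ (g y)⁻¹ y)
    (hg : ∀ y ∈ Set.Icc α β, HasDerivAt g (dg y) y)
    (hdg : ContinuousOn dg (Set.Icc α β)) :
    ‖∫ y in α..β, Complex.exp (Complex.I * (θ y : ℝ))‖ ≤
      |g α| + |g β| + ∫ y in α..β, |dg y| := by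
  have hu : Set.uIcc α β = Set.Icc α β := Set.uIcc_of_le hαβ
  have hnorm : ∀ y : ℝ, ‖Complex.exp (Complex.I * (θ y : ℝ))‖ = 1 := fun y => by
    rw [mul_comm, Complex.norm_exp_ofReal_mul_I]
  have hE : ∀ y ∈ Set.Icc α β, HasDerivAt (fun y => Complex.exp (Complex.I * (θ y : ℝ)))
      (Complex.exp (Complex.I * (θ y : ℝ)) * (Complex.I * ((g y)⁻¹ : ℝ))) y := fun y hy =>
    (((hθ y hy).ofReal_comp).const_mul Complex.I).cexp
  have hEc : ContinuousOn (fun y => Complex.exp (Complex.I * (θ y : ℝ))) (Set.Icc α β) :=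
    fun y hy => (hE y hy).continuousAt.continuousWithinAt
  have hgc : ContinuousOn g (Set.Icc α β) :=
    fun y hy => (hg y hy).continuousAt.continuousWithinAt
  have hH : ∀ y ∈ Set.Icc α β, HasDerivAt
      (fun y => Complex.exp (Complex.I * (θ y : ℝ)) * (-Complex.I * (g y : ℝ)))
      (Complex.exp (Complex.I * (θ y : ℝ)) +
        Complex.exp (Complex.I * (θ y : ℝ)) * (-Complex.I * (dg y : ℝ))) y := by
    intro y hy
    have h1 := (hE y hy).mul (((hg y hy).ofReal_comp).const_mul (-Complex.I))
    refine h1.congr_deriv ?_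
    have h2 : (g y : ℂ) ≠ 0 := by exact_mod_cast hg0 y hy
    push_cast
    field_simp
    linear_combination (-1 : ℂ) * Complex.I_sq
  have hi1 : IntervalIntegrable (fun y => Complex.exp (Complex.I * (θ y : ℝ))) volume α β :=
    ContinuousOn.intervalIntegrable (hu ▸ hEc)
  have hc2 : ContinuousOn (fun y => Complex.exp (Complex.I * (θ y : ℝ)) *
      (-Complex.I * (dg y : ℝ))) (Set.Icc α β) :=
    hEc.mul (continuousOn_const.mul (Complex.continuous_ofReal.comp_continuousOn hdg))
  have hi2 : IntervalIntegrable (fun y => Complex.exp (Complex.I * (θ y : ℝ)) *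
      (-Complex.I * (dg y : ℝ))) volume α β := ContinuousOn.intervalIntegrable (hu ▸ hc2)
  have hftc := intervalIntegral.integral_eq_sub_of_hasDerivAt (a := α) (b := β)
    (fun y hy => hH y (hu ▸ hy)) (hi1.add hi2)
  rw [intervalIntegral.integral_add hi1 hi2, ← eq_sub_iff_add_eq] at hftc
  rw [hftc]
  have h3 : ‖∫ y in α..β, Complex.exp (Complex.I * (θ y : ℝ)) * (-Complex.I * (dg y : ℝ))‖ ≤
      ∫ y in α..β, |dg y| := by
    refine (intervalIntegral.norm_integral_le_integral_norm hαβ).trans (le_of_eq ?_)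
    refine intervalIntegral.integral_congr fun y _ => ?_
    simp only [norm_mul, hnorm, norm_neg, Complex.norm_I, one_mul, Complex.norm_real,
      Real.norm_eq_abs]
  refine (norm_sub_le _ _).trans ?_
  refine add_le_add ((norm_sub_le _ _).trans ?_) h3
  simp only [norm_mul, hnorm, norm_neg, Complex.norm_I, one_mul, Complex.norm_real,
    Real.norm_eq_abs]
  linarith

/-- The dispersion relation along a line: `√((w + φ²(u + y²)) / (w + u + y²))`. -/
def linePhase (φ w u y : ℝ) : ℝ := √((w + φ ^ 2 * (u + y ^ 2)) / (w + u + y ^ 2))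

theorem linePhase_mem {φ w u : ℝ} (hφ : 0 < φ) (hw : 0 < w) (hu : 0 ≤ u) (y : ℝ) :
    min 1 φ ≤ linePhase φ w u y ∧ linePhase φ w u y ≤ max 1 φ := by
  have hk : 0 < w + u + y ^ 2 := by positivity
  constructor
  · apply Real.le_sqrt_of_sq_le
    rw [le_div_iff₀ hk]
    have h1 : min 1 φ ^ 2 ≤ 1 := by
      have := min_le_left 1 φ
      have : 0 < min 1 φ := lt_min one_pos hφ
      nlinarith
    have h2 : min 1 φ ^ 2 ≤ φ ^ 2 := by
      have : 0 < min 1 φ := lt_min one_pos hφ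
      gcongr
      exact min_le_right _ _
    nlinarith [mul_le_mul_of_nonneg_right h1 hw.le,
      mul_le_mul_of_nonneg_right h2 (by positivity : 0 ≤ u + y ^ 2)]
  · apply Real.sqrt_le_iff.2 ⟨by positivity, ?_⟩
    rw [div_le_iff₀ hk]
    have h1 : 1 ≤ max 1 φ ^ 2 := by
      have := le_max_left 1 φ
      nlinarith
    have h2 : φ ^ 2 ≤ max 1 φ ^ 2 := by
      gcongr
      exact le_max_right _ _
    nlinarith [mul_le_mul_of_nonneg_right h1 hw.le,
      mul_le_mul_of_nonneg_right h2 (by positivity : 0 ≤ u + y ^ 2)]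

theorem hasDerivAt_linePhase {φ w u : ℝ} (hφ : 0 < φ) (hw : 0 < w) (hu : 0 ≤ u) (y : ℝ) :
    HasDerivAt (linePhase φ w u)
      (y * (w * (φ ^ 2 - 1)) / (linePhase φ w u y * (w + u + y ^ 2) ^ 2)) y := by
  have hk : 0 < w + u + y ^ 2 := by positivity
  have hN : 0 < w + φ ^ 2 * (u + y ^ 2) := by positivity
  have h1 : HasDerivAt (fun y => w + φ ^ 2 * (u + y ^ 2)) (φ ^ 2 * (2 * y)) y := by
    simpa using (((hasDerivAt_pow 2 y).const_add u).const_mul (φ ^ 2)).const_add w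
  have h2 : HasDerivAt (fun y => w + u + y ^ 2) (2 * y) y := by
    simpa using (hasDerivAt_pow 2 y).const_add (w + u)
  have h3 := (h1.div h2 hk.ne').sqrt (div_pos hN hk).ne'
  refine h3.congr_deriv ?_
  have hs : 0 < √((w + φ ^ 2 * (u + y ^ 2)) / (w + u + y ^ 2)) := Real.sqrt_pos.2 (div_pos hN hk)
  rw [linePhase]
  simp only [Pi.div_apply]
  field_simp
  ring

/-- The constant of the dispersive estimate. -/
def dispConst (φ : ℝ) : ℝ := 1 + (|φ ^ 2 - 1| / min 1 φ + 7 * max 1 φ) / |φ ^ 2 - 1|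

theorem norm_integral_exp_linePhase_far {φ w u τ ρ η β : ℝ} (hφ : 0 < φ) (hφ1 : φ ≠ 1)
    (hw : 0 < w) (hu : 0 ≤ u) (hτ : τ ≠ 0) (hη : 0 < η) (hηβ : η ≤ β) 
    (hρ0 : 0 < ρ) (hρ : w + u + β ^ 2 ≤ ρ ^ 2) :
    ‖∫ y in η..β, Complex.exp (Complex.I * (τ * linePhase φ w u y : ℝ))‖ ≤
      (dispConst φ - 1) * (ρ ^ 4 / (|τ| * w * η)) := by
  have hφ2 : φ ^ 2 - 1 ≠ 0 := by
    intro h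
    apply hφ1
    nlinarith [sq_nonneg (φ - 1)]
  set h := linePhase φ w u with hh
  set c := τ * (w * (φ ^ 2 - 1)) with hc
  have hc0 : c ≠ 0 := by positivity
  have hmem := linePhase_mem hφ hw hu
  have hmin : 0 < min 1 φ := lt_min one_pos hφ
  have hh0 : ∀ y, 0 < h y := fun y => hmin.trans_le (hmem y).1
  set g : ℝ → ℝ := fun y => h y * (w + u + y ^ 2) ^ 2 / y / c with hg
  set dg : ℝ → ℝ := fun y => (w * (φ ^ 2 - 1) / h y + 4 * h y * (w + u + y ^ 2) -
    h y * (w + u + y ^ 2) ^ 2 / y ^ 2) / c with hdg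
  have hpos : ∀ y ∈ Set.Icc η β, 0 < y := fun y hy => hη.trans_le hy.1
  have hgd : ∀ y ∈ Set.Icc η β, HasDerivAt g (dg y) y := by
    intro y hy
    have hy0 := hpos y hy
    have hk : 0 < w + u + y ^ 2 := by positivity
    have h2 : HasDerivAt (fun y => (w + u + y ^ 2) ^ 2) (2 * (w + u + y ^ 2) * (2 * y)) y := by
      have := ((hasDerivAt_pow 2 y).const_add (w + u)).pow 2
      refine this.congr_deriv ?_
      simp
    have h3 := (((hasDerivAt_linePhase hφ hw hu y).mul h2).div (hasDerivAt_id y) hy0.ne').div_const c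
    refine h3.congr_deriv ?_
    simp only [hdg, ← hh, id, Pi.mul_apply]
    have := hh0 y
    field_simp
    ring
  have hhc : Continuous h :=
    continuous_iff_continuousAt.2 fun y => (hasDerivAt_linePhase hφ hw hu y).continuousAt
  have hdgc : ContinuousOn dg (Set.Icc η β) := by
    have h1 : ∀ y ∈ Set.Icc η β, h y ≠ 0 := fun y _ => (hh0 y).ne'
    have h2 : ∀ y ∈ Set.Icc η β, y ^ 2 ≠ 0 := fun y hy => pow_ne_zero _ (hpos y hy).ne'
    have h3 := hhc.continuousOn (s := Set.Icc η β)
    refine ContinuousOn.div_const ?_ _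
    refine ContinuousOn.sub (ContinuousOn.add ?_ (by fun_prop)) ?_
    · exact continuousOn_const.div h3 h1
    · exact ContinuousOn.div (by fun_prop) (by fun_prop) h2
  have hmain := norm_integral_exp_phase_le (θ := fun y => τ * h y) (g := g) (dg := dg) hηβ
    (fun y hy => by
      have hy0 := hpos y hy
      have := hh0 y
      have hk : 0 < w + u + y ^ 2 := by positivity
      simp only [hg]
      positivity)
    (fun y hy => by
      have hy0 := hpos y hy
      have := hh0 y
      have hk : 0 < w + u + y ^ 2 := by positivity
      have h1 := (hasDerivAt_linePhase hφ hw hu y).const_mul τ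
      refine h1.congr_deriv ?_
      simp only [hg, ← hh, hc]
      field_simp)
    hgd hdgc
  refine hmain.trans ?_
  have hk : ∀ y ∈ Set.Icc η β, w + u + y ^ 2 ≤ ρ ^ 2 := fun y hy => by
    have : y ^ 2 ≤ β ^ 2 := by
      have := hpos y hy
      have := hy.2
      gcongr
    linarith
  have hyρ : ∀ y ∈ Set.Icc η β, y ^ 2 ≤ ρ ^ 2 := fun y hy => by
    have := hk y hy
    linarith
  set Cm := max 1 φ with hCm
  have hgb : ∀ y ∈ Set.Icc η β, |g y| ≤ Cm * ρ ^ 4 / η / |c| := by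
    intro y hy
    have hy0 := hpos y hy
    have hk0 : 0 < w + u + y ^ 2 := by positivity
    have := hh0 y
    simp only [hg]
    rw [abs_div, abs_of_pos (by positivity : 0 < h y * (w + u + y ^ 2) ^ 2 / y)]
    have h1 : (w + u + y ^ 2) ^ 2 ≤ ρ ^ 4 := by
      calc (w + u + y ^ 2) ^ 2 ≤ (ρ ^ 2) ^ 2 := by gcongr; exact hk y hy
        _ = ρ ^ 4 := by ring
    gcongr
    · exact (hmem y).2
    · exact hy.1
  have hdgb : ∀ y ∈ Set.Icc η β, |dg y| ≤
      ((|φ ^ 2 - 1| / min 1 φ + 5 * Cm) * ρ ^ 4 / |c|) * (y ^ 2)⁻¹ := by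
    intro y hy
    have hy0 := hpos y hy
    have hk0 : 0 < w + u + y ^ 2 := by positivity
    have hhy := hh0 y
    have hkρ := hk y hy
    have h4 : ρ ^ 2 ≤ ρ ^ 4 * (y ^ 2)⁻¹ := by
      rw [← div_eq_mul_inv, le_div_iff₀ (by positivity)]
      calc ρ ^ 2 * y ^ 2 ≤ ρ ^ 2 * ρ ^ 2 := mul_le_mul_of_nonneg_left (hyρ y hy) (sq_nonneg ρ)
        _ = ρ ^ 4 := by ring
    have h1 : |w * (φ ^ 2 - 1) / h y| ≤ |φ ^ 2 - 1| / min 1 φ * (ρ ^ 4 * (y ^ 2)⁻¹) := by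
      rw [abs_div, abs_mul, abs_of_pos hw, abs_of_pos hhy, mul_comm w, mul_div_right_comm]
      have : w ≤ ρ ^ 4 * (y ^ 2)⁻¹ := by nlinarith [sq_nonneg y]
      gcongr
      exact (hmem y).1
    have h2 : |4 * h y * (w + u + y ^ 2)| ≤ 4 * Cm * (ρ ^ 4 * (y ^ 2)⁻¹) := by
      rw [abs_of_pos (by positivity)]
      have : w + u + y ^ 2 ≤ ρ ^ 4 * (y ^ 2)⁻¹ := hkρ.trans h4
      gcongr
      exact (hmem y).2
    have h3 : |h y * (w + u + y ^ 2) ^ 2 / y ^ 2| ≤ Cm * (ρ ^ 4 * (y ^ 2)⁻¹) := by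
      rw [abs_of_pos (by positivity), mul_div_assoc, div_eq_mul_inv]
      have : (w + u + y ^ 2) ^ 2 ≤ ρ ^ 4 := by
        calc (w + u + y ^ 2) ^ 2 ≤ (ρ ^ 2) ^ 2 := by gcongr
          _ = ρ ^ 4 := by ring
      gcongr
      exact (hmem y).2
    simp only [hdg]
    rw [abs_div]
    calc _ ≤ (|φ ^ 2 - 1| / min 1 φ * (ρ ^ 4 * (y ^ 2)⁻¹) + 4 * Cm * (ρ ^ 4 * (y ^ 2)⁻¹) +
          Cm * (ρ ^ 4 * (y ^ 2)⁻¹)) / |c| := by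
          gcongr
          exact (abs_sub _ _).trans (add_le_add ((abs_add_le _ _).trans (add_le_add h1 h2)) h3)
      _ = _ := by ring
  set K := (|φ ^ 2 - 1| / min 1 φ + 5 * Cm) * ρ ^ 4 / |c| with hK
  have hK0 : 0 ≤ K := by positivity
  have hinv : ∀ y ∈ Set.Icc η β, HasDerivAt (fun y => -K * y⁻¹) (K * (y ^ 2)⁻¹) y := fun y hy => by
    have := (hasDerivAt_inv (hpos y hy).ne').const_mul (-K)
    refine this.congr_deriv ?_
    ring
  have hcont : ContinuousOn (fun y => K * (y ^ 2)⁻¹) (Set.Icc η β) := by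
    refine continuousOn_const.mul (ContinuousOn.inv₀ (by fun_prop) fun y hy => ?_)
    exact pow_ne_zero _ (hpos y hy).ne'
  have huIcc : Set.uIcc η β = Set.Icc η β := Set.uIcc_of_le hηβ
  have hInt : ∫ y in η..β, |dg y| ≤ K / η := by
    calc ∫ y in η..β, |dg y| ≤ ∫ y in η..β, K * (y ^ 2)⁻¹ := by
          refine intervalIntegral.integral_mono_on hηβ
            (ContinuousOn.intervalIntegrable (huIcc ▸ hdgc.abs))
            (ContinuousOn.intervalIntegrable (huIcc ▸ hcont)) hdgb
      _ = -K * β⁻¹ - -K * η⁻¹ :=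
          intervalIntegral.integral_eq_sub_of_hasDerivAt (fun y hy => hinv y (huIcc ▸ hy))
            (ContinuousOn.intervalIntegrable (huIcc ▸ hcont))
      _ ≤ K / η := by
          have : 0 ≤ K * β⁻¹ := mul_nonneg hK0 (inv_nonneg.2 (hη.le.trans hηβ))
          rw [div_eq_mul_inv]
          linarith
  have e1 := hgb η (Set.left_mem_Icc.2 hηβ)
  have e2 := hgb β (Set.right_mem_Icc.2 hηβ)
  have habs : |c| = |τ| * w * |φ ^ 2 - 1| := by
    rw [hc, abs_mul, abs_mul, abs_of_pos hw]; ring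
  calc _ ≤ Cm * ρ ^ 4 / η / |c| + Cm * ρ ^ 4 / η / |c| + K / η := by linarith
    _ = _ := by
      rw [hK, habs, dispConst]
      have : 0 < |τ| := abs_pos.2 hτ
      have : 0 < |φ ^ 2 - 1| := abs_pos.2 hφ2
      rw [← hCm]
      field_simp
      ring

theorem dispConst_ge_one {φ : ℝ} (hφ : 0 < φ) : 1 ≤ dispConst φ := by
  have : 0 < min 1 φ := lt_min one_pos hφ
  rw [dispConst]
  have : 0 ≤ (|φ ^ 2 - 1| / min 1 φ + 7 * max 1 φ) / |φ ^ 2 - 1| := by positivity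
  linarith

theorem norm_integral_exp_linePhase_le {φ w u τ ρ β : ℝ} (hφ : 0 < φ) (hφ1 : φ ≠ 1)
    (hw : 0 < w) (hu : 0 ≤ u) (hτ : τ ≠ 0) (hβ : 0 ≤ β)
    (hρ0 : 0 < ρ) (hρ : w + u + β ^ 2 ≤ ρ ^ 2) :
    ‖∫ y in (0 : ℝ)..β, Complex.exp (Complex.I * (τ * linePhase φ w u y : ℝ))‖ ≤
      dispConst φ * (ρ ^ 2 / (√w * √|τ|)) := by
  have hτ0 : 0 < |τ| := abs_pos.2 hτ
  set η := ρ ^ 2 / (√w * √|τ|) with hη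
  have hη0 : 0 < η := by positivity
  have hC := dispConst_ge_one hφ
  have hnorm : ∀ y : ℝ, ‖Complex.exp (Complex.I * (τ * linePhase φ w u y : ℝ))‖ ≤ 1 := fun y => by
    rw [mul_comm, Complex.norm_exp_ofReal_mul_I]
  have htriv : ∀ b : ℝ, 0 ≤ b →
      ‖∫ y in (0 : ℝ)..b, Complex.exp (Complex.I * (τ * linePhase φ w u y : ℝ))‖ ≤ b := by
    intro b hb
    have := intervalIntegral.norm_integral_le_of_norm_le_const (a := 0) (b := b)
      (fun y _ => hnorm y)
    simpa [abs_of_nonneg hb] using this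
  have hcont : Continuous fun y : ℝ => Complex.exp (Complex.I * (τ * linePhase φ w u y : ℝ)) := by
    have : Continuous (linePhase φ w u) :=
      continuous_iff_continuousAt.2 fun y => (hasDerivAt_linePhase hφ hw hu y).continuousAt
    fun_prop
  rcases le_total β η with h | h
  · exact (htriv β hβ).trans (h.trans (by nlinarith))
  · rw [← intervalIntegral.integral_add_adjacent_intervals (b := η)
      (hcont.intervalIntegrable _ _) (hcont.intervalIntegrable _ _)]
    refine (norm_add_le _ _).trans ?_
    have h1 := norm_integral_exp_linePhase_far hφ hφ1 hw hu hτ hη0 h hρ0 hρ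
    have h2 : ρ ^ 4 / (|τ| * w * η) = η := by
      rw [hη]
      have hs := Real.sq_sqrt hw.le
      have ht := Real.sq_sqrt hτ0.le
      have : 0 < √w := Real.sqrt_pos.2 hw
      have : 0 < √|τ| := Real.sqrt_pos.2 hτ0
      rw [div_eq_div_iff (by positivity) (by positivity)]
      field_simp
      rw [hs, ht]
      ring
    rw [h2] at h1
    linarith [htriv η hη0.le]

/-! ### The dispersive estimate -/

/-- The dispersion relation `√(ξ₃² + F⁻²|ξ_h|²) / |ξ|`. -/
def wavePhase (F : ℝ) (ξ : Space) : ℝ :=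
  √((ξ 2 ^ 2 + F⁻¹ ^ 2 * (ξ 0 ^ 2 + ξ 1 ^ 2)) / ‖ξ‖ ^ 2)

/-- The frequencies `|ξ| ≤ ρ`, `|ξ₃| ≥ δ`. -/
def freqRegion (δ ρ : ℝ) : Set Space := {ξ | ‖ξ‖ ≤ ρ ∧ δ ≤ |ξ 2|}

theorem norm_sq_space (ξ : Space) : ‖ξ‖ ^ 2 = ξ 0 ^ 2 + ξ 1 ^ 2 + ξ 2 ^ 2 := by
  simp [EuclideanSpace.norm_sq_eq, Fin.sum_univ_three]

theorem measurable_wavePhase (F : ℝ) : Measurable (wavePhase F) := by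
  unfold wavePhase
  fun_prop

theorem measurableSet_freqRegion (δ ρ : ℝ) : MeasurableSet (freqRegion δ ρ) := by
  have h1 : Measurable fun ξ : Space => ‖ξ‖ := by fun_prop
  have h2 : Measurable fun ξ : Space => |ξ 2| := by fun_prop
  exact (measurableSet_le h1 measurable_const).inter (measurableSet_le measurable_const h2)

theorem freqRegion_subset_closedBall (δ ρ : ℝ) :
    freqRegion δ ρ ⊆ Metric.closedBall 0 ρ := fun ξ hξ => by simpa using hξ.1

theorem volume_freqRegion_lt_top (δ ρ : ℝ) : volume (freqRegion δ ρ) < ⊤ :=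
  (measure_mono (freqRegion_subset_closedBall δ ρ)).trans_lt measure_closedBall_lt_top

/-- A horizontal reflection, exchanging the first axis and the direction `(c, s, 0)`. -/
def horizontalReflectionLin (c s : ℝ) : Space →ₗ[ℝ] Space where
  toFun ξ := !₂[c * ξ 0 + s * ξ 1, s * ξ 0 - c * ξ 1, ξ 2]
  map_add' ξ η := by
    ext i
    fin_cases i <;> simp <;> ring
  map_smul' a ξ := by
    ext i
    fin_cases i <;> simp <;> ring

theorem horizontalReflectionLin_involutive {c s : ℝ} (h : c ^ 2 + s ^ 2 = 1) :
    Function.Involutive (horizontalReflectionLin c s) := by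
  intro ξ
  ext i
  fin_cases i <;> simp [horizontalReflectionLin]
  · linear_combination ξ 0 * h
  · linear_combination ξ 1 * h

theorem norm_horizontalReflectionLin {c s : ℝ} (h : c ^ 2 + s ^ 2 = 1) (ξ : Space) :
    ‖horizontalReflectionLin c s ξ‖ = ‖ξ‖ := by
  rw [← sq_eq_sq₀ (norm_nonneg _) (norm_nonneg _), norm_sq_space, norm_sq_space]
  simp [horizontalReflectionLin]
  linear_combination (ξ 0 ^ 2 + ξ 1 ^ 2) * h

/-- `horizontalReflectionLin` as a linear isometry. -/
def horizontalReflection (c s : ℝ) (h : c ^ 2 + s ^ 2 = 1) : Space ≃ₗᵢ[ℝ] Space where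
  toLinearEquiv := LinearEquiv.ofInvolutive _ (horizontalReflectionLin_involutive h)
  norm_map' := norm_horizontalReflectionLin h

theorem horizontalReflection_apply (c s : ℝ) (h : c ^ 2 + s ^ 2 = 1) (ξ : Space) :
    horizontalReflection c s h ξ = !₂[c * ξ 0 + s * ξ 1, s * ξ 0 - c * ξ 1, ξ 2] := rfl

theorem wavePhase_horizontalReflection (F c s : ℝ) (h : c ^ 2 + s ^ 2 = 1) (ξ : Space) :
    wavePhase F (horizontalReflection c s h ξ) = wavePhase F ξ := by
  rw [wavePhase, LinearIsometryEquiv.norm_map, wavePhase, horizontalReflection_apply]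
  congr 3
  simp
  left
  linear_combination (ξ 0 ^ 2 + ξ 1 ^ 2) * h

theorem horizontalReflection_mem_freqRegion (δ ρ c s : ℝ) (h : c ^ 2 + s ^ 2 = 1) (ξ : Space) :
    horizontalReflection c s h ξ ∈ freqRegion δ ρ ↔ ξ ∈ freqRegion δ ρ := by
  simp only [freqRegion, Set.mem_ofPred_eq, LinearIsometryEquiv.norm_map]
  simp [horizontalReflection_apply]

theorem exists_unit_horizontal (x y : ℝ) : ∃ c s : ℝ, c ^ 2 + s ^ 2 = 1 ∧ x * s = y * c := by
  by_cases h : x ^ 2 + y ^ 2 = 0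
  · refine ⟨1, 0, by norm_num, ?_⟩
    have : y = 0 := by nlinarith [sq_nonneg x, sq_nonneg y]
    simp [this]
  · have hpos : 0 < x ^ 2 + y ^ 2 := lt_of_le_of_ne (by positivity) (Ne.symm h)
    have hs := Real.sq_sqrt hpos.le
    have hs0 : 0 < √(x ^ 2 + y ^ 2) := Real.sqrt_pos.2 hpos
    refine ⟨x / √(x ^ 2 + y ^ 2), y / √(x ^ 2 + y ^ 2), ?_, ?_⟩
    · rw [div_pow, div_pow, hs]
      field_simp
    · ring

/-- Integration over `ℝ³`, the second variable first. -/
theorem norm_integral_space_le {f : Space → ℂ} (hf : Integrable f) :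
    ‖∫ ξ, f ξ‖ ≤ ∫ z : Fin 2 → ℝ, ‖∫ y : ℝ, f !₂[z 0, y, z 1]‖ := by
  have e1 := PiLp.volume_preserving_toLp (Fin 3)
  have e2 := (volume_preserving_piFinSuccAbove (fun _ : Fin 3 => ℝ) 1).symm
  have e3 := e1.comp e2
  have hemb : MeasurableEmbedding ((WithLp.toLp 2 : (Fin 3 → ℝ) → Space) ∘
      (MeasurableEquiv.piFinSuccAbove (fun _ : Fin 3 => ℝ) 1).symm) :=
    (MeasurableEquiv.toLp 2 (Fin 3 → ℝ)).measurableEmbedding.comp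
      (MeasurableEquiv.measurableEmbedding _)
  have hf' := (e3.integrable_comp_emb hemb).2 hf
  rw [← e3.integral_comp hemb]
  have hpt : ∀ (y : ℝ) (z : Fin 2 → ℝ), (WithLp.toLp 2 ((MeasurableEquiv.piFinSuccAbove
      (fun _ : Fin 3 => ℝ) 1).symm (y, z)) : Space) = !₂[z 0, y, z 1] := by
    intro y z
    ext i
    fin_cases i <;> rfl
  have : (volume : Measure (ℝ × (Fin 2 → ℝ))) = volume.prod volume := rfl
  rw [this] at hf' ⊢
  refine (congrArg norm (integral_prod_symm _ hf')).le.trans ?_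
  refine (norm_integral_le_integral_norm _).trans (le_of_eq ?_)
  refine integral_congr_ae (Filter.Eventually.of_forall fun z => ?_)
  dsimp only [Function.comp]
  simp_rw [hpt]

theorem norm_integral_slice_le {F δ ρ τ : ℝ} (hF : 0 < F) (hF1 : F ≠ 1) (hδ : 0 < δ) (hρ : 0 < ρ)
    (hτ : τ ≠ 0) (A B : ℝ) (z : Fin 2 → ℝ) :
    ‖∫ y : ℝ, (freqRegion δ ρ).indicator (fun ξ => Complex.exp (Complex.I *
      ((ξ 0 * A + ξ 2 * B + τ * wavePhase F ξ : ℝ) : ℂ))) !₂[z 0, y, z 1]‖ ≤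
      (Set.Icc (fun _ => -ρ) (fun _ => ρ) : Set (Fin 2 → ℝ)).indicator
        (fun _ => 2 * dispConst F⁻¹ * (ρ ^ 2 / (δ * √|τ|))) z := by
  have hmem : ∀ y : ℝ, (!₂[z 0, y, z 1] : Space) ∈ freqRegion δ ρ ↔
      z 0 ^ 2 + y ^ 2 + z 1 ^ 2 ≤ ρ ^ 2 ∧ δ ≤ |z 1| := by
    intro y
    rw [freqRegion, Set.mem_ofPred_eq, ← sq_le_sq₀ (norm_nonneg _) hρ.le, norm_sq_space]
    simp
  have hC := dispConst_ge_one (inv_pos.2 hF)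
  by_cases hz : z 0 ^ 2 + z 1 ^ 2 ≤ ρ ^ 2 ∧ δ ≤ |z 1|
  swap
  · have h0 : ∀ y : ℝ, (!₂[z 0, y, z 1] : Space) ∉ freqRegion δ ρ := fun y hy => hz (by
      rw [hmem] at hy
      exact ⟨by nlinarith [hy.1, sq_nonneg y], hy.2⟩)
    simp_rw [Set.indicator_of_notMem (h0 _)]
    simp only [integral_zero, norm_zero]
    exact Set.indicator_nonneg (fun _ _ => by positivity) _
  obtain ⟨hz1, hz2⟩ := hz
  have hzI : z ∈ (Set.Icc (fun _ => -ρ) (fun _ => ρ) : Set (Fin 2 → ℝ)) := by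
    have h0 : |z 0| ≤ ρ := abs_le_of_sq_le_sq (by nlinarith [sq_nonneg (z 1)]) hρ.le
    have h1 : |z 1| ≤ ρ := abs_le_of_sq_le_sq (by nlinarith [sq_nonneg (z 0)]) hρ.le
    rw [abs_le] at h0 h1
    constructor <;> intro i <;> fin_cases i <;> simp [h0, h1]
  rw [Set.indicator_of_mem hzI]
  set β := √(ρ ^ 2 - (z 0 ^ 2 + z 1 ^ 2)) with hβ
  have hβ0 : 0 ≤ β := Real.sqrt_nonneg _
  have hβ2 : β ^ 2 = ρ ^ 2 - (z 0 ^ 2 + z 1 ^ 2) := Real.sq_sqrt (by linarith)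
  have hw : 0 < z 1 ^ 2 := by
    have : z 1 ≠ 0 := by
      intro h
      rw [h] at hz2
      simp at hz2
      linarith
    positivity
  set g : ℝ → ℂ := fun y => Complex.exp (Complex.I *
    (τ * linePhase F⁻¹ (z 1 ^ 2) (z 0 ^ 2) y : ℝ)) with hg
  have hφ1 : F⁻¹ ≠ 1 := by simpa using hF1
  have hInt : ∀ y : ℝ, (freqRegion δ ρ).indicator (fun ξ => Complex.exp (Complex.I *
      ((ξ 0 * A + ξ 2 * B + τ * wavePhase F ξ : ℝ) : ℂ))) !₂[z 0, y, z 1] =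
      Complex.exp (Complex.I * ((z 0 * A + z 1 * B : ℝ) : ℂ)) *
        (Set.Icc (-β) β).indicator g y := by
    intro y
    have hiff : (!₂[z 0, y, z 1] : Space) ∈ freqRegion δ ρ ↔ y ∈ Set.Icc (-β) β := by
      rw [hmem, Set.mem_Icc, ← abs_le, ← sq_le_sq₀ (abs_nonneg y) hβ0, hβ2, sq_abs]
      constructor
      · rintro ⟨h, -⟩
        linarith
      · intro h
        exact ⟨by linarith, hz2⟩
    by_cases hy : y ∈ Set.Icc (-β) β
    · rw [Set.indicator_of_mem hy, Set.indicator_of_mem (hiff.2 hy), hg, ← Complex.exp_add]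
      congr 1
      have hph : wavePhase F !₂[z 0, y, z 1] = linePhase F⁻¹ (z 1 ^ 2) (z 0 ^ 2) y := by
        rw [wavePhase, linePhase, norm_sq_space]
        simp
        congr 2
        ring
      rw [hph]
      simp
      ring
    · rw [Set.indicator_of_notMem hy, Set.indicator_of_notMem (fun h => hy (hiff.1 h)), mul_zero]
  simp_rw [hInt]
  rw [integral_const_mul, norm_mul]
  have hn : ‖Complex.exp (Complex.I * ((z 0 * A + z 1 * B : ℝ) : ℂ))‖ = 1 := by
    rw [mul_comm, Complex.norm_exp_ofReal_mul_I]
  rw [hn, one_mul, integral_indicator measurableSet_Icc, integral_Icc_eq_integral_Ioc,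
    ← intervalIntegral.integral_of_le (by linarith)]
  have hgc : Continuous g := by
    have : Continuous (linePhase F⁻¹ (z 1 ^ 2) (z 0 ^ 2)) :=
      continuous_iff_continuousAt.2 fun y =>
        (hasDerivAt_linePhase (inv_pos.2 hF) hw (sq_nonneg _) y).continuousAt
    fun_prop
  have hsym : ∫ y in (-β)..0, g y = ∫ y in (0 : ℝ)..β, g y := by
    have h1 := intervalIntegral.integral_comp_neg (a := 0) (b := β) g
    rw [neg_zero] at h1
    rw [← h1]
    refine intervalIntegral.integral_congr fun y _ => ?_
    simp [hg, linePhase]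
  rw [← intervalIntegral.integral_add_adjacent_intervals (b := 0)
    (hgc.intervalIntegrable _ _) (hgc.intervalIntegrable _ _), hsym, ← two_mul, norm_mul]
  have hmain := norm_integral_exp_linePhase_le (inv_pos.2 hF) hφ1 hw (sq_nonneg (z 0)) hτ hβ0 hρ
    (by linarith)
  have hle : ρ ^ 2 / (√(z 1 ^ 2) * √|τ|) ≤ ρ ^ 2 / (δ * √|τ|) := by
    have : 0 < √|τ| := Real.sqrt_pos.2 (abs_pos.2 hτ)
    rw [Real.sqrt_sq_eq_abs]
    gcongr
  calc ‖(2 : ℂ)‖ * ‖∫ y in (0 : ℝ)..β, g y‖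
      ≤ 2 * (dispConst F⁻¹ * (ρ ^ 2 / (√(z 1 ^ 2) * √|τ|))) := by
        rw [Complex.norm_ofNat]
        gcongr
    _ ≤ 2 * (dispConst F⁻¹ * (ρ ^ 2 / (δ * √|τ|))) := by gcongr
    _ = _ := by ring

/-- The dispersive estimate for the frequencies `|ξ| ≤ ρ`, `|ξ₃| ≥ δ`. -/
theorem norm_dispersive_kernel_le {F δ ρ τ : ℝ} (hF : 0 < F) (hF1 : F ≠ 1) (hδ : 0 < δ)
    (hρ : 0 < ρ) (hτ : τ ≠ 0) (x : Space) :
    ‖∫ ξ in freqRegion δ ρ, Complex.exp (Complex.I *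
      ((inner ℝ x ξ + τ * wavePhase F ξ : ℝ) : ℂ))‖ ≤
      8 * dispConst F⁻¹ * (ρ ^ 4 / (δ * √|τ|)) := by
  obtain ⟨c, s, hcs, hxy⟩ := exists_unit_horizontal (x 0) (x 1)
  set e := horizontalReflection c s hcs with he
  have hmp := e.measurePreserving
  rw [← integral_indicator (measurableSet_freqRegion δ ρ),
    ← hmp.integral_comp e.toHomeomorph.measurableEmbedding]
  have hpt : ∀ ξ : Space, (freqRegion δ ρ).indicator (fun ξ => Complex.exp (Complex.I *
      ((inner ℝ x ξ + τ * wavePhase F ξ : ℝ) : ℂ))) (e ξ) =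
      (freqRegion δ ρ).indicator (fun ξ => Complex.exp (Complex.I *
      ((ξ 0 * (c * x 0 + s * x 1) + ξ 2 * x 2 + τ * wavePhase F ξ : ℝ) : ℂ))) ξ := by
    intro ξ
    by_cases hξ : ξ ∈ freqRegion δ ρ
    · rw [Set.indicator_of_mem hξ,
        Set.indicator_of_mem ((horizontalReflection_mem_freqRegion δ ρ c s hcs ξ).2 hξ),
        wavePhase_horizontalReflection]
      congr 4
      rw [horizontalReflection_apply, PiLp.inner_apply, Fin.sum_univ_three]
      simp
      linear_combination ξ 1 * hxy
    · rw [Set.indicator_of_notMem hξ, Set.indicator_of_notMem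
        (fun h => hξ ((horizontalReflection_mem_freqRegion δ ρ c s hcs ξ).1 h))]
  simp_rw [hpt]
  set G : Space → ℂ := (freqRegion δ ρ).indicator (fun ξ => Complex.exp (Complex.I *
      ((ξ 0 * (c * x 0 + s * x 1) + ξ 2 * x 2 + τ * wavePhase F ξ : ℝ) : ℂ))) with hG
  have hGi : Integrable G := by
    rw [hG, integrable_indicator_iff (measurableSet_freqRegion δ ρ)]
    refine IntegrableOn.of_bound (volume_freqRegion_lt_top δ ρ) ?_ 1 ?_
    · have := measurable_wavePhase F
      have h0 : Measurable fun ξ : Space => ξ 0 := by fun_prop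
      have h2 : Measurable fun ξ : Space => ξ 2 := by fun_prop
      exact (by fun_prop : Measurable _).aestronglyMeasurable
    · refine Filter.Eventually.of_forall fun ξ => ?_
      rw [mul_comm, Complex.norm_exp_ofReal_mul_I]
  refine (norm_integral_space_le hGi).trans ?_
  set S : Set (Fin 2 → ℝ) := Set.Icc (fun _ => -ρ) (fun _ => ρ) with hS
  have hSm : MeasurableSet S := measurableSet_Icc
  have hSv : volume.real S = 4 * ρ ^ 2 := by
    rw [Measure.real, hS, Real.volume_Icc_pi_toReal (fun _ => by linarith)]
    simp
    ring
  calc ∫ z : Fin 2 → ℝ, ‖∫ y : ℝ, G !₂[z 0, y, z 1]‖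
      ≤ ∫ z, S.indicator (fun _ => 2 * dispConst F⁻¹ * (ρ ^ 2 / (δ * √|τ|))) z := by
        refine integral_mono_of_nonneg (Filter.Eventually.of_forall fun _ => norm_nonneg _) ?_
          (Filter.Eventually.of_forall fun z =>
            norm_integral_slice_le hF hF1 hδ hρ hτ (c * x 0 + s * x 1) (x 2) z)
        rw [integrable_indicator_iff hSm]
        exact integrableOn_const (by rw [hS]; exact isCompact_Icc.measure_lt_top.ne)
    _ = 8 * dispConst F⁻¹ * (ρ ^ 4 / (δ * √|τ|)) := by
        rw [integral_indicator_const _ hSm, hSv, smul_eq_mul]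
        ring

/-! ### The `TT*` argument -/

section TTstar

variable {α Ω V : Type*} [MeasurableSpace α] [MeasurableSpace Ω] {μ : Measure α} {ν : Measure Ω}
  [IsFiniteMeasure ν] [NormedAddCommGroup V] [InnerProductSpace ℂ V]

/-- The adjoint of `G ↦ ∫ E(a, ξ) G(ξ) dξ`. -/
def adjointTransform (E : α → Ω → ℂ) (μ : Measure α) (φ : α → V) (ξ : Ω) : V :=
  ∫ a, (starRingEnd ℂ (E a ξ)) • φ a ∂μ

theorem integrable_kernel_smul_prod {E : α → Ω → ℂ} (hE : Measurable (Function.uncurry E))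
    (hE1 : ∀ a ξ, ‖E a ξ‖ ≤ 1) {φ : α → V} (hφ : Integrable φ μ) :
    Integrable (fun z : α × Ω => (starRingEnd ℂ (E z.1 z.2)) • φ z.1) (μ.prod ν) := by
  refine (hφ.comp_fst ν).bdd_smul 1 ?_ ?_
  · exact ((Complex.continuous_conj.measurable).comp hE).aestronglyMeasurable
  · exact Filter.Eventually.of_forall fun z => by simpa using hE1 z.1 z.2

variable [SFinite μ]

theorem integrable_adjointTransform {E : α → Ω → ℂ} (hE : Measurable (Function.uncurry E))
    (hE1 : ∀ a ξ, ‖E a ξ‖ ≤ 1) {φ : α → V} (hφ : Integrable φ μ) :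
    Integrable (adjointTransform E μ φ) ν :=
  (integrable_kernel_smul_prod hE hE1 hφ).integral_prod_right

variable [CompleteSpace V]

theorem integral_inner_transform {E : α → Ω → ℂ} (hE : Measurable (Function.uncurry E))
    (hE1 : ∀ a ξ, ‖E a ξ‖ ≤ 1) {φ : α → V} (hφ : Integrable φ μ) {G : Ω → V}
    (hG : Integrable G ν) :
    ∫ a, (inner ℂ (φ a) (∫ ξ, E a ξ • G ξ ∂ν)) ∂μ = ∫ ξ, (inner ℂ (adjointTransform E μ φ ξ) (G ξ)) ∂ν := by
  have hEa : ∀ a, Integrable (fun ξ => E a ξ • G ξ) ν := fun a =>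
    hG.bdd_smul 1 (hE.comp measurable_prodMk_left).aestronglyMeasurable
      (Filter.Eventually.of_forall fun ξ => hE1 a ξ)
  have hEξ : ∀ ξ, Integrable (fun a => (starRingEnd ℂ (E a ξ)) • φ a) μ := fun ξ =>
    hφ.bdd_smul 1 ((Complex.continuous_conj.measurable).comp
      (hE.comp measurable_prodMk_right)).aestronglyMeasurable
      (Filter.Eventually.of_forall fun a => by simpa using hE1 a ξ)
  have h1 : ∀ a, (inner ℂ (φ a) (∫ ξ, E a ξ • G ξ ∂ν)) = ∫ ξ, E a ξ * (inner ℂ (φ a) (G ξ)) ∂ν := by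
    intro a
    rw [← integral_inner (hEa a)]
    simp_rw [inner_smul_right]
  have h2 : ∀ ξ, (inner ℂ (adjointTransform E μ φ ξ) (G ξ)) = ∫ a, E a ξ * (inner ℂ (φ a) (G ξ)) ∂μ := by
    intro ξ
    rw [← inner_conj_symm, adjointTransform, ← integral_inner (hEξ ξ), ← integral_conj]
    refine integral_congr_ae (Filter.Eventually.of_forall fun a => ?_)
    simp [inner_smul_right]
  simp_rw [h1, h2]
  refine integral_integral_swap ?_
  have hb : Integrable (fun z : α × Ω => ‖φ z.1‖ * ‖G z.2‖) (μ.prod ν) :=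
    hφ.norm.mul_prod hG.norm
  refine hb.mono' ?_ ?_
  · exact (hE.aestronglyMeasurable).mul ((hφ.1.comp_fst).inner (hG.1.comp_snd))
  · refine Filter.Eventually.of_forall fun z => ?_
    simp only [Function.uncurry, norm_mul]
    calc ‖E z.1 z.2‖ * ‖(inner ℂ (φ z.1) (G z.2))‖ ≤ 1 * (‖φ z.1‖ * ‖G z.2‖) := by
          gcongr
          · exact hE1 _ _
          · exact norm_inner_le_norm _ _
      _ = _ := one_mul _

theorem transform_adjointTransform {E : α → Ω → ℂ} (hE : Measurable (Function.uncurry E))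
    (hE1 : ∀ a ξ, ‖E a ξ‖ ≤ 1) {φ : α → V} (hφ : Integrable φ μ) (a : α) :
    ∫ ξ, E a ξ • adjointTransform E μ φ ξ ∂ν =
      ∫ b, (∫ ξ, E a ξ * starRingEnd ℂ (E b ξ) ∂ν) • φ b ∂μ := by
  simp_rw [adjointTransform, ← integral_smul, ← integral_smul_const, ← mul_smul]
  rw [integral_integral_swap]
  simp_rw [Function.uncurry_def, mul_smul]
  refine Integrable.bdd_smul (integrable_kernel_smul_prod hE hE1 hφ).swap 1 ?_ ?_
  · exact (hE.comp (measurable_const.prodMk measurable_fst)).aestronglyMeasurable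
  · exact Filter.Eventually.of_forall fun z => hE1 _ _

theorem enorm_integral_inner_le {E : α → Ω → ℂ} (hE : Measurable (Function.uncurry E))
    (hE1 : ∀ a ξ, ‖E a ξ‖ ≤ 1) {φ : α → V} (hφ : Integrable φ μ) {G : Ω → V}
    (hG : Integrable G ν) {k : α → α → ℝ≥0∞}
    (hk : ∀ a b, ‖∫ ξ, E a ξ * starRingEnd ℂ (E b ξ) ∂ν‖ₑ ≤ k a b) :
    ‖∫ a, (inner ℂ (φ a) (∫ ξ, E a ξ • G ξ ∂ν)) ∂μ‖ₑ ≤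
      (∫⁻ a, ∫⁻ b, ‖φ a‖ₑ * ‖φ b‖ₑ * k a b ∂μ ∂μ) ^ (1 / 2 : ℝ) * eLpNorm G 2 ν := by
  set Φ := adjointTransform E μ φ with hΦ
  have hΦi : Integrable Φ ν := integrable_adjointTransform hE hE1 hφ
  have hsq : ∫⁻ ξ, ‖Φ ξ‖ₑ ^ (2 : ℝ) ∂ν ≤ ∫⁻ a, ∫⁻ b, ‖φ a‖ₑ * ‖φ b‖ₑ * k a b ∂μ ∂μ := by
    have hbd : ∀ ξ, ‖Φ ξ‖ ≤ ∫ a, ‖φ a‖ ∂μ := by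
      intro ξ
      refine (norm_integral_le_integral_norm _).trans ?_
      refine integral_mono_of_nonneg (Filter.Eventually.of_forall fun _ => norm_nonneg _) hφ.norm
        (Filter.Eventually.of_forall fun a => ?_)
      simp only [norm_smul, RCLike.norm_conj]
      exact mul_le_of_le_one_left (norm_nonneg _) (hE1 a ξ)
    have hInt : Integrable (fun ξ => (inner ℂ (Φ ξ) (Φ ξ))) ν := by
      refine (hΦi.norm.const_mul (∫ a, ‖φ a‖ ∂μ)).mono' (hΦi.1.inner hΦi.1)
        (Filter.Eventually.of_forall fun ξ => ?_)
      exact (norm_inner_le_norm _ _).trans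
        (mul_le_mul_of_nonneg_right (hbd ξ) (norm_nonneg _))
    have h1 : ∫⁻ ξ, ‖Φ ξ‖ₑ ^ (2 : ℝ) ∂ν = ‖∫ ξ, (inner ℂ (Φ ξ) (Φ ξ)) ∂ν‖ₑ := by
      have h2 : ∫ ξ, (inner ℂ (Φ ξ) (Φ ξ)) ∂ν = ((∫ ξ, ‖Φ ξ‖ ^ 2 ∂ν : ℝ) : ℂ) := by
        rw [← integral_complex_ofReal]
        refine integral_congr_ae (Filter.Eventually.of_forall fun ξ => ?_)
        simp [inner_self_eq_norm_sq_to_K]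
      have h3 : Integrable (fun ξ => ‖Φ ξ‖ ^ 2) ν := by
        refine hInt.norm.congr (Filter.Eventually.of_forall fun ξ => ?_)
        simp [inner_self_eq_norm_sq_to_K]
      rw [h2, ← ofReal_norm, Complex.norm_real, Real.norm_of_nonneg
        (integral_nonneg fun _ => by positivity),
        ofReal_integral_eq_lintegral_ofReal h3 (Filter.Eventually.of_forall fun _ => by positivity)]
      refine lintegral_congr fun ξ => ?_
      rw [ENNReal.ofReal_pow (norm_nonneg _), ofReal_norm]
      norm_cast
    rw [h1, ← integral_inner_transform hE hE1 hφ hΦi]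
    refine (enorm_integral_le_lintegral_enorm _).trans (lintegral_mono fun a => ?_)
    rw [transform_adjointTransform hE hE1 hφ a]
    calc ‖(inner ℂ (φ a) (∫ b, (∫ ξ, E a ξ * starRingEnd ℂ (E b ξ) ∂ν) • φ b ∂μ))‖ₑ
        ≤ ‖φ a‖ₑ * ‖∫ b, (∫ ξ, E a ξ * starRingEnd ℂ (E b ξ) ∂ν) • φ b ∂μ‖ₑ := by
          rw [← ofReal_norm, ← ofReal_norm, ← ofReal_norm,
            ← ENNReal.ofReal_mul (norm_nonneg _)]
          exact ENNReal.ofReal_le_ofReal (norm_inner_le_norm _ _)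
      _ ≤ ‖φ a‖ₑ * ∫⁻ b, k a b * ‖φ b‖ₑ ∂μ := by
          gcongr
          refine (enorm_integral_le_lintegral_enorm _).trans (lintegral_mono fun b => ?_)
          rw [enorm_smul]
          gcongr
          exact hk a b
      _ = ∫⁻ b, ‖φ a‖ₑ * ‖φ b‖ₑ * k a b ∂μ := by
          rw [← lintegral_const_mul' _ _ (by simp)]
          refine lintegral_congr fun b => ?_
          ring
  rw [integral_inner_transform hE hE1 hφ hG]
  refine (enorm_integral_le_lintegral_enorm _).trans ?_
  calc ∫⁻ ξ, ‖(inner ℂ (Φ ξ) (G ξ))‖ₑ ∂ν ≤ ∫⁻ ξ, ‖Φ ξ‖ₑ * ‖G ξ‖ₑ ∂ν := by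
        refine lintegral_mono fun ξ => ?_
        rw [← ofReal_norm, ← ofReal_norm, ← ofReal_norm, ← ENNReal.ofReal_mul (norm_nonneg _)]
        exact ENNReal.ofReal_le_ofReal (norm_inner_le_norm _ _)
    _ ≤ (∫⁻ ξ, ‖Φ ξ‖ₑ ^ (2 : ℝ) ∂ν) ^ (1 / 2 : ℝ) * (∫⁻ ξ, ‖G ξ‖ₑ ^ (2 : ℝ) ∂ν) ^ (1 / 2 : ℝ) :=
        ENNReal.lintegral_mul_le_Lp_mul_Lq ν Real.HolderConjugate.two_two hΦi.1.enorm hG.1.enorm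
    _ ≤ _ := by
        rw [eLpNorm_eq_lintegral_rpow_enorm_toReal (by simp) (by simp)]
        simp only [ENNReal.toReal_ofNat]
        gcongr

end TTstar

/-- Young's inequality for the bilinear form with a convolution kernel `L ^ (2 / q)`. -/
theorem lintegral_lintegral_young_le {M L : ℝ → ℝ≥0∞} (hM : Measurable M) (hL : Measurable L)
    {q : ℝ} (hq : 2 ≤ q) (S : Set ℝ) :
    ∫⁻ a in S, ∫⁻ b in S, M a ^ (1 - 1 / q) * M b ^ (1 - 1 / q) * L (a - b) ^ (2 / q) ≤
      (∫⁻ a in S, M a) ^ (2 - 2 / q) * (∫⁻ x, L x) ^ (2 / q) := by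
  have hq0 : 0 < q := by linarith
  have hq1 : 1 / q ≤ 1 / 2 := one_div_le_one_div_of_le (by norm_num) hq
  have hq2 : 0 < 1 / q := by positivity
  set I := ∫⁻ a in S, M a with hI
  set J := ∫⁻ x, L x with hJ
  set f : Fin 3 → ℝ × ℝ → ℝ≥0∞ := ![fun z => M z.1 * M z.2, fun z => M z.1 * L (z.1 - z.2),
    fun z => M z.2 * L (z.1 - z.2)] with hf
  have hfm : ∀ i, Measurable (f i) := by
    intro i
    fin_cases i
    · exact (hM.comp measurable_fst).mul (hM.comp measurable_snd)
    · exact (hM.comp measurable_fst).mul (hL.comp (measurable_fst.sub measurable_snd))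
    · exact (hM.comp measurable_snd).mul (hL.comp (measurable_fst.sub measurable_snd))
  have hH := ENNReal.lintegral_prod_norm_pow_le
    (μ := (volume.restrict S).prod (volume.restrict S)) Finset.univ (f := f)
    (fun i _ => (hfm i).aemeasurable) (p := ![1 - 2 / q, 1 / q, 1 / q])
    (by rw [Fin.sum_univ_three]; simp; ring)
    (fun i _ => by
      fin_cases i
      · simp
        rw [div_le_one hq0]
        exact hq
      · simpa using hq0.le
      · simpa using hq0.le)
  simp only [Fin.prod_univ_three, hf, Matrix.cons_val_zero, Matrix.cons_val_one,
    Matrix.cons_val] at hH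
  have hm : Measurable fun z : ℝ × ℝ =>
      M z.1 ^ (1 - 1 / q) * M z.2 ^ (1 - 1 / q) * L (z.1 - z.2) ^ (2 / q) :=
    (((hM.comp measurable_fst).pow_const _).mul ((hM.comp measurable_snd).pow_const _)).mul
      ((hL.comp (measurable_fst.sub measurable_snd)).pow_const _)
  rw [← lintegral_prod (μ := volume.restrict S) (ν := volume.restrict S)
    (fun z : ℝ × ℝ => M z.1 ^ (1 - 1 / q) * M z.2 ^ (1 - 1 / q) * L (z.1 - z.2) ^ (2 / q))
    hm.aemeasurable]
  have h0 : 0 ≤ 1 - 2 / q := by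
    have : 2 / q = 2 * (1 / q) := by ring
    linarith
  have i1 : ∫⁻ z, M z.1 * M z.2 ∂((volume.restrict S).prod (volume.restrict S)) = I * I :=
    lintegral_prod_mul hM.aemeasurable hM.aemeasurable
  have i2 : ∫⁻ z, M z.1 * L (z.1 - z.2) ∂((volume.restrict S).prod (volume.restrict S)) ≤
      I * J := by
    rw [lintegral_prod _ (by simpa [hf] using (hfm 1).aemeasurable)]
    rw [hI, ← lintegral_mul_const _ hM]
    refine lintegral_mono fun a => ?_
    dsimp only
    rw [lintegral_const_mul _ (by fun_prop)]
    gcongr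
    refine (setLIntegral_le_lintegral _ _).trans (le_of_eq ?_)
    exact lintegral_sub_left_eq_self L a
  have i3 : ∫⁻ z, M z.2 * L (z.1 - z.2) ∂((volume.restrict S).prod (volume.restrict S)) ≤
      I * J := by
    rw [lintegral_prod_symm _ (by simpa [hf] using (hfm 2).aemeasurable)]
    rw [hI, ← lintegral_mul_const _ hM]
    refine lintegral_mono fun b => ?_
    dsimp only
    rw [lintegral_const_mul _ (by fun_prop)]
    gcongr
    refine (setLIntegral_le_lintegral _ _).trans (le_of_eq ?_)
    exact lintegral_sub_right_eq_self L b
  calc ∫⁻ z, M z.1 ^ (1 - 1 / q) * M z.2 ^ (1 - 1 / q) * L (z.1 - z.2) ^ (2 / q)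
        ∂((volume.restrict S).prod (volume.restrict S))
      = ∫⁻ z, (M z.1 * M z.2) ^ (1 - 2 / q) * (M z.1 * L (z.1 - z.2)) ^ (1 / q) *
          (M z.2 * L (z.1 - z.2)) ^ (1 / q) ∂((volume.restrict S).prod (volume.restrict S)) := by
        refine lintegral_congr fun z => ?_
        rw [ENNReal.mul_rpow_of_nonneg _ _ h0, ENNReal.mul_rpow_of_nonneg _ _ hq2.le,
          ENNReal.mul_rpow_of_nonneg _ _ hq2.le, show 1 - 1 / q = (1 - 2 / q) + 1 / q by ring,
          ENNReal.rpow_add_of_nonneg _ _ h0 hq2.le, ENNReal.rpow_add_of_nonneg _ _ h0 hq2.le,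
          show 2 / q = 1 / q + 1 / q by ring, ENNReal.rpow_add_of_nonneg _ _ hq2.le hq2.le]
        ring
    _ ≤ (I * I) ^ (1 - 2 / q) * (I * J) ^ (1 / q) * (I * J) ^ (1 / q) := by
        refine hH.trans ?_
        rw [i1]
        gcongr
    _ = I ^ (2 - 2 / q) * J ^ (2 / q) := by
        rw [ENNReal.mul_rpow_of_nonneg _ _ h0, ENNReal.mul_rpow_of_nonneg _ _ hq2.le,
          show 2 - 2 / q = (1 - 2 / q) + (1 - 2 / q) + 1 / q + 1 / q by ring,
          ENNReal.rpow_add_of_nonneg _ _ (by positivity) hq2.le,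
          ENNReal.rpow_add_of_nonneg _ _ (by positivity) hq2.le,
          ENNReal.rpow_add_of_nonneg _ _ h0 h0,
          show 2 / q = 1 / q + 1 / q by ring, ENNReal.rpow_add_of_nonneg _ _ hq2.le hq2.le]
        ring

/-! ### Strichartz estimate for the model propagator -/

/-- The unitary part of the model propagator, with its damping, along a path `x`. -/
def pathKernel (F β κ : ℝ) (x : ℝ → Space) (t : ℝ) (ξ : Space) : ℂ :=
  (Real.exp (-κ * |t|) : ℂ) *
    Complex.exp (Complex.I * ((inner ℝ (x t) ξ + t * β * wavePhase F ξ : ℝ) : ℂ))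

theorem measurable_pathKernel (F β κ : ℝ) {x : ℝ → Space} (hx : Measurable x) :
    Measurable (Function.uncurry (pathKernel F β κ x)) := by
  have h1 : Measurable fun z : ℝ × Space => wavePhase F z.2 :=
    (measurable_wavePhase F).comp measurable_snd
  have h2 : Measurable fun z : ℝ × Space => (inner ℝ (x z.1) z.2 : ℝ) :=
    (hx.comp measurable_fst).inner measurable_snd
  unfold pathKernel Function.uncurry
  fun_prop

theorem norm_pathKernel (F β κ : ℝ) (x : ℝ → Space) (t : ℝ) (ξ : Space) :
    ‖pathKernel F β κ x t ξ‖ = Real.exp (-κ * |t|) := by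
  rw [pathKernel, norm_mul, mul_comm Complex.I, Complex.norm_exp_ofReal_mul_I, mul_one,
    Complex.norm_real, Real.norm_of_nonneg (Real.exp_pos _).le]

open Classical in
/-- The kernel `c |τ|^{-1/2} e^{-κ|τ|}`. -/
def decayKernel (c κ τ : ℝ) : ℝ≥0∞ :=
  if τ = 0 then ⊤ else ENNReal.ofReal (c / √|τ| * Real.exp (-κ * |τ|))

theorem measurable_decayKernel (c κ : ℝ) : Measurable (decayKernel c κ) := by
  unfold decayKernel
  refine Measurable.ite (measurableSet_singleton 0) measurable_const ?_
  fun_prop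

/-- The constant of the dispersive estimate in the region `|ξ| ≤ ρ`, `|ξ₃| ≥ δ`. -/
def kernelConst (F δ ρ β : ℝ) : ℝ := 8 * dispConst F⁻¹ * ρ ^ 4 / (δ * √|β|)

theorem enorm_integral_pathKernel_le {F δ ρ β κ : ℝ} (hF : 0 < F) (hF1 : F ≠ 1) (hδ : 0 < δ)
    (hρ : 0 < ρ) (hβ : β ≠ 0) (hκ : 0 ≤ κ) (x : ℝ → Space) (a b : ℝ) :
    ‖∫ ξ in freqRegion δ ρ, pathKernel F β κ x a ξ *
      starRingEnd ℂ (pathKernel F β κ x b ξ)‖ₑ ≤ decayKernel (kernelConst F δ ρ β) κ (a - b) := by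
  by_cases hab : a - b = 0
  · simp [decayKernel, hab]
  rw [decayKernel, if_neg hab, ← ofReal_norm]
  apply ENNReal.ofReal_le_ofReal
  have hpt : ∀ ξ : Space, pathKernel F β κ x a ξ * starRingEnd ℂ (pathKernel F β κ x b ξ) =
      ((Real.exp (-κ * |a|) * Real.exp (-κ * |b|) : ℝ) : ℂ) * Complex.exp (Complex.I *
        ((inner ℝ (x a - x b) ξ + (a - b) * β * wavePhase F ξ : ℝ) : ℂ)) := by
    intro ξ
    rw [pathKernel, pathKernel, map_mul, ← Complex.exp_conj, Complex.conj_ofReal, map_mul,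
      Complex.conj_I, Complex.conj_ofReal, inner_sub_left]
    have : ∀ A B : ℂ, ∀ p q : ℂ, A * Complex.exp p * (B * Complex.exp q) =
        A * B * Complex.exp (p + q) := fun A B p q => by rw [Complex.exp_add]; ring
    rw [this]
    push_cast
    congr 2
    ring
  simp_rw [hpt]
  rw [integral_const_mul, norm_mul, Complex.norm_real, Real.norm_of_nonneg (by positivity)]
  have h1 := norm_dispersive_kernel_le hF hF1 hδ hρ (mul_ne_zero hab hβ) (x a - x b)
  have h2 : Real.exp (-κ * |a|) * Real.exp (-κ * |b|) ≤ Real.exp (-κ * |a - b|) := by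
    rw [← Real.exp_add]
    apply Real.exp_le_exp.2
    nlinarith [abs_sub a b]
  have hC := dispConst_ge_one (inv_pos.2 hF)
  calc _ ≤ Real.exp (-κ * |a - b|) * (8 * dispConst F⁻¹ * (ρ ^ 4 / (δ * √|(a - b) * β|))) := by
        gcongr
    _ = _ := by
        rw [abs_mul, Real.sqrt_mul (abs_nonneg _), kernelConst]
        have : 0 < √|a - b| := Real.sqrt_pos.2 (abs_pos.2 hab)
        have : 0 < √|β| := Real.sqrt_pos.2 (abs_pos.2 hβ)
        field_simp

/-- Strichartz estimate along a measurable path `t ↦ x t`. -/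
theorem strichartz_path {F δ ρ β κ q : ℝ} (hF : 0 < F) (hF1 : F ≠ 1) (hδ : 0 < δ) (hρ : 0 < ρ)
    (hβ : β ≠ 0) (hκ : 0 < κ) (hq : 2 ≤ q) {x : ℝ → Space} (hx : Measurable x) {G : Space → Vec}
    (hGm : StronglyMeasurable G) (hG : IntegrableOn G (freqRegion δ ρ)) :
    (∫⁻ t in Set.Ioi (0 : ℝ),
      ‖∫ ξ in freqRegion δ ρ, pathKernel F β κ x t ξ • G ξ‖ₑ ^ q) ^ (1 / q) ≤
      (∫⁻ τ, decayKernel (kernelConst F δ ρ β) κ τ ^ (q / 2)) ^ (1 / q) *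
        eLpNorm G 2 (volume.restrict (freqRegion δ ρ)) := by
  have hq0 : 0 < q := by linarith
  set E := pathKernel F β κ x with hE
  set ν := volume.restrict (freqRegion δ ρ) with hν
  have : IsFiniteMeasure ν := ⟨by rw [hν]; simpa using volume_freqRegion_lt_top δ ρ⟩
  have hEm := measurable_pathKernel F β κ hx
  have hE1 : ∀ a ξ, ‖E a ξ‖ ≤ 1 := fun a ξ => by
    rw [hE, norm_pathKernel, Real.exp_le_one_iff]
    nlinarith [abs_nonneg a]
  set v : ℝ → Vec := fun t => ∫ ξ, E t ξ • G ξ ∂ν with hv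
  have hvm : StronglyMeasurable v := by
    refine StronglyMeasurable.integral_prod_right (f := fun t ξ => E t ξ • G ξ) ?_
    exact hEm.stronglyMeasurable.smul (hGm.comp_measurable measurable_snd)
  set g1 := ∫ ξ, ‖G ξ‖ ∂ν with hg1
  have hg10 : 0 ≤ g1 := integral_nonneg fun _ => norm_nonneg _
  have hvb : ∀ t ∈ Set.Ioi (0 : ℝ), ‖v t‖ ≤ g1 * Real.exp (-κ * t) := by
    intro t ht
    refine (norm_integral_le_integral_norm _).trans (le_of_eq ?_)
    rw [hg1, ← integral_mul_const]
    refine integral_congr_ae (Filter.Eventually.of_forall fun ξ => ?_)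
    simp only [norm_smul, hE, norm_pathKernel, abs_of_pos (show 0 < t from ht)]
    ring
  have hpow : ∀ e : ℝ, 0 < e → IntegrableOn (fun t => ‖v t‖ ^ e) (Set.Ioi (0 : ℝ)) := by
    intro e he
    have hInt : IntegrableOn (fun t => g1 ^ e * Real.exp (-(κ * e) * t)) (Set.Ioi (0 : ℝ)) :=
      (integrableOn_exp_mul_Ioi (by nlinarith : -(κ * e) < 0) 0).const_mul _
    refine hInt.mono' ?_ ?_
    · exact (hvm.norm.measurable.pow_const e).aestronglyMeasurable
    · refine (ae_restrict_iff' measurableSet_Ioi).2 (Filter.Eventually.of_forall fun t ht => ?_)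
      rw [Real.norm_of_nonneg (by positivity)]
      calc ‖v t‖ ^ e ≤ (g1 * Real.exp (-κ * t)) ^ e :=
            Real.rpow_le_rpow (norm_nonneg _) (hvb t ht) he.le
        _ = _ := by
            rw [Real.mul_rpow hg10 (Real.exp_pos _).le, ← Real.exp_mul]
            congr 2
            ring
  set φ : ℝ → Vec := fun t => ((‖v t‖ ^ (q - 2) : ℝ) : ℂ) • v t with hφ
  have hφn : ∀ t, ‖φ t‖ = ‖v t‖ ^ (q - 1) := by
    intro t
    rw [hφ]
    simp only [norm_smul, Complex.norm_real]
    rw [Real.norm_of_nonneg (by positivity)]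
    rcases eq_or_lt_of_le (norm_nonneg (v t)) with h | h
    · rw [← h, mul_zero, Real.zero_rpow (by linarith)]
    · rw [← Real.rpow_add_one h.ne']
      congr 1
      ring
  have hφm : StronglyMeasurable φ := by
    have h : StronglyMeasurable fun t => ((‖v t‖ ^ (q - 2) : ℝ) : ℂ) :=
      (Complex.measurable_ofReal.comp (hvm.norm.measurable.pow_const _)).stronglyMeasurable
    exact h.smul hvm
  have hφi : Integrable φ (volume.restrict (Set.Ioi (0 : ℝ))) := by
    refine (hpow (q - 1) (by linarith)).mono' hφm.aestronglyMeasurable ?_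
    exact Filter.Eventually.of_forall fun t => (hφn t).le
  set M : ℝ → ℝ≥0∞ := fun t => ‖v t‖ₑ ^ q with hM
  have hMm : Measurable M := hvm.enorm.pow_const q
  have hφM : ∀ t, ‖φ t‖ₑ = M t ^ (1 - 1 / q) := by
    intro t
    rw [hM, ← ofReal_norm, hφn, ← ENNReal.ofReal_rpow_of_nonneg (norm_nonneg _) (by linarith),
      ofReal_norm, ← ENNReal.rpow_mul]
    congr 1
    field_simp
  have hinner : ∀ t, inner ℂ (φ t) (v t) = ((‖v t‖ ^ q : ℝ) : ℂ) := by
    intro t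
    rw [hφ]
    simp only [inner_smul_left, Complex.conj_ofReal, inner_self_eq_norm_sq_to_K]
    rcases eq_or_lt_of_le (norm_nonneg (v t)) with h | h
    · rw [← h, Real.zero_rpow (by linarith : q ≠ 0)]
      simp
    · have : ‖v t‖ ^ q = ‖v t‖ ^ (q - 2) * ‖v t‖ ^ 2 := by
        rw [← Real.rpow_natCast, ← Real.rpow_add h]
        congr 1
        push_cast
        ring
      rw [this]
      push_cast
      rfl
  set J := ∫⁻ τ, decayKernel (kernelConst F δ ρ β) κ τ ^ (q / 2) with hJ
  set I := ∫⁻ t in Set.Ioi (0 : ℝ), M t with hI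
  have hIeq : ‖∫ t in Set.Ioi (0 : ℝ), inner ℂ (φ t) (v t)‖ₑ = I := by
    simp_rw [hinner]
    rw [integral_complex_ofReal, ← ofReal_norm, Complex.norm_real,
      Real.norm_of_nonneg (integral_nonneg fun _ => by positivity),
      ofReal_integral_eq_lintegral_ofReal (hpow q hq0)
        (Filter.Eventually.of_forall fun _ => by positivity)]
    refine lintegral_congr fun t => ?_
    rw [← ENNReal.ofReal_rpow_of_nonneg (norm_nonneg _) hq0.le, ofReal_norm]
  have hItop : I ≠ ⊤ := by
    rw [← hIeq]
    exact enorm_ne_top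
  refine rpow_le_of_le_mul_rpow (by linarith) hItop ?_
  have hTT := enorm_integral_inner_le (μ := volume.restrict (Set.Ioi (0 : ℝ))) hEm hE1 hφi hG
    (k := fun a b => decayKernel (kernelConst F δ ρ β) κ (a - b))
    (fun a b => enorm_integral_pathKernel_le hF hF1 hδ hρ hβ hκ.le x a b)
  have hY := lintegral_lintegral_young_le hMm
    ((measurable_decayKernel (kernelConst F δ ρ β) κ).pow_const (q / 2)) hq (Set.Ioi (0 : ℝ))
  rw [hIeq] at hTT
  calc I ≤ _ := hTT
    _ ≤ (I ^ (2 - 2 / q) * J ^ (2 / q)) ^ (1 / 2 : ℝ) * eLpNorm G 2 ν := by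
        gcongr
        refine le_trans (le_of_eq ?_) hY
        refine lintegral_congr fun a => lintegral_congr fun b => ?_
        rw [hφM, hφM]
        congr 1
        rw [← ENNReal.rpow_mul, show q / 2 * (2 / q) = 1 by field_simp, ENNReal.rpow_one]
    _ = _ := by
        have h1 : 0 ≤ 1 - 1 / q := by
          rw [sub_nonneg, div_le_one hq0]
          linarith
        rw [ENNReal.mul_rpow_of_nonneg _ _ (by norm_num), ← ENNReal.rpow_mul, ← ENNReal.rpow_mul,
          show (2 - 2 / q) * (1 / 2) = 1 - 1 / q by ring, show 2 / q * (1 / 2) = 1 / q by ring]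
        ring

/-! ### Suprema over a dense sequence -/

section Selection

variable {X : Type*} [MeasurableSpace X]

theorem exists_measurable_argmax {d : ℕ → X} {h : ℝ → X → ℝ≥0∞}
    (hm : ∀ n, Measurable fun t => h t (d n)) (n : ℕ) :
    ∃ x : ℝ → X, Measurable x ∧ (Measurable fun t => h t (x t)) ∧
      ∀ t, ∀ i ≤ n, h t (d i) ≤ h t (x t) := by
  induction n with
  | zero =>
    refine ⟨fun _ => d 0, measurable_const, hm 0, fun t i hi => ?_⟩
    rw [Nat.le_zero.1 hi]
  | succ n ih =>
    obtain ⟨x, hx, hxm, hxi⟩ := ih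
    classical
    have hS : MeasurableSet {t | h t (x t) < h t (d (n + 1))} := measurableSet_lt hxm (hm _)
    refine ⟨fun t => if h t (x t) < h t (d (n + 1)) then d (n + 1) else x t,
      Measurable.ite hS measurable_const hx, ?_, fun t i hi => ?_⟩
    · have : (fun t => h t (if h t (x t) < h t (d (n + 1)) then d (n + 1) else x t)) =
          fun t => if h t (x t) < h t (d (n + 1)) then h t (d (n + 1)) else h t (x t) := by
        ext t
        split_ifs <;> rfl
      rw [this]
      exact Measurable.ite hS (hm _) hxm
    · dsimp only
      rcases Nat.le_succ_iff.1 hi with hi | rfl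
      · split_ifs with hlt
        · exact (hxi t i hi).trans hlt.le
        · exact hxi t i hi
      · split_ifs with hlt
        · exact le_rfl
        · exact not_lt.1 hlt

/-- A bound along all measurable paths gives a bound of the supremum over a sequence. -/
theorem lintegral_iSup_rpow_le_of_paths {d : ℕ → X} {h : ℝ → X → ℝ≥0∞}
    (hm : ∀ n, Measurable fun t => h t (d n)) {q : ℝ} (hq : 0 < q) {S : Set ℝ} {C : ℝ≥0∞}
    (hC : ∀ x : ℝ → X, Measurable x → (∫⁻ t in S, h t (x t) ^ q) ^ (1 / q) ≤ C) :
    (∫⁻ t in S, (⨆ n, h t (d n)) ^ q) ^ (1 / q) ≤ C := by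
  rw [one_div, ENNReal.rpow_inv_le_iff hq]
  have h1 : ∀ t, (⨆ n, h t (d n)) ^ q = ⨆ n, (⨆ i, ⨆ (_ : i ≤ n), h t (d i)) ^ q := by
    intro t
    have h2 : ⨆ n, h t (d n) = ⨆ n, ⨆ i, ⨆ (_ : i ≤ n), h t (d i) := by
      apply le_antisymm
      · exact iSup_le fun n => le_iSup_of_le n (le_iSup₂_of_le n le_rfl le_rfl)
      · exact iSup_le fun n => iSup₂_le fun i _ => le_iSup (fun n => h t (d n)) i
    rw [h2]
    exact (ENNReal.orderIsoRpow q hq).map_iSup _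
  simp_rw [h1]
  rw [lintegral_iSup]
  · refine iSup_le fun n => ?_
    obtain ⟨x, hx, -, hxi⟩ := exists_measurable_argmax hm n
    rw [← ENNReal.rpow_inv_le_iff hq, ← one_div]
    refine le_trans ?_ (hC x hx)
    gcongr with t
    exact iSup₂_le fun i hi => hxi t i hi
  · intro n
    exact (Measurable.iSup fun i => Measurable.iSup fun _ => hm i).pow_const q
  · intro m n hmn t
    refine ENNReal.rpow_le_rpow ?_ hq.le
    exact iSup₂_le fun i hi => le_iSup₂_of_le i (hi.trans hmn) le_rfl

end Selection

/-! ### Propagators -/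

/-- `e^{tζ(D)} 𝓕⁻¹ G`. -/
def waveField (ζ : Space → ℂ) (G : Space → Vec) (t : ℝ) : Space → Vec :=
  invFourier fun ξ => Complex.exp (t * ζ ξ) • G ξ

/-- The supremum in space of `e^{tζ(D)} 𝓕⁻¹ G`. -/
def supNorm (ζ : Space → ℂ) (G : Space → Vec) (t : ℝ) : ℝ≥0∞ :=
  ⨆ n, ‖waveField ζ G t (TopologicalSpace.denseSeq Space n)‖ₑ

theorem stronglyMeasurable_waveField {ζ : Space → ℂ} (hζ : Measurable ζ) {H : ℝ → Space → Vec}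
    (hH : StronglyMeasurable (Function.uncurry H)) :
    StronglyMeasurable fun z : (ℝ × ℝ) × Space => waveField ζ (H z.1.2) z.1.1 z.2 := by
  have h1 : Measurable fun z : ((ℝ × ℝ) × Space) × Space => ζ z.2 := hζ.comp measurable_snd
  have h2 : Measurable fun z : ((ℝ × ℝ) × Space) × Space =>
      Complex.exp (Complex.I * (inner ℝ z.1.2 z.2 : ℝ)) := by fun_prop
  have h3 : Measurable fun z : ((ℝ × ℝ) × Space) × Space =>
      Complex.exp (z.1.1.1 * ζ z.2) := by fun_prop
  have h4 : StronglyMeasurable fun z : ((ℝ × ℝ) × Space) × Space => H z.1.1.2 z.2 :=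
    hH.comp_measurable (g := fun z : ((ℝ × ℝ) × Space) × Space => (z.1.1.2, z.2)) (by fun_prop)
  have h5 : StronglyMeasurable fun z : (ℝ × ℝ) × Space => ∫ ξ : Space,
      Complex.exp (Complex.I * (inner ℝ z.2 ξ : ℝ)) • Complex.exp (z.1.1 * ζ ξ) • H z.1.2 ξ :=
    StronglyMeasurable.integral_prod_right (f := fun (z : (ℝ × ℝ) × Space) (ξ : Space) =>
      Complex.exp (Complex.I * (inner ℝ z.2 ξ : ℝ)) • Complex.exp (z.1.1 * ζ ξ) • H z.1.2 ξ)
      (h2.stronglyMeasurable.smul (h3.stronglyMeasurable.smul h4))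
  exact h5.const_smul ((2 * Real.pi : ℂ) ^ 3)⁻¹

theorem measurable_supNorm_uncurry {ζ : Space → ℂ} (hζ : Measurable ζ) {H : ℝ → Space → Vec}
    (hH : StronglyMeasurable (Function.uncurry H)) :
    Measurable (Function.uncurry fun t s => supNorm ζ (H s) t) := by
  refine Measurable.iSup fun n => ?_
  have h := (stronglyMeasurable_waveField hζ hH).comp_measurable
    (g := fun z : ℝ × ℝ => (z, TopologicalSpace.denseSeq Space n)) (by fun_prop)
  exact h.enorm

theorem measurable_supNorm {ζ : Space → ℂ} (hζ : Measurable ζ) {G : Space → Vec}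
    (hG : StronglyMeasurable G) : Measurable (supNorm ζ G) := by
  have h0 : StronglyMeasurable (Function.uncurry fun (_ : ℝ) => G) :=
    hG.comp_measurable measurable_snd
  refine Measurable.iSup fun n => ?_
  have h := (stronglyMeasurable_waveField hζ h0).comp_measurable
    (g := fun t : ℝ => ((t, (0 : ℝ)), TopologicalSpace.denseSeq Space n)) (by fun_prop)
  exact h.enorm

theorem enorm_invFourier_le (g : Space → Vec) (x : Space) :
    ‖invFourier g x‖ₑ ≤ ‖∫ ξ : Space, Complex.exp (Complex.I * (inner ℝ x ξ : ℝ)) • g ξ‖ₑ := by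
  rw [invFourier, enorm_smul, enorm_two_pi_pow_inv]
  refine mul_le_of_le_one_left zero_le ?_
  rw [ENNReal.ofReal_le_one]
  have : 1 ≤ (2 * Real.pi) ^ 3 := one_le_pow₀ (by linarith [Real.pi_gt_three])
  exact inv_le_one_of_one_le₀ this

/-- The symbol of the model propagator. -/
def modelSymbol (F β κ : ℝ) (ξ : Space) : ℂ := -κ + Complex.I * (β * wavePhase F ξ : ℝ)

theorem measurable_modelSymbol (F β κ : ℝ) : Measurable (modelSymbol F β κ) := by
  have := measurable_wavePhase F
  unfold modelSymbol
  fun_prop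

theorem re_modelSymbol (F β κ : ℝ) (ξ : Space) : (modelSymbol F β κ ξ).re = -κ := by
  simp [modelSymbol]

/-- Strichartz estimate for the model propagator. -/
theorem strichartz_model {F δ ρ β κ q : ℝ} (hF : 0 < F) (hF1 : F ≠ 1) (hδ : 0 < δ) (hρ : 0 < ρ)
    (hβ : β ≠ 0) (hκ : 0 < κ) (hq : 2 ≤ q) {G : Space → Vec}
    (hGm : StronglyMeasurable G) (hG : Integrable G) (hsupp : ∀ ξ ∉ freqRegion δ ρ, G ξ = 0) :
    (∫⁻ t in Set.Ioi (0 : ℝ), supNorm (modelSymbol F β κ) G t ^ q) ^ (1 / q) ≤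
      (∫⁻ τ, decayKernel (kernelConst F δ ρ β) κ τ ^ (q / 2)) ^ (1 / q) * eLpNorm G 2 volume := by
  refine lintegral_iSup_rpow_le_of_paths (h := fun t x => ‖waveField (modelSymbol F β κ) G t x‖ₑ)
    (fun n => ?_) (by linarith) fun x hx => ?_
  · have h := (stronglyMeasurable_waveField (measurable_modelSymbol F β κ) (H := fun _ => G)
      (hGm.comp_measurable measurable_snd)).comp_measurable
      (g := fun t : ℝ => ((t, (0 : ℝ)), TopologicalSpace.denseSeq Space n)) (by fun_prop)
    exact h.enorm
  · have h1 : eLpNorm G 2 (volume.restrict (freqRegion δ ρ)) ≤ eLpNorm G 2 volume :=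
      eLpNorm_mono_measure _ Measure.restrict_le_self
    refine le_trans ?_ ((strichartz_path hF hF1 hδ hρ hβ hκ hq hx hGm hG.integrableOn).trans
      (mul_le_mul_right h1 _))
    refine ENNReal.rpow_le_rpow ?_ (by positivity)
    refine setLIntegral_mono' measurableSet_Ioi fun t ht => ?_
    refine ENNReal.rpow_le_rpow ?_ (by linarith)
    refine (enorm_invFourier_le _ _).trans (le_of_eq ?_)
    rw [← integral_indicator (measurableSet_freqRegion δ ρ)]
    congr 1
    refine integral_congr_ae (Filter.Eventually.of_forall fun ξ => ?_)
    by_cases hξ : ξ ∈ freqRegion δ ρ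
    · simp only [Set.indicator_of_mem hξ]
      rw [← mul_smul, pathKernel, abs_of_pos (show 0 < t from ht), modelSymbol, ← Complex.exp_add,
        Complex.ofReal_exp, ← Complex.exp_add]
      congr 2
      push_cast
      ring
    · simp [Set.indicator_of_notMem hξ, hsupp ξ hξ]

/-! ### The Duhamel formula -/

theorem norm_exp_mul_le_one {z : ℂ} (hz : z.re ≤ 0) {t : ℝ} (ht : 0 ≤ t) :
    ‖Complex.exp (t * z)‖ ≤ 1 := by
  rw [Complex.norm_exp, Real.exp_le_one_iff]
  simp
  exact mul_nonpos_of_nonneg_of_nonpos ht hz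

/-- The inverse Fourier transform of a Duhamel integral. -/
theorem invFourier_duhamel {ζ : Space → ℂ} (hζ : Measurable ζ) (hre : ∀ ξ, (ζ ξ).re ≤ 0)
    {H : ℝ → Space → Vec} (hH : StronglyMeasurable (Function.uncurry H)) {t : ℝ}
    (hInt : IntegrableOn (Function.uncurry H) (Set.Ioo 0 t ×ˢ Set.univ)) (x : Space) :
    invFourier (fun ξ => ∫ s in Set.Ioo 0 t, Complex.exp ((t - s : ℝ) * ζ ξ) • H s ξ) x =
      ∫ s in Set.Ioo 0 t, waveField ζ (H s) (t - s) x := by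
  have hInt' : Integrable (fun z : ℝ × Space => Complex.exp (Complex.I * (inner ℝ x z.2 : ℝ)) •
      Complex.exp ((t - z.1 : ℝ) * ζ z.2) • H z.1 z.2)
      ((volume.restrict (Set.Ioo 0 t)).prod volume) := by
    have h0 : Integrable (Function.uncurry H) ((volume.restrict (Set.Ioo 0 t)).prod volume) := by
      rw [IntegrableOn, Measure.volume_eq_prod, ← Measure.prod_restrict, Measure.restrict_univ]
        at hInt
      exact hInt
    refine h0.norm.mono' ?_ ?_
    · have h1 : Measurable fun z : ℝ × Space => ζ z.2 := hζ.comp measurable_snd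
      have h2 : Measurable fun z : ℝ × Space =>
        Complex.exp (Complex.I * (inner ℝ x z.2 : ℝ)) := by fun_prop
      have h3 : Measurable fun z : ℝ × Space => Complex.exp ((t - z.1 : ℝ) * ζ z.2) := by fun_prop
      exact (h2.stronglyMeasurable.smul (h3.stronglyMeasurable.smul hH)).aestronglyMeasurable
    · have hmem : ∀ᵐ z ∂((volume.restrict (Set.Ioo 0 t)).prod (volume : Measure Space)),
          z.1 ∈ Set.Ioo 0 t := by
        have := (ae_restrict_mem (μ := (volume : Measure ℝ)) (measurableSet_Ioo (a := 0) (b := t)))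
        exact Measure.quasiMeasurePreserving_fst.ae this
      filter_upwards [hmem] with z hz
      rw [norm_smul, norm_smul, mul_comm Complex.I, Complex.norm_exp_ofReal_mul_I, one_mul]
      exact mul_le_of_le_one_left (norm_nonneg _)
        (norm_exp_mul_le_one (hre _) (by linarith [hz.2]))
  unfold waveField invFourier
  rw [integral_smul]
  congr 1
  have hswap := integral_integral_swap (f := fun s ξ =>
    Complex.exp (Complex.I * (inner ℝ x ξ : ℝ)) • Complex.exp ((t - s : ℝ) * ζ ξ) • H s ξ) hInt'
  dsimp only
  rw [hswap]
  refine integral_congr_ae (Filter.Eventually.of_forall fun ξ => ?_)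
  exact (integral_smul _ _).symm

theorem invFourier_add {f g : Space → Vec} (hf : Integrable f) (hg : Integrable g) (x : Space) :
    invFourier (fun ξ => f ξ + g ξ) x = invFourier f x + invFourier g x := by
  have hm : Measurable fun ξ : Space => Complex.exp (Complex.I * (inner ℝ x ξ : ℝ)) := by fun_prop
  have h : ∀ {u : Space → Vec}, Integrable u →
      Integrable fun ξ => Complex.exp (Complex.I * (inner ℝ x ξ : ℝ)) • u ξ := fun {u} hu =>
    hu.bdd_smul 1 hm.aestronglyMeasurable (Filter.Eventually.of_forall fun ξ => by
      rw [mul_comm, Complex.norm_exp_ofReal_mul_I])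
  simp only [invFourier, smul_add]
  rw [integral_add (h hf) (h hg), smul_add]

theorem integrable_exp_smul {ζ : Space → ℂ} (hζ : Measurable ζ) (hre : ∀ ξ, (ζ ξ).re ≤ 0)
    {G : Space → Vec} (hG : Integrable G) {t : ℝ} (ht : 0 ≤ t) :
    Integrable fun ξ => Complex.exp (t * ζ ξ) • G ξ :=
  hG.bdd_smul 1 (by fun_prop : Measurable fun ξ => Complex.exp (t * ζ ξ)).aestronglyMeasurable
    (Filter.Eventually.of_forall fun ξ => norm_exp_mul_le_one (hre ξ) ht)

theorem exp_eq_exp_add_integral (z w : ℂ) {t : ℝ} (ht : 0 ≤ t) :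
    Complex.exp (t * z) = Complex.exp (t * w) +
      ∫ s in Set.Ioo 0 t, Complex.exp ((t - s : ℝ) * w) * ((z - w) * Complex.exp (s * z)) := by
  have hd : ∀ s : ℝ, HasDerivAt (fun s : ℝ => Complex.exp ((t - s : ℝ) * w) * Complex.exp (s * z))
      (Complex.exp ((t - s : ℝ) * w) * ((z - w) * Complex.exp (s * z))) s := by
    intro s
    have h1 : HasDerivAt (fun s : ℝ => ((t - s : ℝ) : ℂ) * w) (-w) s := by
      have := (((hasDerivAt_id s).const_sub t).ofReal_comp).mul_const w
      refine this.congr_deriv ?_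
      simp
    have h2 : HasDerivAt (fun s : ℝ => (s : ℂ) * z) z s := by
      have := ((hasDerivAt_id s).ofReal_comp).mul_const z
      refine this.congr_deriv ?_
      simp
    refine (h1.cexp.mul h2.cexp).congr_deriv ?_
    ring
  have hc : Continuous fun s : ℝ =>
      Complex.exp ((t - s : ℝ) * w) * ((z - w) * Complex.exp (s * z)) := by fun_prop
  have := intervalIntegral.integral_eq_sub_of_hasDerivAt (a := 0) (b := t) (fun s _ => hd s)
    (hc.intervalIntegrable _ _)
  rw [intervalIntegral.integral_of_le ht, integral_Ioc_eq_integral_Ioo] at this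
  rw [this]
  simp

theorem measurable_duhamel {N : ℝ → ℝ → ℝ≥0∞} (hN : Measurable (Function.uncurry N)) :
    Measurable fun t : ℝ => ∫⁻ s in Set.Ioo 0 t, N (t - s) s := by
  have : (fun t : ℝ => ∫⁻ s in Set.Ioo 0 t, N (t - s) s) = fun t : ℝ =>
      ∫⁻ s, {z : ℝ × ℝ | 0 < z.2 ∧ z.2 < z.1}.indicator (fun z => N (z.1 - z.2) z.2) (t, s) := by
    ext t
    rw [← lintegral_indicator measurableSet_Ioo]
    refine lintegral_congr fun s => ?_
    simp [Set.indicator_apply]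
  rw [this]
  refine Measurable.lintegral_prod_right' (f := {z : ℝ × ℝ | 0 < z.2 ∧ z.2 < z.1}.indicator
    (fun z => N (z.1 - z.2) z.2)) ?_
  refine Measurable.indicator ?_ ((measurableSet_lt measurable_const measurable_snd).inter
    (measurableSet_lt measurable_snd measurable_fst))
  exact hN.comp ((measurable_fst.sub measurable_snd).prodMk measurable_snd)

theorem lintegral_add_duhamel_rpow_le {f : ℝ → ℝ≥0∞} (hf : Measurable f) {N : ℝ → ℝ → ℝ≥0∞}
    (hN : Measurable (Function.uncurry N)) {q : ℝ} (hq : 1 ≤ q) :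
    (∫⁻ t in Set.Ioi (0 : ℝ), (f t + ∫⁻ s in Set.Ioo 0 t, N (t - s) s) ^ q) ^ (1 / q) ≤
      (∫⁻ t in Set.Ioi (0 : ℝ), f t ^ q) ^ (1 / q) +
      ∫⁻ s in Set.Ioi (0 : ℝ), (∫⁻ τ in Set.Ioi (0 : ℝ), N τ s ^ q) ^ (1 / q) :=
  (ENNReal.lintegral_Lp_add_le hf.aemeasurable (measurable_duhamel hN).aemeasurable hq).trans
    (add_le_add le_rfl (duhamel_minkowski hN hq))

theorem supNorm_le_add_duhamel {ζ ζ₀ : Space → ℂ} (hζ : Measurable ζ) (hre : ∀ ξ, (ζ ξ).re ≤ 0)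
    (hζ₀m : Measurable ζ₀) (hre₀ : ∀ ξ, (ζ₀ ξ).re ≤ 0) {G : Space → Vec} (hG : Integrable G)
    (hHm : StronglyMeasurable (Function.uncurry fun (s : ℝ) (ξ : Space) =>
      ((ζ ξ - ζ₀ ξ) * Complex.exp (s * ζ ξ)) • G ξ)) {t : ℝ} (ht : 0 < t)
    (hHi : IntegrableOn (Function.uncurry fun (s : ℝ) (ξ : Space) =>
      ((ζ ξ - ζ₀ ξ) * Complex.exp (s * ζ ξ)) • G ξ) (Set.Ioo 0 t ×ˢ Set.univ)) :
    supNorm ζ G t ≤ supNorm ζ₀ G t + ∫⁻ s in Set.Ioo 0 t,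
      supNorm ζ₀ (fun ξ => ((ζ ξ - ζ₀ ξ) * Complex.exp (s * ζ ξ)) • G ξ) (t - s) := by
  set H : ℝ → Space → Vec := fun s ξ => ((ζ ξ - ζ₀ ξ) * Complex.exp (s * ζ ξ)) • G ξ with hH
  have ht0 : 0 ≤ t := le_of_lt ht
  refine iSup_le fun n => ?_
  set x := TopologicalSpace.denseSeq Space n with hx
  have h1 : waveField ζ G t x = waveField ζ₀ G t x +
      ∫ s in Set.Ioo 0 t, waveField ζ₀ (H s) (t - s) x := by
    rw [← invFourier_duhamel hζ₀m hre₀ hHm hHi x]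
    have hdec : ∀ ξ, Complex.exp (t * ζ ξ) • G ξ = Complex.exp (t * ζ₀ ξ) • G ξ +
        ∫ s in Set.Ioo 0 t, Complex.exp ((t - s : ℝ) * ζ₀ ξ) • H s ξ := by
      intro ξ
      simp_rw [hH, ← mul_smul]
      rw [integral_smul_const, ← add_smul, exp_eq_exp_add_integral (ζ ξ) (ζ₀ ξ) ht0]
    have hi2 : Integrable fun ξ =>
        ∫ s in Set.Ioo 0 t, Complex.exp ((t - s : ℝ) * ζ₀ ξ) • H s ξ := by
      refine ((integrable_exp_smul hζ hre hG ht0).sub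
        (integrable_exp_smul hζ₀m hre₀ hG ht0)).congr (Filter.Eventually.of_forall fun ξ => ?_)
      simp only [Pi.sub_apply]
      rw [hdec ξ]
      abel
    rw [waveField, waveField, ← invFourier_add (integrable_exp_smul hζ₀m hre₀ hG ht0) hi2]
    congr 1
    ext1 ξ
    exact hdec ξ
  rw [h1]
  refine (enorm_add_le _ _).trans (add_le_add ?_ ?_)
  · exact le_iSup (fun n => ‖waveField ζ₀ G t (TopologicalSpace.denseSeq Space n)‖ₑ) n
  · refine (enorm_integral_le_lintegral_enorm _).trans (lintegral_mono fun s => ?_)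
    exact le_iSup (fun n => ‖waveField ζ₀ (H s) (t - s) (TopologicalSpace.denseSeq Space n)‖ₑ) n

/-- Strichartz estimate for a propagator close to the model. -/
theorem strichartz_general {F δ ρ β κ q Λ : ℝ} (hF : 0 < F) (hF1 : F ≠ 1) (hδ : 0 < δ) (hρ : 0 < ρ)
    (hβ : β ≠ 0) (hκ : 0 < κ) (hq : 2 ≤ q) (hΛ : 0 ≤ Λ) {ζ : Space → ℂ} (hζ : Measurable ζ)
    (hre : ∀ ξ, (ζ ξ).re ≤ -κ) (hζΛ : ∀ ξ, ‖ζ ξ - modelSymbol F β κ ξ‖ ≤ Λ * κ)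
    {G : Space → Vec} (hGm : StronglyMeasurable G) (hG : Integrable G)
    (hsupp : ∀ ξ ∉ freqRegion δ ρ, G ξ = 0) :
    (∫⁻ t in Set.Ioi (0 : ℝ), supNorm ζ G t ^ q) ^ (1 / q) ≤
      (∫⁻ τ, decayKernel (kernelConst F δ ρ β) κ τ ^ (q / 2)) ^ (1 / q) *
        (ENNReal.ofReal (1 + Λ) * eLpNorm G 2 volume) := by
  set ζ₀ := modelSymbol F β κ with hζ₀
  have hζ₀m : Measurable ζ₀ := measurable_modelSymbol F β κ
  have hre₀ : ∀ ξ, (ζ₀ ξ).re ≤ 0 := fun ξ => by rw [hζ₀, re_modelSymbol]; linarith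
  have hre' : ∀ ξ, (ζ ξ).re ≤ 0 := fun ξ => (hre ξ).trans (by linarith)
  set J := ∫⁻ τ, decayKernel (kernelConst F δ ρ β) κ τ ^ (q / 2) with hJ
  set H : ℝ → Space → Vec := fun s ξ => ((ζ ξ - ζ₀ ξ) * Complex.exp (s * ζ ξ)) • G ξ with hH
  have hHm : StronglyMeasurable (Function.uncurry H) := by
    have h1 : Measurable fun z : ℝ × Space => ζ z.2 := hζ.comp measurable_snd
    have h2 : Measurable fun z : ℝ × Space => ζ₀ z.2 := hζ₀m.comp measurable_snd
    have h3 : Measurable fun z : ℝ × Space => (ζ z.2 - ζ₀ z.2) * Complex.exp (z.1 * ζ z.2) := by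
      fun_prop
    exact h3.stronglyMeasurable.smul (hGm.comp_measurable measurable_snd)
  have hHb : ∀ s, 0 ≤ s → ∀ ξ, ‖H s ξ‖ ≤ Λ * κ * Real.exp (-κ * s) * ‖G ξ‖ := by
    intro s hs ξ
    rw [hH]
    simp only [norm_smul, norm_mul]
    have h1 : ‖Complex.exp (s * ζ ξ)‖ ≤ Real.exp (-κ * s) := by
      rw [Complex.norm_exp]
      apply Real.exp_le_exp.2
      simp
      nlinarith [hre ξ]
    gcongr
    exact hζΛ ξ
  have hHi : ∀ s, 0 ≤ s → Integrable (H s) := by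
    intro s hs
    refine (hG.norm.const_mul (Λ * κ * Real.exp (-κ * s))).mono' ?_
      (Filter.Eventually.of_forall (hHb s hs))
    exact (hHm.comp_measurable measurable_prodMk_left).aestronglyMeasurable
  have hHprod : ∀ t : ℝ, IntegrableOn (Function.uncurry H) (Set.Ioo 0 t ×ˢ Set.univ) := by
    intro t
    rw [IntegrableOn, Measure.volume_eq_prod, ← Measure.prod_restrict, Measure.restrict_univ]
    have h0 : Integrable (fun z : ℝ × Space => (Λ * κ) * ‖G z.2‖)
        ((volume.restrict (Set.Ioo 0 t)).prod volume) :=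
      (hG.norm.comp_snd (volume.restrict (Set.Ioo 0 t))).const_mul (Λ * κ)
    refine h0.mono' hHm.aestronglyMeasurable ?_
    have hmem : ∀ᵐ z ∂((volume.restrict (Set.Ioo 0 t)).prod (volume : Measure Space)),
        z.1 ∈ Set.Ioo 0 t :=
      Measure.quasiMeasurePreserving_fst.ae (ae_restrict_mem measurableSet_Ioo)
    filter_upwards [hmem] with z hz
    refine (hHb z.1 hz.1.le z.2).trans ?_
    have : Real.exp (-κ * z.1) ≤ 1 := by
      rw [Real.exp_le_one_iff]
      nlinarith [hz.1]
    have : Λ * κ * Real.exp (-κ * z.1) ≤ Λ * κ * 1 := by gcongr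
    nlinarith [norm_nonneg (G z.2)]
  have hpt : ∀ t ∈ Set.Ioi (0 : ℝ), supNorm ζ G t ≤ supNorm ζ₀ G t +
      ∫⁻ s in Set.Ioo 0 t, supNorm ζ₀ (H s) (t - s) := fun t ht =>
    supNorm_le_add_duhamel hζ hre' hζ₀m hre₀ hG hHm ht (hHprod t)
  have hq1 : 1 ≤ q := by linarith
  have hN := measurable_supNorm_uncurry hζ₀m hHm
  calc (∫⁻ t in Set.Ioi (0 : ℝ), supNorm ζ G t ^ q) ^ (1 / q)
      ≤ (∫⁻ t in Set.Ioi (0 : ℝ), (supNorm ζ₀ G t +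
          ∫⁻ s in Set.Ioo 0 t, supNorm ζ₀ (H s) (t - s)) ^ q) ^ (1 / q) := by
        refine ENNReal.rpow_le_rpow ?_ (by positivity)
        exact setLIntegral_mono' measurableSet_Ioi fun t ht =>
          ENNReal.rpow_le_rpow (hpt t ht) (by linarith)
    _ ≤ (∫⁻ t in Set.Ioi (0 : ℝ), supNorm ζ₀ G t ^ q) ^ (1 / q) +
        ∫⁻ s in Set.Ioi (0 : ℝ),
          (∫⁻ τ in Set.Ioi (0 : ℝ), supNorm ζ₀ (H s) τ ^ q) ^ (1 / q) :=
        lintegral_add_duhamel_rpow_le (N := fun τ s => supNorm ζ₀ (H s) τ)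
          (measurable_supNorm hζ₀m hGm) hN hq1
    _ ≤ J ^ (1 / q) * eLpNorm G 2 volume +
        ∫⁻ s in Set.Ioi (0 : ℝ), J ^ (1 / q) *
          (ENNReal.ofReal (Λ * κ) * eLpNorm G 2 volume * ENNReal.ofReal (Real.exp (-κ * s))) := by
        refine add_le_add (strichartz_model hF hF1 hδ hρ hβ hκ hq hGm hG hsupp) ?_
        refine setLIntegral_mono' measurableSet_Ioi fun s hs => ?_
        have hs0 : 0 ≤ s := le_of_lt hs
        refine (strichartz_model hF hF1 hδ hρ hβ hκ hq
          (hHm.comp_measurable measurable_prodMk_left) (hHi s hs0)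
          (fun ξ hξ => by simp [hsupp ξ hξ, hH])).trans ?_
        refine mul_le_mul_right ?_ _
        have h1 : eLpNorm (H s) 2 volume ≤
            ENNReal.ofReal (Λ * κ * Real.exp (-κ * s)) * eLpNorm G 2 volume :=
          eLpNorm_le_mul_eLpNorm_of_ae_le_mul (Filter.Eventually.of_forall (hHb s hs0)) 2
        refine h1.trans (le_of_eq ?_)
        rw [ENNReal.ofReal_mul (by positivity)]
        ring
    _ = _ := by
        have hm : Measurable fun s : ℝ => ENNReal.ofReal (Real.exp (-κ * s)) := by fun_prop
        rw [lintegral_const_mul _ (hm.const_mul _), lintegral_const_mul _ hm,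
          lintegral_exp_neg_Ioi hκ, ENNReal.ofReal_add zero_le_one hΛ, ENNReal.ofReal_one]
        have h2 : ENNReal.ofReal (Λ * κ) * eLpNorm G 2 volume * ENNReal.ofReal (1 / κ) =
            ENNReal.ofReal Λ * eLpNorm G 2 volume := by
          rw [mul_right_comm, ← ENNReal.ofReal_mul (by positivity)]
          congr 2
          field_simp
        rw [h2]
        ring

theorem lintegral_decayKernel {c κ q : ℝ} (hc : 0 < c) (hκ : 0 < κ) (hq0 : 0 < q) (hq4 : q < 4) :
    ∫⁻ τ, decayKernel c κ τ ^ (q / 2) = ENNReal.ofReal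
      (2 * (c ^ (q / 2) * ((1 / (κ * (q / 2))) ^ (1 - q / 4) * Real.Gamma (1 - q / 4)))) := by
  set f : ℝ → ℝ := fun x => c ^ (q / 2) * (x ^ ((1 - q / 4) - 1) * Real.exp (-(κ * (q / 2) * x)))
    with hf
  have hval : ∫ x in Set.Ioi (0 : ℝ), f x =
      c ^ (q / 2) * ((1 / (κ * (q / 2))) ^ (1 - q / 4) * Real.Gamma (1 - q / 4)) := by
    rw [hf, integral_const_mul, Real.integral_rpow_mul_exp_neg_mul_Ioi (by linarith) (by positivity)]
  have hG : 0 < Real.Gamma (1 - q / 4) := Real.Gamma_pos_of_pos (by linarith)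
  have hpt : ∀ᵐ τ : ℝ, decayKernel c κ τ ^ (q / 2) = ENNReal.ofReal (f |τ|) := by
    have h0 : ∀ᵐ τ : ℝ, τ ≠ 0 := by simp [ae_iff]
    filter_upwards [h0] with τ hτ
    have hτ0 : 0 < |τ| := abs_pos.2 hτ
    have hs : 0 < √|τ| := Real.sqrt_pos.2 hτ0
    rw [decayKernel, if_neg hτ, ENNReal.ofReal_rpow_of_nonneg (by positivity) (by positivity)]
    congr 1
    rw [Real.mul_rpow (by positivity) (Real.exp_pos _).le, Real.div_rpow hc.le hs.le, ← Real.exp_mul,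
      Real.sqrt_eq_rpow, ← Real.rpow_mul hτ0.le, hf]
    dsimp only
    rw [show (1 - q / 4) - 1 = -(1 / 2 * (q / 2)) by ring, Real.rpow_neg hτ0.le]
    rw [show -κ * |τ| * (q / 2) = -(κ * (q / 2) * |τ|) by ring]
    ring
  have habs : ∫ x, f |x| = 2 * ∫ x in Set.Ioi (0 : ℝ), f x := integral_comp_abs
  rw [hval] at habs
  have hpos : 0 < 2 * (c ^ (q / 2) * ((1 / (κ * (q / 2))) ^ (1 - q / 4) *
      Real.Gamma (1 - q / 4))) := by positivity
  have hfi : Integrable fun x => f |x| := by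
    by_contra h
    rw [integral_undef h] at habs
    linarith
  rw [lintegral_congr_ae hpt, ← habs, ofReal_integral_eq_lintegral_ofReal hfi]
  refine Filter.Eventually.of_forall fun x => ?_
  simp only [hf, Pi.zero_apply]
  positivity

/-! ### Interpolation in space -/

theorem enorm_waveField_le_supNorm {ζ : Space → ℂ} (hζ : Measurable ζ) (hre : ∀ ξ, (ζ ξ).re ≤ 0)
    {G : Space → Vec} (hG : Integrable G) {t : ℝ} (ht : 0 ≤ t) (x : Space) :
    ‖waveField ζ G t x‖ₑ ≤ supNorm ζ G t := by
  have hc : Continuous (waveField ζ G t) :=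
    continuous_invFourier (integrable_exp_smul hζ hre hG ht)
  have hcl : IsClosed {x | ‖waveField ζ G t x‖ₑ ≤ supNorm ζ G t} :=
    isClosed_le hc.enorm continuous_const
  have hd : Set.range (TopologicalSpace.denseSeq Space) ⊆
      {x | ‖waveField ζ G t x‖ₑ ≤ supNorm ζ G t} := by
    rintro _ ⟨n, rfl⟩
    exact le_iSup (fun n => ‖waveField ζ G t (TopologicalSpace.denseSeq Space n)‖ₑ) n
  have := (TopologicalSpace.denseRange_denseSeq Space).closure_eq ▸ closure_minimal hd hcl
  exact this (Set.mem_univ x)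

theorem eLpNorm_le_interpolate {u : Space → Vec} (hu : AEStronglyMeasurable u volume) {S : ℝ≥0∞}
    (hS : ∀ x, ‖u x‖ₑ ≤ S) {r : ℝ≥0∞} (hr : 4 < r) :
    eLpNorm u r volume ≤
      S ^ (1 - 2 * (r⁻¹).toReal) * eLpNorm u 2 volume ^ (2 * (r⁻¹).toReal) := by
  rcases eq_or_ne r ⊤ with rfl | hr'
  · simp only [ENNReal.inv_top, ENNReal.toReal_zero, mul_zero, sub_zero, ENNReal.rpow_one,
      ENNReal.rpow_zero, mul_one, eLpNorm_exponent_top]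
    exact eLpNormEssSup_le_of_ae_enorm_bound (Filter.Eventually.of_forall hS)
  · have hr0 : r ≠ 0 := by rintro rfl; simp at hr
    set a := r.toReal with ha
    have ha4 : 4 < a := by
      have := (ENNReal.toReal_lt_toReal (by simp) hr').2 hr
      simpa using this
    have hinv : (r⁻¹).toReal = 1 / a := by rw [ENNReal.toReal_inv, one_div]
    rw [eLpNorm_eq_lintegral_rpow_enorm_toReal hr0 hr',
      eLpNorm_eq_lintegral_rpow_enorm_toReal (by simp) (by simp), ← ha, hinv]
    simp only [ENNReal.toReal_ofNat]
    rw [← ENNReal.rpow_mul]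
    calc (∫⁻ x, ‖u x‖ₑ ^ a) ^ (1 / a) ≤ (∫⁻ x, S ^ (a - 2) * ‖u x‖ₑ ^ (2 : ℝ)) ^ (1 / a) := by
          refine ENNReal.rpow_le_rpow (lintegral_mono fun x => ?_) (by positivity)
          calc ‖u x‖ₑ ^ a = ‖u x‖ₑ ^ (a - 2) * ‖u x‖ₑ ^ (2 : ℝ) := by
                rw [← ENNReal.rpow_add_of_nonneg _ _ (by linarith) (by norm_num)]
                congr 1
                ring
            _ ≤ _ := by
                exact mul_le_mul_left (ENNReal.rpow_le_rpow (hS x) (by linarith)) _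
      _ ≤ (S ^ (a - 2) * ∫⁻ x, ‖u x‖ₑ ^ (2 : ℝ)) ^ (1 / a) := by
          refine ENNReal.rpow_le_rpow ?_ (by positivity)
          rw [lintegral_const_mul'' _ (hu.enorm.pow_const _)]
      _ = _ := by
          have : 0 < a := by linarith
          rw [ENNReal.mul_rpow_of_nonneg _ _ (by positivity), ← ENNReal.rpow_mul]
          congr 2 <;> field_simp

theorem eLpNorm_exp_smul_le {ζ : Space → ℂ} {κ : ℝ} (hre : ∀ ξ, (ζ ξ).re ≤ -κ)
    {G : Space → Vec} {t : ℝ} (ht : 0 ≤ t) (p : ℝ≥0∞) :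
    eLpNorm (fun ξ => Complex.exp (t * ζ ξ) • G ξ) p volume ≤
      ENNReal.ofReal (Real.exp (-κ * t)) * eLpNorm G p volume := by
  refine eLpNorm_le_mul_eLpNorm_of_ae_le_mul (Filter.Eventually.of_forall fun ξ => ?_) p
  rw [norm_smul, Complex.norm_exp]
  gcongr
  simp
  nlinarith [hre ξ]

theorem eLpNorm_one_le_of_support {δ ρ : ℝ} {G : Space → Vec} (hG : StronglyMeasurable G)
    (hsupp : ∀ ξ ∉ freqRegion δ ρ, G ξ = 0) :
    eLpNorm G 1 volume ≤ volume (freqRegion δ ρ) ^ (1 / 2 : ℝ) * eLpNorm G 2 volume := by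
  have hind : (freqRegion δ ρ).indicator G = G := by
    ext1 ξ
    by_cases h : ξ ∈ freqRegion δ ρ
    · rw [Set.indicator_of_mem h]
    · rw [Set.indicator_of_notMem h, hsupp ξ h]
  have h1 : ∀ p, eLpNorm G p volume = eLpNorm G p (volume.restrict (freqRegion δ ρ)) := fun p => by
    rw [← eLpNorm_indicator_eq_eLpNorm_restrict (measurableSet_freqRegion δ ρ), hind]
  rw [h1 1, h1 2, mul_comm]
  have h2 := eLpNorm_le_eLpNorm_mul_rpow_measure_univ (μ := volume.restrict (freqRegion δ ρ))
    (p := 1) (q := 2) (by norm_num) (f := G) hG.aestronglyMeasurable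
  refine h2.trans (le_of_eq ?_)
  rw [Measure.restrict_apply_univ]
  norm_num

theorem supNorm_le_eLpNorm_two {δ ρ : ℝ} {ζ : Space → ℂ} {κ : ℝ} (hre : ∀ ξ, (ζ ξ).re ≤ -κ)
    {G : Space → Vec} (hG : StronglyMeasurable G) (hsupp : ∀ ξ ∉ freqRegion δ ρ, G ξ = 0) {t : ℝ}
    (ht : 0 ≤ t) :
    supNorm ζ G t ≤ volume (freqRegion δ ρ) ^ (1 / 2 : ℝ) *
      (ENNReal.ofReal (Real.exp (-κ * t)) * eLpNorm G 2 volume) := by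
  refine iSup_le fun n => ?_
  refine (enorm_invFourier_le _ _).trans ((enorm_integral_le_lintegral_enorm _).trans ?_)
  have h1 : ∫⁻ ξ, ‖Complex.exp (Complex.I *
      (inner ℝ (TopologicalSpace.denseSeq Space n) ξ : ℝ)) • Complex.exp (t * ζ ξ) • G ξ‖ₑ =
      eLpNorm (fun ξ => Complex.exp (t * ζ ξ) • G ξ) 1 volume := by
    rw [eLpNorm_one_eq_lintegral_enorm]
    refine lintegral_congr fun ξ => ?_
    have : ‖Complex.exp (Complex.I *
        (inner ℝ (TopologicalSpace.denseSeq Space n) ξ : ℝ))‖ₑ = 1 := by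
      rw [← ofReal_norm, mul_comm, Complex.norm_exp_ofReal_mul_I, ENNReal.ofReal_one]
    rw [enorm_smul, this, one_mul]
  rw [h1]
  refine (eLpNorm_exp_smul_le hre ht 1).trans ?_
  rw [mul_left_comm]
  gcongr
  exact eLpNorm_one_le_of_support hG hsupp

theorem inv_toReal_lt {r : ℝ≥0∞} (hr : 4 < r) : (r⁻¹).toReal < 1 / 4 := by
  have h1 : r⁻¹ < 4⁻¹ := ENNReal.inv_lt_inv.2 hr
  have := (ENNReal.toReal_lt_toReal (ne_top_of_lt h1) (by simp)).2 h1
  simpa [ENNReal.toReal_inv] using this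

/-- The constant in front of the `L²` part of the interpolation inequality. -/
def bernsteinConst (δ ρ : ℝ) : ℝ≥0∞ :=
  (volume (freqRegion δ ρ) ^ (1 / 2 : ℝ) * plancherelConst) ^ (1 / 2 : ℝ)

/-- A majorant of the `L^r` norm of `e^{tζ(D)} 𝓕⁻¹ G`, where `σ = 1 - 4 / r`. -/
def majorant (A : ℝ≥0∞) (σ κ : ℝ) (ζ : Space → ℂ) (G : Space → Vec) (t : ℝ) : ℝ≥0∞ :=
  supNorm ζ G t ^ σ * (A * (ENNReal.ofReal (Real.exp (-κ * t)) * eLpNorm G 2 volume)) ^ (1 - σ)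

theorem eLpNorm_waveField_le_majorant {δ ρ : ℝ} {ζ : Space → ℂ} (hζ : Measurable ζ) {κ : ℝ}
    (hκ : 0 ≤ κ) (hre : ∀ ξ, (ζ ξ).re ≤ -κ) {G : Space → Vec} (hGm : StronglyMeasurable G)
    (hG : Integrable G) (hsupp : ∀ ξ ∉ freqRegion δ ρ, G ξ = 0) {r : ℝ≥0∞} (hr : 4 < r) {t : ℝ}
    (ht : 0 ≤ t) :
    eLpNorm (waveField ζ G t) r volume ≤
      majorant (bernsteinConst δ ρ) (1 - 4 * (r⁻¹).toReal) κ ζ G t := by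
  have hre' : ∀ ξ, (ζ ξ).re ≤ 0 := fun ξ => (hre ξ).trans (by linarith)
  set a := (r⁻¹).toReal with ha
  have ha0 : 0 ≤ a := ENNReal.toReal_nonneg
  have ha4 : a < 1 / 4 := inv_toReal_lt hr
  set S := supNorm ζ G t with hS
  set X := ENNReal.ofReal (Real.exp (-κ * t)) * eLpNorm G 2 volume with hX
  have h1 := eLpNorm_le_interpolate
    (continuous_invFourier (integrable_exp_smul hζ hre' hG ht)).aestronglyMeasurable (fun x => enorm_waveField_le_supNorm hζ hre' hG ht x) hr
  have h2 : eLpNorm (waveField ζ G t) 2 volume ≤ plancherelConst * X := by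
    rw [waveField, eLpNorm_invFourier_two (integrable_exp_smul hζ hre' hG ht)]
    gcongr
    exact eLpNorm_exp_smul_le hre ht 2
  have h3 := supNorm_le_eLpNorm_two hre hGm hsupp ht
  refine h1.trans ?_
  rw [← ha, ← hS, show 1 - 2 * a = (1 - 4 * a) + 2 * a by ring,
    ENNReal.rpow_add_of_nonneg _ _ (by linarith) (by linarith), majorant, mul_assoc]
  refine mul_le_mul_right ?_ _
  calc S ^ (2 * a) * eLpNorm (waveField ζ G t) 2 volume ^ (2 * a)
      ≤ (volume (freqRegion δ ρ) ^ (1 / 2 : ℝ) * X) ^ (2 * a) * (plancherelConst * X) ^ (2 * a) := by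
        gcongr
    _ = (bernsteinConst δ ρ * X) ^ (4 * a) := by
        have h4 : (bernsteinConst δ ρ * X) ^ (4 * a) =
            ((bernsteinConst δ ρ * X) ^ (2 : ℝ)) ^ (2 * a) := by
          rw [← ENNReal.rpow_mul]
          congr 1
          ring
        rw [h4, ← ENNReal.mul_rpow_of_nonneg _ _ (by linarith)]
        congr 1
        rw [bernsteinConst, ENNReal.mul_rpow_of_nonneg _ _ (by norm_num), ← ENNReal.rpow_mul]
        norm_num
        ring
    _ = _ := by congr 1; ring

/-! ### The constants -/

theorem rpow_self_ge {a : ℝ} (ha : 0 < a) : 1 / 3 ≤ a ^ a := by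
  have h1 : a - 1 ≤ Real.log a * a := by
    have h := Real.one_sub_inv_le_log_of_pos ha
    have h2 := mul_le_mul_of_nonneg_right h ha.le
    rw [sub_mul, inv_mul_cancel₀ ha.ne', one_mul] at h2
    exact h2
  rw [Real.rpow_def_of_pos ha]
  calc (1 / 3 : ℝ) ≤ Real.exp (-1) := by
        rw [Real.exp_neg, one_div]
        exact inv_anti₀ (Real.exp_pos 1) (by linarith [Real.exp_one_lt_d9])
    _ ≤ Real.exp (Real.log a * a) := Real.exp_le_exp.2 (by linarith)

theorem rpow_inv_self_le {p : ℝ} (hp : 1 ≤ p) : p ^ (1 / p) ≤ 2 := by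
  have hp0 : 0 < p := by linarith
  have h1 : p ≤ (2 : ℝ) ^ p := by
    have h := one_add_mul_self_le_rpow_one_add (s := 1) (by norm_num) hp
    norm_num at h
    linarith
  calc p ^ (1 / p) ≤ ((2 : ℝ) ^ p) ^ (1 / p) := Real.rpow_le_rpow hp0.le h1 (by positivity)
    _ = 2 := by
        rw [← Real.rpow_mul (by norm_num), mul_one_div_cancel hp0.ne', Real.rpow_one]

theorem DConst_ge {p ρ : ℝ} (ha : 0 < expo p ρ) : 1 / 3 ≤ DConst p ρ := by
  refine le_trans ?_ (le_max_left _ _)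
  rw [bConst]
  have h1 : (1 : ℝ) ≤ (2 / (3 / 4) ^ 2 : ℝ) ^ expo p ρ :=
    Real.one_le_rpow (by norm_num) ha.le
  have h2 := rpow_self_ge ha
  nlinarith

theorem dConst_eq {p σ : ℝ} (hσ : p * σ < 4) :
    dConst p ((1 - σ) / 4) = (2 : ℝ) ^ (1 / p) * (8 / ((3 / 4) ^ 2 * p)) ^ expo p ((1 - σ) / 4) *
      Real.Gamma (1 - p * σ / 4) ^ (1 / p) := by
  rw [dConst, Real.Gamma_eq_integral (by linarith)]
  congr 2
  refine setIntegral_congr_fun measurableSet_Ioi fun x hx => ?_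
  have hx0 : (0 : ℝ) < x := hx
  rw [show 1 - p * σ / 4 - 1 = -(p / 4 * (1 - 4 * ((1 - σ) / 4))) by ring,
    Real.rpow_neg hx0.le, div_eq_mul_inv]

theorem expo_eq (p σ : ℝ) : expo p ((1 - σ) / 4) = 1 / p - σ / 4 := by
  rw [expo]
  ring

/-- The time integral for `2 ≤ pσ < 4`. -/
theorem time_constant_large {p σ c κ : ℝ} (hp : 1 ≤ p) (hσ : 0 < σ) (h2 : 2 ≤ p * σ)
    (h4 : p * σ < 4) (hc : 0 < c) (hκ : 0 < κ) :
    (2 * (c ^ (p * σ / 2) * ((1 / (κ * (p * σ / 2))) ^ (1 - p * σ / 4) *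
      Real.Gamma (1 - p * σ / 4)))) ^ (1 / p) ≤
      2 * (c ^ (σ / 2) * κ ^ (-(1 / p - σ / 4)) * DConst p ((1 - σ) / 4)) := by
  have hp0 : 0 < p := by linarith
  set a := 1 / p - σ / 4 with ha
  have hpa : (1 - p * σ / 4) * (1 / p) = a := by rw [ha]; field_simp
  have ha0 : 0 < a := by
    rw [← hpa]
    have : 0 < 1 - p * σ / 4 := by linarith
    positivity
  have hap : a ≤ 1 / p := by rw [ha]; linarith
  set g := Real.Gamma (1 - p * σ / 4) with hg
  have hg0 : 0 < g := Real.Gamma_pos_of_pos (by linarith)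
  have hD : (2 : ℝ) ^ (1 / p) * g ^ (1 / p) ≤ 2 * DConst p ((1 - σ) / 4) := by
    have h1 : dConst p ((1 - σ) / 4) ≤ DConst p ((1 - σ) / 4) := le_max_right _ _
    rw [dConst_eq h4, expo_eq, ← ha, ← hg] at h1
    have h3 : 1 / 2 ≤ (8 / ((3 / 4) ^ 2 * p) : ℝ) ^ a := by
      have h5 : p ^ a ≤ 2 := (Real.rpow_le_rpow_of_exponent_le hp hap).trans (rpow_inv_self_le hp)
      calc (1 / 2 : ℝ) ≤ 1 / p ^ a := one_div_le_one_div_of_le (by positivity) h5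
        _ = (1 / p) ^ a := by rw [Real.div_rpow zero_le_one hp0.le, Real.one_rpow]
        _ ≤ _ := by
            refine Real.rpow_le_rpow (by positivity) ?_ ha0.le
            rw [div_le_div_iff₀ hp0 (by positivity)]
            nlinarith
    have h6 : 0 < (2 : ℝ) ^ (1 / p) * g ^ (1 / p) := by positivity
    nlinarith
  have hκa : (1 / (κ * (p * σ / 2))) ^ a ≤ κ ^ (-a) := by
    rw [Real.rpow_neg hκ.le, ← Real.inv_rpow hκ.le]
    refine Real.rpow_le_rpow (by positivity) ?_ ha0.le
    rw [one_div]
    refine inv_anti₀ hκ ?_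
    nlinarith
  have hbase : 0 ≤ 1 / (κ * (p * σ / 2)) := by positivity
  rw [Real.mul_rpow (by norm_num) (by positivity), Real.mul_rpow (by positivity) (by positivity),
    Real.mul_rpow (by positivity) hg0.le, ← Real.rpow_mul hc.le, ← Real.rpow_mul hbase, hpa,
    show p * σ / 2 * (1 / p) = σ / 2 by field_simp]
  calc (2 : ℝ) ^ (1 / p) * (c ^ (σ / 2) * ((1 / (κ * (p * σ / 2))) ^ a * g ^ (1 / p)))
      = (c ^ (σ / 2) * (1 / (κ * (p * σ / 2))) ^ a) * ((2 : ℝ) ^ (1 / p) * g ^ (1 / p)) := by ring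
    _ ≤ (c ^ (σ / 2) * κ ^ (-a)) * (2 * DConst p ((1 - σ) / 4)) := by gcongr
    _ = _ := by ring

/-- The time integral for `pσ < 2`. -/
theorem time_constant_small {p σ c κ : ℝ} (hp : 1 ≤ p) (hσ : 0 < σ) (hσ1 : σ ≤ 1) (h2 : p * σ < 2)
    (hc : 0 < c) (hκ : 0 < κ) :
    (2 * (c ^ ((2 : ℝ) / 2) * ((1 / (κ / 2 * ((2 : ℝ) / 2))) ^ (1 - (2 : ℝ) / 4) *
      Real.Gamma (1 - (2 : ℝ) / 4)))) ^ (σ / 2) *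
      (1 / (κ * p / (2 * (1 - p * σ / 2)))) ^ ((1 - p * σ / 2) * (1 / p)) ≤
      96 * (c ^ (σ / 2) * κ ^ (-(1 / p - σ / 4)) * DConst p ((1 - σ) / 4)) := by
  have hp0 : 0 < p := by linarith
  have hθ : 0 < 1 - p * σ / 2 := by linarith
  set a := 1 / p - σ / 4 with ha
  set b := 1 / p - σ / 2 with hb
  have hpb : (1 - p * σ / 2) * (1 / p) = b := by rw [hb]; field_simp
  have hb0 : 0 < b := by rw [← hpb]; positivity
  have ha0 : 0 < a := by rw [ha]; rw [hb] at hb0; linarith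
  have hb1 : b ≤ 1 := by
    have : 1 / p ≤ 1 := by rw [div_le_one hp0]; exact hp
    rw [hb]; linarith
  have hD : 1 / 3 ≤ DConst p ((1 - σ) / 4) := DConst_ge (by rw [expo_eq]; exact ha0)
  rw [hpb]
  have hG : Real.Gamma (1 - (2 : ℝ) / 4) = √Real.pi := by
    rw [← Real.Gamma_one_half_eq]; norm_num
  have e1 : (1 / (κ * p / (2 * (1 - p * σ / 2)))) ^ b ≤ 2 * κ ^ (-b) := by
    calc (1 / (κ * p / (2 * (1 - p * σ / 2)))) ^ b ≤ (2 * κ⁻¹) ^ b := by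
          refine Real.rpow_le_rpow (by positivity) ?_ hb0.le
          rw [one_div_div, div_le_iff₀ (by positivity)]
          have : 2 * κ⁻¹ * (κ * p) = 2 * p := by field_simp
          rw [this]
          nlinarith [mul_pos hp0 hσ]
      _ = 2 ^ b * κ ^ (-b) := by
          rw [Real.mul_rpow (by norm_num) (by positivity), Real.inv_rpow hκ.le,
            Real.rpow_neg hκ.le]
      _ ≤ 2 * κ ^ (-b) := by
          gcongr
          calc (2 : ℝ) ^ b ≤ 2 ^ (1 : ℝ) := Real.rpow_le_rpow_of_exponent_le (by norm_num) hb1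
            _ = 2 := by norm_num
  have hsq : (1 / (κ / 2 * ((2 : ℝ) / 2))) ^ (1 - (2 : ℝ) / 4) = (2 * κ⁻¹) ^ (1 / 2 : ℝ) := by
    congr 1
    · field_simp
    · norm_num
  have e2 : (2 * (c ^ ((2 : ℝ) / 2) * ((1 / (κ / 2 * ((2 : ℝ) / 2))) ^ (1 - (2 : ℝ) / 4) *
      Real.Gamma (1 - (2 : ℝ) / 4)))) ^ (σ / 2) ≤ 16 * (c ^ (σ / 2) * κ ^ (-(σ / 4))) := by
    rw [hG, hsq]
    have h3 : √Real.pi ≤ 2 := by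
      rw [Real.sqrt_le_iff]
      constructor
      · norm_num
      · linarith [Real.pi_lt_four]
    have h4 : (2 * κ⁻¹) ^ (1 / 2 : ℝ) ≤ 2 * (κ⁻¹) ^ (1 / 2 : ℝ) := by
      rw [Real.mul_rpow (by norm_num) (by positivity)]
      gcongr
      calc (2 : ℝ) ^ (1 / 2 : ℝ) ≤ 2 ^ (1 : ℝ) :=
            Real.rpow_le_rpow_of_exponent_le (by norm_num) (by norm_num)
        _ = 2 := by norm_num
    calc _ ≤ (16 * (c * (κ⁻¹) ^ (1 / 2 : ℝ))) ^ (σ / 2) := by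
          refine Real.rpow_le_rpow (by positivity) ?_ (by positivity)
          rw [show (2 : ℝ) / 2 = 1 by norm_num, Real.rpow_one]
          calc 2 * (c * ((2 * κ⁻¹) ^ (1 / 2 : ℝ) * √Real.pi))
              ≤ 2 * (c * ((2 * (κ⁻¹) ^ (1 / 2 : ℝ)) * 2)) := by gcongr
            _ ≤ _ := by
                have : 0 < c * (κ⁻¹) ^ (1 / 2 : ℝ) := by positivity
                nlinarith
      _ = 16 ^ (σ / 2) * (c ^ (σ / 2) * κ ^ (-(σ / 4))) := by
          rw [Real.mul_rpow (by norm_num) (by positivity), Real.mul_rpow hc.le (by positivity),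
            ← Real.rpow_mul (by positivity), Real.inv_rpow hκ.le, Real.rpow_neg hκ.le]
          congr 4
          ring
      _ ≤ _ := by
          gcongr
          calc (16 : ℝ) ^ (σ / 2) ≤ 16 ^ (1 : ℝ) :=
                Real.rpow_le_rpow_of_exponent_le (by norm_num) (by linarith)
            _ = 16 := by norm_num
  calc _ ≤ 16 * (c ^ (σ / 2) * κ ^ (-(σ / 4))) * (2 * κ ^ (-b)) := by gcongr
    _ = 96 * (c ^ (σ / 2) * κ ^ (-a) * (1 / 3)) := by
        have : κ ^ (-a) = κ ^ (-(σ / 4)) * κ ^ (-b) := by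
          rw [← Real.rpow_add hκ]
          congr 1
          rw [ha, hb]
          ring
        rw [this]
        ring
    _ ≤ _ := by gcongr

/-! ### The homogeneous Strichartz estimate -/

theorem waveField_shift (ζ : Space → ℂ) (c : ℝ) (G : Space → Vec) (t : ℝ) (x : Space) :
    waveField ζ G t x = ((Real.exp (-c * t) : ℝ) : ℂ) • waveField (fun ξ => ζ ξ + c) G t x := by
  rw [waveField, waveField, invFourier, invFourier, smul_comm]
  congr 1
  refine Eq.trans ?_ (integral_smul ((Real.exp (-c * t) : ℝ) : ℂ) fun ξ : Space =>
    Complex.exp (Complex.I * (inner ℝ x ξ : ℝ)) • (Complex.exp (t * (ζ ξ + c)) • G ξ))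
  refine integral_congr_ae (Filter.Eventually.of_forall fun ξ => ?_)
  dsimp only
  rw [smul_comm ((Real.exp (-c * t) : ℝ) : ℂ), ← mul_smul ((Real.exp (-c * t) : ℝ) : ℂ),
    Complex.ofReal_exp, ← Complex.exp_add]
  congr 3
  push_cast
  ring

theorem supNorm_shift (ζ : Space → ℂ) (c : ℝ) (G : Space → Vec) (t : ℝ) :
    supNorm ζ G t = ENNReal.ofReal (Real.exp (-c * t)) * supNorm (fun ξ => ζ ξ + c) G t := by
  rw [supNorm, supNorm, ENNReal.mul_iSup]
  congr 1
  ext n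
  rw [waveField_shift ζ c, enorm_smul, ← ofReal_norm ((Real.exp (-c * t) : ℝ) : ℂ), Complex.norm_real,
    Real.norm_of_nonneg (Real.exp_pos _).le]

theorem modelSymbol_half (F β κ : ℝ) (ξ : Space) :
    modelSymbol F β (κ / 2) ξ = modelSymbol F β κ ξ + ((κ / 2 : ℝ) : ℂ) := by
  simp only [modelSymbol]
  push_cast
  ring

theorem kernelConst_pos {F δ ρ β : ℝ} (hF : 0 < F) (hδ : 0 < δ) (hρ : 0 < ρ) (hβ : β ≠ 0) :
    0 < kernelConst F δ ρ β := by
  have := dispConst_ge_one (inv_pos.2 hF)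
  have : 0 < √|β| := Real.sqrt_pos.2 (abs_pos.2 hβ)
  rw [kernelConst]
  positivity

theorem homogeneous_strichartz {F δ ρ β κ p σ Λ : ℝ} (hF : 0 < F) (hF1 : F ≠ 1) (hδ : 0 < δ)
    (hρ : 0 < ρ) (hβ : β ≠ 0) (hκ : 0 < κ) (hp : 1 ≤ p) (hσ : 0 < σ) (hσ1 : σ ≤ 1)
    (h4 : p * σ < 4) (hΛ : 0 ≤ Λ) {ζ : Space → ℂ} (hζ : Measurable ζ)
    (hre : ∀ ξ, (ζ ξ).re ≤ -κ) (hζΛ : ∀ ξ, ‖ζ ξ - modelSymbol F β κ ξ‖ ≤ Λ * κ)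
    {G : Space → Vec} (hGm : StronglyMeasurable G) (hG : Integrable G)
    (hsupp : ∀ ξ ∉ freqRegion δ ρ, G ξ = 0) (A : ℝ≥0∞) :
    (∫⁻ t in Set.Ioi (0 : ℝ), majorant A σ κ ζ G t ^ p) ^ (1 / p) ≤
      ENNReal.ofReal (96 * (1 + 2 * Λ) * (kernelConst F δ ρ β ^ (σ / 2) *
        κ ^ (-(1 / p - σ / 4)) * DConst p ((1 - σ) / 4))) * A ^ (1 - σ) * eLpNorm G 2 volume := by
  have hp0 : 0 < p := by linarith
  set c := kernelConst F δ ρ β with hcdef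
  have hc : 0 < c := kernelConst_pos hF hδ hρ hβ
  set g := eLpNorm G 2 volume with hg
  set D := DConst p ((1 - σ) / 4) with hD
  have hD0 : 0 < D := by
    have := DConst_ge (p := p) (ρ := (1 - σ) / 4) (by
      rw [expo_eq, sub_pos, lt_div_iff₀ hp0]
      linarith)
    linarith
  have hσ' : 0 ≤ 1 - σ := by linarith
  have hgg : g ^ (1 - σ) * g ^ σ = g := by
    rw [← ENNReal.rpow_add_of_nonneg _ _ hσ' hσ.le]
    simp
  rcases le_or_gt 2 (p * σ) with h2 | h2
  · have hS := strichartz_general hF hF1 hδ hρ hβ hκ h2 hΛ hζ hre hζΛ hGm hG hsupp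
    rw [← hcdef, ← hg, lintegral_decayKernel hc hκ (by linarith) h4] at hS
    have hSm := measurable_supNorm hζ hGm
    set I := ∫⁻ t in Set.Ioi (0 : ℝ), supNorm ζ G t ^ (p * σ) with hI
    have h1 : ∫⁻ t in Set.Ioi (0 : ℝ), majorant A σ κ ζ G t ^ p ≤
        (A * g) ^ ((1 - σ) * p) * I := by
      rw [hI, ← lintegral_const_mul _ (hSm.pow_const _)]
      refine setLIntegral_mono' measurableSet_Ioi fun t ht => ?_
      rw [majorant, ENNReal.mul_rpow_of_nonneg _ _ hp0.le, ← ENNReal.rpow_mul, ← ENNReal.rpow_mul,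
        mul_comm, mul_comm σ p]
      refine mul_le_mul_left (ENNReal.rpow_le_rpow ?_ (by positivity)) _
      gcongr
      refine mul_le_of_le_one_left zero_le ?_
      rw [ENNReal.ofReal_le_one, Real.exp_le_one_iff]
      have : (0 : ℝ) < t := ht
      nlinarith
    have h3 : I ^ (1 / p) ≤ ENNReal.ofReal (2 * (c ^ (σ / 2) * κ ^ (-(1 / p - σ / 4)) * D)) *
        (ENNReal.ofReal (1 + 2 * Λ) * g ^ σ) := by
      have h5 : I ^ (1 / p) = (I ^ (1 / (p * σ))) ^ σ := by
        rw [← ENNReal.rpow_mul]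
        congr 1
        field_simp
      rw [h5]
      refine (ENNReal.rpow_le_rpow hS hσ.le).trans ?_
      rw [ENNReal.mul_rpow_of_nonneg _ _ hσ.le, ENNReal.mul_rpow_of_nonneg _ _ hσ.le,
        ← ENNReal.rpow_mul, show 1 / (p * σ) * σ = 1 / p by field_simp]
      gcongr
      · have hG0 : 0 < Real.Gamma (1 - p * σ / 4) := Real.Gamma_pos_of_pos (by linarith)
        rw [ENNReal.ofReal_rpow_of_nonneg (by positivity) (by positivity)]
        exact ENNReal.ofReal_le_ofReal (time_constant_large hp hσ h2 h4 hc hκ)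
      · rw [ENNReal.ofReal_rpow_of_nonneg (by positivity) hσ.le]
        apply ENNReal.ofReal_le_ofReal
        calc (1 + Λ) ^ σ ≤ (1 + Λ) ^ (1 : ℝ) :=
              Real.rpow_le_rpow_of_exponent_le (by linarith) hσ1
          _ ≤ 1 + 2 * Λ := by rw [Real.rpow_one]; linarith
    calc _ ≤ ((A * g) ^ ((1 - σ) * p) * I) ^ (1 / p) := ENNReal.rpow_le_rpow h1 (by positivity)
      _ = A ^ (1 - σ) * g ^ (1 - σ) * I ^ (1 / p) := by
          rw [ENNReal.mul_rpow_of_nonneg _ _ (by positivity), ← ENNReal.rpow_mul,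
            show (1 - σ) * p * (1 / p) = 1 - σ by field_simp,
            ENNReal.mul_rpow_of_nonneg _ _ hσ']
      _ ≤ A ^ (1 - σ) * g ^ (1 - σ) *
          (ENNReal.ofReal (2 * (c ^ (σ / 2) * κ ^ (-(1 / p - σ / 4)) * D)) *
            (ENNReal.ofReal (1 + 2 * Λ) * g ^ σ)) := by gcongr
      _ = ENNReal.ofReal (2 * (1 + 2 * Λ) * (c ^ (σ / 2) * κ ^ (-(1 / p - σ / 4)) * D)) *
          A ^ (1 - σ) * (g ^ (1 - σ) * g ^ σ) := by
          rw [show 2 * (1 + 2 * Λ) * (c ^ (σ / 2) * κ ^ (-(1 / p - σ / 4)) * D) =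
            2 * (c ^ (σ / 2) * κ ^ (-(1 / p - σ / 4)) * D) * (1 + 2 * Λ) by ring,
            ENNReal.ofReal_mul (p := 2 * (c ^ (σ / 2) * κ ^ (-(1 / p - σ / 4)) * D))
              (by positivity)]
          generalize ENNReal.ofReal (2 * (c ^ (σ / 2) * κ ^ (-(1 / p - σ / 4)) * D)) = X
          ring
      _ ≤ _ := by
          rw [hgg]
          gcongr
          norm_num
  · set ζ' : Space → ℂ := fun ξ => ζ ξ + ((κ / 2 : ℝ) : ℂ) with hζ'
    have hζ'm : Measurable ζ' := hζ.add_const _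
    have hS := strichartz_general hF hF1 hδ hρ hβ (half_pos hκ) le_rfl
      (by positivity : 0 ≤ 2 * Λ) hζ'm
      (fun ξ => by simp only [hζ', Complex.add_re, Complex.ofReal_re]; linarith [hre ξ])
      (fun ξ => by
        rw [modelSymbol_half, hζ', add_sub_add_right_eq_sub]
        refine (hζΛ ξ).trans (le_of_eq ?_)
        ring) hGm hG hsupp
    rw [← hcdef, ← hg, lintegral_decayKernel hc (half_pos hκ) (by norm_num) (by norm_num)] at hS
    have hSm := measurable_supNorm hζ'm hGm
    set θ := p * σ / 2 with hθ
    have hθ0 : 0 < θ := by positivity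
    have hθ1 : 0 < 1 - θ := by rw [hθ]; linarith
    set I := ∫⁻ t in Set.Ioi (0 : ℝ), supNorm ζ' G t ^ (2 : ℝ) with hI
    set κ' := κ * p / (2 * (1 - θ)) with hκ'
    have hκ'0 : 0 < κ' := by positivity
    have hem : Measurable fun t : ℝ => ENNReal.ofReal (Real.exp (-κ' * t)) := by fun_prop
    have h1 : ∫⁻ t in Set.Ioi (0 : ℝ), majorant A σ κ ζ G t ^ p ≤
        (A * g) ^ ((1 - σ) * p) * (I ^ θ * ENNReal.ofReal (1 / κ') ^ (1 - θ)) := by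
      have hH := ENNReal.lintegral_mul_norm_pow_le
        (μ := volume.restrict (Set.Ioi (0 : ℝ)))
        (f := fun t => supNorm ζ' G t ^ (2 : ℝ))
        (g := fun t => ENNReal.ofReal (Real.exp (-κ' * t)))
        (hSm.pow_const _).aemeasurable hem.aemeasurable hθ0.le hθ1.le (by ring)
      rw [lintegral_exp_neg_Ioi hκ'0] at hH
      refine le_trans ?_ (mul_le_mul_right hH _)
      have hm : Measurable fun t => (supNorm ζ' G t ^ (2 : ℝ)) ^ θ *
          ENNReal.ofReal (Real.exp (-κ' * t)) ^ (1 - θ) :=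
        ((hSm.pow_const _).pow_const _).mul (hem.pow_const _)
      rw [← lintegral_const_mul _ hm]
      refine setLIntegral_mono' measurableSet_Ioi fun t ht => ?_
      have ht0 : (0 : ℝ) < t := ht
      rw [majorant, supNorm_shift ζ (κ / 2), ENNReal.mul_rpow_of_nonneg _ _ hp0.le,
        ← ENNReal.rpow_mul, ← ENNReal.rpow_mul]
      have e1 : A * (ENNReal.ofReal (Real.exp (-κ * t)) * g) =
        ENNReal.ofReal (Real.exp (-κ * t)) * (A * g) := by ring
      rw [e1, ENNReal.mul_rpow_of_nonneg _ _ (by positivity),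
        ENNReal.mul_rpow_of_nonneg _ _ (by positivity), ← ENNReal.rpow_mul,
        show (2 : ℝ) * θ = σ * p by rw [hθ]; ring]
      have e2 : ENNReal.ofReal (Real.exp (-(κ / 2) * t)) ^ (σ * p) *
          ENNReal.ofReal (Real.exp (-κ * t)) ^ ((1 - σ) * p) ≤
          ENNReal.ofReal (Real.exp (-κ' * t)) ^ (1 - θ) := by
        rw [ENNReal.ofReal_rpow_of_pos (Real.exp_pos _), ENNReal.ofReal_rpow_of_pos (Real.exp_pos _),
          ENNReal.ofReal_rpow_of_pos (Real.exp_pos _), ← ENNReal.ofReal_mul (by positivity),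
          ← Real.exp_mul, ← Real.exp_mul, ← Real.exp_mul, ← Real.exp_add]
        apply ENNReal.ofReal_le_ofReal
        apply Real.exp_le_exp.2
        have e3 : -κ' * t * (1 - θ) = -(κ * t * p / 2) := by
          rw [hκ']
          field_simp
        rw [e3]
        have : 0 ≤ κ * t * p * (1 - σ) := by positivity
        nlinarith
      calc _ = (A * g) ^ ((1 - σ) * p) * supNorm ζ' G t ^ (σ * p) *
            (ENNReal.ofReal (Real.exp (-(κ / 2) * t)) ^ (σ * p) *
          ENNReal.ofReal (Real.exp (-κ * t)) ^ ((1 - σ) * p)) := by ring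
        _ ≤ (A * g) ^ ((1 - σ) * p) * supNorm ζ' G t ^ (σ * p) *
            ENNReal.ofReal (Real.exp (-κ' * t)) ^ (1 - θ) := by gcongr
        _ = _ := by ring
    have h3 : (I ^ θ * ENNReal.ofReal (1 / κ') ^ (1 - θ)) ^ (1 / p) ≤
        ENNReal.ofReal (96 * (c ^ (σ / 2) * κ ^ (-(1 / p - σ / 4)) * D)) *
        (ENNReal.ofReal (1 + 2 * Λ) * g ^ σ) := by
      have h5 : I ^ (θ * (1 / p)) = (I ^ (1 / 2 : ℝ)) ^ σ := by
        rw [← ENNReal.rpow_mul]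
        congr 1
        rw [hθ]
        field_simp
      rw [ENNReal.mul_rpow_of_nonneg _ _ (by positivity), ← ENNReal.rpow_mul, ← ENNReal.rpow_mul, h5]
      refine (mul_le_mul_left (ENNReal.rpow_le_rpow hS hσ.le) _).trans ?_
      rw [ENNReal.mul_rpow_of_nonneg _ _ hσ.le, ENNReal.mul_rpow_of_nonneg _ _ hσ.le,
        ← ENNReal.rpow_mul, show (1 / 2 : ℝ) * σ = σ / 2 by ring]
      have hG0 : 0 < Real.Gamma (1 - (2 : ℝ) / 4) := Real.Gamma_pos_of_pos (by norm_num)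
      have h6 := time_constant_small hp hσ hσ1 h2 hc hκ
      rw [← hθ, ← hκ', ← hD] at h6
      rw [mul_right_comm]
      refine mul_le_mul' ?_ ?_
      · rw [ENNReal.ofReal_rpow_of_nonneg (by positivity) (by positivity),
          ENNReal.ofReal_rpow_of_nonneg (by positivity) (by positivity),
          ← ENNReal.ofReal_mul (by positivity)]
        exact ENNReal.ofReal_le_ofReal h6
      · gcongr
        rw [ENNReal.ofReal_rpow_of_nonneg (by positivity) hσ.le]
        apply ENNReal.ofReal_le_ofReal
        calc (1 + 2 * Λ) ^ σ ≤ (1 + 2 * Λ) ^ (1 : ℝ) :=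
              Real.rpow_le_rpow_of_exponent_le (by linarith) hσ1
          _ = 1 + 2 * Λ := by rw [Real.rpow_one]
    calc _ ≤ ((A * g) ^ ((1 - σ) * p) * (I ^ θ * ENNReal.ofReal (1 / κ') ^ (1 - θ))) ^ (1 / p) :=
          ENNReal.rpow_le_rpow h1 (by positivity)
      _ = A ^ (1 - σ) * g ^ (1 - σ) * (I ^ θ * ENNReal.ofReal (1 / κ') ^ (1 - θ)) ^ (1 / p) := by
          rw [ENNReal.mul_rpow_of_nonneg _ _ (by positivity : 0 ≤ 1 / p), ← ENNReal.rpow_mul,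
            show (1 - σ) * p * (1 / p) = 1 - σ by field_simp,
            ENNReal.mul_rpow_of_nonneg _ _ hσ']
      _ ≤ A ^ (1 - σ) * g ^ (1 - σ) *
          (ENNReal.ofReal (96 * (c ^ (σ / 2) * κ ^ (-(1 / p - σ / 4)) * D)) *
            (ENNReal.ofReal (1 + 2 * Λ) * g ^ σ)) := by gcongr
      _ = ENNReal.ofReal (96 * (1 + 2 * Λ) * (c ^ (σ / 2) * κ ^ (-(1 / p - σ / 4)) * D)) *
          A ^ (1 - σ) * (g ^ (1 - σ) * g ^ σ) := by
          rw [show 96 * (1 + 2 * Λ) * (c ^ (σ / 2) * κ ^ (-(1 / p - σ / 4)) * D) =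
            96 * (c ^ (σ / 2) * κ ^ (-(1 / p - σ / 4)) * D) * (1 + 2 * Λ) by ring,
            ENNReal.ofReal_mul (p := 96 * (c ^ (σ / 2) * κ ^ (-(1 / p - σ / 4)) * D))
              (by positivity)]
          generalize ENNReal.ofReal (96 * (c ^ (σ / 2) * κ ^ (-(1 / p - σ / 4)) * D)) = X
          ring
      _ = _ := by rw [hgg]

/-! ### The spectrum of the symbol -/

/-- The matrix `ε (𝔹 + ν|ξ|²)` in terms of the direction `n` of `ξ`, with `φ = F⁻¹` and
`η = ε (ν' - ν)|ξ|²`. -/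
def waveMatrix (φ η n₀ n₁ n₂ : ℂ) : Matrix (Fin 4) (Fin 4) ℂ :=
  !![n₀ * n₁, 1 - n₀ ^ 2, 0, n₀ * n₂ * φ;
     n₁ ^ 2 - 1, -(n₁ * n₀), 0, n₁ * n₂ * φ;
     n₂ * n₁, -(n₂ * n₀), 0, n₂ ^ 2 * φ - φ;
     0, 0, φ, -η]

theorem det_scalar_sub_waveMatrix {φ η n₀ n₁ n₂ : ℂ} (hn : n₀ ^ 2 + n₁ ^ 2 + n₂ ^ 2 = 1) (μ : ℂ) :
    (Matrix.scalar (Fin 4) μ - waveMatrix φ η n₀ n₁ n₂).det =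
      μ * (μ ^ 3 + η * μ ^ 2 + (n₂ ^ 2 + (1 - n₂ ^ 2) * φ ^ 2) * μ + η * n₂ ^ 2) := by
  rw [Matrix.det_succ_row_zero]
  simp [Fin.sum_univ_succ, Matrix.det_fin_three, waveMatrix, Fin.succAbove, Matrix.submatrix]
  linear_combination -(μ ^ 2 + μ * η + φ ^ 2) * hn

theorem waveMatrix_annihilates {φ η n₀ n₁ n₂ : ℂ} (hn : n₀ ^ 2 + n₁ ^ 2 + n₂ ^ 2 = 1) :
    let e := waveMatrix φ η n₀ n₁ n₂
    e ^ 4 + η • e ^ 3 + (n₂ ^ 2 + (1 - n₂ ^ 2) * φ ^ 2) • e ^ 2 + (η * n₂ ^ 2) • e = 0 := by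
  intro e
  have h : e.charpoly = Polynomial.X ^ 4 + Polynomial.C η * Polynomial.X ^ 3 +
      Polynomial.C (n₂ ^ 2 + (1 - n₂ ^ 2) * φ ^ 2) * Polynomial.X ^ 2 +
      Polynomial.C (η * n₂ ^ 2) * Polynomial.X := by
    refine Polynomial.funext fun μ => ?_
    rw [Matrix.eval_charpoly, det_scalar_sub_waveMatrix hn]
    simp only [Polynomial.eval_add, Polynomial.eval_mul, Polynomial.eval_pow, Polynomial.eval_X,
      Polynomial.eval_C]
    ring
  have h2 := Matrix.aeval_self_charpoly e
  rw [h] at h2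
  generalize n₂ ^ 2 + (1 - n₂ ^ 2) * φ ^ 2 = α at h2 ⊢
  generalize η * n₂ ^ 2 = γ at h2 ⊢
  simpa only [map_add, map_mul, map_pow, Polynomial.aeval_X, Polynomial.aeval_C,
    Algebra.algebraMap_eq_smul_one, smul_mul_assoc, one_mul] using h2

/-- The cofactor of `X - μ` in the characteristic polynomial of the wave matrix. -/
def waveCofactor (η a μ : ℂ) (e : Matrix (Fin 4) (Fin 4) ℂ) : Matrix (Fin 4) (Fin 4) ℂ :=
  e ^ 3 + (μ + η) • e ^ 2 + (μ ^ 2 + η * μ + a ^ 2) • e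

theorem smul_eq_waveCofactor {η a b μ c w z : ℂ} {e B P : Matrix (Fin 4) (Fin 4) ℂ}
    (he : e ^ 4 + η • e ^ 3 + a ^ 2 • e ^ 2 + (η * b) • e = 0)
    (hμ : μ ^ 3 + η * μ ^ 2 + a ^ 2 * μ + η * b = 0)
    (hB : B = c • e + w • 1) (hc : c ≠ 0) (hz : z = c * μ + w) (hP : IsEigenprojection B z P) :
    (μ ^ 3 + (μ + η) * μ ^ 2 + (μ ^ 2 + η * μ + a ^ 2) * μ) • P = waveCofactor η a μ e := by
  obtain ⟨-, h2, h3⟩ := hP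
  have hBe : B - z • 1 = c • (e - μ • 1) := by
    rw [hB, hz, smul_sub, add_smul, smul_smul]
    abel
  have hPe : P * e = μ • P := by
    have h4 : P * (B - z • 1) = 0 := by
      refine Matrix.ext_of_mulVec_single fun j => ?_
      rw [← Matrix.mulVec_mulVec, Matrix.zero_mulVec]
      exact (h3 _).2 ⟨Pi.single j 1, by rw [Matrix.sub_mulVec, Matrix.smul_mulVec, Matrix.one_mulVec]⟩
    rw [hBe, Matrix.mul_smul, smul_eq_zero] at h4
    have h5 := h4.resolve_left hc
    rw [Matrix.mul_sub, Matrix.mul_smul, Matrix.mul_one, sub_eq_zero] at h5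
    exact h5
  have hq : P * waveCofactor η a μ e = waveCofactor η a μ e := by
    have h6 : (e - μ • 1) * waveCofactor η a μ e = 0 := by
      have : (e - μ • 1) * waveCofactor η a μ e =
        (e ^ 4 + η • e ^ 3 + a ^ 2 • e ^ 2 + (η * b) • e) -
          (μ ^ 3 + η * μ ^ 2 + a ^ 2 * μ + η * b) • e := by
        rw [waveCofactor]
        simp only [sub_mul, mul_add, mul_smul_comm, smul_mul_assoc, one_mul, ← sq, ← pow_succ']
        module
      rw [this, he, hμ, zero_smul, sub_zero]
    have h7 : (B - z • 1) * waveCofactor η a μ e = 0 := by rw [hBe, smul_mul_assoc, h6, smul_zero]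
    refine Matrix.ext_of_mulVec_single fun j => ?_
    rw [← Matrix.mulVec_mulVec]
    refine (h2 _).2 ?_
    have h8 := congrArg (fun N => N.mulVec (Pi.single j 1)) h7
    simp only [← Matrix.mulVec_mulVec, Matrix.zero_mulVec, Matrix.sub_mulVec, Matrix.smul_mulVec,
      Matrix.one_mulVec] at h8
    exact sub_eq_zero.1 h8
  have hP2 : P * e ^ 2 = μ ^ 2 • P := by
    rw [pow_two, ← mul_assoc, hPe, smul_mul_assoc, hPe, smul_smul, pow_two]
  have hP3 : P * e ^ 3 = μ ^ 3 • P := by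
    rw [pow_succ, ← mul_assoc, hP2, smul_mul_assoc, hPe, smul_smul, ← pow_succ]
  rw [← hq, waveCofactor, mul_add, mul_add, mul_smul_comm, mul_smul_comm, hP3, hP2, hPe]
  module

/-! ### The roots of the cubic -/

/-- A real cubic `X³ + ηX² + a²X + ηb` with small `η` has a root close to `i a`. -/
theorem exists_cubic_root {η a b : ℝ} (ha : 0 < a) (hb : 0 ≤ b) (hba : b ≤ a ^ 2)
    (hη : |η| ≤ a / 10) :
    ∃ x y ρ : ℝ, 0 < y ∧ ρ = -η - 2 * x ∧ x ^ 2 + y ^ 2 + 2 * x * ρ = a ^ 2 ∧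
      (x ^ 2 + y ^ 2) * ρ = -(η * b) ∧ |x| ≤ |η| / 2 ∧ x ≤ max 0 (-η / 2) ∧ |y - a| ≤ |η| := by
  have hη2 : η ^ 2 ≤ a ^ 2 / 100 := by
    have := pow_le_pow_left₀ (abs_nonneg η) hη 2
    rw [sq_abs] at this
    linarith
  obtain ⟨ρ, hρ, hroot⟩ : ∃ ρ ∈ Set.uIcc (-η) 0, ρ ^ 3 + η * ρ ^ 2 + a ^ 2 * ρ + η * b = 0 := by
    have hc : ContinuousOn (fun ρ : ℝ => ρ ^ 3 + η * ρ ^ 2 + a ^ 2 * ρ + η * b)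
      (Set.uIcc (-η) 0) := by fun_prop
    obtain ⟨ρ, h1, h2⟩ := intermediate_value_uIcc hc (show (0 : ℝ) ∈ _ by
      rw [Set.mem_uIcc]
      rcases le_total 0 η with h | h
      · left
        constructor <;> nlinarith
      · right
        constructor <;> nlinarith)
    exact ⟨ρ, h1, h2⟩
  have hρη : ρ * (ρ + η) ≤ 0 ∧ |ρ + η| ≤ |η| ∧ -(ρ + η) / 2 ≤ max 0 (-η / 2) := by
    rw [Set.mem_uIcc] at hρ
    rcases hρ with ⟨h1, h2⟩ | ⟨h1, h2⟩
    · refine ⟨by nlinarith, ?_, le_max_of_le_left (by linarith)⟩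
      rw [abs_of_nonneg (by linarith), abs_of_nonneg (by linarith)]
      linarith
    · refine ⟨by nlinarith, ?_, le_max_of_le_right (by linarith)⟩
      rw [abs_of_nonpos (by linarith), abs_of_nonpos (by linarith)]
      linarith
  obtain ⟨hs, hs2, hs3⟩ := hρη
  have hs4 : (ρ + η) ^ 2 ≤ η ^ 2 := sq_le_sq.2 hs2
  have hs5 : -(η ^ 2 / 4) ≤ ρ * (ρ + η) := by nlinarith [sq_nonneg (ρ + η / 2)]
  set Y := a ^ 2 + ρ * (ρ + η) - (ρ + η) ^ 2 / 4 with hY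
  have hY0 : 0 < Y := by nlinarith
  have hYa : Y ≤ a ^ 2 := by nlinarith [sq_nonneg (ρ + η)]
  refine ⟨-(ρ + η) / 2, √Y, ρ, Real.sqrt_pos.2 hY0, by ring, ?_, ?_, ?_, hs3, ?_⟩
  · rw [Real.sq_sqrt hY0.le, hY]
    ring
  · rw [Real.sq_sqrt hY0.le, hY]
    linear_combination hroot
  · rw [abs_div, abs_neg, abs_two]
    linarith
  · have h1 : √Y ≤ a := by rw [Real.sqrt_le_iff]; exact ⟨ha.le, hYa⟩
    rw [abs_sub_comm, abs_of_nonneg (by linarith)]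
    have h2 : a - |η| ≤ √Y := by
      apply Real.le_sqrt_of_sq_le
      have : |η| ^ 2 = η ^ 2 := sq_abs η
      nlinarith [abs_nonneg η]
    linarith

theorem cubic_root_factor {x y ρ η a b : ℝ} (h1 : ρ = -η - 2 * x)
    (h2 : x ^ 2 + y ^ 2 + 2 * x * ρ = a ^ 2) (h3 : (x ^ 2 + y ^ 2) * ρ = -(η * b)) (X : ℂ) :
    X ^ 3 + η * X ^ 2 + a ^ 2 * X + η * b =
      (X - (x + Complex.I * y)) * (X - (x - Complex.I * y)) * (X - ρ) := by
  have h1' : (ρ : ℂ) = -η - 2 * x := by exact_mod_cast congrArg Complex.ofReal h1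
  have h2' : (x : ℂ) ^ 2 + y ^ 2 + 2 * x * ρ = a ^ 2 := by exact_mod_cast congrArg Complex.ofReal h2
  have h3' : ((x : ℂ) ^ 2 + y ^ 2) * ρ = -(η * b) := by exact_mod_cast congrArg Complex.ofReal h3
  linear_combination X ^ 2 * h1' - X * h2' + h3' + ((y : ℂ) ^ 2 * (X - ρ)) * Complex.I_sq

/-! ### The eigenprojections -/

theorem waveCofactor_mul_sub {η a b μ : ℂ} {e : Matrix (Fin 4) (Fin 4) ℂ}
    (he : e ^ 4 + η • e ^ 3 + a ^ 2 • e ^ 2 + (η * b) • e = 0)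
    (hμ : μ ^ 3 + η * μ ^ 2 + a ^ 2 * μ + η * b = 0) :
    waveCofactor η a μ e * e = μ • waveCofactor η a μ e ∧
      e * waveCofactor η a μ e = μ • waveCofactor η a μ e := by
  have h : e ^ 4 + (μ + η) • e ^ 3 + (μ ^ 2 + η * μ + a ^ 2) • e ^ 2 =
      μ • waveCofactor η a μ e := by
    have : e ^ 4 + (μ + η) • e ^ 3 + (μ ^ 2 + η * μ + a ^ 2) • e ^ 2 - μ • waveCofactor η a μ e =
        (e ^ 4 + η • e ^ 3 + a ^ 2 • e ^ 2 + (η * b) • e) -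
          (μ ^ 3 + η * μ ^ 2 + a ^ 2 * μ + η * b) • e := by
      rw [waveCofactor]
      module
    rw [he, hμ, zero_smul, sub_zero] at this
    exact sub_eq_zero.1 this
  constructor
  · rw [← h, waveCofactor]
    simp only [add_mul, smul_mul_assoc, ← sq, ← pow_succ]
  · rw [← h, waveCofactor]
    simp only [mul_add, mul_smul_comm, ← sq, ← pow_succ']

/-- The value at `μ` of the cofactor of `X - μ`. -/
def waveCofactorAt (η a μ : ℂ) : ℂ :=
  μ ^ 3 + (μ + η) * μ ^ 2 + (μ ^ 2 + η * μ + a ^ 2) * μ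

theorem isEigenprojection_waveCofactor {η a b μ c w z : ℂ} {e B : Matrix (Fin 4) (Fin 4) ℂ}
    (he : e ^ 4 + η • e ^ 3 + a ^ 2 • e ^ 2 + (η * b) • e = 0)
    (hμ : μ ^ 3 + η * μ ^ 2 + a ^ 2 * μ + η * b = 0)
    (hB : B = c • e + w • 1) (hc : c ≠ 0) (hz : z = c * μ + w) (h0 : waveCofactorAt η a μ ≠ 0) :
    IsEigenprojection B z ((waveCofactorAt η a μ)⁻¹ • waveCofactor η a μ e) := by
  obtain ⟨hqe, heq⟩ := waveCofactor_mul_sub he hμ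
  set q := waveCofactor η a μ e with hq
  set k := waveCofactorAt η a μ with hk
  have hBz : ∀ v, B.mulVec v - z • v = c • (e.mulVec v - μ • v) := by
    intro v
    rw [hB, hz, Matrix.add_mulVec, Matrix.smul_mulVec, Matrix.smul_mulVec, Matrix.one_mulVec]
    module
  have hqv : ∀ v, e.mulVec v = μ • v → q.mulVec v = k • v := by
    intro v hv
    have h2 : (e ^ 2).mulVec v = μ ^ 2 • v := by
      rw [sq, ← Matrix.mulVec_mulVec, hv, Matrix.mulVec_smul, hv, smul_smul, sq]
    have h3 : (e ^ 3).mulVec v = μ ^ 3 • v := by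
      rw [pow_succ, ← Matrix.mulVec_mulVec, hv, Matrix.mulVec_smul, h2, smul_smul, ← pow_succ']
    rw [hq, waveCofactor, Matrix.add_mulVec, Matrix.add_mulVec, Matrix.smul_mulVec,
      Matrix.smul_mulVec, h3, h2, hv, hk, waveCofactorAt]
    module
  have heqv : ∀ v, e.mulVec (q.mulVec v) = μ • q.mulVec v := by
    intro v
    rw [Matrix.mulVec_mulVec, heq, Matrix.smul_mulVec]
  refine ⟨?_, fun v => ⟨fun hv => ?_, fun hv => ?_⟩, fun v => ⟨fun hv => ?_, ?_⟩⟩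
  · have hqq : q * q = k • q := by
      refine Matrix.ext_of_mulVec_single fun j => ?_
      rw [← Matrix.mulVec_mulVec, hqv _ (heqv _), Matrix.smul_mulVec]
    rw [smul_mul_smul_comm, hqq, smul_smul, mul_assoc, inv_mul_cancel₀ h0, mul_one]
  · rw [← sub_eq_zero, hBz]
    have : e.mulVec v = μ • v := by
      rw [← hv, Matrix.smul_mulVec, Matrix.mulVec_smul, heqv, smul_comm]
    rw [this, sub_self, smul_zero]
  · have h1 := hBz v
    rw [hv, sub_self, eq_comm, smul_eq_zero] at h1
    rw [Matrix.smul_mulVec, hqv v (sub_eq_zero.1 (h1.resolve_left hc)), smul_smul,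
      inv_mul_cancel₀ h0, one_smul]
  · rw [Matrix.smul_mulVec, smul_eq_zero] at hv
    have hv := hv.resolve_left (inv_ne_zero h0)
    refine ⟨(-(k * c)⁻¹) • (e ^ 2 + (2 * μ + η) • e + (3 * μ ^ 2 + 2 * η * μ + a ^ 2) • 1).mulVec v,
      ?_⟩
    have h5 : ∀ u, B.mulVec ((-(k * c)⁻¹) • u) - z • (-(k * c)⁻¹) • u =
        (-k⁻¹) • (e.mulVec u - μ • u) := by
      intro u
      rw [hBz, Matrix.mulVec_smul, smul_comm μ, ← smul_sub, smul_smul]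
      congr 1
      field_simp
    rw [h5, Matrix.mulVec_mulVec, ← Matrix.smul_mulVec, ← Matrix.sub_mulVec]
    have h6 : e * (e ^ 2 + (2 * μ + η) • e + (3 * μ ^ 2 + 2 * η * μ + a ^ 2) • 1) -
        μ • (e ^ 2 + (2 * μ + η) • e + (3 * μ ^ 2 + 2 * η * μ + a ^ 2) • 1) = q - k • 1 := by
      rw [hq, hk, waveCofactor, waveCofactorAt]
      simp only [mul_add, mul_smul_comm, mul_one, ← sq, ← pow_succ']
      module
    rw [h6, Matrix.sub_mulVec, hv, Matrix.smul_mulVec, Matrix.one_mulVec, zero_sub, smul_neg,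
      neg_smul, neg_neg, smul_smul, inv_mul_cancel₀ h0, one_smul]
  · rintro ⟨u, rfl⟩
    rw [hBz, Matrix.smul_mulVec, Matrix.mulVec_smul, Matrix.mulVec_sub, Matrix.mulVec_mulVec, hqe,
      Matrix.mulVec_smul, Matrix.smul_mulVec, sub_self, smul_zero, smul_zero]

theorem eigenprojection_eq {η a b μ c w z : ℂ} {e B : Matrix (Fin 4) (Fin 4) ℂ}
    (he : e ^ 4 + η • e ^ 3 + a ^ 2 • e ^ 2 + (η * b) • e = 0)
    (hμ : μ ^ 3 + η * μ ^ 2 + a ^ 2 * μ + η * b = 0)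
    (hB : B = c • e + w • 1) (hc : c ≠ 0) (hz : z = c * μ + w) (h0 : waveCofactorAt η a μ ≠ 0) :
    eigenprojection B z = (waveCofactorAt η a μ)⁻¹ • waveCofactor η a μ e := by
  have h : ∃ P, IsEigenprojection B z P := ⟨_, isEigenprojection_waveCofactor he hμ hB hc hz h0⟩
  rw [eigenprojection, dif_pos h, ← smul_eq_waveCofactor he hμ hB hc hz h.choose_spec, smul_smul]
  rw [← waveCofactorAt, inv_mul_cancel₀ h0, one_smul]

/-! ### Bounds for matrices -/

theorem norm_mul_apply_le {A B : Matrix (Fin 4) (Fin 4) ℂ} {p q : ℝ} (hp : 0 ≤ p)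
    (hA : ∀ i j, ‖A i j‖ ≤ p) (hB : ∀ i j, ‖B i j‖ ≤ q) (i j : Fin 4) :
    ‖(A * B) i j‖ ≤ 4 * (p * q) := by
  rw [Matrix.mul_apply]
  refine (norm_sum_le_of_le _ fun l _ => (norm_mul_le _ _).trans
    (mul_le_mul (hA i l) (hB l j) (norm_nonneg _) hp)).trans_eq ?_
  simp

theorem norm_toEuclideanLin_le {A : Matrix (Fin 4) (Fin 4) ℂ} {p : ℝ} (hp : 0 ≤ p)
    (hA : ∀ i j, ‖A i j‖ ≤ p) (v : Vec) :
    ‖Matrix.toEuclideanLin A v‖ ≤ 8 * p * ‖v‖ := by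
  have h1 : ∀ i, ‖Matrix.toEuclideanLin A v i‖ ≤ 4 * (p * ‖v‖) := by
    intro i
    have : Matrix.toEuclideanLin A v i = ∑ l, A i l * v l := rfl
    rw [this]
    refine (norm_sum_le_of_le _ fun l _ => (norm_mul_le _ _).trans
      (mul_le_mul (hA i l) (PiLp.norm_apply_le v l) (norm_nonneg _) hp)).trans_eq ?_
    simp
  rw [← sq_le_sq₀ (norm_nonneg _) (by positivity), EuclideanSpace.norm_sq_eq]
  calc ∑ i, ‖Matrix.toEuclideanLin A v i‖ ^ 2 ≤ ∑ _i : Fin 4, (4 * (p * ‖v‖)) ^ 2 :=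
        Finset.sum_le_sum fun i _ => pow_le_pow_left₀ (norm_nonneg _) (h1 i) 2
    _ = _ := by simp; ring

theorem norm_waveMatrix_le {φ η n₀ n₁ n₂ : ℝ} (hn : n₀ ^ 2 + n₁ ^ 2 + n₂ ^ 2 = 1) (hφ : 0 ≤ φ)
    (hη : |η| ≤ 1) (i j : Fin 4) : ‖waveMatrix φ η n₀ n₁ n₂ i j‖ ≤ 1 + φ := by
  have h0 : |n₀| ≤ 1 := abs_le_one_iff_mul_self_le_one.2 (by nlinarith)
  have h1 : |n₁| ≤ 1 := abs_le_one_iff_mul_self_le_one.2 (by nlinarith)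
  have h2 : |n₂| ≤ 1 := abs_le_one_iff_mul_self_le_one.2 (by nlinarith)
  have m : ∀ {x y : ℝ}, |x| ≤ 1 → |y| ≤ 1 → |x * y| ≤ 1 := fun hx hy => by
    rw [abs_mul]; exact mul_le_one₀ hx (abs_nonneg _) hy
  have m' : ∀ {x y : ℝ}, |x| ≤ 1 → |y| ≤ 1 → |x * y * φ| ≤ 1 + φ := fun hx hy => by
    rw [abs_mul, abs_of_nonneg hφ]
    have := m hx hy
    nlinarith
  have s0 : |1 - n₀ ^ 2| ≤ 1 := by rw [abs_le]; constructor <;> nlinarith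
  have s1 : |n₁ ^ 2 - 1| ≤ 1 := by rw [abs_le]; constructor <;> nlinarith
  have s2 : |n₂ ^ 2 * φ - φ| ≤ 1 + φ := by rw [abs_le]; constructor <;> nlinarith [sq_nonneg n₂]
  have s3 : |φ| ≤ 1 + φ := by rw [abs_of_nonneg hφ]; linarith
  have l : ∀ {x : ℝ}, |x| ≤ 1 → |x| ≤ 1 + φ := fun h => h.trans (by linarith)
  have key : waveMatrix φ η n₀ n₁ n₂ =
    (!![n₀ * n₁, 1 - n₀ ^ 2, 0, n₀ * n₂ * φ;
     n₁ ^ 2 - 1, -(n₁ * n₀), 0, n₁ * n₂ * φ;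
     n₂ * n₁, -(n₂ * n₀), 0, n₂ ^ 2 * φ - φ;
     0, 0, φ, -η] : Matrix (Fin 4) (Fin 4) ℝ).map Complex.ofReal := by
    ext i j
    fin_cases i <;> fin_cases j <;> simp [waveMatrix]
  rw [key, Matrix.map_apply, Complex.norm_real, Real.norm_eq_abs]
  have z : |(0 : ℝ)| ≤ 1 + φ := by simp; linarith
  fin_cases i <;> fin_cases j
  exacts [l (m h0 h1), l s0, z, m' h0 h2, l s1, l ((abs_neg _).trans_le (m h1 h0)), z, m' h1 h2,
    l (m h2 h1), l ((abs_neg _).trans_le (m h2 h0)), z, s2, z, z, s3, l ((abs_neg _).trans_le hη)]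

/-! ### The spectrum of `𝔹(ξ, ε)` -/

/-- `ε (ν' - ν)|ξ|²`. -/
def viscosityGap (ν ν' ε : ℝ) (ξ : Space) : ℝ := ε * (ν' - ν) * ‖ξ‖ ^ 2

/-- `ε (𝔹(ξ, ε) + ν|ξ|²)`. -/
def scaledSymbol (F ν ν' ε : ℝ) (ξ : Space) : Matrix (Fin 4) (Fin 4) ℂ :=
  waveMatrix (F⁻¹ : ℝ) (viscosityGap ν ν' ε ξ : ℝ) (ξ 0 / ‖ξ‖ : ℝ) (ξ 1 / ‖ξ‖ : ℝ) (ξ 2 / ‖ξ‖ : ℝ)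

theorem symbolB_eq (F ν ν' : ℝ) {ε : ℝ} (hε : ε ≠ 0) {ξ : Space} (hξ : ξ ≠ 0) :
    symbolB F ν ν' ε ξ = ((ε⁻¹ : ℝ) : ℂ) • scaledSymbol F ν ν' ε ξ +
      ((-(ν * ‖ξ‖ ^ 2) : ℝ) : ℂ) • (1 : Matrix (Fin 4) (Fin 4) ℂ) := by
  have hk : (‖ξ‖ : ℂ) ≠ 0 := by exact_mod_cast norm_ne_zero_iff.2 hξ
  have hε' : (ε : ℂ) ≠ 0 := by exact_mod_cast hε
  have key : scaledSymbol F ν ν' ε ξ + ((ε * ν * ‖ξ‖ ^ 2 : ℝ) : ℂ) • (-1) =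
      (ε : ℂ) • symbolB F ν ν' ε ξ := by
    ext i j
    fin_cases i <;> fin_cases j <;>
    simp [symbolB, scaledSymbol, waveMatrix, viscosityGap, leraySymbol, rotStratMatrix,
      Matrix.mul_apply, Fin.sum_univ_four, Matrix.one_apply] <;>
    field_simp <;> ring
  have h2 := congrArg (fun N => ((ε⁻¹ : ℝ) : ℂ) • N) key
  simp only [smul_smul, smul_add] at h2
  rw [show ((ε⁻¹ : ℝ) : ℂ) * ε = 1 by push_cast; field_simp, one_smul] at h2
  rw [← h2]
  congr 1
  rw [smul_neg, ← neg_smul]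
  congr 1
  push_cast
  field_simp

theorem direction_sq {ξ : Space} (hξ : ξ ≠ 0) :
    (ξ 0 / ‖ξ‖) ^ 2 + (ξ 1 / ‖ξ‖) ^ 2 + (ξ 2 / ‖ξ‖) ^ 2 = 1 := by
  have hk : ‖ξ‖ ≠ 0 := norm_ne_zero_iff.2 hξ
  rw [div_pow, div_pow, div_pow, ← add_div, ← add_div, ← norm_sq_space, div_self (by positivity)]

theorem direction_sq_complex {ξ : Space} (hξ : ξ ≠ 0) :
    ((ξ 0 / ‖ξ‖ : ℝ) : ℂ) ^ 2 + ((ξ 1 / ‖ξ‖ : ℝ) : ℂ) ^ 2 + ((ξ 2 / ‖ξ‖ : ℝ) : ℂ) ^ 2 = 1 := by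
  rw [← Complex.ofReal_pow, ← Complex.ofReal_pow, ← Complex.ofReal_pow, ← Complex.ofReal_add,
    ← Complex.ofReal_add, direction_sq hξ, Complex.ofReal_one]

theorem wavePhase_sq (F : ℝ) {ξ : Space} (hξ : ξ ≠ 0) :
    wavePhase F ξ ^ 2 = (ξ 2 / ‖ξ‖) ^ 2 + (1 - (ξ 2 / ‖ξ‖) ^ 2) * F⁻¹ ^ 2 := by
  have hk : ‖ξ‖ ≠ 0 := norm_ne_zero_iff.2 hξ
  rw [wavePhase, Real.sq_sqrt (by positivity)]
  have h := direction_sq hξ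
  have h1 : 1 - (ξ 2 / ‖ξ‖) ^ 2 = (ξ 0 / ‖ξ‖) ^ 2 + (ξ 1 / ‖ξ‖) ^ 2 := by linarith
  rw [h1]
  field_simp

theorem wavePhase_bounds {F : ℝ} (hF : 0 < F) {ξ : Space} (hξ : ξ ≠ 0) :
    min 1 F⁻¹ ≤ wavePhase F ξ ∧ wavePhase F ξ ≤ 1 + F⁻¹ ∧ (ξ 2 / ‖ξ‖) ^ 2 ≤ wavePhase F ξ ^ 2 := by
  have h := wavePhase_sq F hξ
  have h1 := direction_sq hξ
  have hF' : 0 < F⁻¹ := inv_pos.2 hF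
  have hw : 0 ≤ wavePhase F ξ := Real.sqrt_nonneg _
  have hb : 0 ≤ 1 - (ξ 2 / ‖ξ‖) ^ 2 := by nlinarith
  set b := (ξ 2 / ‖ξ‖) ^ 2 with hbdef
  have hb0 : 0 ≤ b := by positivity
  refine ⟨?_, ?_, by rw [h]; nlinarith [mul_nonneg hb (sq_nonneg F⁻¹)]⟩
  · refine (sq_le_sq₀ (by positivity) hw).1 ?_
    rw [h]
    have hm0 : 0 < min 1 F⁻¹ := lt_min one_pos hF'
    have hm1 : min 1 F⁻¹ ^ 2 ≤ 1 := by
      have := pow_le_pow_left₀ hm0.le (min_le_left 1 F⁻¹) 2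
      simpa using this
    have hm2 : min 1 F⁻¹ ^ 2 ≤ F⁻¹ ^ 2 := pow_le_pow_left₀ hm0.le (min_le_right 1 F⁻¹) 2
    nlinarith
  · refine (sq_le_sq₀ hw (by positivity)).1 ?_
    rw [h]
    nlinarith [mul_nonneg hb0 (sq_nonneg F⁻¹)]

theorem scaledSymbol_annihilates (F ν ν' ε : ℝ) {ξ : Space} (hξ : ξ ≠ 0) :
    scaledSymbol F ν ν' ε ξ ^ 4 + (viscosityGap ν ν' ε ξ : ℂ) • scaledSymbol F ν ν' ε ξ ^ 3 +
      (wavePhase F ξ : ℂ) ^ 2 • scaledSymbol F ν ν' ε ξ ^ 2 +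
      ((viscosityGap ν ν' ε ξ : ℂ) * ((ξ 2 / ‖ξ‖) ^ 2 : ℝ)) • scaledSymbol F ν ν' ε ξ = 0 := by
  have h := waveMatrix_annihilates (φ := (F⁻¹ : ℝ)) (η := (viscosityGap ν ν' ε ξ : ℝ))
    (n₀ := (ξ 0 / ‖ξ‖ : ℝ)) (n₁ := (ξ 1 / ‖ξ‖ : ℝ)) (n₂ := (ξ 2 / ‖ξ‖ : ℝ))
    (direction_sq_complex hξ)
  have h2 : (wavePhase F ξ : ℂ) ^ 2 = ((ξ 2 / ‖ξ‖ : ℝ) : ℂ) ^ 2 +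
      (1 - ((ξ 2 / ‖ξ‖ : ℝ) : ℂ) ^ 2) * ((F⁻¹ : ℝ) : ℂ) ^ 2 := by
    exact_mod_cast wavePhase_sq F hξ
  rw [h2, Complex.ofReal_pow]
  exact h

theorem hasEigenvalue_symbolB (F ν ν' : ℝ) {ε : ℝ} (hε : ε ≠ 0) {ξ : Space} (hξ : ξ ≠ 0) (μ : ℂ) :
    Module.End.HasEigenvalue (Matrix.toLin' (symbolB F ν ν' ε ξ))
      (((ε⁻¹ : ℝ) : ℂ) * μ + ((-(ν * ‖ξ‖ ^ 2) : ℝ) : ℂ)) ↔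
    μ * (μ ^ 3 + (viscosityGap ν ν' ε ξ : ℂ) * μ ^ 2 + (wavePhase F ξ : ℂ) ^ 2 * μ +
      (viscosityGap ν ν' ε ξ : ℂ) * ((ξ 2 / ‖ξ‖) ^ 2 : ℝ)) = 0 := by
  have h2 : (wavePhase F ξ : ℂ) ^ 2 = ((ξ 2 / ‖ξ‖ : ℝ) : ℂ) ^ 2 +
      (1 - ((ξ 2 / ‖ξ‖ : ℝ) : ℂ) ^ 2) * ((F⁻¹ : ℝ) : ℂ) ^ 2 := by
    exact_mod_cast wavePhase_sq F hξ
  have h := det_scalar_sub_waveMatrix (φ := (F⁻¹ : ℝ)) (η := (viscosityGap ν ν' ε ξ : ℝ))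
    (n₀ := (ξ 0 / ‖ξ‖ : ℝ)) (n₁ := (ξ 1 / ‖ξ‖ : ℝ)) (n₂ := (ξ 2 / ‖ξ‖ : ℝ))
    (direction_sq_complex hξ) μ
  rw [← h2] at h
  rw [Complex.ofReal_pow (ξ 2 / ‖ξ‖), ← h, ← Matrix.exists_mulVec_eq_zero_iff]
  have hε' : ((ε⁻¹ : ℝ) : ℂ) ≠ 0 := by exact_mod_cast inv_ne_zero hε
  have key : ∀ v : Fin 4 → ℂ, Matrix.toLin' (symbolB F ν ν' ε ξ) v =
      (((ε⁻¹ : ℝ) : ℂ) * μ + ((-(ν * ‖ξ‖ ^ 2) : ℝ) : ℂ)) • v ↔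
      (Matrix.scalar (Fin 4) μ - scaledSymbol F ν ν' ε ξ).mulVec v = 0 := by
    intro v
    rw [Matrix.toLin'_apply, symbolB_eq F ν ν' hε hξ, Matrix.add_mulVec, Matrix.smul_mulVec,
      Matrix.smul_mulVec, Matrix.one_mulVec, add_smul, add_left_inj, mul_smul,
      (smul_right_injective _ hε').eq_iff, Matrix.sub_mulVec, sub_eq_zero, eq_comm,
      Matrix.scalar_apply, ← Matrix.smul_one_eq_diagonal, Matrix.smul_mulVec, Matrix.one_mulVec]
  constructor
  · intro hev
    obtain ⟨v, hv⟩ := hev.exists_hasEigenvector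
    exact ⟨v, hv.2, (key v).1 (Module.End.mem_eigenspace_iff.1 hv.1)⟩
  · rintro ⟨v, hv0, hv⟩
    exact Module.End.hasEigenvalue_of_hasEigenvector
      ⟨Module.End.mem_eigenspace_iff.2 ((key v).2 hv), hv0⟩

/-- The frequencies where the viscosity is a small perturbation of the waves. -/
def waveRegime (F ν ν' ε : ℝ) : Set Space :=
  {ξ | ξ ≠ 0 ∧ |viscosityGap ν ν' ε ξ| ≤ min 1 F⁻¹ / 10}

theorem measurable_viscosityGap (ν ν' ε : ℝ) : Measurable (viscosityGap ν ν' ε) := by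
  unfold viscosityGap
  fun_prop

theorem measurableSet_waveRegime (F ν ν' ε : ℝ) : MeasurableSet (waveRegime F ν ν' ε) := by
  have h := measurable_viscosityGap ν ν' ε
  exact (measurableSet_singleton (0 : Space)).compl.inter
    (measurableSet_le (continuous_abs.measurable.comp h) measurable_const)

/-- `ε (λ(ξ, ε) + ν|ξ|²)`. -/
def scaledLam (F ν ν' ε : ℝ) (ξ : Space) : ℂ := ε * (lam F ν ν' ε ξ + (ν * ‖ξ‖ ^ 2 : ℝ))

theorem lam_eq (F ν ν' : ℝ) {ε : ℝ} (hε : ε ≠ 0) (ξ : Space) :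
    lam F ν ν' ε ξ = ((ε⁻¹ : ℝ) : ℂ) * scaledLam F ν ν' ε ξ + ((-(ν * ‖ξ‖ ^ 2) : ℝ) : ℂ) := by
  have : (ε : ℂ) ≠ 0 := by exact_mod_cast hε
  rw [scaledLam]
  push_cast
  field_simp
  ring

theorem scaledLam_spec {F ν ν' ε : ℝ} (hF : 0 < F) (hε : 0 < ε) {ξ : Space}
    (hξ : ξ ∈ waveRegime F ν ν' ε) :
    ∃ x y ρ : ℝ, scaledLam F ν ν' ε ξ = x + Complex.I * y ∧
      0 < y ∧ ρ = -viscosityGap ν ν' ε ξ - 2 * x ∧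
      x ^ 2 + y ^ 2 + 2 * x * ρ = wavePhase F ξ ^ 2 ∧
      (x ^ 2 + y ^ 2) * ρ = -(viscosityGap ν ν' ε ξ * (ξ 2 / ‖ξ‖) ^ 2) ∧
      |x| ≤ |viscosityGap ν ν' ε ξ| / 2 ∧ x ≤ max 0 (-viscosityGap ν ν' ε ξ / 2) ∧
      |y - wavePhase F ξ| ≤ |viscosityGap ν ν' ε ξ| := by
  obtain ⟨hξ0, hη⟩ := hξ
  obtain ⟨hw1, hw2, hw3⟩ := wavePhase_bounds hF hξ0
  have hm : 0 < min 1 F⁻¹ := lt_min one_pos (inv_pos.2 hF)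
  obtain ⟨x, y, ρ, hy, hρ, h1, h2, h3⟩ := exists_cubic_root (hm.trans_le hw1) (by positivity) hw3
    (hη.trans (by linarith))
  refine ⟨x, y, ρ, ?_, hy, hρ, h1, h2, h3⟩
  have hfac := cubic_root_factor hρ h1 h2
  have hex : ∃ z : ℂ, 0 < z.im ∧
      Module.End.HasEigenvalue (Matrix.toLin' (symbolB F ν ν' ε ξ)) z := by
    refine ⟨((ε⁻¹ : ℝ) : ℂ) * (x + Complex.I * y) + ((-(ν * ‖ξ‖ ^ 2) : ℝ) : ℂ), ?_, ?_⟩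
    · rw [Complex.add_im, Complex.im_ofReal_mul, Complex.ofReal_im, add_zero]
      have : ((x : ℂ) + Complex.I * y).im = y := by simp
      rw [this]
      positivity
    · rw [hasEigenvalue_symbolB F ν ν' hε.ne' hξ0, hfac, sub_self, zero_mul, zero_mul, mul_zero]
  have hlam : lam F ν ν' ε ξ = hex.choose := by
    rw [lam, upperEigenvalue, dif_pos hex]
  obtain ⟨him, hev⟩ := hex.choose_spec
  rw [← hlam] at him hev
  have him' : 0 < (scaledLam F ν ν' ε ξ).im := by
    rw [scaledLam, Complex.im_ofReal_mul, Complex.add_im, Complex.ofReal_im, add_zero]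
    positivity
  rw [lam_eq F ν ν' hε.ne', hasEigenvalue_symbolB F ν ν' hε.ne' hξ0, hfac] at hev
  have n1 : scaledLam F ν ν' ε ξ ≠ 0 := fun h => by rw [h] at him'; simp at him'
  have n2 : scaledLam F ν ν' ε ξ - (x - Complex.I * y) ≠ 0 := fun h => by
    have := congrArg Complex.im h
    simp at this
    linarith
  have n3 : scaledLam F ν ν' ε ξ - ρ ≠ 0 := fun h => by
    have := congrArg Complex.im h
    simp at this
    linarith
  simpa [n1, n2, n3, sub_eq_zero] using hev

/-- The map sending the roots `μ, μ̄, ρ` of a real cubic to its coefficients. -/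
def cubicCoeffs (w : ℂ × ℝ) : ℝ × ℝ × ℝ :=
  (-(2 * w.1.re + w.2), w.1.re ^ 2 + w.1.im ^ 2 + 2 * w.1.re * w.2,
    -((w.1.re ^ 2 + w.1.im ^ 2) * w.2))

theorem injOn_cubicCoeffs : Set.InjOn cubicCoeffs {w | 0 < w.1.im} := by
  rintro ⟨μ, ρ⟩ h ⟨μ', ρ'⟩ h' heq
  have h : 0 < μ.im := h
  have h' : 0 < μ'.im := h'
  simp only [cubicCoeffs, Prod.mk.injEq] at heq
  obtain ⟨h1, h2, h3⟩ := heq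
  have k1 : ((-(2 * μ.re + ρ) : ℝ) : ℂ) = (-(2 * μ'.re + ρ') : ℝ) := by rw [h1]
  have k2 : ((μ.re ^ 2 + μ.im ^ 2 + 2 * μ.re * ρ : ℝ) : ℂ) =
    (μ'.re ^ 2 + μ'.im ^ 2 + 2 * μ'.re * ρ' : ℝ) := by rw [h2]
  have k3 : ((-((μ.re ^ 2 + μ.im ^ 2) * ρ) : ℝ) : ℂ) = (-((μ'.re ^ 2 + μ'.im ^ 2) * ρ') : ℝ) := by
    rw [h3]
  push_cast at k1 k2 k3
  have hμ : (μ' - (μ.re + Complex.I * μ.im)) * (μ' - (μ.re - Complex.I * μ.im)) * (μ' - ρ) = 0 := by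
    have e : μ' = μ'.re + Complex.I * μ'.im := by
      conv_lhs => rw [← Complex.re_add_im μ', mul_comm]
    have e2 : (μ' - (μ'.re + Complex.I * μ'.im)) = 0 := sub_eq_zero.2 e
    linear_combination μ' ^ 2 * k1 + μ' * k2 + k3 +
      (μ' - (μ'.re - Complex.I * μ'.im)) * (μ' - ρ') * e2 +
      (μ'.im ^ 2 * (μ' - ρ') - μ.im ^ 2 * (μ' - ρ)) * Complex.I_sq
  have n2 : μ' - (μ.re - Complex.I * μ.im) ≠ 0 := fun h0 => by
    have := congrArg Complex.im h0
    simp at this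
    linarith
  have n3 : μ' - ρ ≠ 0 := fun h0 => by
    have := congrArg Complex.im h0
    simp at this
    linarith
  have e : μ' = μ := by
    have : μ' - (μ.re + Complex.I * μ.im) = 0 := by simpa [n2, n3] using hμ
    rw [sub_eq_zero.1 this, mul_comm, Complex.re_add_im]
  subst e
  rw [show ρ = ρ' by linarith]

theorem measurable_scaledLam {F ν ν' ε : ℝ} (hF : 0 < F) (hε : 0 < ε) :
    Measurable ((waveRegime F ν ν' ε).indicator (scaledLam F ν ν' ε)) := by
  classical
  set S := waveRegime F ν ν' ε with hS
  have hSm : MeasurableSet S := measurableSet_waveRegime F ν ν' ε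
  set U : Set (ℂ × ℝ) := {w | 0 < w.1.im} with hU
  have hUm : MeasurableSet U :=
    measurableSet_lt measurable_const (Complex.measurable_im.comp measurable_fst)
  have hcont : Continuous cubicCoeffs := by
    have := Complex.continuous_re
    have := Complex.continuous_im
    unfold cubicCoeffs
    fun_prop
  have hemb := hcont.continuousOn.measurableEmbedding hUm injOn_cubicCoeffs
  have hmem : ∀ ξ ∈ S, (scaledLam F ν ν' ε ξ,
      -viscosityGap ν ν' ε ξ - 2 * (scaledLam F ν ν' ε ξ).re) ∈ U := by
    intro ξ hξ
    obtain ⟨x, y, ρ, h, hy, -⟩ := scaledLam_spec hF hε hξ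
    change 0 < (scaledLam F ν ν' ε ξ).im
    rw [h]
    simpa using hy
  let g : Space → U := fun ξ => if h : ξ ∈ S then ⟨_, hmem ξ h⟩ else
    ⟨(Complex.I, 0), by simp [hU]⟩
  have hcoef : (U.domRestrict cubicCoeffs) ∘ g = S.piecewise
      (fun ξ => (viscosityGap ν ν' ε ξ, wavePhase F ξ ^ 2,
        viscosityGap ν ν' ε ξ * (ξ 2 / ‖ξ‖) ^ 2)) fun _ => cubicCoeffs (Complex.I, 0) := by
    ext1 ξ
    by_cases hξ : ξ ∈ S
    · obtain ⟨x, y, ρ, h, hy, hρ, h1, h2, -⟩ := scaledLam_spec hF hε hξ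
      have hre : (scaledLam F ν ν' ε ξ).re = x := by rw [h]; simp
      have him : (scaledLam F ν ν' ε ξ).im = y := by rw [h]; simp
      rw [Set.piecewise_eq_of_mem _ _ _ hξ]
      simp only [g, Function.comp, dif_pos hξ, Set.domRestrict_apply, cubicCoeffs, hre, him, ← hρ,
        h1, h2, neg_neg, Prod.mk.injEq, and_true]
      rw [hρ]
      ring
    · rw [Set.piecewise_eq_of_notMem _ _ _ hξ]
      simp only [g, Function.comp, dif_neg hξ, Set.domRestrict_apply]
  have hg : Measurable g := by
    rw [← hemb.measurable_comp_iff, hcoef]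
    have h1 := measurable_viscosityGap ν ν' ε
    have h2 := measurable_wavePhase F
    exact Measurable.piecewise hSm (by fun_prop) measurable_const
  have hfin : S.indicator (scaledLam F ν ν' ε) = S.indicator fun ξ => ((g ξ : ℂ × ℝ)).1 := by
    refine Set.indicator_congr fun ξ hξ => ?_
    simp only [g, dif_pos hξ]
  rw [hfin]
  exact (measurable_fst.comp (measurable_subtype_coe.comp hg)).indicator hSm

/-! ### Uniform bounds for the eigenprojections -/

theorem waveCofactorAt_lower {η a x t : ℝ} (ha : 0 < a) (hη : |η| ≤ a / 10) (hx : |x| ≤ |η| / 2)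
    (ht : |(|t| - a)| ≤ |η|) : a ^ 3 / 2 ≤ ‖waveCofactorAt η a (x + Complex.I * t)‖ := by
  set μ : ℂ := x + Complex.I * t with hμ
  have h1 : 9 / 10 * a ≤ |t| := by
    have := (abs_le.1 ht).1
    linarith
  have hfac : waveCofactorAt η a μ = μ * (3 * μ ^ 2 + 2 * η * μ + a ^ 2) := by
    rw [waveCofactorAt]
    ring
  have hre : (3 * μ ^ 2 + 2 * η * μ + a ^ 2).re = 3 * (x ^ 2 - t ^ 2) + 2 * η * x + a ^ 2 := by
    rw [hμ]
    simp [pow_two]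
  have him : μ.im = t := by rw [hμ]; simp
  have hη2 : η ^ 2 ≤ a ^ 2 / 100 := by
    have := pow_le_pow_left₀ (abs_nonneg η) hη 2
    rw [sq_abs] at this
    linarith
  have hx2 : x ^ 2 ≤ η ^ 2 / 4 := by
    have := pow_le_pow_left₀ (abs_nonneg x) hx 2
    rw [sq_abs, div_pow, sq_abs] at this
    linarith
  have hηx : 2 * η * x ≤ η ^ 2 + x ^ 2 := by nlinarith [sq_nonneg (η - x)]
  have ht2 : 81 / 100 * a ^ 2 ≤ t ^ 2 := by
    have := pow_le_pow_left₀ (by positivity) h1 2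
    rw [sq_abs] at this
    linarith
  have k1 : a ^ 2 ≤ ‖3 * μ ^ 2 + 2 * η * μ + a ^ 2‖ := by
    refine le_trans ?_ (Complex.abs_re_le_norm _)
    rw [hre, abs_of_nonpos (by nlinarith)]
    nlinarith
  have k2 : a / 2 ≤ ‖μ‖ := by
    refine le_trans ?_ (Complex.abs_im_le_norm _)
    rw [him]
    linarith
  rw [hfac, norm_mul]
  calc a ^ 3 / 2 = a / 2 * a ^ 2 := by ring
    _ ≤ _ := by gcongr

theorem norm_waveCofactor_le {η a m : ℝ} {μ : ℂ} {e : Matrix (Fin 4) (Fin 4) ℂ} (hm : 0 ≤ m)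
    (he : ∀ i j, ‖e i j‖ ≤ m) (hη : |η| ≤ m) (ha : |a| ≤ m) (hμ : ‖μ‖ ≤ 2 * m) (i j : Fin 4) :
    ‖waveCofactor η a μ e i j‖ ≤ 35 * m ^ 3 := by
  have h2 : ∀ i j, ‖(e ^ 2) i j‖ ≤ 4 * (m * m) := by
    rw [sq]
    exact norm_mul_apply_le hm he he
  have h3 : ∀ i j, ‖(e ^ 3) i j‖ ≤ 4 * (4 * (m * m) * m) := by
    rw [pow_succ]
    exact norm_mul_apply_le (by positivity) h2 he
  have c0 : ‖(η : ℂ)‖ ≤ m := by rwa [Complex.norm_real]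
  have c0' : ‖(a : ℂ)‖ ≤ m := by rwa [Complex.norm_real]
  have c1 : ‖μ + η‖ ≤ 3 * m := (norm_add_le _ _).trans (by linarith)
  have c2 : ‖μ ^ 2 + η * μ + a ^ 2‖ ≤ 7 * m ^ 2 := by
    refine (norm_add₃_le).trans ?_
    rw [norm_pow, norm_mul, norm_pow]
    calc ‖μ‖ ^ 2 + ‖(η : ℂ)‖ * ‖μ‖ + ‖(a : ℂ)‖ ^ 2 ≤ (2 * m) ^ 2 + m * (2 * m) + m ^ 2 := by gcongr
      _ = _ := by ring
  rw [waveCofactor, Matrix.add_apply, Matrix.add_apply, Matrix.smul_apply, Matrix.smul_apply]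
  refine (norm_add₃_le).trans ?_
  rw [norm_smul, norm_smul]
  calc ‖(e ^ 3) i j‖ + ‖μ + η‖ * ‖(e ^ 2) i j‖ + ‖μ ^ 2 + η * μ + a ^ 2‖ * ‖e i j‖
      ≤ 4 * (4 * (m * m) * m) + 3 * m * (4 * (m * m)) + 7 * m ^ 2 * m := by
        gcongr
        exacts [h3 i j, h2 i j, he i j]
    _ = _ := by ring

theorem measurable_mul_apply {X : Type*} [MeasurableSpace X]
    {A B : X → Matrix (Fin 4) (Fin 4) ℂ} (hA : ∀ i j, Measurable fun ξ => A ξ i j)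
    (hB : ∀ i j, Measurable fun ξ => B ξ i j) (i j : Fin 4) :
    Measurable fun ξ => (A ξ * B ξ) i j := by
  simp only [Matrix.mul_apply]
  exact Finset.measurable_sum _ fun l _ => (hA i l).mul (hB l j)

theorem measurable_scaledSymbol (F ν ν' ε : ℝ) (i j : Fin 4) :
    Measurable fun ξ => scaledSymbol F ν ν' ε ξ i j := by
  have h := measurable_viscosityGap ν ν' ε
  have hn : ∀ l : Fin 3, Measurable fun ξ : Space => ((ξ l / ‖ξ‖ : ℝ) : ℂ) := fun l =>
    Complex.measurable_ofReal.comp (by fun_prop)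
  have h0 := hn 0
  have h1 := hn 1
  have h2 := hn 2
  have h3 : Measurable fun ξ => ((viscosityGap ν ν' ε ξ : ℝ) : ℂ) := Complex.measurable_ofReal.comp h
  unfold scaledSymbol waveMatrix
  fin_cases i <;> fin_cases j <;> simp <;> fun_prop

theorem measurable_waveCofactor {X : Type*} [MeasurableSpace X] {η a μ : X → ℂ}
    {e : X → Matrix (Fin 4) (Fin 4) ℂ} (hη : Measurable η) (ha : Measurable a) (hμ : Measurable μ)
    (h1 : ∀ i j, Measurable fun ξ => e ξ i j) (i j : Fin 4) :
    Measurable fun ξ => waveCofactor (η ξ) (a ξ) (μ ξ) (e ξ) i j := by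
  have h2 : ∀ i j, Measurable fun ξ => (e ξ ^ 2) i j := by
    intro i j
    simp only [sq]
    exact measurable_mul_apply (A := e) (B := e) h1 h1 i j
  have h3 : ∀ i j, Measurable fun ξ => (e ξ ^ 3) i j := by
    intro i j
    have h := measurable_mul_apply (A := fun ξ => e ξ ^ 2) (B := e) h2 h1 i j
    simp only [← pow_succ] at h
    exact h
  have h1 := h1 i j
  have h2 := h2 i j
  have h3 := h3 i j
  simp only [waveCofactor, Matrix.add_apply, Matrix.smul_apply, smul_eq_mul]
  exact (h3.add ((hμ.add hη).mul h2)).add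
    ((((hμ.pow_const 2).add (hη.mul hμ)).add (ha.pow_const 2)).mul h1)

/-- A bound for the norms of the eigenprojections. -/
def projConst (F : ℝ) : ℝ := 8 * (70 * ((1 + F⁻¹) / min 1 F⁻¹) ^ 3)

theorem projConst_pos {F : ℝ} (hF : 0 < F) : 0 < projConst F := by
  have hm : 0 < min 1 F⁻¹ := lt_min one_pos (inv_pos.2 hF)
  have : 0 < F⁻¹ := inv_pos.2 hF
  rw [projConst]
  positivity

theorem exists_eigenprojection_data {F ν ν' ε s : ℝ} (hF : 0 < F) (hν : 0 < ν) (hν' : 0 < ν')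
    (hε : 0 < ε) (hs : s = 1 ∨ s = -1) :
    ∃ (z : Space → ℂ) (Q : Space → Matrix (Fin 4) (Fin 4) ℂ), Measurable z ∧
      (∀ i j, Measurable fun ξ => Q ξ i j) ∧
      (∀ ξ v, ‖Matrix.toEuclideanLin (Q ξ) v‖ ≤ projConst F * ‖v‖) ∧
      ∀ ξ ∈ waveRegime F ν ν' ε,
        z ξ = (lam F ν ν' ε ξ).re + Complex.I * (s * (lam F ν ν' ε ξ).im : ℝ) ∧
        Q ξ = eigenprojection (symbolB F ν ν' ε ξ) (z ξ) ∧
        Q ξ * symbolB F ν ν' ε ξ = z ξ • Q ξ ∧ (z ξ).re ≤ -(min ν ν' * ‖ξ‖ ^ 2) ∧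
        ‖z ξ - Complex.I * (s * ε⁻¹ * wavePhase F ξ : ℝ)‖ ≤ 3 * (ν + ν') * ‖ξ‖ ^ 2 := by
  set S := waveRegime F ν ν' ε with hS
  have hSm : MeasurableSet S := measurableSet_waveRegime F ν ν' ε
  set m0 : Space → ℂ := S.indicator (scaledLam F ν ν' ε) with hm0
  have hm0m : Measurable m0 := measurable_scaledLam hF hε
  set μ : Space → ℂ := fun ξ => (m0 ξ).re + Complex.I * (s * (m0 ξ).im : ℝ) with hμdef
  have hμm : Measurable μ := by
    have h1 := Complex.measurable_re.comp hm0m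
    have h2 := Complex.measurable_im.comp hm0m
    exact (Complex.measurable_ofReal.comp h1).add
      ((Complex.measurable_ofReal.comp (h2.const_mul s)).const_mul _)
  set q : Space → ℂ := fun ξ => waveCofactorAt (viscosityGap ν ν' ε ξ) (wavePhase F ξ) (μ ξ) with hq
  set W : Space → Matrix (Fin 4) (Fin 4) ℂ := fun ξ =>
    waveCofactor (viscosityGap ν ν' ε ξ) (wavePhase F ξ) (μ ξ) (scaledSymbol F ν ν' ε ξ) with hW
  have hηm : Measurable fun ξ => (viscosityGap ν ν' ε ξ : ℂ) :=
    Complex.measurable_ofReal.comp (measurable_viscosityGap ν ν' ε)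
  have ham : Measurable fun ξ => (wavePhase F ξ : ℂ) :=
    Complex.measurable_ofReal.comp (measurable_wavePhase F)
  have hqm : Measurable q := by
    simp only [hq, waveCofactorAt]
    fun_prop
  have hWm : ∀ i j, Measurable fun ξ => W ξ i j :=
    measurable_waveCofactor hηm ham hμm (measurable_scaledSymbol F ν ν' ε)
  set z : Space → ℂ := fun ξ => ((ε⁻¹ : ℝ) : ℂ) * μ ξ + ((-(ν * ‖ξ‖ ^ 2) : ℝ) : ℂ) with hz
  set Q : Space → Matrix (Fin 4) (Fin 4) ℂ := fun ξ i j => S.indicator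
    (fun ξ => (q ξ)⁻¹ * W ξ i j) ξ with hQ
  have hQin : ∀ ξ ∈ S, Q ξ = (q ξ)⁻¹ • W ξ := by
    intro ξ hξ
    ext i j
    simp only [hQ, Set.indicator_of_mem hξ, Matrix.smul_apply, smul_eq_mul]
  have hQout : ∀ ξ ∉ S, Q ξ = 0 := by
    intro ξ hξ
    ext i j
    simp only [hQ, Set.indicator_of_notMem hξ, Matrix.zero_apply]
  have hzm : Measurable z :=
    (hμm.const_mul _).add (Complex.measurable_ofReal.comp (by fun_prop))
  have hm : 0 < min 1 F⁻¹ := lt_min one_pos (inv_pos.2 hF)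
  have hF' : 0 < F⁻¹ := inv_pos.2 hF
  have hss : s * s = 1 := by rcases hs with rfl | rfl <;> norm_num
  have hsabs : |s| = 1 := by rcases hs with rfl | rfl <;> simp
  have hcore : ∀ ξ ∈ S, ∃ x y : ℝ, scaledLam F ν ν' ε ξ = x + Complex.I * y ∧
      μ ξ = x + Complex.I * (s * y : ℝ) ∧ 0 < y ∧
      μ ξ ^ 3 + viscosityGap ν ν' ε ξ * μ ξ ^ 2 + wavePhase F ξ ^ 2 * μ ξ +
        viscosityGap ν ν' ε ξ * ((ξ 2 / ‖ξ‖) ^ 2 : ℝ) = 0 ∧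
      |x| ≤ |viscosityGap ν ν' ε ξ| / 2 ∧ x ≤ max 0 (-viscosityGap ν ν' ε ξ / 2) ∧
      |y - wavePhase F ξ| ≤ |viscosityGap ν ν' ε ξ| := by
    intro ξ hξ
    obtain ⟨x, y, ρ, h, hy, hρ, h1, h2, h3, h4, h5⟩ := scaledLam_spec hF hε hξ
    have hμξ : μ ξ = x + Complex.I * (s * y : ℝ) := by
      simp only [hμdef, hm0, Set.indicator_of_mem hξ, h]
      simp
    refine ⟨x, y, h, hμξ, hy, ?_, h3, h4, h5⟩
    rw [cubic_root_factor hρ h1 h2, hμξ]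
    rcases hs with rfl | rfl
    · simp
    · push_cast
      ring
  have hq0 : ∀ ξ ∈ S, wavePhase F ξ ^ 3 / 2 ≤ ‖q ξ‖ ∧ ‖μ ξ‖ ≤ 2 * (1 + F⁻¹) := by
    intro ξ hξ
    obtain ⟨x, y, h, hμξ, hy, -, h3, -, h5⟩ := hcore ξ hξ
    obtain ⟨w1, w2, w3⟩ := wavePhase_bounds hF hξ.1
    have hη := hξ.2
    have hmin := min_le_left 1 F⁻¹
    have hsy : |s * y| = y := by rw [abs_mul, hsabs, one_mul, abs_of_pos hy]
    constructor
    · have : q ξ = waveCofactorAt (viscosityGap ν ν' ε ξ) (wavePhase F ξ)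
        (x + Complex.I * (s * y : ℝ)) := by rw [← hμξ]
      rw [this]
      exact waveCofactorAt_lower (hm.trans_le w1) (hη.trans (by linarith)) h3 (by rwa [hsy])
    · rw [hμξ]
      refine (norm_add_le _ _).trans ?_
      rw [norm_mul, Complex.norm_I, Complex.norm_real, Complex.norm_real, Real.norm_eq_abs,
        Real.norm_eq_abs, hsy]
      have := (abs_le.1 h5).2
      linarith
  have hq0' : ∀ ξ ∈ S, q ξ ≠ 0 := by
    intro ξ hξ
    have h1 := (hq0 ξ hξ).1
    have h2 : 0 < wavePhase F ξ := hm.trans_le (wavePhase_bounds hF hξ.1).1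
    rw [← norm_pos_iff]
    exact lt_of_lt_of_le (by positivity) h1
  refine ⟨z, Q, hzm, fun i j => ?_, fun ξ v => ?_, fun ξ hξ => ?_⟩
  · exact (hqm.inv.mul (hWm i j)).indicator hSm
  · by_cases hξ : ξ ∈ S
    · refine norm_toEuclideanLin_le (by positivity) (fun i j => ?_) v
      rw [hQin ξ hξ, Matrix.smul_apply, norm_smul, norm_inv]
      obtain ⟨w1, w2, w3⟩ := wavePhase_bounds hF hξ.1
      have hη := hξ.2
      have hmin := min_le_left 1 F⁻¹
      have e1 : ‖W ξ i j‖ ≤ 35 * (1 + F⁻¹) ^ 3 := by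
        refine norm_waveCofactor_le (by positivity) (norm_waveMatrix_le (direction_sq hξ.1) hF'.le
          (by linarith)) (by linarith) ?_ (hq0 ξ hξ).2 i j
        rwa [abs_of_pos (hm.trans_le w1)]
      have e2 : min 1 F⁻¹ ^ 3 / 2 ≤ ‖q ξ‖ := le_trans (by gcongr) (hq0 ξ hξ).1
      calc ‖q ξ‖⁻¹ * ‖W ξ i j‖ ≤ (min 1 F⁻¹ ^ 3 / 2)⁻¹ * (35 * (1 + F⁻¹) ^ 3) := by gcongr
        _ = _ := by field_simp; norm_num
    · rw [hQout ξ hξ]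
      simp only [map_zero, LinearMap.zero_apply, norm_zero]
      have := projConst_pos hF
      positivity
  · obtain ⟨x, y, h, hμξ, hy, hroot, h3, h4, h5⟩ := hcore ξ hξ
    have hB := symbolB_eq F ν ν' hε.ne' hξ.1
    have hc : ((ε⁻¹ : ℝ) : ℂ) ≠ 0 := by exact_mod_cast (inv_pos.2 hε).ne'
    have hann := scaledSymbol_annihilates F ν ν' ε hξ.1
    have hηε : ε⁻¹ * |viscosityGap ν ν' ε ξ| = |ν' - ν| * ‖ξ‖ ^ 2 := by
      rw [viscosityGap, abs_mul, abs_mul, abs_of_pos hε, abs_of_nonneg (sq_nonneg ‖ξ‖)]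
      field_simp
    have hε' := inv_pos.2 hε
    refine ⟨?_, ?_, ?_, ?_, ?_⟩
    · rw [lam_eq F ν ν' hε.ne', Complex.add_re, Complex.add_im, Complex.re_ofReal_mul,
        Complex.im_ofReal_mul, Complex.ofReal_re, Complex.ofReal_im, h]
      simp only [hz, hμξ]
      simp
      ring
    · rw [hQin ξ hξ, eigenprojection_eq hann hroot hB hc rfl (hq0' ξ hξ)]
    · rw [hB, hQin ξ hξ, Matrix.mul_add, Matrix.mul_smul, Matrix.mul_smul, Matrix.mul_one,
        smul_mul_assoc, (waveCofactor_mul_sub hann hroot).1]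
      simp only [hz]
      module
    · have hre : (z ξ).re = ε⁻¹ * x - ν * ‖ξ‖ ^ 2 := by
        simp only [hz, Complex.add_re, Complex.re_ofReal_mul, Complex.ofReal_re, hμξ]
        simp
        ring
      rw [hre]
      have h6 : ε⁻¹ * x ≤ max 0 (-((ν' - ν) * ‖ξ‖ ^ 2) / 2) := by
        calc ε⁻¹ * x ≤ ε⁻¹ * max 0 (-viscosityGap ν ν' ε ξ / 2) := by gcongr
          _ = _ := by
            rw [mul_max_of_nonneg _ _ hε'.le, mul_zero, viscosityGap]
            congr 1
            field_simp
      have hk : 0 ≤ ‖ξ‖ ^ 2 := by positivity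
      rcases le_total ν ν' with hle | hle
      · rw [min_eq_left hle]
        have : max 0 (-((ν' - ν) * ‖ξ‖ ^ 2) / 2) = 0 := max_eq_left (by nlinarith)
        linarith
      · rw [min_eq_right hle]
        have : max 0 (-((ν' - ν) * ‖ξ‖ ^ 2) / 2) = -((ν' - ν) * ‖ξ‖ ^ 2) / 2 :=
          max_eq_right (by nlinarith)
        nlinarith
    · have e : z ξ - Complex.I * (s * ε⁻¹ * wavePhase F ξ : ℝ) = ((ε⁻¹ * x : ℝ) : ℂ) +
          Complex.I * (s * (ε⁻¹ * (y - wavePhase F ξ)) : ℝ) + ((-(ν * ‖ξ‖ ^ 2) : ℝ) : ℂ) := by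
        simp only [hz, hμξ]
        push_cast
        ring
      rw [e]
      refine (norm_add₃_le).trans ?_
      rw [norm_mul, Complex.norm_I, Complex.norm_real, Complex.norm_real, Complex.norm_real,
        Real.norm_eq_abs, Real.norm_eq_abs, Real.norm_eq_abs, abs_neg, abs_mul s, hsabs, abs_mul,
        abs_mul, abs_of_pos hε', abs_of_nonneg (by positivity : 0 ≤ ν * ‖ξ‖ ^ 2), one_mul, one_mul]
      have g1 : ε⁻¹ * |x| ≤ |ν' - ν| * ‖ξ‖ ^ 2 / 2 := by
        rw [← hηε]
        have := mul_le_mul_of_nonneg_left h3 hε'.le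
        linarith
      have g2 : ε⁻¹ * |y - wavePhase F ξ| ≤ |ν' - ν| * ‖ξ‖ ^ 2 := by
        rw [← hηε]
        gcongr
      have g3 : |ν' - ν| ≤ ν + ν' := by rw [abs_le]; constructor <;> linarith
      have hk : 0 ≤ ‖ξ‖ ^ 2 := by positivity
      have g4 : |ν' - ν| * ‖ξ‖ ^ 2 ≤ (ν + ν') * ‖ξ‖ ^ 2 := by gcongr
      nlinarith [mul_nonneg hν'.le hk, mul_nonneg hν.le hk]

theorem exists_projector_data {F ν ν' ε : ℝ} (hF : 0 < F) (hν : 0 < ν) (hν' : 0 < ν')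
    (hε : 0 < ε) {P : Space → Matrix (Fin 4) (Fin 4) ℂ}
    (hP : P ∈ ({proj₃ F ν ν' ε, proj₄ F ν ν' ε} : Set (Space → Matrix (Fin 4) (Fin 4) ℂ))) :
    ∃ (s : ℝ) (z : Space → ℂ) (Q : Space → Matrix (Fin 4) (Fin 4) ℂ), |s| = 1 ∧ Measurable z ∧
      (∀ i j, Measurable fun ξ => Q ξ i j) ∧
      (∀ ξ v, ‖Matrix.toEuclideanLin (Q ξ) v‖ ≤ projConst F * ‖v‖) ∧
      ∀ ξ ∈ waveRegime F ν ν' ε, Q ξ = P ξ ∧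
        Q ξ * symbolB F ν ν' ε ξ = z ξ • Q ξ ∧ (z ξ).re ≤ -(min ν ν' * ‖ξ‖ ^ 2) ∧
        ‖z ξ - Complex.I * (s * ε⁻¹ * wavePhase F ξ : ℝ)‖ ≤ 3 * (ν + ν') * ‖ξ‖ ^ 2 := by
  rcases hP with rfl | hP
  · obtain ⟨z, Q, h1, h2, h3, h4⟩ := exists_eigenprojection_data (s := 1) hF hν hν' hε (Or.inl rfl)
    refine ⟨1, z, Q, by simp, h1, h2, h3, fun ξ hξ => ?_⟩
    obtain ⟨k1, k2, k3⟩ := h4 ξ hξ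
    refine ⟨?_, k3⟩
    rw [k2, proj₃, k1, one_mul, mul_comm, Complex.re_add_im]
  · rw [Set.mem_singleton_iff.1 hP]
    obtain ⟨z, Q, h1, h2, h3, h4⟩ := exists_eigenprojection_data (s := -1) hF hν hν' hε (Or.inr rfl)
    refine ⟨-1, z, Q, by simp, h1, h2, h3, fun ξ hξ => ?_⟩
    obtain ⟨k1, k2, k3⟩ := h4 ξ hξ
    refine ⟨?_, k3⟩
    rw [k2, proj₄, k1]
    congr 1
    rw [neg_one_mul, mul_comm]
    apply Complex.ext <;> simp

/-! ### Variation of constants -/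

theorem integral_Ioo_mul_exp_neg (z : ℂ) {r t : ℝ} (hrt : r ≤ t) :
    ∫ s in Set.Ioo r t, z * Complex.exp (-s * z) =
      Complex.exp (-r * z) - Complex.exp (-t * z) := by
  have hd : ∀ s : ℝ, HasDerivAt (fun s : ℝ => -Complex.exp (-s * z)) (z * Complex.exp (-s * z)) s := by
    intro s
    have h1 : HasDerivAt (fun s : ℝ => -(s : ℂ) * z) (-z) s := by
      have := ((Complex.ofRealCLM.hasDerivAt (x := s)).neg).mul_const z
      simpa using this
    exact (h1.cexp.neg).congr_deriv (by ring)
  rw [← integral_Ioc_eq_integral_Ioo, ← intervalIntegral.integral_of_le hrt,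
    intervalIntegral.integral_eq_sub_of_hasDerivAt (fun s _ => hd s)
      (Continuous.intervalIntegrable (by fun_prop) _ _)]
  ring

theorem integrableOn_exp_smul {E : Type*} [NormedAddCommGroup E] [NormedSpace ℂ E]
    (z : ℂ) {g : ℝ → E} {t : ℝ} (hg : IntegrableOn g (Set.Ioo 0 t)) :
    IntegrableOn (fun s : ℝ => Complex.exp (-s * z) • g s) (Set.Ioo 0 t) := by
  have hc : Continuous fun s : ℝ => Complex.exp (-s * z) := by fun_prop
  obtain ⟨C, hC⟩ := (isCompact_Icc (a := (0 : ℝ)) (b := t)).exists_bound_of_continuousOn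
    hc.continuousOn
  refine Integrable.bdd_smul hg C hc.aestronglyMeasurable ?_
  filter_upwards [ae_restrict_mem measurableSet_Ioo] with s hs
  exact hC s (Set.Ioo_subset_Icc_self hs)

theorem variation_of_constants {E : Type*} [NormedAddCommGroup E] [NormedSpace ℂ E]
    [CompleteSpace E] {z : ℂ} {h g : ℝ → E} {h0 : E} {t : ℝ} (ht : 0 < t)
    (hh : IntegrableOn h (Set.Ioo 0 t)) (hg : IntegrableOn g (Set.Ioo 0 t))
    (heq : ∀ᵐ s ∂volume.restrict (Set.Ioo 0 t),
      h s = h0 + ∫ r in Set.Ioo 0 s, (z • h r + g r)) :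
    h0 + ∫ r in Set.Ioo 0 t, (z • h r + g r) =
      Complex.exp (t * z) • h0 + ∫ s in Set.Ioo 0 t, Complex.exp ((t - s : ℝ) * z) • g s := by
  set q : ℝ → E := fun r => z • h r + g r with hq
  have hqi : IntegrableOn q (Set.Ioo 0 t) := (Integrable.smul z hh).add hg
  set μ := volume.restrict (Set.Ioo 0 t) with hμ
  have hki : Integrable (fun s : ℝ => z * Complex.exp (-s * z)) μ := by
    have : ContinuousOn (fun s : ℝ => z * Complex.exp (-s * z)) (Set.Icc 0 t) := by fun_prop
    exact (this.integrableOn_Icc).mono_set Set.Ioo_subset_Icc_self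
  have hA : ∫ s, (z * Complex.exp (-s * z)) • h s ∂μ =
      (1 - Complex.exp (-t * z)) • h0 +
        ∫ r, (Complex.exp (-r * z) - Complex.exp (-t * z)) • q r ∂μ := by
    have e1 : ∫ s, (z * Complex.exp (-s * z)) • h s ∂μ =
        ∫ s, ((z * Complex.exp (-s * z)) • h0 +
          ∫ r, {w : ℝ × ℝ | w.2 < w.1}.indicator
            (fun w => (z * Complex.exp (-w.1 * z)) • q w.2) (s, r) ∂μ) ∂μ := by
      refine integral_congr_ae ?_
      filter_upwards [heq, ae_restrict_mem measurableSet_Ioo] with s hs hst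
      rw [hs, smul_add]
      congr 1
      have : ∫ r in Set.Ioo 0 s, q r = ∫ r, (Set.Iio s).indicator q r ∂μ := by
        rw [integral_indicator measurableSet_Iio, hμ, Measure.restrict_restrict measurableSet_Iio]
        congr 2
        ext r
        simp only [Set.mem_inter_iff, Set.mem_Iio, Set.mem_Ioo]
        constructor
        · rintro ⟨h1, h2⟩
          exact ⟨h2, h1, h2.trans hst.2⟩
        · rintro ⟨h1, h2, -⟩
          exact ⟨h2, h1⟩
      rw [this, ← integral_smul]
      refine integral_congr_ae (Filter.Eventually.of_forall fun r => ?_)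
      simp only [Set.indicator_apply, Set.mem_Iio, Set.mem_ofPred_eq]
      split_ifs
      · rfl
      · rw [smul_zero]
    have hprod : Integrable ({w : ℝ × ℝ | w.2 < w.1}.indicator
        (fun w => (z * Complex.exp (-w.1 * z)) • q w.2)) (μ.prod μ) :=
      (hki.smul_prod hqi).indicator (measurableSet_lt measurable_snd measurable_fst)
    rw [e1, integral_add (hki.smul_const h0) hprod.integral_prod_left,
      integral_smul_const,
      integral_integral_swap (f := fun s r => {w : ℝ × ℝ | w.2 < w.1}.indicator
        (fun w => (z * Complex.exp (-w.1 * z)) • q w.2) (s, r)) hprod, integral_Ioo_mul_exp_neg z ht.le]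
    congr 1
    · simp
    · refine integral_congr_ae ?_
      filter_upwards [ae_restrict_mem measurableSet_Ioo] with r hr
      rw [← integral_Ioo_mul_exp_neg z hr.2.le, ← integral_smul_const,
        show (fun s => {w : ℝ × ℝ | w.2 < w.1}.indicator
          (fun w => (z * Complex.exp (-w.1 * z)) • q w.2) (s, r)) =
          (Set.Ioi r).indicator fun s : ℝ => (z * Complex.exp (-s * z)) • q r by
            ext s; simp [Set.indicator_apply],
        integral_indicator measurableSet_Ioi, hμ, Measure.restrict_restrict measurableSet_Ioi]
      congr 2
      ext s
      simp only [Set.mem_inter_iff, Set.mem_Ioi, Set.mem_Ioo]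
      constructor
      · rintro ⟨h1, -, h2⟩
        exact ⟨h1, h2⟩
      · rintro ⟨h1, h2⟩
        exact ⟨h1, hr.1.trans h1, h2⟩
  have hB : ∫ r, (Complex.exp (-r * z) - Complex.exp (-t * z)) • q r ∂μ =
      (∫ s, (z * Complex.exp (-s * z)) • h s ∂μ + ∫ s, Complex.exp (-s * z) • g s ∂μ) -
        Complex.exp (-t * z) • ∫ r, q r ∂μ := by
    have i2 : Integrable (fun s : ℝ => (z * Complex.exp (-s * z)) • h s) μ := by
      have := (integrableOn_exp_smul z hh).smul z
      simp only [Pi.smul_def, smul_smul] at this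
      exact this
    rw [← integral_add i2 (integrableOn_exp_smul z hg), ← integral_smul,
      ← integral_sub (f := fun s : ℝ => (z * Complex.exp (-s * z)) • h s + Complex.exp (-s * z) • g s)
        (g := fun s : ℝ => Complex.exp (-t * z) • q s)
        (i2.add (integrableOn_exp_smul z hg)) (Integrable.smul _ hqi)]
    refine integral_congr_ae (Filter.Eventually.of_forall fun r => ?_)
    simp only [hq]
    module
  rw [hB] at hA
  have hC : Complex.exp (-t * z) • (h0 + ∫ r, q r ∂μ) =
      h0 + ∫ s, Complex.exp (-s * z) • g s ∂μ := by
    rw [← sub_eq_zero, ← sub_eq_zero.2 hA]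
    module
  have hD := congrArg (fun v => Complex.exp (t * z) • v) hC
  simp only [smul_smul, ← Complex.exp_add, smul_add (Complex.exp (t * z)) h0] at hD
  rw [show (t : ℂ) * z + -t * z = 0 by ring, Complex.exp_zero, one_smul, ← integral_smul] at hD
  rw [hD]
  congr 1
  refine integral_congr_ae (Filter.Eventually.of_forall fun s => ?_)
  simp only [smul_smul, ← Complex.exp_add]
  congr 2
  push_cast
  ring

/-! ### Measurable representatives and Duhamel's formula -/

theorem measurableSet_timeInterval (T : ℝ≥0∞) : MeasurableSet (timeInterval T) :=
  (measurableSet_lt measurable_const measurable_id).inter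
    (measurableSet_lt ENNReal.measurable_ofReal measurable_const)

theorem exists_rat_mem_timeInterval {T : ℝ≥0∞} {t : ℝ} (ht : t ∈ timeInterval T) :
    ∃ q : ℚ, t < q ∧ (q : ℝ) ∈ timeInterval T := by
  obtain ⟨q, hq0, h1, h2⟩ := ENNReal.lt_iff_exists_rat_btwn.1 ht.2
  have h3 : t < q := by
    by_contra h
    exact absurd (ENNReal.ofReal_le_ofReal (not_lt.1 h)) (not_le.2 h1)
  exact ⟨q, h3, ht.1.trans h3, h2⟩

theorem Ioo_subset_timeInterval {T : ℝ≥0∞} {t : ℝ} (ht : t ∈ timeInterval T) :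
    Set.Ioo 0 t ⊆ timeInterval T := fun _ hs =>
  ⟨hs.1, (ENNReal.ofReal_le_ofReal hs.2.le).trans_lt ht.2⟩

/-- `U` is a jointly measurable version of the Fourier transform of `u` on `(0, T) × ℝ³`. -/
structure IsRepresentative (T : ℝ≥0∞) (u : ℝ → Field) (U : ℝ → Space → Vec) : Prop where
  stronglyMeasurable : StronglyMeasurable (Function.uncurry U)
  ae_time : ∀ᵐ t ∂volume.restrict (timeInterval T), (u t).hat =ᵐ[volume] U t
  ae_freq : ∀ᵐ ξ : Space, ∀ᵐ t ∂volume.restrict (timeInterval T), (u t).hat ξ = U t ξ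
  integrableOn : ∀ t ∈ timeInterval T, ∀ K : Set Space, IsCompact K →
    IntegrableOn (Function.uncurry U) (Set.Ioo 0 t ×ˢ K)
  integrableOn_slice : ∀ᵐ ξ : Space, ∀ t ∈ timeInterval T,
    IntegrableOn (fun s => U s ξ) (Set.Ioo 0 t)

theorem LocIntegrableInTime.exists_representative {T : ℝ≥0∞} {u : ℝ → Field}
    (hu : LocIntegrableInTime T u) : ∃ U, IsRepresentative T u U := by
  classical
  set I := timeInterval T with hI
  have hIm : MeasurableSet I := measurableSet_timeInterval T
  set w : ℝ × Space → Vec := fun z => (u z.1).hat z.2 with hw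
  have hrest : (volume : Measure (ℝ × Space)).restrict (I ×ˢ Set.univ) =
      (volume.restrict I).prod volume := by
    rw [Measure.volume_eq_prod, ← Measure.prod_restrict, Measure.restrict_univ]
  have hwm : AEStronglyMeasurable w ((volume.restrict I).prod volume) := by
    rw [← hrest]
    set A : ℚ × ℕ → Set (ℝ × Space) := fun a =>
      if (a.1 : ℝ) ∈ I then Set.Ioc 0 (a.1 : ℝ) ×ˢ Metric.closedBall 0 (a.2 : ℝ) else ∅ with hA
    have h1 : ∀ a, AEStronglyMeasurable w (volume.restrict (A a)) := by
      intro a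
      simp only [hA]
      split_ifs with h
      · exact (hu _ h _ (isCompact_closedBall 0 _)).aestronglyMeasurable
      · simp
    refine (aestronglyMeasurable_iUnion_iff.2 h1).mono_measure (Measure.restrict_mono ?_ le_rfl)
    rintro ⟨t, ξ⟩ ⟨ht, -⟩
    obtain ⟨q, hq1, hq2⟩ := exists_rat_mem_timeInterval ht
    obtain ⟨n, hn⟩ := exists_nat_ge ‖ξ‖
    refine Set.mem_iUnion.2 ⟨(q, n), ?_⟩
    have hq2 : (q : ℝ) ∈ I := hq2
    simp only [hA, if_pos hq2]
    exact ⟨⟨ht.1, hq1.le⟩, by simpa using hn⟩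
  set W := hwm.mk w with hW
  have hWw : ∀ᵐ z ∂(volume.restrict I).prod volume, w z = W z := hwm.ae_eq_mk
  have hInt : ∀ t ∈ I, ∀ K : Set Space, IsCompact K → IntegrableOn W (Set.Ioo 0 t ×ˢ K) := by
    intro t ht K hK
    have h1 : IntegrableOn w (Set.Ioo 0 t ×ˢ K) :=
      (hu t ht K hK).mono_set (Set.prod_mono Set.Ioo_subset_Ioc_self subset_rfl)
    refine h1.congr ?_
    rw [← hrest] at hWw
    exact ae_restrict_of_ae_restrict_of_subset
      (Set.prod_mono (Ioo_subset_timeInterval ht) (Set.subset_univ _)) hWw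
  refine ⟨fun t ξ => W (t, ξ), hwm.stronglyMeasurable_mk, Measure.ae_ae_of_ae_prod hWw, ?_, hInt,
    ?_⟩
  · have h1 : ∀ᵐ z ∂(volume : Measure Space).prod (volume.restrict I), w z.swap = W z.swap :=
      (Measure.measurePreserving_swap).quasiMeasurePreserving.ae hWw
    exact Measure.ae_ae_of_ae_prod h1
  · have h1 : ∀ (q : ℚ) (n : ℕ), ∀ᵐ ξ : Space, (q : ℝ) ∈ I → ξ ∈ Metric.closedBall (0 : Space) n →
        IntegrableOn (fun s => W (s, ξ)) (Set.Ioo 0 (q : ℝ)) := by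
      intro q n
      by_cases hq : (q : ℝ) ∈ I
      · have h2 := hInt q hq _ (isCompact_closedBall (0 : Space) n)
        rw [IntegrableOn, Measure.volume_eq_prod, ← Measure.prod_restrict] at h2
        have h3 := (ae_restrict_iff' measurableSet_closedBall).1 h2.prod_left_ae
        filter_upwards [h3] with ξ hξ _ hn
        exact hξ hn
      · exact Filter.Eventually.of_forall fun ξ h => absurd h hq
    filter_upwards [ae_all_iff.2 fun q => ae_all_iff.2 (h1 q)] with ξ hξ t ht
    obtain ⟨q, hq1, hq2⟩ := exists_rat_mem_timeInterval ht
    obtain ⟨n, hn⟩ := exists_nat_ge ‖ξ‖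
    exact (hξ q n hq2 (by simpa using hn)).mono_set (Set.Ioo_subset_Ioo_right hq1.le)

theorem measurable_vec {X : Type*} [MeasurableSpace X] {g : X → Vec}
    (hg : ∀ i, Measurable fun x => g x i) : Measurable g := by
  have h : Measurable fun x => (WithLp.ofLp (g x)) := measurable_pi_iff.2 hg
  exact (WithLp.measurable_toLp 2 (Fin 4 → ℂ)).comp h

theorem stronglyMeasurable_toEuclideanLin {X : Type*} [MeasurableSpace X]
    {A : X → Matrix (Fin 4) (Fin 4) ℂ} (hA : ∀ i j, Measurable fun x => A x i j) {g : X → Vec}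
    (hg : StronglyMeasurable g) :
    StronglyMeasurable fun x => Matrix.toEuclideanLin (A x) (g x) := by
  refine (measurable_vec fun i => ?_).stronglyMeasurable
  have : (fun x => Matrix.toEuclideanLin (A x) (g x) i) = fun x => ∑ l, A x i l * g x l := rfl
  rw [this]
  have hgm := hg.measurable
  exact Finset.measurable_sum _ fun l _ => (hA i l).mul (by fun_prop)

theorem measurable_symbolB (F ν ν' ε : ℝ) (i j : Fin 4) :
    Measurable fun ξ => symbolB F ν ν' ε ξ i j := by
  refine Complex.measurable_ofReal.comp ?_
  simp only [leraySymbol, Matrix.sub_apply, Matrix.smul_apply, Matrix.mul_apply, Fin.sum_univ_four,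
    Matrix.vecMulVec_apply]
  have hv : ∀ l : Fin 4, Measurable fun ξ : Space => (![ξ 0, ξ 1, ξ 2, 0] : Fin 4 → ℝ) l := by
    intro l
    fin_cases l <;> simp <;> fun_prop
  have h0 := hv 0
  have h1 := hv 1
  have h2 := hv 2
  have h3 := hv 3
  have hi := hv i
  fun_prop

theorem stronglyMeasurable_setIntegral_Ioo {X : Type*} [MeasurableSpace X] {g : ℝ → X → Vec}
    (hg : StronglyMeasurable (Function.uncurry g)) :
    StronglyMeasurable fun z : ℝ × X => ∫ r in Set.Ioo 0 z.1, g r z.2 := by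
  have h : (fun z : ℝ × X => ∫ r in Set.Ioo 0 z.1, g r z.2) = fun z : ℝ × X =>
      ∫ r, {a : (ℝ × X) × ℝ | 0 < a.2 ∧ a.2 < a.1.1}.indicator
        (fun a => g a.2 a.1.2) (z, r) := by
    ext1 z
    rw [← integral_indicator measurableSet_Ioo]
    refine integral_congr_ae (Filter.Eventually.of_forall fun r => ?_)
    simp [Set.indicator_apply]
  rw [h]
  refine StronglyMeasurable.integral_prod_right' (StronglyMeasurable.indicator ?_ ?_)
  · exact hg.comp_measurable (by fun_prop : Measurable fun a : (ℝ × X) × ℝ => (a.2, a.1.2))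
  · exact (measurableSet_lt measurable_const measurable_snd).inter
      (measurableSet_lt measurable_snd (by fun_prop))

theorem IsSolution.duhamel {F ν ν' ε : ℝ} {T : ℝ≥0∞} {f₀ : Field} {Fb Fl f : ℝ → Field}
    (hf : IsSolution F ν ν' ε T f₀ Fb Fl f) {Ub Ul : ℝ → Space → Vec}
    (hUb : IsRepresentative T Fb Ub) (hUl : IsRepresentative T Fl Ul) {S : Set Space}
    {z : Space → ℂ} {Q : Space → Matrix (Fin 4) (Fin 4) ℂ}
    (hQ : ∀ ξ ∈ S, Q ξ * symbolB F ν ν' ε ξ = z ξ • Q ξ) :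
    ∀ᵐ t ∂volume.restrict (timeInterval T), ∀ᵐ ξ : Space, ξ ∈ S →
      Matrix.toEuclideanLin (Q ξ) ((f t).hat ξ) =
        Complex.exp (t * z ξ) • Matrix.toEuclideanLin (Q ξ) (f₀.hat ξ) +
          ((∫ s in Set.Ioo 0 t, Complex.exp ((t - s : ℝ) * z ξ) •
            Matrix.toEuclideanLin (Q ξ) (Ub s ξ)) +
          ∫ s in Set.Ioo 0 t, Complex.exp ((t - s : ℝ) * z ξ) •
            Matrix.toEuclideanLin (Q ξ) (Ul s ξ)) := by
  obtain ⟨U, hU⟩ := hf.locIntegrable.exists_representative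
  set I := timeInterval T with hI
  have hIm : MeasurableSet I := measurableSet_timeInterval T
  have hg0 : AEStronglyMeasurable f₀.hat volume := f₀.locallyIntegrable_hat.aestronglyMeasurable
  set G := hg0.mk f₀.hat with hG
  have hGm : StronglyMeasurable G := hg0.stronglyMeasurable_mk
  have hGe : ∀ᵐ ξ, f₀.hat ξ = G ξ := hg0.ae_eq_mk
  set q : ℝ → Space → Vec := fun s ξ =>
    Matrix.toEuclideanLin (symbolB F ν ν' ε ξ) (U s ξ) + (Ub s ξ + Ul s ξ) with hq
  have hqm : StronglyMeasurable (Function.uncurry q) := by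
    have h1 : StronglyMeasurable fun a : ℝ × Space =>
        Matrix.toEuclideanLin (symbolB F ν ν' ε a.2) (Function.uncurry U a) :=
      stronglyMeasurable_toEuclideanLin
        (fun i j => (measurable_symbolB F ν ν' ε i j).comp measurable_snd) hU.stronglyMeasurable
    exact h1.add (hUb.stronglyMeasurable.add hUl.stronglyMeasurable)
  have hE : ∀ᵐ t ∂volume.restrict I, ∀ᵐ ξ : Space,
      U t ξ = G ξ + ∫ r in Set.Ioo 0 t, q r ξ := by
    filter_upwards [hf.eqn, hU.ae_time, ae_restrict_mem hIm] with t h1 h2 ht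
    filter_upwards [h1, h2, hGe, hU.ae_freq, hUb.ae_freq, hUl.ae_freq] with ξ k1 k2 k3 k4 k5 k6
    rw [← k2, k1, k3, intervalIntegral.integral_of_le ht.1.le, integral_Ioc_eq_integral_Ioo]
    congr 1
    refine integral_congr_ae ?_
    filter_upwards [ae_restrict_of_ae_restrict_of_subset (Ioo_subset_timeInterval ht) k4,
      ae_restrict_of_ae_restrict_of_subset (Ioo_subset_timeInterval ht) k5,
      ae_restrict_of_ae_restrict_of_subset (Ioo_subset_timeInterval ht) k6] with s l4 l5 l6
    simp only [hq, l4, l5, l6]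
  have hset : MeasurableSet {a : ℝ × Space |
      U a.1 a.2 = G a.2 + ∫ r in Set.Ioo 0 a.1, q r a.2} :=
    hU.stronglyMeasurable.measurableSet_eq_fun
      ((hGm.comp_measurable measurable_snd).add (stronglyMeasurable_setIntegral_Ioo hqm))
  have hE' := (Measure.ae_ae_comm (p := fun t ξ => U t ξ = G ξ + ∫ r in Set.Ioo 0 t, q r ξ)
    hset).1 hE
  filter_upwards [hE, hU.ae_time, ae_restrict_mem hIm] with t h1 h2 ht
  filter_upwards [h1, h2, hGe, hE', hU.integrableOn_slice, hUb.integrableOn_slice,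
    hUl.integrableOn_slice] with ξ k1 k2 k3 k4 k5 k6 k7 hξ
  set A := (Matrix.toEuclideanLin (Q ξ)).toContinuousLinearMap with hA
  have hAv : ∀ v, Matrix.toEuclideanLin (Q ξ) v = A v := fun v => rfl
  have hBA : ∀ v, A (Matrix.toEuclideanLin (symbolB F ν ν' ε ξ) v) = z ξ • A v := by
    intro v
    have h3 := hQ ξ hξ
    have h4 := congrArg (fun N => Matrix.toEuclideanLin N v) h3
    simp only [map_smul, LinearMap.smul_apply] at h4
    rw [← hAv, ← hAv, ← h4]
    simp [Matrix.toLpLin_apply, Matrix.mulVec_mulVec]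
  have hcomm : ∀ s ∈ I, A (G ξ + ∫ r in Set.Ioo 0 s, q r ξ) =
      A (G ξ) + ∫ r in Set.Ioo 0 s, (z ξ • A (U r ξ) + (A (Ub r ξ) + A (Ul r ξ))) := by
    intro s hs
    have hqi : IntegrableOn (fun r => q r ξ) (Set.Ioo 0 s) :=
      ((Matrix.toEuclideanLin (symbolB F ν ν' ε ξ)).toContinuousLinearMap.integrable_comp
        (k5 s hs)).add ((k6 s hs).add (k7 s hs))
    rw [map_add, ← A.integral_comp_comm hqi]
    congr 1
    refine integral_congr_ae (Filter.Eventually.of_forall fun r => ?_)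
    simp only [hq, map_add, hBA]
  have hvar := variation_of_constants (z := z ξ) (h := fun r => A (U r ξ))
    (g := fun r => A (Ub r ξ) + A (Ul r ξ)) (h0 := A (G ξ)) ht.1
    (A.integrable_comp (k5 t ht)) ((A.integrable_comp (k6 t ht)).add (A.integrable_comp (k7 t ht)))
    (by
      filter_upwards [ae_restrict_of_ae_restrict_of_subset (Ioo_subset_timeInterval ht) k4,
        ae_restrict_mem measurableSet_Ioo] with s hs hst
      rw [hs, hcomm s (Ioo_subset_timeInterval ht hst)])
  have hexp : ∀ {g : ℝ → Vec}, IntegrableOn g (Set.Ioo 0 t) →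
      IntegrableOn (fun s : ℝ => Complex.exp ((t - s : ℝ) * z ξ) • g s) (Set.Ioo 0 t) := by
    intro g hg
    have h3 := (integrableOn_exp_smul (z ξ) hg).smul (Complex.exp (t * z ξ))
    refine h3.congr (Filter.Eventually.of_forall fun s => ?_)
    simp only [Pi.smul_apply, smul_smul, ← Complex.exp_add]
    congr 2
    push_cast
    ring
  rw [hAv, k2, k1, hcomm t ht, hvar, k3]
  simp only [hAv, smul_add]
  rw [← integral_add (hexp (A.integrable_comp (k6 t ht))) (hexp (A.integrable_comp (k7 t ht)))]

/-! ### The estimate of one dyadic block -/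

theorem eLpNorm_setIntegral_le {w : ℝ → Space → Vec} (hw : StronglyMeasurable (Function.uncurry w))
    {A : Set ℝ} {N : ℝ → ℝ≥0∞} {r : ℝ≥0∞} (hr : 1 ≤ r)
    (h1 : r ≠ ⊤ → ∀ᵐ s ∂volume.restrict A, eLpNorm (w s) r volume ≤ N s)
    (h2 : r = ⊤ → ∀ᵐ s ∂volume.restrict A, ∀ x, ‖w s x‖ₑ ≤ N s) :
    eLpNorm (fun x => ∫ s in A, w s x) r volume ≤ ∫⁻ s in A, N s := by
  rcases eq_or_ne r ⊤ with hr' | hr'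
  · rw [hr', eLpNorm_exponent_top]
    refine eLpNormEssSup_le_of_ae_enorm_bound (Filter.Eventually.of_forall fun x => ?_)
    refine (enorm_integral_le_lintegral_enorm _).trans (lintegral_mono_ae ?_)
    filter_upwards [h2 hr'] with s hs
    exact hs x
  · have hr0 : r ≠ 0 := by rintro rfl; simp at hr
    have hr1 : 1 ≤ r.toReal := by
      have := ENNReal.toReal_mono hr' hr
      simpa using this
    rw [eLpNorm_eq_lintegral_rpow_enorm_toReal hr0 hr']
    have hm : Measurable (Function.uncurry fun (x : Space) (s : ℝ) => ‖w s x‖ₑ) :=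
      (hw.comp_measurable measurable_swap).enorm
    calc (∫⁻ x, ‖∫ s in A, w s x‖ₑ ^ r.toReal) ^ (1 / r.toReal)
        ≤ (∫⁻ x, (∫⁻ s in A, ‖w s x‖ₑ) ^ r.toReal) ^ (1 / r.toReal) := by
          gcongr
          exact enorm_integral_le_lintegral_enorm _
      _ ≤ ∫⁻ s in A, (∫⁻ x, ‖w s x‖ₑ ^ r.toReal) ^ (1 / r.toReal) :=
          lintegral_lintegral_rpow_le hm hr1
      _ ≤ ∫⁻ s in A, N s := by
          refine lintegral_mono_ae ?_
          filter_upwards [h1 hr'] with s hs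
          rwa [eLpNorm_eq_lintegral_rpow_enorm_toReal hr0 hr'] at hs

theorem measurable_eLpNorm_two {H : ℝ → Space → Vec}
    (hH : StronglyMeasurable (Function.uncurry H)) :
    Measurable fun s => eLpNorm (H s) 2 volume := by
  simp only [eLpNorm_eq_lintegral_rpow_enorm_toReal (two_ne_zero) ENNReal.ofNat_ne_top]
  exact ((hH.enorm.pow_const _).lintegral_prod_right').pow_const _

theorem measurable_majorant_uncurry {ζ : Space → ℂ} (hζ : Measurable ζ) {H : ℝ → Space → Vec}
    (hH : StronglyMeasurable (Function.uncurry H)) (A : ℝ≥0∞) (σ κ : ℝ) :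
    Measurable (Function.uncurry fun t s => majorant A σ κ ζ (H s) t) := by
  have h1 := measurable_supNorm_uncurry hζ hH
  have h2 : Measurable fun z : ℝ × ℝ => eLpNorm (H z.2) 2 volume :=
    (measurable_eLpNorm_two hH).comp measurable_snd
  have h3 : Measurable fun z : ℝ × ℝ => ENNReal.ofReal (Real.exp (-κ * z.1)) := by fun_prop
  exact (h1.pow_const σ).mul (((h3.mul h2).const_mul A).pow_const (1 - σ))

theorem eLpNorm_shifted_waveField_le {δ ρ κ : ℝ} {ζ : Space → ℂ} (hζ : Measurable ζ)
    (hκ : 0 ≤ κ) (hre : ∀ ξ, (ζ ξ).re ≤ -κ) {G : Space → Vec} (hGm : StronglyMeasurable G)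
    (hG : Integrable G) (hsupp : ∀ ξ ∉ freqRegion δ ρ, G ξ = 0) {r : ℝ≥0∞} (hr : 4 < r) {t : ℝ}
    (ht : 0 ≤ t) :
    eLpNorm (waveField (fun ξ => ζ ξ - κ) G t) r volume ≤ ENNReal.ofReal (Real.exp (-κ * t)) *
      majorant (bernsteinConst δ ρ) (1 - 4 * (r⁻¹).toReal) κ ζ G t := by
  have h : waveField (fun ξ => ζ ξ - κ) G t =
      ((Real.exp (-κ * t) : ℝ) : ℂ) • waveField ζ G t := by
    ext1 x
    rw [waveField_shift _ κ]
    simp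
  rw [h, eLpNorm_const_smul, ← ofReal_norm, Complex.norm_real,
    Real.norm_of_nonneg (Real.exp_pos _).le]
  gcongr
  exact eLpNorm_waveField_le_majorant hζ hκ hre hGm hG hsupp hr ht

theorem enorm_shifted_waveField_le {δ ρ κ : ℝ} {ζ : Space → ℂ} (hζ : Measurable ζ)
    (hκ : 0 ≤ κ) (hre : ∀ ξ, (ζ ξ).re ≤ -κ) {G : Space → Vec} (hG : Integrable G) {t : ℝ}
    (ht : 0 ≤ t) (x : Space) :
    ‖waveField (fun ξ => ζ ξ - κ) G t x‖ₑ ≤ ENNReal.ofReal (Real.exp (-κ * t)) *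
      majorant (bernsteinConst δ ρ) 1 κ ζ G t := by
  rw [waveField_shift _ κ, enorm_smul, ← ofReal_norm ((Real.exp (-κ * t) : ℝ) : ℂ),
    Complex.norm_real, Real.norm_of_nonneg (Real.exp_pos _).le]
  simp only [sub_add_cancel, majorant, ENNReal.rpow_one, sub_self, ENNReal.rpow_zero, mul_one]
  gcongr
  exact enorm_waveField_le_supNorm hζ (fun ξ => (hre ξ).trans (by linarith)) hG ht x

theorem stronglyMeasurable_waveField_sub {ζ : Space → ℂ} (hζ : Measurable ζ) {H : ℝ → Space → Vec}
    (hH : StronglyMeasurable (Function.uncurry H)) (t : ℝ) :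
    StronglyMeasurable
      (Function.uncurry fun (s : ℝ) (x : Space) => waveField ζ (H s) (t - s) x) := by
  have hg : Measurable fun z : ℝ × Space => (((t - z.1, z.1) : ℝ × ℝ), z.2) := by fun_prop
  have := (stronglyMeasurable_waveField hζ hH).comp_measurable hg
  exact this

theorem aestronglyMeasurable_duhamel {ζ : Space → ℂ} (hζ : Measurable ζ) {H : ℝ → Space → Vec}
    (hH : StronglyMeasurable (Function.uncurry H)) (t : ℝ) (A : Set ℝ) :
    AEStronglyMeasurable (fun x => ∫ s in A, waveField ζ (H s) (t - s) x) volume := by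
  have h := (stronglyMeasurable_waveField_sub hζ hH t).comp_measurable
    (measurable_swap (α := Space) (β := ℝ))
  have h2 := h.integral_prod_right' (ν := volume.restrict A)
  exact h2.aestronglyMeasurable

theorem aestronglyMeasurable_waveField {ζ : Space → ℂ} (hζ : Measurable ζ) {G : Space → Vec}
    (hG : StronglyMeasurable G) (t : ℝ) : AEStronglyMeasurable (waveField ζ G t) volume := by
  have h1 : StronglyMeasurable (Function.uncurry fun (_ : ℝ) => G) :=
    hG.comp_measurable measurable_snd
  have hg : Measurable fun x : Space => (((t, 0) : ℝ × ℝ), x) := by fun_prop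
  have h2 := (stronglyMeasurable_waveField hζ h1).comp_measurable hg
  exact h2.aestronglyMeasurable

theorem eLpNorm_duhamel_le {δ ρ κ : ℝ} {ζ : Space → ℂ} (hζ : Measurable ζ)
    (hκ : 0 ≤ κ) (hre : ∀ ξ, (ζ ξ).re ≤ -κ) {H : ℝ → Space → Vec}
    (hHm : StronglyMeasurable (Function.uncurry H))
    (hH : ∀ᵐ s ∂volume.restrict (Set.Ioi 0), Integrable (H s))
    (hsupp : ∀ s, ∀ ξ ∉ freqRegion δ ρ, H s ξ = 0) {r : ℝ≥0∞} (hr : 4 < r) (t : ℝ) :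
    eLpNorm (fun x => ∫ s in Set.Ioo 0 t, waveField (fun ξ => ζ ξ - κ) (H s) (t - s) x) r volume ≤
      ∫⁻ s in Set.Ioo 0 t, ENNReal.ofReal (Real.exp (-κ * (t - s))) *
        majorant (bernsteinConst δ ρ) (1 - 4 * (r⁻¹).toReal) κ ζ (H s) (t - s) := by
  have hH' : ∀ᵐ s ∂volume.restrict (Set.Ioo 0 t), Integrable (H s) :=
    ae_restrict_of_ae_restrict_of_subset Set.Ioo_subset_Ioi_self hH
  have hm : Measurable fun ξ => ζ ξ - (κ : ℂ) := hζ.sub_const _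
  refine eLpNorm_setIntegral_le
    (w := fun s x => waveField (fun ξ => ζ ξ - κ) (H s) (t - s) x)
    (stronglyMeasurable_waveField_sub hm hHm t)
    (le_trans (by norm_num) hr.le) (fun hr' => ?_) fun hr' => ?_
  · filter_upwards [hH', ae_restrict_mem measurableSet_Ioo] with s hs hst
    exact eLpNorm_shifted_waveField_le hζ hκ hre
      hHm.of_uncurry_left hs (hsupp s) hr
      (by linarith [hst.2])
  · filter_upwards [hH', ae_restrict_mem measurableSet_Ioo] with s hs hst x
    have h := enorm_shifted_waveField_le (δ := δ) (ρ := ρ) hζ hκ hre hs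
      (by linarith [hst.2] : 0 ≤ t - s) x
    simpa [hr'] using h

/-- The constant of the estimate of one dyadic block. -/
def blockConst (F δ ρ β κ p σ Λ : ℝ) : ℝ≥0∞ :=
  ENNReal.ofReal (96 * (1 + 2 * Λ) * (kernelConst F δ ρ β ^ (σ / 2) *
    κ ^ (-(1 / p - σ / 4)) * DConst p ((1 - σ) / 4))) * bernsteinConst δ ρ ^ (1 - σ)

theorem block_estimate {F δ ρ β κ p σ Λ : ℝ} {r : ℝ≥0∞} (hF : 0 < F) (hF1 : F ≠ 1) (hδ : 0 < δ)
    (hρ : 0 < ρ) (hβ : β ≠ 0) (hκ : 0 < κ) (hp : 1 ≤ p) (hr : 4 < r)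
    (hσ : σ = 1 - 4 * (r⁻¹).toReal) (h4 : p * σ < 4) (hΛ : 0 ≤ Λ) {ζ : Space → ℂ}
    (hζ : Measurable ζ) (hre : ∀ ξ, (ζ ξ).re ≤ -κ)
    (hζΛ : ∀ ξ, ‖ζ ξ - modelSymbol F β κ ξ‖ ≤ Λ * κ)
    {G : Space → Vec} (hGm : StronglyMeasurable G) (hG : Integrable G)
    (hGs : ∀ ξ ∉ freqRegion δ ρ, G ξ = 0) {Hb Hl : ℝ → Space → Vec}
    (hbm : StronglyMeasurable (Function.uncurry Hb))
    (hb : ∀ᵐ s ∂volume.restrict (Set.Ioi 0), Integrable (Hb s))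
    (hbs : ∀ s, ∀ ξ ∉ freqRegion δ ρ, Hb s ξ = 0)
    (hlm : StronglyMeasurable (Function.uncurry Hl))
    (hl : ∀ᵐ s ∂volume.restrict (Set.Ioi 0), Integrable (Hl s))
    (hls : ∀ s, ∀ ξ ∉ freqRegion δ ρ, Hl s ξ = 0)
    (hl0 : p < 2 → ∀ᵐ s ∂volume.restrict (Set.Ioi 0), eLpNorm (Hl s) 2 volume = 0)
    {I : Set ℝ} (hIm : MeasurableSet I) (hI : I ⊆ Set.Ioi 0) {v : ℝ → Space → Vec}
    (hv : ∀ᵐ t ∂volume.restrict I, v t =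
      waveField (fun ξ => ζ ξ - κ) G t +
        ((fun x => ∫ s in Set.Ioo 0 t, waveField (fun ξ => ζ ξ - κ) (Hb s) (t - s) x) +
        fun x => ∫ s in Set.Ioo 0 t, waveField (fun ξ => ζ ξ - κ) (Hl s) (t - s) x)) :
    eLpNorm (fun t => eLpNorm (v t) r volume) (ENNReal.ofReal p) (volume.restrict I) ≤
      blockConst F δ ρ β κ p σ Λ * (eLpNorm G 2 volume +
        (∫⁻ s in Set.Ioi 0, eLpNorm (Hb s) 2 volume) +
        ENNReal.ofReal (1 / (2 * κ)) ^ (1 / 2 : ℝ) *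
          (∫⁻ s in Set.Ioi 0, eLpNorm (Hl s) 2 volume ^ (2 : ℝ)) ^ (1 / 2 : ℝ)) := by
  have hp0 : 0 < p := by linarith
  have hσ0 : 0 < σ := by rw [hσ]; linarith [inv_toReal_lt hr]
  have hσ1 : σ ≤ 1 := by rw [hσ]; linarith [ENNReal.toReal_nonneg (a := r⁻¹)]
  set A := bernsteinConst δ ρ with hA
  have hhom : ∀ {G : Space → Vec}, StronglyMeasurable G → Integrable G →
      (∀ ξ ∉ freqRegion δ ρ, G ξ = 0) →
      (∫⁻ t in Set.Ioi (0 : ℝ), majorant A σ κ ζ G t ^ p) ^ (1 / p) ≤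
        blockConst F δ ρ β κ p σ Λ * eLpNorm G 2 volume := fun h1 h2 h3 =>
    homogeneous_strichartz hF hF1 hδ hρ hβ hκ hp hσ0 hσ1 h4 hΛ hζ hre hζΛ h1 h2 h3 A
  have hmeas1 : ∀ t s : ℝ, s < t → ENNReal.ofReal (Real.exp (-κ * (t - s))) ≤ 1 := by
    intro t s hst
    rw [ENNReal.ofReal_le_one, Real.exp_le_one_iff]
    nlinarith
  have hMm : ∀ {H : ℝ → Space → Vec}, StronglyMeasurable (Function.uncurry H) →
      Measurable (Function.uncurry fun t s => majorant A σ κ ζ (H s) t) := fun hH =>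
    measurable_majorant_uncurry hζ hH A σ κ
  have hslice : ∀ {H : ℝ → Space → Vec}, StronglyMeasurable (Function.uncurry H) → ∀ s,
      StronglyMeasurable (H s) := fun hH s =>
    hH.of_uncurry_left
  have hem : Measurable fun z : ℝ × ℝ => ENNReal.ofReal (Real.exp (-κ * z.1)) := by fun_prop
  set X1 : ℝ → ℝ≥0∞ := fun t => majorant A σ κ ζ G t with hX1
  set X2 : ℝ → ℝ≥0∞ := fun t => ∫⁻ s in Set.Ioo 0 t, majorant A σ κ ζ (Hb s) (t - s) with hX2
  set X3 : ℝ → ℝ≥0∞ := fun t => ∫⁻ s in Set.Ioo 0 t,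
    ENNReal.ofReal (Real.exp (-κ * (t - s))) * majorant A σ κ ζ (Hl s) (t - s) with hX3
  have hX1m : Measurable X1 := by
    have h1 : StronglyMeasurable (Function.uncurry fun (_ : ℝ) => G) :=
      hGm.comp_measurable measurable_snd
    exact (hMm h1).of_uncurry_right (y := 0)
  have hX2m : Measurable X2 := measurable_duhamel (hMm hbm)
  have hX3m : Measurable X3 := measurable_duhamel
    (N := fun t s => ENNReal.ofReal (Real.exp (-κ * t)) * majorant A σ κ ζ (Hl s) t)
    (hem.mul (hMm hlm))
  have hX : ∀ᵐ t ∂volume.restrict I, eLpNorm (v t) r volume ≤ X1 t + (X2 t + X3 t) := by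
    filter_upwards [hv, ae_restrict_mem hIm] with t hvt ht
    have ht0 : 0 < t := hI ht
    have hm : Measurable fun ξ => ζ ξ - (κ : ℂ) := hζ.sub_const _
    have hr1 : 1 ≤ r := le_trans (by norm_num) hr.le
    have hwm : ∀ {H : ℝ → Space → Vec}, StronglyMeasurable (Function.uncurry H) →
        AEStronglyMeasurable (fun x => ∫ s in Set.Ioo 0 t,
          waveField (fun ξ => ζ ξ - κ) (H s) (t - s) x) volume := fun hH =>
      aestronglyMeasurable_duhamel hm hH t _
    have hGw := aestronglyMeasurable_waveField hm hGm t
    rw [hvt]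
    refine (eLpNorm_add_le hGw ((hwm hbm).add (hwm hlm)) hr1).trans (add_le_add ?_
      ((eLpNorm_add_le (hwm hbm) (hwm hlm) hr1).trans (add_le_add ?_ ?_)))
    · refine (eLpNorm_shifted_waveField_le hζ hκ.le hre hGm hG hGs hr ht0.le).trans ?_
      rw [← hσ]
      refine mul_le_of_le_one_left zero_le ?_
      simpa using hmeas1 t 0 ht0
    · refine (eLpNorm_duhamel_le hζ hκ.le hre hbm hb hbs hr t).trans ?_
      rw [← hσ]
      refine setLIntegral_mono' measurableSet_Ioo fun s hs => ?_
      exact mul_le_of_le_one_left zero_le (hmeas1 t s hs.2)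
    · refine (eLpNorm_duhamel_le hζ hκ.le hre hlm hl hls hr t).trans ?_
      rw [← hσ]
  have hpe : ENNReal.ofReal p ≠ 0 := by simpa using hp0
  rw [eLpNorm_eq_lintegral_rpow_enorm_toReal hpe ENNReal.ofReal_ne_top,
    ENNReal.toReal_ofReal hp0.le]
  simp only [enorm_eq_self]
  have h1 : (∫⁻ t in Set.Ioi (0 : ℝ), X1 t ^ p) ^ (1 / p) ≤
      blockConst F δ ρ β κ p σ Λ * eLpNorm G 2 volume := hhom hGm hG hGs
  have hL1 : ∀ {H : ℝ → Space → Vec}, StronglyMeasurable (Function.uncurry H) →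
      (∀ᵐ s ∂volume.restrict (Set.Ioi 0), Integrable (H s)) →
      (∀ s, ∀ ξ ∉ freqRegion δ ρ, H s ξ = 0) →
      (∫⁻ t in Set.Ioi (0 : ℝ), (∫⁻ s in Set.Ioo 0 t, majorant A σ κ ζ (H s) (t - s)) ^ p) ^ (1 / p)
        ≤ blockConst F δ ρ β κ p σ Λ * ∫⁻ s in Set.Ioi 0, eLpNorm (H s) 2 volume := by
    intro H hHm hH hHs
    refine (duhamel_minkowski (hMm hHm) hp).trans ?_
    rw [← lintegral_const_mul _ (measurable_eLpNorm_two hHm)]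
    refine lintegral_mono_ae ?_
    filter_upwards [hH] with s hs
    exact hhom (hslice hHm s) hs (hHs s)
  have h2 : (∫⁻ t in Set.Ioi (0 : ℝ), X2 t ^ p) ^ (1 / p) ≤
      blockConst F δ ρ β κ p σ Λ * ∫⁻ s in Set.Ioi 0, eLpNorm (Hb s) 2 volume :=
    hL1 hbm hb hbs
  have h3 : (∫⁻ t in Set.Ioi (0 : ℝ), X3 t ^ p) ^ (1 / p) ≤ blockConst F δ ρ β κ p σ Λ *
      (ENNReal.ofReal (1 / (2 * κ)) ^ (1 / 2 : ℝ) *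
        (∫⁻ s in Set.Ioi 0, eLpNorm (Hl s) 2 volume ^ (2 : ℝ)) ^ (1 / 2 : ℝ)) := by
    rcases lt_or_ge p 2 with hp2 | hp2
    · have h0 : ∫⁻ s in Set.Ioi 0, eLpNorm (Hl s) 2 volume = 0 := by
        rw [lintegral_eq_zero_iff (measurable_eLpNorm_two hlm)]
        exact hl0 hp2
      calc (∫⁻ t in Set.Ioi (0 : ℝ), X3 t ^ p) ^ (1 / p) ≤ _ := by
            refine ENNReal.rpow_le_rpow (lintegral_mono fun t => ENNReal.rpow_le_rpow
              (setLIntegral_mono' measurableSet_Ioo fun s hs => ?_) hp0.le) (by positivity)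
            exact mul_le_of_le_one_left zero_le (hmeas1 t s hs.2)
        _ ≤ _ := hL1 hlm hl hls
        _ ≤ _ := by rw [h0, mul_zero]; exact zero_le
    · refine (duhamel_minkowski_two (hMm hlm) hp2 hκ).trans ?_
      rw [mul_left_comm]
      gcongr
      calc (∫⁻ s in Set.Ioi (0 : ℝ), ((∫⁻ τ in Set.Ioi (0 : ℝ),
            majorant A σ κ ζ (Hl s) τ ^ p) ^ (1 / p)) ^ (2 : ℝ)) ^ (1 / 2 : ℝ)
          ≤ (∫⁻ s in Set.Ioi 0, (blockConst F δ ρ β κ p σ Λ * eLpNorm (Hl s) 2 volume) ^ (2 : ℝ)) ^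
            (1 / 2 : ℝ) := by
            refine ENNReal.rpow_le_rpow (lintegral_mono_ae ?_) (by positivity)
            filter_upwards [hl] with s hs
            exact ENNReal.rpow_le_rpow (hhom (hslice hlm s) hs (hls s)) (by norm_num)
        _ = _ := by
            simp only [ENNReal.mul_rpow_of_nonneg _ _ (by norm_num : (0 : ℝ) ≤ 2)]
            rw [lintegral_const_mul _ ((measurable_eLpNorm_two hlm).pow_const _),
              ENNReal.mul_rpow_of_nonneg _ _ (by norm_num), ← ENNReal.rpow_mul]
            norm_num
  calc (∫⁻ t in I, eLpNorm (v t) r volume ^ p) ^ (1 / p)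
      ≤ (∫⁻ t in I, (X1 t + (X2 t + X3 t)) ^ p) ^ (1 / p) := by
        refine ENNReal.rpow_le_rpow (lintegral_mono_ae ?_) (by positivity)
        filter_upwards [hX] with t ht
        exact ENNReal.rpow_le_rpow ht hp0.le
    _ ≤ (∫⁻ t in Set.Ioi (0 : ℝ), (X1 t + (X2 t + X3 t)) ^ p) ^ (1 / p) :=
        ENNReal.rpow_le_rpow (lintegral_mono_set hI) (by positivity)
    _ ≤ (∫⁻ t in Set.Ioi (0 : ℝ), X1 t ^ p) ^ (1 / p) +
        (∫⁻ t in Set.Ioi (0 : ℝ), (X2 t + X3 t) ^ p) ^ (1 / p) :=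
        ENNReal.lintegral_Lp_add_le hX1m.aemeasurable (hX2m.add hX3m).aemeasurable hp
    _ ≤ (∫⁻ t in Set.Ioi (0 : ℝ), X1 t ^ p) ^ (1 / p) +
        ((∫⁻ t in Set.Ioi (0 : ℝ), X2 t ^ p) ^ (1 / p) +
          (∫⁻ t in Set.Ioi (0 : ℝ), X3 t ^ p) ^ (1 / p)) := by
        gcongr
        exact ENNReal.lintegral_Lp_add_le hX2m.aemeasurable hX3m.aemeasurable hp
    _ ≤ _ := by
        rw [add_assoc, mul_add, mul_add]
        exact add_le_add h1 (add_le_add h2 h3)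

/-! ### The truncated dyadic blocks -/

/-- The symbol of `Δ̇ⱼ 𝒫_{r,R}`. -/
def blockSymbol (χ : ℝ → ℝ) (r R : ℝ) (j : ℤ) (ξ : Space) : ℝ :=
  dyadicSymbol χ j ξ * (χ (‖ξ‖ / R) * (1 - χ (|ξ 2| / r)))

/-- The frequencies of `Δ̇ⱼ 𝒫_{r,R}`. -/
def blockRegion (r R : ℝ) (j : ℤ) : Set Space :=
  freqRegion (3 * r / 4) (4 * R / 3) ∩ {ξ | 3 / 4 * (2 : ℝ) ^ j ≤ ‖ξ‖ ∧ ‖ξ‖ ≤ 8 / 3 * (2 : ℝ) ^ j}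

theorem measurableSet_blockRegion (r R : ℝ) (j : ℤ) : MeasurableSet (blockRegion r R j) :=
  (measurableSet_freqRegion _ _).inter
    ((measurableSet_le measurable_const measurable_norm).inter
      (measurableSet_le measurable_norm measurable_const))

theorem IsCutoff.nonneg {χ : ℝ → ℝ} (hχ : IsCutoff χ) {x : ℝ} (hx : 0 ≤ x) : 0 ≤ χ x := by
  rw [← hχ.eq_zero (max x (4 / 3)) (le_max_right _ _)]
  exact hχ.antitone hx (le_max_of_le_left hx) (le_max_left _ _)

theorem IsCutoff.le_one {χ : ℝ → ℝ} (hχ : IsCutoff χ) {x : ℝ} (hx : 0 ≤ x) : χ x ≤ 1 := by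
  rw [← hχ.eq_one 0 ⟨le_rfl, by norm_num⟩]
  exact hχ.antitone (Set.mem_Ici.2 le_rfl) hx hx

theorem IsCutoff.measurable {χ : ℝ → ℝ} (hχ : IsCutoff χ) : Measurable χ :=
  hχ.smooth.continuous.measurable

theorem measurable_blockSymbol {χ : ℝ → ℝ} (hχ : IsCutoff χ) (r R : ℝ) (j : ℤ) :
    Measurable (blockSymbol χ r R j) := by
  have := hχ.measurable
  unfold blockSymbol dyadicSymbol
  fun_prop

theorem abs_blockSymbol_le {χ : ℝ → ℝ} (hχ : IsCutoff χ) {r R : ℝ} (hr : 0 < r) (hR : 0 < R)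
    (j : ℤ) (ξ : Space) : |blockSymbol χ r R j ξ| ≤ 1 := by
  have b : ∀ {x : ℝ}, 0 ≤ x → 0 ≤ χ x ∧ χ x ≤ 1 := fun hx => ⟨hχ.nonneg hx, hχ.le_one hx⟩
  have h1 := b (by positivity : 0 ≤ (2 : ℝ) ^ (-j) * ‖ξ‖ / 2)
  have h2 := b (by positivity : 0 ≤ (2 : ℝ) ^ (-j) * ‖ξ‖)
  have h3 := b (by positivity : 0 ≤ ‖ξ‖ / R)
  have h4 := b (by positivity : 0 ≤ |ξ 2| / r)
  have a1 : |dyadicSymbol χ j ξ| ≤ 1 := by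
    rw [dyadicSymbol, abs_le]
    constructor <;> linarith
  have a2 : |χ (‖ξ‖ / R)| ≤ 1 := by rw [abs_le]; constructor <;> linarith
  have a3 : |1 - χ (|ξ 2| / r)| ≤ 1 := by rw [abs_le]; constructor <;> linarith
  rw [blockSymbol, abs_mul, abs_mul]
  exact mul_le_one₀ a1 (by positivity) (mul_le_one₀ a2 (abs_nonneg _) a3)

theorem blockSymbol_eq_zero {χ : ℝ → ℝ} (hχ : IsCutoff χ) {r R : ℝ} (hr : 0 < r) (hR : 0 < R)
    {j : ℤ} {ξ : Space} (hξ : ξ ∉ blockRegion r R j) : blockSymbol χ r R j ξ = 0 := by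
  have hj : (0 : ℝ) < 2 ^ j := by positivity
  have hjj : (2 : ℝ) ^ (-j) = ((2 : ℝ) ^ j)⁻¹ := zpow_neg _ _
  have hk := norm_nonneg ξ
  by_contra hne
  refine hξ ⟨⟨?_, ?_⟩, ?_, ?_⟩
  · by_contra hlt
    refine hne ?_
    rw [blockSymbol, hχ.eq_zero (‖ξ‖ / R), zero_mul, mul_zero]
    rw [le_div_iff₀ hR]
    linarith
  · by_contra hlt
    refine hne ?_
    rw [blockSymbol, hχ.eq_one (|ξ 2| / r), sub_self, mul_zero, mul_zero]
    refine ⟨by positivity, ?_⟩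
    rw [div_le_iff₀ hr]
    linarith
  · by_contra hlt
    refine hne ?_
    have h1 : (2 : ℝ) ^ (-j) * ‖ξ‖ ≤ 3 / 4 := by
      rw [hjj, inv_mul_le_iff₀ hj]
      linarith
    have h0 : 0 ≤ (2 : ℝ) ^ (-j) * ‖ξ‖ := by positivity
    rw [blockSymbol, dyadicSymbol, hχ.eq_one _ ⟨h0, h1⟩, hχ.eq_one _ ⟨by linarith, by linarith⟩,
      sub_self, zero_mul]
  · by_contra hlt
    refine hne ?_
    have h1 : 8 / 3 ≤ (2 : ℝ) ^ (-j) * ‖ξ‖ := by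
      rw [hjj, inv_mul_eq_div, le_div_iff₀ hj]
      linarith
    rw [blockSymbol, dyadicSymbol, hχ.eq_zero _ (by linarith), hχ.eq_zero _ (by linarith),
      sub_self, zero_mul]

theorem dyadicBlock_truncate (χ : ℝ → ℝ) (r R : ℝ) (j : ℤ) (g : Space → Vec) :
    dyadicBlock χ j (truncate χ r R g) =
      invFourier fun ξ => (blockSymbol χ r R j ξ : ℂ) • g ξ := by
  simp only [dyadicBlock, truncate, blockSymbol, smul_smul, Complex.ofReal_mul]

/-- The Fourier transform of `Δ̇ⱼ |D|^d P(D) 𝒫_{r,R} u`, for `g` that of `u`. -/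
def blockProj (χ : ℝ → ℝ) (r R d : ℝ) (j : ℤ) (P : Space → Matrix (Fin 4) (Fin 4) ℂ)
    (g : Space → Vec) (ξ : Space) : Vec :=
  ((blockSymbol χ r R j ξ * ‖ξ‖ ^ d : ℝ) : ℂ) • Matrix.toEuclideanLin (P ξ) (g ξ)

theorem dyadicBlock_derivProj (χ : ℝ → ℝ) (r R d : ℝ) (j : ℤ)
    (P : Space → Matrix (Fin 4) (Fin 4) ℂ) (g : Space → Vec) :
    dyadicBlock χ j (derivProj d P (truncate χ r R g)) =
      invFourier (blockProj χ r R d j P g) := by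
  rw [dyadicBlock]
  congr 1
  ext1 ξ
  simp only [blockProj, derivProj, truncate, blockSymbol, map_smul, smul_smul, Complex.ofReal_mul]
  congr 1
  ring

theorem blockProj_eq_zero {χ : ℝ → ℝ} (hχ : IsCutoff χ) {r R : ℝ} (hr : 0 < r) (hR : 0 < R)
    (d : ℝ) {j : ℤ} (P : Space → Matrix (Fin 4) (Fin 4) ℂ) (g : Space → Vec) {ξ : Space}
    (hξ : ξ ∉ blockRegion r R j) : blockProj χ r R d j P g ξ = 0 := by
  rw [blockProj, blockSymbol_eq_zero hχ hr hR hξ, zero_mul, Complex.ofReal_zero, zero_smul]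

/-- On the `j`-th annulus `|ξ|^d` is comparable with `2^{jd}`. -/
theorem norm_rpow_le_of_annulus {k N : ℝ} (d : ℝ) (hN : 0 < N) (h1 : 3 / 4 * N ≤ k)
    (h2 : k ≤ 8 / 3 * N) : k ^ d ≤ (8 / 3 : ℝ) ^ |d| * N ^ d := by
  have hk : 0 < k := by nlinarith
  have : k ^ d = (k / N) ^ d * N ^ d := by
    rw [← Real.mul_rpow (by positivity) hN.le, div_mul_cancel₀ _ hN.ne']
  rw [this]
  refine mul_le_mul_of_nonneg_right ?_ (by positivity)
  have h3 : 3 / 4 ≤ k / N := by rwa [le_div_iff₀ hN]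
  have h4 : k / N ≤ 8 / 3 := by rwa [div_le_iff₀ hN]
  rcases le_total 0 d with hd | hd
  · rw [abs_of_nonneg hd]
    exact Real.rpow_le_rpow (by positivity) h4 hd
  · rw [abs_of_nonpos hd, ← neg_neg d, Real.rpow_neg (by positivity), neg_neg,
      ← Real.inv_rpow (by positivity)]
    refine Real.rpow_le_rpow (by positivity) ?_ (by linarith)
    rw [inv_le_comm₀ (by positivity) (by norm_num)]
    linarith

theorem norm_blockProj_le {χ : ℝ → ℝ} (hχ : IsCutoff χ) {r R : ℝ} (hr : 0 < r) (hR : 0 < R)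
    (d : ℝ) (j : ℤ) {Q : Space → Matrix (Fin 4) (Fin 4) ℂ} {K : ℝ}
    (hQ : ∀ ξ v, ‖Matrix.toEuclideanLin (Q ξ) v‖ ≤ K * ‖v‖) (g : Space → Vec) (ξ : Space) :
    ‖blockProj χ r R d j Q g ξ‖ ≤ K * (8 / 3 : ℝ) ^ |d| * (2 : ℝ) ^ ((j : ℝ) * d) *
      ‖(blockSymbol χ r R j ξ : ℂ) • g ξ‖ := by
  by_cases hξ : ξ ∈ blockRegion r R j
  · have hk := norm_rpow_le_of_annulus d (by positivity : (0 : ℝ) < 2 ^ j) hξ.2.1 hξ.2.2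
    rw [← Real.rpow_intCast, ← Real.rpow_mul (by norm_num)] at hk
    rw [blockProj, norm_smul, norm_smul, Complex.norm_real, Complex.norm_real, norm_mul,
      Real.norm_of_nonneg (Real.rpow_nonneg (norm_nonneg ξ) d)]
    calc ‖blockSymbol χ r R j ξ‖ * ‖ξ‖ ^ d * ‖Matrix.toEuclideanLin (Q ξ) (g ξ)‖
        ≤ ‖blockSymbol χ r R j ξ‖ * ((8 / 3 : ℝ) ^ |d| * (2 : ℝ) ^ ((j : ℝ) * d)) *
          (K * ‖g ξ‖) := by
          gcongr
          exact hQ ξ (g ξ)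
      _ = _ := by ring
  · rw [blockProj_eq_zero hχ hr hR d Q g hξ, blockSymbol_eq_zero hχ hr hR hξ]
    simp

theorem stronglyMeasurable_blockProj {χ : ℝ → ℝ} (hχ : IsCutoff χ) (r R d : ℝ) (j : ℤ)
    {Q : Space → Matrix (Fin 4) (Fin 4) ℂ} (hQ : ∀ i l, Measurable fun ξ => Q ξ i l)
    {U : ℝ → Space → Vec} (hU : StronglyMeasurable (Function.uncurry U)) :
    StronglyMeasurable (Function.uncurry fun s => blockProj χ r R d j Q (U s)) := by
  have h1 : StronglyMeasurable fun z : ℝ × Space =>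
      Matrix.toEuclideanLin (Q z.2) (Function.uncurry U z) :=
    stronglyMeasurable_toEuclideanLin (fun i l => (hQ i l).comp measurable_snd) hU
  have hb : Measurable fun z : ℝ × Space => blockSymbol χ r R j z.2 :=
    (measurable_blockSymbol hχ r R j).comp measurable_snd
  have h2 : StronglyMeasurable fun z : ℝ × Space =>
      ((blockSymbol χ r R j z.2 * ‖z.2‖ ^ d : ℝ) : ℂ) := by
    refine (Complex.measurable_ofReal.comp ?_).stronglyMeasurable
    exact hb.mul (by fun_prop)
  exact h2.smul h1

/-! ### Integrability of the blocks -/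

theorem blockRegion_subset_closedBall (r R : ℝ) (j : ℤ) :
    blockRegion r R j ⊆ Metric.closedBall 0 (4 * R / 3) :=
  Set.inter_subset_left.trans (freqRegion_subset_closedBall _ _)

theorem norm_blockSymbol_smul_le {χ : ℝ → ℝ} (hχ : IsCutoff χ) {r R : ℝ} (hr : 0 < r) (hR : 0 < R)
    (j : ℤ) (g : Space → Vec) (ξ : Space) :
    ‖(blockSymbol χ r R j ξ : ℂ) • g ξ‖ ≤ ‖g ξ‖ := by
  rw [norm_smul, Complex.norm_real, Real.norm_eq_abs]
  exact mul_le_of_le_one_left (norm_nonneg _) (abs_blockSymbol_le hχ hr hR j ξ)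

theorem integrable_of_bound_of_support {X : Type*} [MeasurableSpace X] {μ : Measure X} {A : Set X}
    {U W : X → Vec} {C : ℝ} (hW : AEStronglyMeasurable W μ) (hU : IntegrableOn U A μ)
    (hb : ∀ x, ‖W x‖ ≤ C * ‖U x‖) (h0 : ∀ x ∉ A, W x = 0) : Integrable W μ := by
  have h1 : IntegrableOn W A μ := (hU.norm.const_mul C).mono' hW.restrict
    (Filter.Eventually.of_forall hb)
  exact h1.integrable_of_forall_notMem_eq_zero h0

theorem integrable_blockSymbol_smul {χ : ℝ → ℝ} (hχ : IsCutoff χ) {r R : ℝ} (hr : 0 < r)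
    (hR : 0 < R) (j : ℤ) {g : Space → Vec} (hg : LocallyIntegrable g volume) :
    Integrable fun ξ => (blockSymbol χ r R j ξ : ℂ) • g ξ := by
  refine integrable_of_bound_of_support (C := 1) (A := Metric.closedBall 0 (4 * R / 3)) (U := g) ?_
    (hg.integrableOn_isCompact (isCompact_closedBall _ _)) (fun ξ => ?_) fun ξ hξ => ?_
  · have h : Measurable fun ξ => (blockSymbol χ r R j ξ : ℂ) :=
      Complex.measurable_ofReal.comp (measurable_blockSymbol hχ r R j)
    exact h.aestronglyMeasurable.smul hg.aestronglyMeasurable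
  · rw [one_mul]
    exact norm_blockSymbol_smul_le hχ hr hR j g ξ
  · rw [blockSymbol_eq_zero hχ hr hR fun h => hξ (blockRegion_subset_closedBall r R j h)]
    simp

/-- `2^{jd} ‖Δ̇ⱼ 𝒫_{r,R} u‖_{L²}`, for `g` the Fourier transform of `u`. -/
def blockNorm (χ : ℝ → ℝ) (r R d : ℝ) (j : ℤ) (g : Space → Vec) : ℝ≥0∞ :=
  ENNReal.ofReal ((2 : ℝ) ^ ((j : ℝ) * d)) *
    eLpNorm (dyadicBlock χ j (truncate χ r R g)) 2 volume

theorem blockNorm_eq {χ : ℝ → ℝ} (hχ : IsCutoff χ) {r R : ℝ} (hr : 0 < r) (hR : 0 < R) (d : ℝ)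
    (j : ℤ) {g : Space → Vec} (hg : LocallyIntegrable g volume) :
    blockNorm χ r R d j g = ENNReal.ofReal ((2 : ℝ) ^ ((j : ℝ) * d)) * (plancherelConst *
      eLpNorm (fun ξ => (blockSymbol χ r R j ξ : ℂ) • g ξ) 2 volume) := by
  rw [blockNorm, dyadicBlock_truncate,
    eLpNorm_invFourier_two (integrable_blockSymbol_smul hχ hr hR j hg)]

/-- The constant of the `L²` bound of a block of the projected field. -/
def blockProjConst (F d : ℝ) : ℝ≥0∞ :=
  ENNReal.ofReal (projConst F * (8 / 3 : ℝ) ^ |d|) * plancherelConst⁻¹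

theorem eLpNorm_blockProj_le {χ : ℝ → ℝ} (hχ : IsCutoff χ) {F r R : ℝ} (hF : 0 < F) (hr : 0 < r)
    (hR : 0 < R) (d : ℝ) (j : ℤ) {Q : Space → Matrix (Fin 4) (Fin 4) ℂ}
    (hQ : ∀ ξ v, ‖Matrix.toEuclideanLin (Q ξ) v‖ ≤ projConst F * ‖v‖) {g : Space → Vec}
    (hg : LocallyIntegrable g volume) :
    eLpNorm (blockProj χ r R d j Q g) 2 volume ≤
      blockProjConst F d * blockNorm χ r R d j g := by
  have hK := projConst_pos hF
  refine (eLpNorm_le_mul_eLpNorm_of_ae_le_mul (Filter.Eventually.of_forall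
    (norm_blockProj_le hχ hr hR d j hQ g)) 2).trans (le_of_eq ?_)
  rw [blockNorm_eq hχ hr hR d j hg, ENNReal.ofReal_mul (by positivity), blockProjConst]
  calc _ = ENNReal.ofReal (projConst F * (8 / 3 : ℝ) ^ |d|) *
        (ENNReal.ofReal ((2 : ℝ) ^ ((j : ℝ) * d)) * ((plancherelConst⁻¹ * plancherelConst) *
          eLpNorm (fun ξ => (blockSymbol χ r R j ξ : ℂ) • g ξ) 2 volume)) := by
        rw [ENNReal.inv_mul_cancel plancherelConst_ne_zero plancherelConst_ne_top, one_mul,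
          mul_assoc]
    _ = _ := by ring

theorem norm_blockProj_le_norm {χ : ℝ → ℝ} (hχ : IsCutoff χ) {r R : ℝ} (hr : 0 < r) (hR : 0 < R)
    (d : ℝ) (j : ℤ) {Q : Space → Matrix (Fin 4) (Fin 4) ℂ} {K : ℝ} (hK : 0 ≤ K)
    (hQ : ∀ ξ v, ‖Matrix.toEuclideanLin (Q ξ) v‖ ≤ K * ‖v‖) (g : Space → Vec) (ξ : Space) :
    ‖blockProj χ r R d j Q g ξ‖ ≤ K * (8 / 3 : ℝ) ^ |d| * (2 : ℝ) ^ ((j : ℝ) * d) * ‖g ξ‖ :=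
  (norm_blockProj_le hχ hr hR d j hQ g ξ).trans (mul_le_mul_of_nonneg_left
    (norm_blockSymbol_smul_le hχ hr hR j g ξ) (by positivity))

theorem integrable_duhamel {ζ : Space → ℂ} (hζ : Measurable ζ) (hre : ∀ ξ, (ζ ξ).re ≤ 0)
    {H : ℝ → Space → Vec} {t : ℝ}
    (hInt : IntegrableOn (Function.uncurry H) (Set.Ioo 0 t ×ˢ Set.univ)) :
    Integrable fun ξ => ∫ s in Set.Ioo 0 t, Complex.exp ((t - s : ℝ) * ζ ξ) • H s ξ := by
  have h0 : Integrable (Function.uncurry H) ((volume.restrict (Set.Ioo 0 t)).prod volume) := by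
    rw [IntegrableOn, Measure.volume_eq_prod, ← Measure.prod_restrict, Measure.restrict_univ]
      at hInt
    exact hInt
  have hm : Measurable fun z : ℝ × Space => Complex.exp ((t - z.1 : ℝ) * ζ z.2) := by
    have := hζ.comp (measurable_snd : Measurable (Prod.snd : ℝ × Space → Space))
    have h2 : Measurable fun z : ℝ × Space => ((t - z.1 : ℝ) : ℂ) :=
      Complex.measurable_ofReal.comp (by fun_prop)
    exact Complex.measurable_exp.comp (h2.mul this)
  have h1 : Integrable (fun z : ℝ × Space => Complex.exp ((t - z.1 : ℝ) * ζ z.2) • H z.1 z.2)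
      ((volume.restrict (Set.Ioo 0 t)).prod volume) := by
    refine h0.bdd_smul 1 hm.aestronglyMeasurable ?_
    have h2 : ∀ᵐ z ∂((volume.restrict (Set.Ioo 0 t)).prod (volume : Measure Space)),
        z.1 ∈ Set.Ioo 0 t :=
      Measure.quasiMeasurePreserving_fst.ae (ae_restrict_mem measurableSet_Ioo)
    filter_upwards [h2] with z hz
    exact norm_exp_mul_le_one (hre z.2) (by linarith [hz.2])
  exact h1.integral_prod_right

/-- The part of the forcing in the `j`-th block, in the eigenspace, on the time interval `I`. -/
def blockForcing (χ : ℝ → ℝ) (r R d : ℝ) (j : ℤ) (Q : Space → Matrix (Fin 4) (Fin 4) ℂ) (I : Set ℝ)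
    (U : ℝ → Space → Vec) (s : ℝ) (ξ : Space) : Vec :=
  I.indicator (fun s => blockProj χ r R d j Q (U s) ξ) s

section

variable {χ : ℝ → ℝ} {F r R d : ℝ} {j : ℤ} {Q : Space → Matrix (Fin 4) (Fin 4) ℂ} {T : ℝ≥0∞}
  {u : ℝ → Field} {U : ℝ → Space → Vec}

theorem blockForcing_of_mem {I : Set ℝ} {s : ℝ} (hs : s ∈ I) :
    blockForcing χ r R d j Q I U s = blockProj χ r R d j Q (U s) := by
  ext1 ξ
  simp only [blockForcing, Set.indicator_of_mem hs]

theorem blockForcing_of_notMem {I : Set ℝ} {s : ℝ} (hs : s ∉ I) :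
    blockForcing χ r R d j Q I U s = 0 := by
  ext1 ξ
  simp only [blockForcing, Set.indicator_of_notMem hs, Pi.zero_apply]

theorem stronglyMeasurable_blockForcing (hχ : IsCutoff χ)
    (hQ : ∀ i l, Measurable fun ξ => Q ξ i l) (hU : IsRepresentative T u U) :
    StronglyMeasurable (Function.uncurry (blockForcing χ r R d j Q (timeInterval T) U)) := by
  have h : Function.uncurry (blockForcing χ r R d j Q (timeInterval T) U) =
      (timeInterval T ×ˢ (Set.univ : Set Space)).indicator
        (Function.uncurry fun s => blockProj χ r R d j Q (U s)) := by
    ext1 ⟨s, ξ⟩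
    by_cases hs : s ∈ timeInterval T
    · rw [Set.indicator_of_mem (Set.mk_mem_prod hs (Set.mem_univ _))]
      simp only [Function.uncurry, blockForcing_of_mem hs]
    · rw [Set.indicator_of_notMem fun h => hs h.1]
      simp only [Function.uncurry, blockForcing_of_notMem hs, Pi.zero_apply]
  rw [h]
  exact (stronglyMeasurable_blockProj hχ r R d j hQ hU.stronglyMeasurable).indicator
    ((measurableSet_timeInterval T).prod MeasurableSet.univ)

theorem blockForcing_eq_zero (hχ : IsCutoff χ) (hr : 0 < r) (hR : 0 < R) {I : Set ℝ} (s : ℝ)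
    {ξ : Space} (hξ : ξ ∉ blockRegion r R j) : blockForcing χ r R d j Q I U s ξ = 0 := by
  by_cases hs : s ∈ I
  · rw [blockForcing_of_mem hs, blockProj_eq_zero hχ hr hR d Q _ hξ]
  · rw [blockForcing_of_notMem hs, Pi.zero_apply]

theorem integrableOn_blockForcing (hχ : IsCutoff χ) (hF : 0 < F) (hr : 0 < r) (hR : 0 < R)
    (hQm : ∀ i l, Measurable fun ξ => Q ξ i l)
    (hQ : ∀ ξ v, ‖Matrix.toEuclideanLin (Q ξ) v‖ ≤ projConst F * ‖v‖)
    (hU : IsRepresentative T u U) {t : ℝ} (ht : t ∈ timeInterval T) :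
    IntegrableOn (Function.uncurry (blockForcing χ r R d j Q (timeInterval T) U))
      (Set.Ioo 0 t ×ˢ Set.univ) := by
  refine integrable_of_bound_of_support (U := Function.uncurry U)
    (A := Set.univ ×ˢ Metric.closedBall (0 : Space) (4 * R / 3))
    (C := projConst F * (8 / 3 : ℝ) ^ |d| * (2 : ℝ) ^ ((j : ℝ) * d))
    (stronglyMeasurable_blockForcing hχ hQm hU).aestronglyMeasurable ?_ ?_ ?_
  · rw [IntegrableOn, Measure.restrict_restrict (MeasurableSet.univ.prod measurableSet_closedBall),
      Set.prod_inter_prod, Set.univ_inter, Set.inter_univ]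
    exact hU.integrableOn t ht _ (isCompact_closedBall _ _)
  · rintro ⟨s, ξ⟩
    have hK := projConst_pos hF
    simp only [Function.uncurry]
    by_cases hs : s ∈ timeInterval T
    · rw [blockForcing_of_mem hs]
      exact norm_blockProj_le_norm hχ hr hR d j hK.le hQ (U s) ξ
    · rw [blockForcing_of_notMem hs, Pi.zero_apply, norm_zero]
      positivity
  · rintro ⟨s, ξ⟩ h
    exact blockForcing_eq_zero hχ hr hR s fun h' =>
      h ⟨Set.mem_univ _, blockRegion_subset_closedBall r R j h'⟩

theorem ae_blockForcing_eq (hU : IsRepresentative T u U) :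
    ∀ᵐ s ∂volume.restrict (timeInterval T),
      blockForcing χ r R d j Q (timeInterval T) U s =ᵐ[volume]
        blockProj χ r R d j Q (u s).hat := by
  filter_upwards [hU.ae_time, ae_restrict_mem (measurableSet_timeInterval T)] with s h1 hs
  rw [blockForcing_of_mem hs]
  filter_upwards [h1] with ξ hξ
  rw [blockProj, blockProj, hξ]

theorem setLIntegral_Ioi_timeInterval {Φ : ℝ → ℝ≥0∞} (h0 : ∀ s ∉ timeInterval T, Φ s = 0) :
    ∫⁻ s in Set.Ioi 0, Φ s = ∫⁻ s in timeInterval T, Φ s := by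
  rw [← lintegral_indicator measurableSet_Ioi, ← lintegral_indicator (measurableSet_timeInterval T)]
  refine lintegral_congr fun s => ?_
  by_cases hs : s ∈ timeInterval T
  · rw [Set.indicator_of_mem hs, Set.indicator_of_mem (s := Set.Ioi 0) hs.1]
  · rw [Set.indicator_of_notMem hs, Set.indicator_apply]
    split_ifs
    · exact h0 s hs
    · rfl

theorem integrable_blockForcing (hχ : IsCutoff χ) (hF : 0 < F) (hr : 0 < r) (hR : 0 < R)
    (hQm : ∀ i l, Measurable fun ξ => Q ξ i l)
    (hQ : ∀ ξ v, ‖Matrix.toEuclideanLin (Q ξ) v‖ ≤ projConst F * ‖v‖)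
    (hU : IsRepresentative T u U) :
    ∀ᵐ s ∂volume.restrict (Set.Ioi 0),
      Integrable (blockForcing χ r R d j Q (timeInterval T) U s) := by
  have h := (ae_restrict_iff' (measurableSet_timeInterval T)).1 hU.ae_time
  refine ae_restrict_of_ae ?_
  filter_upwards [h] with s hs
  by_cases hsT : s ∈ timeInterval T
  · rw [blockForcing_of_mem hsT]
    refine integrable_of_bound_of_support (U := U s) (A := Metric.closedBall 0 (4 * R / 3))
      ?_ ?_ (norm_blockProj_le_norm hχ hr hR d j (projConst_pos hF).le hQ (U s)) ?_
    · have h2 := stronglyMeasurable_blockProj hχ r R d j hQm hU.stronglyMeasurable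
      exact (h2.of_uncurry_left (x := s)).aestronglyMeasurable
    · exact (((u s).locallyIntegrable_hat.integrableOn_isCompact
        (isCompact_closedBall _ _))).congr (ae_restrict_of_ae (hs hsT))
    · exact fun ξ hξ => blockProj_eq_zero hχ hr hR d Q _ fun h' =>
        hξ (blockRegion_subset_closedBall r R j h')
  · rw [blockForcing_of_notMem hsT]
    exact integrable_zero _ _ _

theorem ae_eLpNorm_blockForcing_le (hχ : IsCutoff χ) (hF : 0 < F) (hr : 0 < r) (hR : 0 < R)
    (hQ : ∀ ξ v, ‖Matrix.toEuclideanLin (Q ξ) v‖ ≤ projConst F * ‖v‖)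
    (hU : IsRepresentative T u U) :
    ∀ᵐ s ∂volume.restrict (timeInterval T),
      eLpNorm (blockForcing χ r R d j Q (timeInterval T) U s) 2 volume ≤
        blockProjConst F d * blockNorm χ r R d j (u s).hat := by
  filter_upwards [ae_blockForcing_eq (χ := χ) (r := r) (R := R) (d := d) (j := j) (Q := Q) hU]
    with s hs
  rw [eLpNorm_congr_ae hs]
  exact eLpNorm_blockProj_le hχ hF hr hR d j hQ (u s).locallyIntegrable_hat

end

/-! ### The blocks of the solution -/

/-- The damping rate used on the `j`-th block. -/
def blockRate (ν ν' : ℝ) (j : ℤ) : ℝ := min ν ν' * ((2 : ℝ) ^ j) ^ 2 / 4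

/-- A bound for the ratio of the perturbation of the wave symbol and the damping rate. -/
def viscosityRatio (ν ν' : ℝ) : ℝ := 86 * ((ν + ν') / min ν ν') + 2

theorem blockRate_pos {ν ν' : ℝ} (hν : 0 < ν) (hν' : 0 < ν') (j : ℤ) : 0 < blockRate ν ν' j := by
  have : 0 < min ν ν' := lt_min hν hν'
  rw [blockRate]
  positivity

theorem mem_waveRegime_of_mem_blockRegion {F ν ν' ε r R : ℝ} {j : ℤ} (hε : 0 < ε) (hr : 0 < r)
    (hsmall : ε * |ν' - ν| * (4 * R / 3) ^ 2 ≤ min 1 F⁻¹ / 10) {ξ : Space}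
    (hξ : ξ ∈ blockRegion r R j) : ξ ∈ waveRegime F ν ν' ε := by
  obtain ⟨⟨h1, h2⟩, -⟩ := hξ
  constructor
  · rintro rfl
    simp at h2
    linarith
  · rw [viscosityGap, abs_mul, abs_mul, abs_of_pos hε, abs_of_nonneg (sq_nonneg ‖ξ‖)]
    refine le_trans ?_ hsmall
    gcongr

open Classical in
/-- The symbol of the evolution on the `j`-th block, extended to all frequencies. -/
def extendedSymbol (F ν ν' β r R : ℝ) (j : ℤ) (z : Space → ℂ) (ξ : Space) : ℂ :=
  if ξ ∈ blockRegion r R j then z ξ + blockRate ν ν' j else modelSymbol F β (blockRate ν ν' j) ξ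

section

variable {F ν ν' β r R : ℝ} {j : ℤ} {z : Space → ℂ}

theorem measurable_extendedSymbol (hz : Measurable z) :
    Measurable (extendedSymbol F ν ν' β r R j z) := by
  classical
  exact Measurable.ite (measurableSet_blockRegion r R j) (hz.add_const _)
    (measurable_modelSymbol F β _)

theorem re_extendedSymbol_le (hν : 0 < ν) (hν' : 0 < ν')
    (hz : ∀ ξ ∈ blockRegion r R j, (z ξ).re ≤ -(min ν ν' * ‖ξ‖ ^ 2)) (ξ : Space) :
    (extendedSymbol F ν ν' β r R j z ξ).re ≤ -blockRate ν ν' j := by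
  have hm : 0 < min ν ν' := lt_min hν hν'
  rw [extendedSymbol]
  split_ifs with h
  · rw [Complex.add_re, Complex.ofReal_re]
    have h1 := hz ξ h
    have h2 : (3 / 4 * (2 : ℝ) ^ j) ^ 2 ≤ ‖ξ‖ ^ 2 := pow_le_pow_left₀ (by positivity) h.2.1 2
    have h3 := mul_le_mul_of_nonneg_left h2 hm.le
    have h4 : 0 < min ν ν' * ((2 : ℝ) ^ j) ^ 2 := by positivity
    rw [mul_pow] at h3
    rw [blockRate]
    nlinarith
  · rw [re_modelSymbol]

theorem norm_extendedSymbol_sub_le (hν : 0 < ν) (hν' : 0 < ν')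
    (hz : ∀ ξ ∈ blockRegion r R j,
      ‖z ξ - Complex.I * (β * wavePhase F ξ : ℝ)‖ ≤ 3 * (ν + ν') * ‖ξ‖ ^ 2) (ξ : Space) :
    ‖extendedSymbol F ν ν' β r R j z ξ - modelSymbol F β (blockRate ν ν' j) ξ‖ ≤
      viscosityRatio ν ν' * blockRate ν ν' j := by
  have hm : 0 < min ν ν' := lt_min hν hν'
  have hκ := blockRate_pos hν hν' j
  rw [extendedSymbol]
  split_ifs with h
  · have e : z ξ + blockRate ν ν' j - modelSymbol F β (blockRate ν ν' j) ξ =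
        (z ξ - Complex.I * (β * wavePhase F ξ : ℝ)) + ((2 * blockRate ν ν' j : ℝ) : ℂ) := by
      rw [modelSymbol]
      push_cast
      ring
    rw [e]
    refine (norm_add_le _ _).trans ?_
    rw [Complex.norm_real, Real.norm_of_nonneg (by positivity)]
    have h1 := hz ξ h
    have h2 : ‖ξ‖ ^ 2 ≤ (8 / 3 * (2 : ℝ) ^ j) ^ 2 := pow_le_pow_left₀ (norm_nonneg _) h.2.2 2
    have h3 : 3 * (ν + ν') * ‖ξ‖ ^ 2 ≤ 3 * (ν + ν') * (8 / 3 * (2 : ℝ) ^ j) ^ 2 := by gcongr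
    have h4 : 3 * (ν + ν') * (8 / 3 * (2 : ℝ) ^ j) ^ 2 ≤
        86 * ((ν + ν') / min ν ν') * blockRate ν ν' j := by
      have : 86 * ((ν + ν') / min ν ν') * blockRate ν ν' j =
          86 / 4 * ((ν + ν') * ((2 : ℝ) ^ j) ^ 2) := by
        rw [blockRate]
        field_simp
      rw [this]
      have h5 : 0 ≤ (ν + ν') * ((2 : ℝ) ^ j) ^ 2 := by positivity
      nlinarith
    rw [viscosityRatio, add_mul]
    linarith
  · rw [sub_self, norm_zero]
    have : 0 ≤ viscosityRatio ν ν' := by rw [viscosityRatio]; positivity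
    positivity

end

theorem dyadic_block_bound {χ : ℝ → ℝ} (hχ : IsCutoff χ) {F ν ν' ε r R p σ : ℝ} {b : ℝ≥0∞}
    (hF : 0 < F) (hF1 : F ≠ 1) (hν : 0 < ν) (hν' : 0 < ν') (hε : 0 < ε) (hr : 0 < r) (hR : 0 < R)
    (hsmall : ε * |ν' - ν| * (4 * R / 3) ^ 2 ≤ min 1 F⁻¹ / 10) (hp : 1 ≤ p) (hb : 4 < b)
    (hσ : σ = 1 - 4 * (b⁻¹).toReal) (h4 : p * σ < 4) (d : ℝ) (j : ℤ) {T : ℝ≥0∞} {f₀ : Field}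
    {Fb Fl f : ℝ → Field} (hFb : LocIntegrableInTime T Fb) (hFl : LocIntegrableInTime T Fl)
    (hFl0 : p < 2 → ∀ᵐ t ∂volume.restrict (timeInterval T), (Fl t).hat =ᵐ[volume] 0)
    (hf : IsSolution F ν ν' ε T f₀ Fb Fl f) {P : Space → Matrix (Fin 4) (Fin 4) ℂ}
    (hP : P ∈ ({proj₃ F ν ν' ε, proj₄ F ν ν' ε} : Set (Space → Matrix (Fin 4) (Fin 4) ℂ))) :
    eLpNorm (fun t => eLpNorm (dyadicBlock χ j (derivProj d P (truncate χ r R (f t).hat))) b volume)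
        (ENNReal.ofReal p) (volume.restrict (timeInterval T)) ≤
      blockConst F (3 * r / 4) (4 * R / 3) ε⁻¹ (blockRate ν ν' j) p σ (viscosityRatio ν ν') *
        blockProjConst F d * (blockNorm χ r R d j f₀.hat +
          (∫⁻ s in timeInterval T, blockNorm χ r R d j (Fb s).hat) +
          ENNReal.ofReal (1 / (2 * blockRate ν ν' j)) ^ (1 / 2 : ℝ) *
            (∫⁻ s in timeInterval T, blockNorm χ r R d j (Fl s).hat ^ (2 : ℝ)) ^ (1 / 2 : ℝ)) := by
  obtain ⟨Ub, hUb⟩ := hFb.exists_representative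
  obtain ⟨Ul, hUl⟩ := hFl.exists_representative
  obtain ⟨s, z, Q, hs, hzm, hQm, hQ, hdata⟩ := exists_projector_data hF hν hν' hε hP
  set I := timeInterval T with hI
  have hIm : MeasurableSet I := measurableSet_timeInterval T
  have hI0 : I ⊆ Set.Ioi 0 := fun t ht => ht.1
  set κ := blockRate ν ν' j with hκdef
  have hκ : 0 < κ := blockRate_pos hν hν' j
  have hε' : 0 < ε⁻¹ := inv_pos.2 hε
  set β := s * ε⁻¹ with hβdef
  have hβabs : |β| = |ε⁻¹| := by rw [hβdef, abs_mul, hs, one_mul]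
  have hβ : β ≠ 0 := by
    rw [← abs_pos, hβabs]
    positivity
  have hkc : kernelConst F (3 * r / 4) (4 * R / 3) β =
      kernelConst F (3 * r / 4) (4 * R / 3) ε⁻¹ := by
    rw [kernelConst, kernelConst, hβabs]
  have hreg : ∀ ξ ∈ blockRegion r R j, ξ ∈ waveRegime F ν ν' ε := fun ξ hξ =>
    mem_waveRegime_of_mem_blockRegion hε hr hsmall hξ
  set ζ := extendedSymbol F ν ν' β r R j z with hζdef
  have hζm : Measurable ζ := measurable_extendedSymbol hzm
  have hre : ∀ ξ, (ζ ξ).re ≤ -κ := re_extendedSymbol_le hν hν' fun ξ hξ => (hdata ξ (hreg ξ hξ)).2.2.1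
  have hζΛ : ∀ ξ, ‖ζ ξ - modelSymbol F β κ ξ‖ ≤ viscosityRatio ν ν' * κ :=
    norm_extendedSymbol_sub_le hν hν' fun ξ hξ => (hdata ξ (hreg ξ hξ)).2.2.2
  have hζz : ∀ ξ ∈ blockRegion r R j, ζ ξ - κ = z ξ := by
    intro ξ hξ
    rw [hζdef, extendedSymbol, if_pos hξ, add_sub_cancel_right]
  have hζ'm : Measurable fun ξ => ζ ξ - (κ : ℂ) := hζm.sub_const _
  have hζ're : ∀ ξ, (ζ ξ - (κ : ℂ)).re ≤ 0 := fun ξ => by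
    rw [Complex.sub_re, Complex.ofReal_re]
    linarith [hre ξ]
  have hΛ : 0 ≤ viscosityRatio ν ν' := by
    have : 0 < min ν ν' := lt_min hν hν'
    rw [viscosityRatio]
    positivity
  have hsub : ∀ {ξ}, ξ ∉ freqRegion (3 * r / 4) (4 * R / 3) → ξ ∉ blockRegion r R j :=
    fun h h' => h h'.1
  have hg0 : AEStronglyMeasurable f₀.hat volume := f₀.locallyIntegrable_hat.aestronglyMeasurable
  set G₀ := hg0.mk f₀.hat with hG₀
  have hG₀m : StronglyMeasurable G₀ := hg0.stronglyMeasurable_mk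
  have hG₀e : f₀.hat =ᵐ[volume] G₀ := hg0.ae_eq_mk
  set G := blockProj χ r R d j Q G₀ with hG
  have hGe : G =ᵐ[volume] blockProj χ r R d j Q f₀.hat := by
    filter_upwards [hG₀e] with ξ hξ
    rw [hG, blockProj, blockProj, hξ]
  have hGm : StronglyMeasurable G := by
    have h1 : StronglyMeasurable (Function.uncurry fun (_ : ℝ) => G₀) :=
      hG₀m.comp_measurable measurable_snd
    exact (stronglyMeasurable_blockProj hχ r R d j hQm h1).of_uncurry_left (x := 0)
  have hGi : Integrable G := by
    refine integrable_of_bound_of_support (U := G₀) (A := Metric.closedBall 0 (4 * R / 3))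
      hGm.aestronglyMeasurable ?_
      (norm_blockProj_le_norm hχ hr hR d j (projConst_pos hF).le hQ G₀) ?_
    · exact (f₀.locallyIntegrable_hat.integrableOn_isCompact
        (isCompact_closedBall _ _)).congr (ae_restrict_of_ae hG₀e)
    · exact fun ξ hξ => blockProj_eq_zero hχ hr hR d Q _ fun h' =>
        hξ (blockRegion_subset_closedBall r R j h')
  set Hb := blockForcing χ r R d j Q I Ub with hHb
  set Hl := blockForcing χ r R d j Q I Ul with hHl
  have hHbm : StronglyMeasurable (Function.uncurry Hb) := stronglyMeasurable_blockForcing hχ hQm hUb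
  have hHlm : StronglyMeasurable (Function.uncurry Hl) := stronglyMeasurable_blockForcing hχ hQm hUl
  have hv : ∀ᵐ t ∂volume.restrict I,
      dyadicBlock χ j (derivProj d P (truncate χ r R (f t).hat)) =
      waveField (fun ξ => ζ ξ - κ) G t +
        ((fun x => ∫ s in Set.Ioo 0 t, waveField (fun ξ => ζ ξ - κ) (Hb s) (t - s) x) +
        fun x => ∫ s in Set.Ioo 0 t, waveField (fun ξ => ζ ξ - κ) (Hl s) (t - s) x) := by
    filter_upwards [hf.duhamel hUb hUl (S := blockRegion r R j) (z := z) (Q := Q)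
      (fun ξ hξ => (hdata ξ (hreg ξ hξ)).2.1), ae_restrict_mem hIm] with t hduh ht
    have hib : IntegrableOn (Function.uncurry Hb) (Set.Ioo 0 t ×ˢ Set.univ) :=
      integrableOn_blockForcing (d := d) (j := j) hχ hF hr hR hQm hQ hUb ht
    have hil : IntegrableOn (Function.uncurry Hl) (Set.Ioo 0 t ×ˢ Set.univ) :=
      integrableOn_blockForcing (d := d) (j := j) hχ hF hr hR hQm hQ hUl ht
    have hforce : ∀ {U : ℝ → Space → Vec} {ξ : Space}, ξ ∈ blockRegion r R j →
        ∫ s in Set.Ioo 0 t, Complex.exp ((t - s : ℝ) * (ζ ξ - κ)) •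
          blockForcing χ r R d j Q I U s ξ =
        ((blockSymbol χ r R j ξ * ‖ξ‖ ^ d : ℝ) : ℂ) • ∫ s in Set.Ioo 0 t,
          Complex.exp ((t - s : ℝ) * z ξ) • Matrix.toEuclideanLin (Q ξ) (U s ξ) := by
      intro U ξ hξ
      rw [← integral_smul]
      refine setIntegral_congr_fun measurableSet_Ioo fun s hs => ?_
      have hsI : s ∈ I := Ioo_subset_timeInterval ht hs
      simp only [blockForcing_of_mem hsI, blockProj, hζz ξ hξ]
      rw [smul_comm]
    have hpt : blockProj χ r R d j P (f t).hat =ᵐ[volume] fun ξ =>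
        Complex.exp (t * (ζ ξ - κ)) • G ξ +
          ((∫ s in Set.Ioo 0 t, Complex.exp ((t - s : ℝ) * (ζ ξ - κ)) • Hb s ξ) +
          ∫ s in Set.Ioo 0 t, Complex.exp ((t - s : ℝ) * (ζ ξ - κ)) • Hl s ξ) := by
      filter_upwards [hduh, hG₀e] with ξ h1 h2
      by_cases hξ : ξ ∈ blockRegion r R j
      · rw [hHb, hHl, hforce hξ, hforce hξ, hζz ξ hξ, hG, blockProj, blockProj, ← h2,
          ← (hdata ξ (hreg ξ hξ)).1, h1 hξ, smul_comm (Complex.exp (t * z ξ)), ← smul_add,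
          ← smul_add]
      · rw [blockProj_eq_zero hχ hr hR d P _ hξ, hG, blockProj_eq_zero hχ hr hR d Q _ hξ]
        simp only [hHb, hHl, blockForcing_eq_zero hχ hr hR _ hξ, smul_zero, integral_zero, add_zero]
    rw [dyadicBlock_derivProj]
    ext1 x
    have hI1 : invFourier (blockProj χ r R d j P (f t).hat) x = invFourier (fun ξ =>
        Complex.exp (t * (ζ ξ - κ)) • G ξ +
          ((∫ s in Set.Ioo 0 t, Complex.exp ((t - s : ℝ) * (ζ ξ - κ)) • Hb s ξ) +
          ∫ s in Set.Ioo 0 t, Complex.exp ((t - s : ℝ) * (ζ ξ - κ)) • Hl s ξ)) x := by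
      rw [invFourier, invFourier]
      congr 1
      refine integral_congr_ae ?_
      filter_upwards [hpt] with ξ hξ
      rw [hξ]
    have j1 := integrable_exp_smul hζ'm hζ're hGi ht.1.le
    have j2 := integrable_duhamel hζ'm hζ're hib
    have j3 := integrable_duhamel hζ'm hζ're hil
    have j4 : Integrable fun ξ =>
        (∫ s in Set.Ioo 0 t, Complex.exp ((t - s : ℝ) * (ζ ξ - κ)) • Hb s ξ) +
          ∫ s in Set.Ioo 0 t, Complex.exp ((t - s : ℝ) * (ζ ξ - κ)) • Hl s ξ := j2.add j3
    rw [hI1, invFourier_add j1 j4, invFourier_add j2 j3,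
      invFourier_duhamel hζ'm hζ're hHbm hib, invFourier_duhamel hζ'm hζ're hHlm hil]
    rfl
  have hl0 : p < 2 → ∀ᵐ s ∂volume.restrict (Set.Ioi 0), eLpNorm (Hl s) 2 volume = 0 := by
    intro hp2
    have h1 := (ae_restrict_iff' hIm).1 (hFl0 hp2)
    have h2 := (ae_restrict_iff' hIm).1
      (ae_blockForcing_eq (χ := χ) (r := r) (R := R) (d := d) (j := j) (Q := Q) hUl)
    refine ae_restrict_of_ae ?_
    filter_upwards [h1, h2] with s h1 h2
    by_cases hs : s ∈ I
    · rw [hHl, eLpNorm_congr_ae (h2 hs), ← eLpNorm_zero (p := 2) (μ := (volume : Measure Space))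
        (ε := Vec)]
      refine eLpNorm_congr_ae ?_
      filter_upwards [h1 hs] with ξ hξ
      rw [blockProj, hξ, Pi.zero_apply, map_zero, smul_zero]
    · rw [hHl, blockForcing_of_notMem hs, eLpNorm_zero]
  have hmain := block_estimate hF hF1 (by positivity : 0 < 3 * r / 4) (by positivity : 0 < 4 * R / 3)
    hβ hκ hp hb hσ h4 hΛ hζm hre hζΛ hGm hGi
    (fun ξ hξ => blockProj_eq_zero hχ hr hR d Q _ (hsub hξ)) hHbm
    (integrable_blockForcing hχ hF hr hR hQm hQ hUb)
    (fun s ξ hξ => blockForcing_eq_zero hχ hr hR s (hsub hξ)) hHlm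
    (integrable_blockForcing hχ hF hr hR hQm hQ hUl)
    (fun s ξ hξ => blockForcing_eq_zero hχ hr hR s (hsub hξ)) hl0 hIm hI0 hv
  have hbc : blockConst F (3 * r / 4) (4 * R / 3) β κ p σ (viscosityRatio ν ν') =
      blockConst F (3 * r / 4) (4 * R / 3) ε⁻¹ κ p σ (viscosityRatio ν ν') := by
    rw [blockConst, blockConst, hkc]
  rw [hbc] at hmain
  refine hmain.trans ?_
  rw [mul_assoc]
  refine mul_le_mul_right ?_ _
  set K := blockProjConst F d with hK
  have n1 : eLpNorm G 2 volume ≤ K * blockNorm χ r R d j f₀.hat := by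
    rw [eLpNorm_congr_ae hGe]
    exact eLpNorm_blockProj_le hχ hF hr hR d j hQ f₀.locallyIntegrable_hat
  have hKtop : K ≠ ⊤ := ENNReal.mul_ne_top ENNReal.ofReal_ne_top
    (ENNReal.inv_ne_top.2 plancherelConst_ne_zero)
  have n2 : ∫⁻ s in Set.Ioi 0, eLpNorm (Hb s) 2 volume ≤
      K * ∫⁻ s in I, blockNorm χ r R d j (Fb s).hat := by
    rw [setLIntegral_Ioi_timeInterval (T := T) fun s hs => by
      rw [hHb, blockForcing_of_notMem hs, eLpNorm_zero], ← lintegral_const_mul' _ _ hKtop]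
    exact lintegral_mono_ae (ae_eLpNorm_blockForcing_le hχ hF hr hR hQ hUb)
  have n3 : (∫⁻ s in Set.Ioi 0, eLpNorm (Hl s) 2 volume ^ (2 : ℝ)) ^ (1 / 2 : ℝ) ≤
      K * (∫⁻ s in I, blockNorm χ r R d j (Fl s).hat ^ (2 : ℝ)) ^ (1 / 2 : ℝ) := by
    rw [setLIntegral_Ioi_timeInterval (T := T) fun s hs => by
      rw [hHl, blockForcing_of_notMem hs, eLpNorm_zero, ENNReal.zero_rpow_of_pos (by norm_num)]]
    calc _ ≤ (∫⁻ s in I, K ^ (2 : ℝ) * blockNorm χ r R d j (Fl s).hat ^ (2 : ℝ)) ^ (1 / 2 : ℝ) := by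
          refine ENNReal.rpow_le_rpow (lintegral_mono_ae ?_) (by norm_num)
          filter_upwards [ae_eLpNorm_blockForcing_le (d := d) (j := j) hχ hF hr hR hQ hUl] with s hs
          rw [← ENNReal.mul_rpow_of_nonneg _ _ (by norm_num)]
          exact ENNReal.rpow_le_rpow hs (by norm_num)
      _ = _ := by
          rw [lintegral_const_mul' _ _ (ENNReal.rpow_ne_top_of_nonneg (by norm_num) hKtop),
            ENNReal.mul_rpow_of_nonneg _ _ (by norm_num), ← ENNReal.rpow_mul]
          norm_num
  rw [mul_add, mul_add, mul_left_comm]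
  exact add_le_add (add_le_add n1 n2) (mul_le_mul_right n3 _)

/-! ### Sequence spaces -/

theorem eLpNorm_count_eq {x : ℤ → ℝ≥0∞} {q : ℝ≥0∞} (hq0 : q ≠ 0) (hq : q ≠ ⊤) :
    eLpNorm x q Measure.count = (∑' j, x j ^ q.toReal) ^ (1 / q.toReal) := by
  rw [eLpNorm_eq_lintegral_rpow_enorm_toReal hq0 hq, lintegral_count]
  simp only [enorm_eq_self]

theorem le_eLpNorm_count {x : ℤ → ℝ≥0∞} {q : ℝ≥0∞} (hq0 : q ≠ 0) (j : ℤ) :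
    x j ≤ eLpNorm x q Measure.count := by
  rcases eq_or_ne q ⊤ with rfl | hq
  · rw [eLpNorm_exponent_top]
    have h := enorm_ae_le_eLpNormEssSup x (Measure.count : Measure ℤ)
    rw [Measure.ae_count_iff] at h
    simpa using h j
  · have hq1 : 0 < q.toReal := ENNReal.toReal_pos hq0 hq
    rw [eLpNorm_count_eq hq0 hq]
    calc x j = (x j ^ q.toReal) ^ (1 / q.toReal) := by
          rw [← ENNReal.rpow_mul, mul_one_div_cancel hq1.ne', ENNReal.rpow_one]
      _ ≤ _ := ENNReal.rpow_le_rpow (ENNReal.le_tsum j) (by positivity)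

theorem eLpNorm_count_le_tsum {x : ℤ → ℝ≥0∞} {q : ℝ≥0∞} (hq1 : 1 ≤ q) :
    eLpNorm x q Measure.count ≤ ∑' j, x j := by
  rcases eq_or_ne q ⊤ with rfl | hq
  · rw [eLpNorm_exponent_top]
    refine eLpNormEssSup_le_of_ae_enorm_bound (Filter.Eventually.of_forall fun j => ?_)
    simpa using ENNReal.le_tsum j
  · have hq0 : q ≠ 0 := by rintro rfl; simp at hq1
    have hq' : 1 ≤ q.toReal := by
      have := ENNReal.toReal_mono hq hq1
      simpa using this
    have hpos : 0 < q.toReal := by linarith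
    set S := ∑' j, x j with hS
    rw [eLpNorm_count_eq hq0 hq]
    have h1 : ∑' j, x j ^ q.toReal ≤ S ^ q.toReal := by
      have hsplit : ∀ y : ℝ≥0∞, y ^ q.toReal = y * y ^ (q.toReal - 1) := fun y => by
        conv_rhs => rw [← ENNReal.rpow_one y, ← ENNReal.rpow_mul, one_mul,
          ← ENNReal.rpow_add_of_nonneg _ _ zero_le_one (by linarith)]
        congr 1
        ring
      calc ∑' j, x j ^ q.toReal ≤ ∑' j, x j * S ^ (q.toReal - 1) := by
            refine ENNReal.tsum_le_tsum fun j => ?_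
            rw [hsplit]
            exact mul_le_mul_right (ENNReal.rpow_le_rpow (ENNReal.le_tsum j) (by linarith)) _
        _ = S ^ q.toReal := by rw [ENNReal.tsum_mul_right, ← hS, ← hsplit]
    calc _ ≤ (S ^ q.toReal) ^ (1 / q.toReal) := ENNReal.rpow_le_rpow h1 (by positivity)
      _ = S := by rw [← ENNReal.rpow_mul, mul_one_div_cancel hpos.ne', ENNReal.rpow_one]

theorem eLpNorm_count_lintegral_le {A : Set ℝ} {n : ℤ → ℝ → ℝ≥0∞}
    (hn : ∀ j, AEMeasurable (n j) (volume.restrict A)) {q : ℝ≥0∞} (hq1 : 1 ≤ q) :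
    eLpNorm (fun j => ∫⁻ s in A, n j s) q Measure.count ≤
      ∫⁻ s in A, eLpNorm (fun j => n j s) q Measure.count := by
  have hq0 : q ≠ 0 := by rintro rfl; simp at hq1
  rcases eq_or_ne q ⊤ with rfl | hq
  · rw [eLpNorm_exponent_top]
    refine eLpNormEssSup_le_of_ae_enorm_bound (Filter.Eventually.of_forall fun j => ?_)
    rw [enorm_eq_self]
    exact lintegral_mono fun s => le_eLpNorm_count (x := fun j => n j s) hq0 j
  · have hq' : 1 ≤ q.toReal := by
      have := ENNReal.toReal_mono hq hq1
      simpa using this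
    set n' : ℤ → ℝ → ℝ≥0∞ := fun j => (hn j).mk (n j) with hn'
    have hm : Measurable (Function.uncurry n') :=
      measurable_from_prod_countable_right fun j => (hn j).measurable_mk
    have hae : ∀ᵐ s ∂volume.restrict A, ∀ j, n j s = n' j s := ae_all_iff.2 fun j => (hn j).ae_eq_mk
    have h := lintegral_lintegral_rpow_le (μ := (Measure.count : Measure ℤ))
      (ν := volume.restrict A) hm hq'
    have e1 : (fun j => ∫⁻ s in A, n j s) = fun j => ∫⁻ s in A, n' j s := by
      ext1 j
      exact lintegral_congr_ae (hn j).ae_eq_mk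
    rw [e1, eLpNorm_count_eq hq0 hq]
    rw [lintegral_count] at h
    refine h.trans (le_of_eq (lintegral_congr_ae ?_))
    filter_upwards [hae] with s hs
    simp only [hs]
    rw [eLpNorm_count_eq hq0 hq, lintegral_count]

theorem tsum_dyadic_le {c : ℝ} (hc : 0 < c) :
    ∑' j : ℤ, (if c ≤ (2 : ℝ) ^ j then ENNReal.ofReal (((2 : ℝ) ^ j)⁻¹) else 0) ≤
      ENNReal.ofReal (2 / c) := by
  obtain ⟨n, hn1, hn2⟩ := exists_mem_Ioc_zpow hc (one_lt_two : (1 : ℝ) < 2)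
  have hinj : Function.Injective fun k : ℕ => n + 1 + (k : ℤ) := fun a b h => by simpa using h
  have hsupp : Function.support (fun j : ℤ =>
      if c ≤ (2 : ℝ) ^ j then ENNReal.ofReal (((2 : ℝ) ^ j)⁻¹) else 0) ⊆
      Set.range fun k : ℕ => n + 1 + (k : ℤ) := by
    intro j hj
    have h1 : c ≤ (2 : ℝ) ^ j := by
      by_contra h
      simp [h] at hj
    have h2 : n < j := (zpow_lt_zpow_iff_right₀ (one_lt_two : (1 : ℝ) < 2)).1 (hn1.trans_le h1)
    exact ⟨(j - (n + 1)).toNat, by simp only; omega⟩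
  rw [← hinj.tsum_eq hsupp]
  have hn0 : (0 : ℝ) < 2 ^ (n + 1) := by positivity
  calc _ ≤ ∑' k : ℕ, ENNReal.ofReal (((2 : ℝ) ^ (n + 1))⁻¹) * (2⁻¹ : ℝ≥0∞) ^ k := by
        refine ENNReal.tsum_le_tsum fun k => ?_
        split_ifs
        · rw [zpow_add₀ two_ne_zero, mul_inv, ENNReal.ofReal_mul (by positivity)]
          refine mul_le_mul_right (le_of_eq ?_) _
          rw [zpow_natCast, ← inv_pow, ENNReal.ofReal_pow (by norm_num),
            ENNReal.ofReal_inv_of_pos two_pos]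
          norm_num
        · exact zero_le
    _ = ENNReal.ofReal (((2 : ℝ) ^ (n + 1))⁻¹) * 2 := by
        rw [ENNReal.tsum_mul_left, ENNReal.tsum_geometric, ENNReal.one_sub_inv_two, inv_inv]
    _ ≤ ENNReal.ofReal c⁻¹ * 2 := by gcongr
    _ = ENNReal.ofReal (2 / c) := by
        rw [← ENNReal.ofReal_ofNat 2, ← ENNReal.ofReal_mul (by positivity)]
        congr 1
        ring

/-! ### Summation over the blocks -/

theorem two_pow_ge_of_mem_blockRegion {r R : ℝ} {j : ℤ} {ξ : Space} (hξ : ξ ∈ blockRegion r R j) :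
    9 * r / 32 ≤ (2 : ℝ) ^ j := by
  have h1 : |ξ 2| ≤ ‖ξ‖ := PiLp.norm_apply_le ξ 2
  have h2 := hξ.1.2
  have h3 := hξ.2.2
  linarith

theorem eLpNorm_dyadicBlock_eq_zero {χ : ℝ → ℝ} (hχ : IsCutoff χ) {r R : ℝ} (hr : 0 < r)
    (hR : 0 < R) (d : ℝ) {j : ℤ} (hj : ¬9 * r / 32 ≤ (2 : ℝ) ^ j)
    (P : Space → Matrix (Fin 4) (Fin 4) ℂ) (g : Space → Vec) (b : ℝ≥0∞) :
    eLpNorm (dyadicBlock χ j (derivProj d P (truncate χ r R g))) b volume = 0 := by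
  rw [dyadicBlock_derivProj]
  have h1 : blockProj χ r R d j P g = 0 := by
    ext1 ξ
    exact blockProj_eq_zero hχ hr hR d P g fun h => hj (two_pow_ge_of_mem_blockRegion h)
  have h2 : invFourier (0 : Space → Vec) = 0 := by
    ext1 x
    simp [invFourier]
  rw [h1, h2, eLpNorm_zero]

theorem aemeasurable_blockNorm {χ : ℝ → ℝ} (hχ : IsCutoff χ) {r R : ℝ} (hr : 0 < r) (hR : 0 < R)
    (d : ℝ) (j : ℤ) {T : ℝ≥0∞} {u : ℝ → Field} (hu : LocIntegrableInTime T u) :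
    AEMeasurable (fun s => blockNorm χ r R d j (u s).hat) (volume.restrict (timeInterval T)) := by
  obtain ⟨U, hU⟩ := hu.exists_representative
  have h1 : StronglyMeasurable (Function.uncurry fun (s : ℝ) (ξ : Space) =>
      (blockSymbol χ r R j ξ : ℂ) • U s ξ) := by
    have h2 : StronglyMeasurable fun z : ℝ × Space => (blockSymbol χ r R j z.2 : ℂ) :=
      (Complex.measurable_ofReal.comp
        ((measurable_blockSymbol hχ r R j).comp measurable_snd)).stronglyMeasurable
    exact h2.smul hU.stronglyMeasurable
  refine ⟨fun s => ENNReal.ofReal ((2 : ℝ) ^ ((j : ℝ) * d)) * (plancherelConst *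
    eLpNorm (fun ξ => (blockSymbol χ r R j ξ : ℂ) • U s ξ) 2 volume),
    ((measurable_eLpNorm_two h1).const_mul _).const_mul _, ?_⟩
  filter_upwards [hU.ae_time] with s hs
  rw [blockNorm_eq hχ hr hR d j (u s).locallyIntegrable_hat]
  congr 2
  refine eLpNorm_congr_ae ?_
  filter_upwards [hs] with ξ hξ
  rw [hξ]

theorem ofReal_blockRate_rpow_le {ν ν' : ℝ} (hν : 0 < ν) (hν' : 0 < ν') (j : ℤ) :
    ENNReal.ofReal (1 / (2 * blockRate ν ν' j)) ^ (1 / 2 : ℝ) ≤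
      ENNReal.ofReal (2 / min ν ν' ^ (1 / 2 : ℝ)) * ENNReal.ofReal (((2 : ℝ) ^ j)⁻¹) := by
  have hm : 0 < min ν ν' := lt_min hν hν'
  have hκ := blockRate_pos hν hν' j
  rw [ENNReal.ofReal_rpow_of_nonneg (by positivity) (by norm_num),
    ← ENNReal.ofReal_mul (by positivity), ← Real.sqrt_eq_rpow, ← Real.sqrt_eq_rpow]
  apply ENNReal.ofReal_le_ofReal
  rw [Real.sqrt_le_left (by positivity), mul_pow, div_pow, Real.sq_sqrt hm.le, blockRate, inv_pow]
  have hN : 0 < ((2 : ℝ) ^ j) ^ 2 := by positivity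
  generalize ((2 : ℝ) ^ j) ^ 2 = N at hN
  have e1 : 1 / (2 * (min ν ν' * N / 4)) = 2 * (1 / (min ν ν' * N)) := by field_simp; norm_num
  have e2 : 2 ^ 2 / min ν ν' * N⁻¹ = 4 * (1 / (min ν ν' * N)) := by field_simp; norm_num
  rw [e1, e2]
  have : 0 < 1 / (min ν ν' * N) := by positivity
  linarith

theorem eLpNorm_count_const_mul_le {q : ℝ≥0∞} (hq : q ≠ 0) (C : ℝ≥0∞) (x : ℤ → ℝ≥0∞) :
    eLpNorm (fun j => C * x j) q Measure.count ≤ C * eLpNorm x q Measure.count := by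
  rcases eq_or_ne q ⊤ with rfl | hq'
  · rw [eLpNorm_exponent_top, eLpNorm_exponent_top, eLpNormEssSup, eLpNormEssSup]
    simp only [enorm_eq_self]
    exact ENNReal.essSup_const_mul.le
  · rw [eLpNorm_eq_lintegral_rpow_enorm_toReal hq hq', eLpNorm_eq_lintegral_rpow_enorm_toReal hq hq',
      lintegral_count, lintegral_count]
    have hq0 : 0 < q.toReal := ENNReal.toReal_pos hq hq'
    simp only [enorm_eq_self, ENNReal.mul_rpow_of_nonneg _ _ hq0.le]
    rw [ENNReal.tsum_mul_left, ENNReal.mul_rpow_of_nonneg _ _ (by positivity), ← ENNReal.rpow_mul,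
      mul_one_div_cancel hq0.ne', ENNReal.rpow_one]

theorem tilde_norm_le {χ : ℝ → ℝ} (hχ : IsCutoff χ) {F ν ν' ε r R p σ : ℝ} {b q : ℝ≥0∞}
    (hF : 0 < F) (hF1 : F ≠ 1) (hν : 0 < ν) (hν' : 0 < ν') (hε : 0 < ε) (hr : 0 < r) (hR : 0 < R)
    (hsmall : ε * |ν' - ν| * (4 * R / 3) ^ 2 ≤ min 1 F⁻¹ / 10) (hp : 1 ≤ p) (hb : 4 < b)
    (hq : 1 ≤ q) (hσ : σ = 1 - 4 * (b⁻¹).toReal) (h4 : p * σ < 4) (d : ℝ) {T : ℝ≥0∞} {f₀ : Field}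
    {Fb Fl f : ℝ → Field} (hFb : LocIntegrableInTime T Fb) (hFl : LocIntegrableInTime T Fl)
    (hFl0 : p < 2 → ∀ᵐ t ∂volume.restrict (timeInterval T), (Fl t).hat =ᵐ[volume] 0)
    (hf : IsSolution F ν ν' ε T f₀ Fb Fl f) {P : Space → Matrix (Fin 4) (Fin 4) ℂ}
    (hP : P ∈ ({proj₃ F ν ν' ε, proj₄ F ν ν' ε} : Set (Space → Matrix (Fin 4) (Fin 4) ℂ)))
    {C : ℝ≥0∞} (hC : ∀ j : ℤ, 9 * r / 32 ≤ (2 : ℝ) ^ j →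
      blockConst F (3 * r / 4) (4 * R / 3) ε⁻¹ (blockRate ν ν' j) p σ (viscosityRatio ν ν') *
        blockProjConst F d ≤ C) :
    tildeBesovNorm χ T (ENNReal.ofReal p) 0 b q
        (fun t => derivProj d P (truncate χ r R (f t).hat)) ≤
      15 * C * (besovNorm χ d 2 q (truncate χ r R f₀.hat) +
        timeBesovNorm χ T 1 d 2 q (fun t => truncate χ r R (Fb t).hat) +
        ENNReal.ofReal (1 / (min ν ν' ^ (1 / 2 : ℝ) * r)) *
          timeBesovNorm χ T 2 d 2 q (fun t => truncate χ r R (Fl t).hat)) := by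
  have hm : 0 < min ν ν' := lt_min hν hν'
  have hq0 : q ≠ 0 := by rintro rfl; simp at hq
  set I := timeInterval T with hI
  set A0 : ℤ → ℝ≥0∞ := fun j => blockNorm χ r R d j f₀.hat with hA0
  set A1 : ℤ → ℝ≥0∞ := fun j => ∫⁻ s in I, blockNorm χ r R d j (Fb s).hat with hA1
  set Y := timeBesovNorm χ T 2 d 2 q (fun t => truncate χ r R (Fl t).hat) with hY
  set E : ℤ → ℝ≥0∞ := fun j =>
    if 9 * r / 32 ≤ (2 : ℝ) ^ j then ENNReal.ofReal (((2 : ℝ) ^ j)⁻¹) else 0 with hE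
  set c := ENNReal.ofReal (2 / min ν ν' ^ (1 / 2 : ℝ)) with hc
  have hYj : ∀ j, (∫⁻ s in I, blockNorm χ r R d j (Fl s).hat ^ (2 : ℝ)) ^ (1 / 2 : ℝ) ≤ Y := by
    intro j
    rw [hY, timeBesovNorm, eLpNorm_eq_lintegral_rpow_enorm_toReal two_ne_zero ENNReal.ofNat_ne_top]
    simp only [enorm_eq_self, ENNReal.toReal_ofNat]
    refine ENNReal.rpow_le_rpow (lintegral_mono fun s => ENNReal.rpow_le_rpow ?_ (by norm_num))
      (by norm_num)
    exact le_eLpNorm_count (x := fun j => blockNorm χ r R d j (Fl s).hat) hq0 j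
  have hX : ∀ j : ℤ, ENNReal.ofReal ((2 : ℝ) ^ ((j : ℝ) * 0)) *
      eLpNorm (fun t => eLpNorm (dyadicBlock χ j (derivProj d P (truncate χ r R (f t).hat)))
        b volume) (ENNReal.ofReal p) (volume.restrict I) ≤
      C * (A0 j + (A1 j + (c * Y) * E j)) := by
    intro j
    rw [mul_zero, Real.rpow_zero, ENNReal.ofReal_one, one_mul]
    by_cases hj : 9 * r / 32 ≤ (2 : ℝ) ^ j
    · refine (dyadic_block_bound hχ hF hF1 hν hν' hε hr hR hsmall hp hb hσ h4 d j hFb hFl hFl0 hf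
        hP).trans (mul_le_mul' (hC j hj) ?_)
      rw [add_assoc]
      refine add_le_add le_rfl (add_le_add le_rfl ?_)
      simp only [hE, if_pos hj]
      calc _ ≤ c * ENNReal.ofReal (((2 : ℝ) ^ j)⁻¹) * Y :=
            mul_le_mul' (ofReal_blockRate_rpow_le hν hν' j) (hYj j)
        _ = _ := by ring
    · have h0 : (fun t => eLpNorm (dyadicBlock χ j (derivProj d P (truncate χ r R (f t).hat)))
          b volume) = fun _ => 0 :=
        funext fun t => eLpNorm_dyadicBlock_eq_zero hχ hr hR d hj P _ b
      rw [h0, eLpNorm_zero']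
      exact zero_le
  have hmeas : ∀ x : ℤ → ℝ≥0∞, AEStronglyMeasurable x (Measure.count : Measure ℤ) := fun x =>
    (measurable_of_countable x).aestronglyMeasurable
  have n1 : eLpNorm A1 q Measure.count ≤
      timeBesovNorm χ T 1 d 2 q (fun t => truncate χ r R (Fb t).hat) := by
    refine (eLpNorm_count_lintegral_le
      (fun j => aemeasurable_blockNorm hχ hr hR d j hFb) hq).trans (le_of_eq ?_)
    rw [timeBesovNorm, eLpNorm_one_eq_lintegral_enorm]
    rfl
  have n2 : eLpNorm (fun j => (c * Y) * E j) q Measure.count ≤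
      15 * (ENNReal.ofReal (1 / (min ν ν' ^ (1 / 2 : ℝ) * r)) * Y) := by
    refine (eLpNorm_count_le_tsum hq).trans ?_
    rw [ENNReal.tsum_mul_left]
    calc (c * Y) * ∑' j, E j ≤ (c * Y) * ENNReal.ofReal (2 / (9 * r / 32)) :=
          mul_le_mul_right (tsum_dyadic_le (by positivity)) _
      _ = (c * ENNReal.ofReal (2 / (9 * r / 32))) * Y := by ring
      _ ≤ (15 * ENNReal.ofReal (1 / (min ν ν' ^ (1 / 2 : ℝ) * r))) * Y := by
          refine mul_le_mul_left ?_ Y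
          rw [hc, ← ENNReal.ofReal_mul (by positivity), ← ENNReal.ofReal_ofNat 15,
            ← ENNReal.ofReal_mul (by positivity)]
          apply ENNReal.ofReal_le_ofReal
          have h1 : 0 < 1 / (min ν ν' ^ (1 / 2 : ℝ) * r) := by positivity
          have e : 2 / min ν ν' ^ (1 / 2 : ℝ) * (2 / (9 * r / 32)) =
              128 / 9 * (1 / (min ν ν' ^ (1 / 2 : ℝ) * r)) := by
            field_simp
            norm_num
          rw [e]
          linarith
      _ = _ := by ring
  have h15 : (1 : ℝ≥0∞) ≤ 15 := by norm_num
  calc tildeBesovNorm χ T (ENNReal.ofReal p) 0 b q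
        (fun t => derivProj d P (truncate χ r R (f t).hat))
      ≤ eLpNorm (fun j => C * (A0 j + (A1 j + (c * Y) * E j))) q Measure.count := by
        rw [tildeBesovNorm]
        refine eLpNorm_mono_enorm fun j => ?_
        simp only [enorm_eq_self]
        exact hX j
    _ ≤ C * eLpNorm (fun j => A0 j + (A1 j + (c * Y) * E j)) q Measure.count :=
        eLpNorm_count_const_mul_le hq0 C _
    _ ≤ C * (eLpNorm A0 q Measure.count + (eLpNorm A1 q Measure.count +
        eLpNorm (fun j => (c * Y) * E j) q Measure.count)) := by
        gcongr
        refine (eLpNorm_add_le (hmeas _) (hmeas _) hq).trans ?_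
        gcongr
        exact eLpNorm_add_le (hmeas _) (hmeas _) hq
    _ ≤ C * (15 * eLpNorm A0 q Measure.count +
        (15 * timeBesovNorm χ T 1 d 2 q (fun t => truncate χ r R (Fb t).hat) +
        15 * (ENNReal.ofReal (1 / (min ν ν' ^ (1 / 2 : ℝ) * r)) * Y))) := by
        gcongr
        · exact le_mul_of_one_le_left zero_le h15
        · exact n1.trans (le_mul_of_one_le_left zero_le h15)
    _ = 15 * C * (eLpNorm A0 q Measure.count +
        timeBesovNorm χ T 1 d 2 q (fun t => truncate χ r R (Fb t).hat) +
        ENNReal.ofReal (1 / (min ν ν' ^ (1 / 2 : ℝ) * r)) * Y) := by ring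

theorem viscosityRatio_eq {ν ν' : ℝ} (hν : 0 < ν) (hν' : 0 < ν') :
    viscosityRatio ν ν' = 86 * (1 + max ν ν' / min ν ν') + 2 := by
  have hm : min ν ν' ≠ 0 := (lt_min hν hν').ne'
  rw [viscosityRatio, ← min_add_max ν ν', add_div, div_self hm]

theorem kernelConst_rpow_le {F r R ε σ : ℝ} (hF : 0 < F) (hr : 0 < r) (hR : 0 < R) (hε : 0 < ε)
    (hσ1 : σ ≤ 1) :
    kernelConst F (3 * r / 4) (4 * R / 3) ε⁻¹ ^ (σ / 2) ≤
      40 * dispConst F⁻¹ * (R ^ (2 * σ) * r ^ (-(σ / 2)) * ε ^ (σ / 4)) := by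
  have hd := dispConst_ge_one (inv_pos.2 hF)
  have hd0 : 0 < dispConst F⁻¹ := by linarith
  have e : kernelConst F (3 * r / 4) (4 * R / 3) ε⁻¹ =
      (8 * (4 / 3) ^ 5) * dispConst F⁻¹ * (R ^ 4 * r⁻¹ * √ε) := by
    have hs : 0 < √ε := Real.sqrt_pos.2 hε
    rw [kernelConst, abs_of_pos (inv_pos.2 hε), Real.sqrt_inv]
    field_simp
  rw [e, Real.mul_rpow (by positivity) (by positivity),
    Real.mul_rpow (x := R ^ 4 * r⁻¹) (by positivity) (by positivity),
    Real.mul_rpow (x := R ^ 4) (by positivity) (by positivity), Real.sqrt_eq_rpow,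
    ← Real.rpow_mul hε.le,
    Real.inv_rpow hr.le, ← Real.rpow_neg hr.le, ← Real.rpow_natCast R, ← Real.rpow_mul hR.le]
  have e1 : ((4 : ℕ) : ℝ) * (σ / 2) = 2 * σ := by push_cast; ring
  have e2 : 1 / 2 * (σ / 2) = σ / 4 := by ring
  rw [e1, e2]
  refine mul_le_mul_of_nonneg_right ?_ (by positivity)
  have h1 : (1 : ℝ) ≤ 8 * (4 / 3) ^ 5 * dispConst F⁻¹ := by linarith
  calc (8 * (4 / 3) ^ 5 * dispConst F⁻¹) ^ (σ / 2)
      ≤ (8 * (4 / 3) ^ 5 * dispConst F⁻¹) ^ (1 : ℝ) :=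
        Real.rpow_le_rpow_of_exponent_le h1 (by linarith)
    _ ≤ 40 * dispConst F⁻¹ := by rw [Real.rpow_one]; linarith

theorem blockRate_rpow_le {ν ν' r a : ℝ} (hν : 0 < ν) (hν' : 0 < ν') (hr : 0 < r) (ha0 : 0 ≤ a)
    (ha1 : a ≤ 1) {j : ℤ} (hj : 9 * r / 32 ≤ (2 : ℝ) ^ j) :
    blockRate ν ν' j ^ (-a) ≤ 64 * (min ν ν' ^ (-a) * r ^ (-(2 * a))) := by
  have hm : 0 < min ν ν' := lt_min hν hν'
  have h1 : (1 / 64) * (min ν ν' * r ^ 2) ≤ blockRate ν ν' j := by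
    have h2 : (9 * r / 32) ^ 2 ≤ ((2 : ℝ) ^ j) ^ 2 := pow_le_pow_left₀ (by positivity) hj 2
    have h3 : r ^ 2 / 16 ≤ ((2 : ℝ) ^ j) ^ 2 := by nlinarith [sq_nonneg r]
    rw [blockRate]
    nlinarith
  refine (Real.rpow_le_rpow_of_nonpos (by positivity) h1 (by linarith)).trans ?_
  rw [Real.mul_rpow (by norm_num) (by positivity), Real.mul_rpow hm.le (by positivity),
    ← Real.rpow_natCast r, ← Real.rpow_mul hr.le]
  have e1 : ((2 : ℕ) : ℝ) * -a = -(2 * a) := by push_cast; ring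
  rw [e1]
  refine mul_le_mul_of_nonneg_right ?_ (by positivity)
  rw [one_div, Real.inv_rpow (by norm_num), Real.rpow_neg (by norm_num), inv_inv]
  calc (64 : ℝ) ^ a ≤ 64 ^ (1 : ℝ) := Real.rpow_le_rpow_of_exponent_le (by norm_num) ha1
    _ = 64 := Real.rpow_one _

/-- A bound for the Bernstein constant of the ball of radius `4 / 3`, at least `1`. -/
def ballConst : ℝ :=
  max 1 (((ENNReal.ofReal ((4 / 3) ^ 3) * volume (Metric.closedBall (0 : Space) 1)) ^ (1 / 2 : ℝ) *
    plancherelConst) ^ (1 / 2 : ℝ)).toReal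

theorem bernsteinConst_le {δ R : ℝ} (hR : 0 < R) :
    bernsteinConst δ (4 * R / 3) ≤ ENNReal.ofReal (ballConst * R ^ (3 / 4 : ℝ)) := by
  set V := ENNReal.ofReal ((4 / 3) ^ 3) * volume (Metric.closedBall (0 : Space) 1) with hV
  have hVtop : V ≠ ⊤ :=
    ENNReal.mul_ne_top ENNReal.ofReal_ne_top measure_closedBall_lt_top.ne
  have hKtop : (V ^ (1 / 2 : ℝ) * plancherelConst) ^ (1 / 2 : ℝ) ≠ ⊤ :=
    ENNReal.rpow_ne_top_of_nonneg (by norm_num) (ENNReal.mul_ne_top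
      (ENNReal.rpow_ne_top_of_nonneg (by norm_num) hVtop) plancherelConst_ne_top)
  have h1 : volume (freqRegion δ (4 * R / 3)) ≤ ENNReal.ofReal (R ^ 3) * V := by
    refine (measure_mono (freqRegion_subset_closedBall _ _)).trans (le_of_eq ?_)
    rw [Measure.addHaar_closedBall' _ _ (by positivity), finrank_euclideanSpace_fin, hV, ← mul_assoc,
      ← ENNReal.ofReal_mul (by positivity)]
    congr 2
    ring
  calc bernsteinConst δ (4 * R / 3)
      ≤ ((ENNReal.ofReal (R ^ 3) * V) ^ (1 / 2 : ℝ) * plancherelConst) ^ (1 / 2 : ℝ) := by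
        rw [bernsteinConst]
        gcongr
    _ = ENNReal.ofReal (R ^ (3 / 4 : ℝ)) * (V ^ (1 / 2 : ℝ) * plancherelConst) ^ (1 / 2 : ℝ) := by
        rw [ENNReal.mul_rpow_of_nonneg _ V (by norm_num), mul_assoc,
          ENNReal.mul_rpow_of_nonneg _ _ (by norm_num), ← ENNReal.rpow_mul,
          ENNReal.ofReal_rpow_of_nonneg (by positivity) (by norm_num), ← Real.rpow_natCast,
          ← Real.rpow_mul hR.le]
        norm_num
    _ ≤ ENNReal.ofReal (R ^ (3 / 4 : ℝ)) * ENNReal.ofReal ballConst := by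
        refine mul_le_mul_right ?_ _
        rw [← ENNReal.ofReal_toReal hKtop]
        exact ENNReal.ofReal_le_ofReal (le_max_right _ _)
    _ = _ := by rw [← ENNReal.ofReal_mul (by positivity), mul_comm]

theorem bernsteinConst_rpow_le {δ R σ : ℝ} (hR : 0 < R) (hσ0 : 0 ≤ σ) (hσ1 : σ ≤ 1) :
    bernsteinConst δ (4 * R / 3) ^ (1 - σ) ≤
      ENNReal.ofReal (ballConst * R ^ (3 / 4 * (1 - σ))) := by
  have h1 : 1 ≤ ballConst := le_max_left _ _
  refine (ENNReal.rpow_le_rpow (bernsteinConst_le hR) (by linarith)).trans ?_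
  rw [ENNReal.ofReal_rpow_of_nonneg (by positivity) (by linarith)]
  apply ENNReal.ofReal_le_ofReal
  rw [Real.mul_rpow (by positivity) (by positivity), ← Real.rpow_mul hR.le]
  refine mul_le_mul_of_nonneg_right ?_ (by positivity)
  calc ballConst ^ (1 - σ) ≤ ballConst ^ (1 : ℝ) :=
        Real.rpow_le_rpow_of_exponent_le h1 (by linarith)
    _ = ballConst := Real.rpow_one _

/-- The constant of the Strichartz estimate, for the ratio `ω` of the viscosities. -/
def strichartzConst (F ω : ℝ) : ℝ :=
  15 * (96 * (1 + 2 * (86 * (1 + max ω 0) + 2)) * (40 * dispConst F⁻¹) * 64 * ballConst * projConst F *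
    plancherelConst⁻¹.toReal)

theorem strichartzConst_pos {F : ℝ} (hF : 0 < F) (ω : ℝ) : 0 < strichartzConst F ω := by
  have hd := dispConst_ge_one (inv_pos.2 hF)
  have hb : 1 ≤ ballConst := le_max_left _ _
  have hp := projConst_pos hF
  have hω : 0 ≤ max ω 0 := le_max_right _ _
  have hi : 0 < plancherelConst⁻¹.toReal := ENNReal.toReal_pos
    (ENNReal.inv_ne_zero.2 plancherelConst_ne_top) (ENNReal.inv_ne_top.2 plancherelConst_ne_zero)
  rw [strichartzConst]
  positivity

theorem blockConst_mul_blockProjConst_le {F ν ν' ε r R p σ : ℝ} (hF : 0 < F) (hν : 0 < ν)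
    (hν' : 0 < ν') (hε : 0 < ε) (hr : 0 < r) (hr1 : r ≤ 1) (hR : 1 ≤ R) (hp : 1 ≤ p) (hσ0 : 0 < σ)
    (hσ1 : σ ≤ 1) (h4 : p * σ < 4) (d : ℝ) {j : ℤ} (hj : 9 * r / 32 ≤ (2 : ℝ) ^ j) :
    blockConst F (3 * r / 4) (4 * R / 3) ε⁻¹ (blockRate ν ν' j) p σ (viscosityRatio ν ν') *
        blockProjConst F d ≤
      ENNReal.ofReal (strichartzConst F (max ν ν' / min ν ν') / 15 * (8 / 3 : ℝ) ^ |d| *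
        (DConst p ((1 - σ) / 4) / min ν ν' ^ (1 / p - σ / 4)) * ε ^ (σ / 4) *
        (R ^ (7 / 4 + 9 * σ / 4) / r ^ (1 + 2 / p + 3 * σ / 2))) := by
  have hR0 : 0 < R := by linarith
  have hp0 : 0 < p := by linarith
  have hm : 0 < min ν ν' := lt_min hν hν'
  have ha0 : 0 < 1 / p - σ / 4 := by
    rw [sub_pos, div_lt_div_iff₀ (by norm_num) hp0]
    linarith
  have ha1 : 1 / p - σ / 4 ≤ 1 := by
    have : 1 / p ≤ 1 := (div_le_one hp0).2 hp
    linarith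
  have hD : 0 < DConst p ((1 - σ) / 4) := by
    have := DConst_ge (p := p) (ρ := (1 - σ) / 4) (by rw [expo_eq]; exact ha0)
    linarith
  have hω : 0 ≤ max ν ν' / min ν ν' := by positivity
  have hd := dispConst_ge_one (inv_pos.2 hF)
  have hb : 1 ≤ ballConst := le_max_left _ _
  have hpr := projConst_pos hF
  have hκ := blockRate_pos hν hν' j
  have hL : 0 ≤ 1 + 2 * viscosityRatio ν ν' := by
    rw [viscosityRatio_eq hν hν']; positivity
  have hi : plancherelConst⁻¹ = ENNReal.ofReal plancherelConst⁻¹.toReal :=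
    (ENNReal.ofReal_toReal (ENNReal.inv_ne_top.2 plancherelConst_ne_zero)).symm
  have hk := kernelConst_rpow_le (ε := ε) hF hr hR0 hε hσ1
  have hkr := blockRate_rpow_le hν hν' hr ha0.le ha1 hj
  have hk0 := kernelConst_pos hF (by positivity : 0 < 3 * r / 4) (by positivity : 0 < 4 * R / 3)
    (inv_ne_zero hε.ne')
  set a := 1 / p - σ / 4 with ha
  set D := DConst p ((1 - σ) / 4)
  set i := plancherelConst⁻¹.toReal with hidef
  have hi0 : 0 ≤ i := ENNReal.toReal_nonneg
  rw [blockConst, blockProjConst, hi]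
  refine (mul_le_mul_left (mul_le_mul_right (bernsteinConst_rpow_le hR0 hσ0.le hσ1) _) _).trans ?_
  rw [← ENNReal.ofReal_mul (by positivity), ← ENNReal.ofReal_mul (by positivity),
    ← ENNReal.ofReal_mul (by positivity)]
  apply ENNReal.ofReal_le_ofReal
  have hRpow : R ^ (2 * σ) * R ^ (3 / 4 * (1 - σ)) ≤ R ^ (7 / 4 + 9 * σ / 4) := by
    rw [← Real.rpow_add hR0]
    exact Real.rpow_le_rpow_of_exponent_le hR (by linarith)
  have hrpow : r ^ (-(σ / 2)) * r ^ (-(2 * a)) ≤ (r ^ (1 + 2 / p + 3 * σ / 2))⁻¹ := by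
    rw [← Real.rpow_add hr, ← Real.rpow_neg hr.le]
    refine Real.rpow_le_rpow_of_exponent_ge hr hr1 ?_
    have : 2 * a = 2 / p - σ / 2 := by rw [ha]; ring
    linarith
  calc _ ≤ 96 * (1 + 2 * viscosityRatio ν ν') *
        (40 * dispConst F⁻¹ * (R ^ (2 * σ) * r ^ (-(σ / 2)) * ε ^ (σ / 4)) *
          (64 * (min ν ν' ^ (-a) * r ^ (-(2 * a)))) * D) * (ballConst * R ^ (3 / 4 * (1 - σ))) *
        (projConst F * (8 / 3 : ℝ) ^ |d| * i) := by
        gcongr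
    _ = (96 * (1 + 2 * viscosityRatio ν ν') * (40 * dispConst F⁻¹) * 64 * ballConst * projConst F *
        i) * (8 / 3 : ℝ) ^ |d| * (D * min ν ν' ^ (-a)) * ε ^ (σ / 4) *
        ((R ^ (2 * σ) * R ^ (3 / 4 * (1 - σ))) * (r ^ (-(σ / 2)) * r ^ (-(2 * a)))) := by ring
    _ ≤ (96 * (1 + 2 * viscosityRatio ν ν') * (40 * dispConst F⁻¹) * 64 * ballConst * projConst F *
        i) * (8 / 3 : ℝ) ^ |d| * (D * min ν ν' ^ (-a)) * ε ^ (σ / 4) *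
        (R ^ (7 / 4 + 9 * σ / 4) * (r ^ (1 + 2 / p + 3 * σ / 2))⁻¹) := by
        gcongr
    _ = _ := by
        rw [strichartzConst, viscosityRatio_eq hν hν', max_eq_left hω, Real.rpow_neg hm.le]
        ring

/-- For small `ε` the viscous perturbation of the wave symbol is small on the frequencies that are
kept by the truncation. -/
theorem exists_small_parameter {F M : ℝ} (hF : 0 < F) (hM : M < 1 / 4) (N : ℝ) :
    ∃ ε₀ : ℝ, 0 < ε₀ ∧ ∀ ε : ℝ, 0 < ε → ε < ε₀ →
      ε ≤ 1 ∧ ε * N * (4 * ε ^ (-M) / 3) ^ 2 ≤ min 1 F⁻¹ / 10 := by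
  have hm : 0 < min 1 F⁻¹ / 10 := by
    have : 0 < min 1 F⁻¹ := lt_min one_pos (inv_pos.2 hF)
    positivity
  have hpos : 0 < 1 - 2 * M := by linarith
  have hlim : Filter.Tendsto (fun ε : ℝ => 16 / 9 * N * ε ^ (1 - 2 * M)) (nhds 0) (nhds 0) := by
    have h1 : Filter.Tendsto (fun ε : ℝ => ε ^ (1 - 2 * M)) (nhds 0) (nhds 0) := by
      simpa [Real.zero_rpow hpos.ne'] using
        (Real.continuousAt_rpow_const 0 (1 - 2 * M) (Or.inr hpos.le)).tendsto
    simpa using h1.const_mul (16 / 9 * N)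
  obtain ⟨δ, hδ, h⟩ := Metric.eventually_nhds_iff.1 (hlim.eventually (gt_mem_nhds hm))
  refine ⟨min δ 1, lt_min hδ one_pos, fun ε hε hlt =>
    ⟨(hlt.trans_le (min_le_right _ _)).le, ?_⟩⟩
  have h2 := h (y := ε) (by
    rw [Real.dist_eq, sub_zero, abs_of_pos hε]
    exact hlt.trans_le (min_le_left _ _))
  refine le_of_eq_of_le ?_ h2.le
  have e : ε ^ (1 - 2 * M) = ε * (ε ^ (-M)) ^ 2 := by
    rw [← Real.rpow_natCast, ← Real.rpow_mul hε.le]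
    nth_rewrite 2 [← Real.rpow_one ε]
    rw [← Real.rpow_add hε]
    congr 1
    push_cast
    ring
  rw [e]
  ring

end PrimitiveSystem

end

theorem mainTheorem6 (χ : ℝ → ℝ) (hχ : PrimitiveSystem.IsCutoff χ)
    (F : ℝ) (hF : 0 < F) (hF1 : F ≠ 1) (ω : ℝ) :
    ∃ C : ℝ, 0 < C ∧
      ∀ ν ν' : ℝ, 0 < ν → 0 < ν' → ν ≠ ν' → max ν ν' / min ν ν' = ω →
      ∀ m M : ℝ, 0 < m → 0 < M → M < 1 / 4 → 3 * M + m < 1 →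
      ∃ ε₀ : ℝ, 0 < ε₀ ∧ ∀ ε : ℝ, 0 < ε → ε < ε₀ →
      ∀ (d : ℝ) (r q : ℝ≥0∞) (p : ℝ), 4 < r → 1 ≤ q → 1 ≤ p → p < 4 / (1 - 4 * (r⁻¹).toReal) →
      ∀ (T : ℝ≥0∞) (f₀ : PrimitiveSystem.Field) (Fb Fl f : ℝ → PrimitiveSystem.Field),
        PrimitiveSystem.LocIntegrableInTime T Fb →
        PrimitiveSystem.LocIntegrableInTime T Fl →
        PrimitiveSystem.DivFree f₀ →
        PrimitiveSystem.ZeroPotentialVorticity F f₀ →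
        (∀ᵐ t ∂(volume.restrict (PrimitiveSystem.timeInterval T)),
          PrimitiveSystem.DivFree (Fb t) ∧ PrimitiveSystem.ZeroPotentialVorticity F (Fb t) ∧
          PrimitiveSystem.DivFree (Fl t) ∧ PrimitiveSystem.ZeroPotentialVorticity F (Fl t)) →
        (p < 2 → ∀ᵐ t ∂(volume.restrict (PrimitiveSystem.timeInterval T)),
          (Fl t).hat =ᵐ[volume] 0) →
        PrimitiveSystem.IsSolution F ν ν' ε T f₀ Fb Fl f →
        ∀ P ∈ ({PrimitiveSystem.proj₃ F ν ν' ε, PrimitiveSystem.proj₄ F ν ν' ε} :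
            Set (PrimitiveSystem.Space → Matrix (Fin 4) (Fin 4) ℂ)),
          PrimitiveSystem.tildeBesovNorm χ T (ENNReal.ofReal p) 0 r q
              (fun t => PrimitiveSystem.derivProj d P
                (PrimitiveSystem.truncate χ (ε ^ m) (ε ^ (-M)) (f t).hat)) ≤
            ENNReal.ofReal
              (C * (8 / 3 : ℝ) ^ |d| *
                (PrimitiveSystem.DConst p (r⁻¹).toReal /
                  min ν ν' ^ (1 / p - 1 / 4 * (1 - 4 * (r⁻¹).toReal))) *
                ε ^ (1 / 4 * (1 - 4 * (r⁻¹).toReal)) *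
                ((ε ^ (-M)) ^ (4 - 9 * (r⁻¹).toReal) /
                  (ε ^ m) ^ (5 / 2 + 2 / p - 6 * (r⁻¹).toReal))) *
            (PrimitiveSystem.besovNorm χ d 2 q
                (PrimitiveSystem.truncate χ (ε ^ m) (ε ^ (-M)) f₀.hat) +
              PrimitiveSystem.timeBesovNorm χ T 1 d 2 q
                (fun t => PrimitiveSystem.truncate χ (ε ^ m) (ε ^ (-M)) (Fb t).hat) +
              ENNReal.ofReal (1 / (min ν ν' ^ (1 / 2 : ℝ) * ε ^ m)) *
                PrimitiveSystem.timeBesovNorm χ T 2 d 2 q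
                  (fun t => PrimitiveSystem.truncate χ (ε ^ m) (ε ^ (-M)) (Fl t).hat)) := by
  refine ⟨PrimitiveSystem.strichartzConst F ω, PrimitiveSystem.strichartzConst_pos hF ω, ?_⟩
  intro ν ν' hν hν' _ hω m M hm hM hM4 _
  obtain ⟨ε₀, hε₀, hsmall⟩ :=
    PrimitiveSystem.exists_small_parameter hF hM4 |ν' - ν|
  refine ⟨ε₀, hε₀, ?_⟩
  intro ε hε hlt d r q p hr hq hp hpr T f₀ Fb Fl f hFb hFl _ _ _ hFl0 hf P hP
  obtain ⟨hε1, hsm⟩ := hsmall ε hε hlt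
  obtain ⟨σ, hσ⟩ : ∃ σ : ℝ, σ = 1 - 4 * (r⁻¹).toReal := ⟨_, rfl⟩
  have hσ0 : 0 < σ := by rw [hσ]; linarith [PrimitiveSystem.inv_toReal_lt hr]
  have hσ1 : σ ≤ 1 := by rw [hσ]; linarith [ENNReal.toReal_nonneg (a := r⁻¹)]
  have h4 : p * σ < 4 := by
    rw [← hσ] at hpr
    exact (lt_div_iff₀ hσ0).1 hpr
  have hR : 1 ≤ ε ^ (-M) := Real.one_le_rpow_of_pos_of_le_one_of_nonpos hε hε1 (by linarith)
  have hr1 : ε ^ m ≤ 1 := Real.rpow_le_one hε.le hε1 hm.le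
  refine (PrimitiveSystem.tilde_norm_le hχ hF hF1 hν hν' hε (Real.rpow_pos_of_pos hε m)
    (Real.rpow_pos_of_pos hε (-M)) hsm hp hr hq hσ h4 d hFb hFl hFl0 hf hP fun j hj =>
      PrimitiveSystem.blockConst_mul_blockProjConst_le hF hν hν' hε (Real.rpow_pos_of_pos hε m) hr1
        hR hp hσ0 hσ1 h4 d hj).trans (le_of_eq ?_)
  have hρ : (r⁻¹).toReal = (1 - σ) / 4 := by rw [hσ]; ring
  have e1 : 1 / 4 * (1 - 4 * ((1 - σ) / 4)) = σ / 4 := by ring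
  have e2 : 4 - 9 * ((1 - σ) / 4) = 7 / 4 + 9 * σ / 4 := by ring
  have e3 : 5 / 2 + 2 / p - 6 * ((1 - σ) / 4) = 1 + 2 / p + 3 * σ / 2 := by ring
  rw [hρ, e1, e2, e3, hω, ← ENNReal.ofReal_ofNat 15, ← ENNReal.ofReal_mul (by norm_num)]
  congr 2
  ring
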